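/- **Setting.** Let $q\in\mathbb R^\times$ be not a root of unity and fix a square root $q^{1/2}\in\mathbb C$. For $n\ge1$ let $\mathbb C^{n+1|n+1}=(\mathbb C^{1|1})^{\hat\otimes(n+1)}$, where $\mathbb C^{1|1}$ has basis $e^{(1)}_{-1}$ (even), $e^{(1)}_{+1}$ (odd) and matrix units $e^{(1)}_{ij}$, and let $V^{+(n)}$, $V^{-(n)}$ be its even and odd subspaces. Write $x(m_1,\dots,m_{n+1})=e^{(1)}_{2m_1-1}\hat\otimes\cdots\hat\otimes e^{(1)}_{2m_{n+1}-1}$ for $m\in\{0,1\}^{n+1}$, and set $a_i\,x(m)=(-1)^{m_1+\dots+m_{i-1}}x(m-\mathbf e_i)$, $a_i^\dagger\,x(m)=(-1)^{m_1+\dots+m_{i-1}}x(m+\mathbf e_i)$ (zero if the argument leaves $\{0,1\}^{n+1}$), $\omega_i\,x(m)=q^{-m_i}x(m)$ for $1\le i\le n+1$, and $\omega_0=q^{-1/2}$, $\omega_{-i}=q^{-1}\omega_i^{-1}$, $a_{-i}=q^{-1}a_i^\dagger$, $a^\dagger_{-i}=q\,a_i$. For $i,j\in\{\pm1,\dots,\pm(n+1)\}$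 put $\ell^\pm_{ii}=q^{\pm1/2}\omega_i^{\pm1}$, $$\ell^-_{ij}=(-1)^{i+j}q^{i-j-3/2}(q-q^{-1})\,a_i^\dagger\,\omega_{i-1}\cdots\omega_{j+1}\,a_j\,\omega_j^{-1}\ (i>j),\qquad \ell^+_{ij}=-(-1)^{i+j}q^{i-j+3/2}(q-q^{-1})\,\omega_i a_i^\dagger\,\omega^{-1}_{i+1}\cdots\omega^{-1}_{j-1}\,a_j\ (i<j),$$ with all other $\ell^\pm_{ij}$, and those with $i=-j$, equal to $0$. For $\rho\in\mathbb C^\times$ the spinor representation $\pi_\rho$ of $U_q^{ex}(\mathcal L\mathfrak{so}_{2n+2})$ is $\pi_\rho(\ell^\pm_{ij}(w))=\dfrac{q^{\pm1/2}w^{\pm1}\ell^\mp_{ij}-q^{\mp1/2}\rho^{\pm1}\ell^\pm_{ij}}{w^{\pm1}-\rho^{\pm1}}$. For $\varepsilon_1,\varepsilon_2\in\{+,-\}$ the *spinor–spinor R-matrix* $R^{\varepsilon_1\varepsilon_2(n,n)}(u,v)\in\mathrm{End}(V^{\varepsilon_1(n)}\otimes V^{\varepsilon_2(n)})$ is the solution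 of $$\Big(\sum_k\pi_v(\ell^\pm_{kj}(w))\otimes\pi_u(\ell^\pm_{ik}(w))\Big)R^{\varepsilon_1\varepsilon_2(n,n)}(u,v)=R^{\varepsilon_1\varepsilon_2(n,n)}(u,v)\Big(\sum_k\pi_v(\ell^\pm_{ik}(w))\otimes\pi_u(\ell^\pm_{kj}(w))\Big)\quad\text{for all } i,j,w,$$ normalised to have coefficient $1$ on $\xi_{\varepsilon_1}\otimes\xi_{\varepsilon_2}$, where $\xi_+=x(0,\dots,0)$ and $\xi_-=x(1,0,\dots,0)$ are the highest weight vectors. For $A=\sum A'\otimes A''$ write $A\,\hat\otimes\,(e^{(1)}_{ab}\otimes e^{(1)}_{cd})=\sum(A'\hat\otimes e^{(1)}_{ab})\otimes(A''\hat\otimes e^{(1)}_{cd})$, where $(X\hat\otimes e^{(1)}_{ab})(x\hat\otimes y)=(-1)^{\deg e^{(1)}_{ab}\deg x}\,Xx\hat\otimes e^{(1)}_{ab}y$ and $\deg e^{(1)}_{ab}=\frac{1-ab}2$. Abbreviate $E_{ab,cd}=e^{(1)}_{ab}\otimes e^{(1)}_{cd}$, writing $-$, $+$ for the indices $-1$,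 $+1$. Let $e^{(+)}_{i}=e^{(1)}_i\hat\otimes e^{(1)}_i$ and $e^{(-)}_i=e^{(1)}_{-i}\hat\otimes e^{(1)}_i$ be the basis of $V^{\pm(1)}$, let $f^{(\pm)}_{ij}:V^{\pm(1)}\to V^{\mp(1)}$ be given by $f^{(\pm)}_{ij}e^{(\pm)}_k=\delta_{jk}e^{(\mp)}_i$, and let $$\alpha(u,v)=\frac{v-u}{qv-q^{-1}u},\qquad \beta(u,v)=\frac{q-q^{-1}}{qv-q^{-1}u}.$$ **Proposition.** Let $n>2$. For $1\le m\le n$ and $u,v\in\mathbb C^\times$ with $u/v\notin\{q^{4k+2}:k\in\mathbb Z\}$ if $\varepsilon_1=\varepsilon_2$, and $u/v\notin\{q^{4k}:k\in\mathbb Z\}$ if $\varepsilon_1\ne\varepsilon_2$, the matrix $R^{\varepsilon_1\varepsilon_2(m,m)}(u,v)$ exists and is unique; moreover $P^{\pm\pm(m,m)}:=R^{\pm\pm(m,m)}(u,u)$ does not depend on $u\in\mathbb C^\times$. For such $u,v$ the R-matrices satisfy the recurrences $$\begin{aligned}R^{\pm\pm(n,n)}(u,v)={}&R^{\pm\pm(n-1,n-1)}(u,v)\hat\otimes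 E_{--,--}+R^{\mp\mp(n-1,n-1)}(u,v)\hat\otimes E_{++,++}\\&+\alpha(u,v)\big(R^{\pm\mp(n-1,n-1)}(u,q^2v)\hat\otimes E_{--,++}+R^{\mp\pm(n-1,n-1)}(u,q^2v)\hat\otimes E_{++,--}\big)\\&-\beta(u,v)\big(v\,U^{\mp\pm(n-1,n-1)}(u,q^2v)\hat\otimes E_{-+,+-}+u\,U^{\pm\mp(n-1,n-1)}(u,q^2v)\hat\otimes E_{+-,-+}\big),\end{aligned}$$ $$\begin{aligned}R^{\pm\mp(n,n)}(u,v)={}&R^{\pm\mp(n-1,n-1)}(u,v)\hat\otimes E_{--,--}+R^{\mp\pm(n-1,n-1)}(u,v)\hat\otimes E_{++,++}\\&+R^{\pm\pm(n-1,n-1)}(u,q^2v)\hat\otimes E_{--,++}+R^{\mp\mp(n-1,n-1)}(u,q^2v)\hat\otimes E_{++,--}\\&+\tfrac{q-q^{-1}}{v-u}\big(v\,U^{\mp\mp(n-1,n-1)}(u,q^2v)\hat\otimes E_{-+,+-}+u\,U^{\pm\pm(n-1,n-1)}(u,q^2v)\hat\otimes E_{+-,-+}\big),\end{aligned}$$ where,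 for $m\ge1$, $$U^{\pm\mp(m,m)}(u,v)=R^{\mp\pm(m,m)}(q^2,1)\,F^{\pm\mp(m,m)}R^{\pm\mp(m,m)}(u,v),\qquad U^{\pm\pm(m,m)}(u,v)=Q^{\pm\pm(m,m)}P^{\pm\pm(m,m)}R^{\pm\pm(m,m)}(u,v),$$ and $F$, $Q$ are defined by $F^{\pm\mp(1,1)}=\sum_{i,j=\pm1}f^{(\pm)}_{ij}\otimes f^{(\mp)}_{ji}$, $Q^{\pm\pm(1,1)}=\sum_{i,j=\pm1}ij\,q^{(i-j)/2}f^{(\pm)}_{ij}\otimes f^{(\pm)}_{-i,-j}$ and, for $m\ge2$, $$\begin{aligned}F^{\pm\mp(m,m)}={}&F^{\pm\mp(m-1,m-1)}\hat\otimes E_{--,--}+F^{\mp\pm(m-1,m-1)}\hat\otimes E_{++,++}\\&+P^{\mp\mp(m-1,m-1)}\hat\otimes E_{-+,+-}+P^{\pm\pm(m-1,m-1)}\hat\otimes E_{+-,-+},\\ Q^{\pm\pm(m,m)}={}&Q^{\pm\pm(m-1,m-1)}\hat\otimes E_{--,--}+Q^{\mp\mp(m-1,m-1)}\hat\otimes E_{++,++}\\&+F^{\pm\mp(m-1,m-1)}\hat\otimes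 E_{--,++}+F^{\mp\pm(m-1,m-1)}\hat\otimes E_{++,--}\\&+q^{-1}R^{\mp\pm(m-1,m-1)}(q^2,1)\hat\otimes E_{-+,+-}+q\,R^{\pm\mp(m-1,m-1)}(q^2,1)\hat\otimes E_{+-,-+}.\end{aligned}$$ -/

import Mathlib

open scoped Kronecker

noncomputable section

namespace SpinorD

/-- The basis of `ℂ^{n+1|n+1} = V^{+(n)} ⊕ V^{-(n)}`. A state `m : St n` stands for the vector
`e_{m 0} ⊗̂ ⋯ ⊗̂ e_{m n}` with `m k = ±1`; equivalently for the monomial `x(m₁, …, m_{n+1})` of the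
exterior algebra in which `x_{k+1}` is present if and only if `m k = +1`. -/
abbrev St (n : ℕ) : Type := Fin (n + 1) → ℤˣ

/-- Operators on `ℂ^{n+1|n+1}` (columns are inputs, rows are outputs). -/
abbrev Op (n : ℕ) : Type := Matrix (St n) (St n) ℂ

/-- Operators on `ℂ^{n+1|n+1} ⊗ ℂ^{n+1|n+1}`. An operator from `V^{ε₁(n)} ⊗ V^{ε₂(n)}` to
`V^{δ₁(n)} ⊗ V^{δ₂(n)}` is regarded as an element of `Op₂ n` by extending it by zero. -/
abbrev Op₂ (n : ℕ) : Type := Matrix (St n × St n) (St n × St n) ℂ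

/-- `(-1) ^ deg m`, where `deg m` is the number of entries of `m` equal to `+1`. The space `V^{+(n)}`
is spanned by the states of parity `1`, the space `V^{-(n)}` by those of parity `-1`. -/
def par {n : ℕ} (m : St n) : ℤˣ := ∏ k, -(m k)

/-- A fixed square root `q^{1/2}`. -/
def sq (q : ℝ) : ℂ := (q : ℂ) ^ ((1 : ℂ) / 2)

/-! ### The spinor representation of the `q`-Clifford algebra -/

/-- The sign `(-1)^{m_1 + ⋯ + m_{k-1}}`. -/
def jwSign {n : ℕ} (m : St n) (k : Fin (n + 1)) : ℂ :=
  ∏ l with l < k, (((-(m l) : ℤˣ) : ℤ) : ℂ)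

/-- The operator `a_{k+1}`: `x(m) ↦ (-1)^{m_1 + ⋯ + m_k} x(m - e_{k+1})`. -/
def annih {n : ℕ} (k : Fin (n + 1)) : Op n := fun r c =>
  if c k = 1 ∧ r = Function.update c k (-1) then jwSign c k else 0

/-- The operator `a†_{k+1}`: `x(m) ↦ (-1)^{m_1 + ⋯ + m_k} x(m + e_{k+1})`. -/
def create {n : ℕ} (k : Fin (n + 1)) : Op n := fun r c =>
  if c k = -1 ∧ r = Function.update c k 1 then jwSign c k else 0

/-- `a_i` for `1 ≤ i ≤ n + 1`. -/
def aPos (n : ℕ) (i : ℤ) : Op n :=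
  if h : 0 < i ∧ i ≤ n + 1 then annih ⟨(i - 1).toNat, by omega⟩ else 0

/-- `a†_i` for `1 ≤ i ≤ n + 1`. -/
def adPos (n : ℕ) (i : ℤ) : Op n :=
  if h : 0 < i ∧ i ≤ n + 1 then create ⟨(i - 1).toNat, by omega⟩ else 0

/-- `a_i` for all `i = ±1, …, ±(n + 1)`, with `a_{-i} = q⁻¹ a†_i` for `i > 0`. -/
def aOp (q : ℝ) (n : ℕ) (i : ℤ) : Op n :=
  if 0 < i then aPos n i else (q : ℂ)⁻¹ • adPos n (-i)

/-- `a†_i` for all `i = ±1, …, ±(n + 1)`, with `a†_{-i} = q a_i` for `i > 0`. -/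
def adOp (q : ℝ) (n : ℕ) (i : ℤ) : Op n :=
  if 0 < i then adPos n i else (q : ℂ) • aPos n (-i)

/-- The eigenvalue `q^{-m_i}` of `ω_i` on `x(m)` for `1 ≤ i ≤ n + 1`. -/
def omPos (q : ℝ) {n : ℕ} (i : ℤ) (m : St n) : ℂ :=
  if h : 0 < i ∧ i ≤ n + 1 then
    (if m ⟨(i - 1).toNat, by omega⟩ = 1 then (q : ℂ)⁻¹ else 1) else 1

/-- The eigenvalue of `ω_i` on `x(m)` for all `i = -(n + 1), …, n + 1`, with `ω_0 = q^{-1/2}` and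
`ω_{-i} = q⁻¹ ω_i⁻¹` for `i > 0`. -/
def omEig (q : ℝ) {n : ℕ} (i : ℤ) (m : St n) : ℂ :=
  if 0 < i then omPos q i m
  else if i = 0 then (sq q)⁻¹
  else (q : ℂ)⁻¹ * (omPos q (-i) m)⁻¹

/-- The operator `ω_i`. -/
def om (q : ℝ) (n : ℕ) (i : ℤ) : Op n := Matrix.diagonal fun m => omEig q i m

/-- The operator `ω_i⁻¹`. -/
def omInv (q : ℝ) (n : ℕ) (i : ℤ) : Op n := Matrix.diagonal fun m => (omEig q i m)⁻¹

/-- The product of the (commuting, diagonal) operators `ω_k`, `i < k < j`. -/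
def omProd (q : ℝ) (n : ℕ) (i j : ℤ) : Op n :=
  Matrix.diagonal fun m => ∏ k ∈ Finset.Ioo i j, omEig q k m

/-- The product of the operators `ω_k⁻¹`, `i < k < j`. -/
def omProdInv (q : ℝ) (n : ℕ) (i j : ℤ) : Op n :=
  Matrix.diagonal fun m => ∏ k ∈ Finset.Ioo i j, (omEig q k m)⁻¹

/-! ### The spinor representation of `U_q(so_{2n+2})` and its evaluation representation -/

/-- The index set `{±1, …, ±(n + 1)}` of the vector representation of `so_{2n+2}`. -/
def vecIdx (n : ℕ) : Finset ℤ := (Finset.Icc (-((n : ℤ) + 1)) ((n : ℤ) + 1)).erase 0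

/-- The image of the generator `ℓ⁺_{ij}` of `U_q(so_{2n+2})` in the spinor representation. -/
def ellP (q : ℝ) (n : ℕ) (i j : ℤ) : Op n :=
  if i = j then sq q • om q n i
  else if i = -j then 0
  else if i < j then
    (-(-1 : ℂ) ^ (i + j) * sq q ^ (2 * (i - j) + 3) * ((q : ℂ) - (q : ℂ)⁻¹)) •
      (om q n i * adOp q n i * omProdInv q n i j * aOp q n j)
  else 0

/-- The image of the generator `ℓ⁻_{ij}` of `U_q(so_{2n+2})` in the spinor representation. -/
def ellM (q : ℝ) (n : ℕ) (i j : ℤ) : Op n :=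
  if i = j then (sq q)⁻¹ • omInv q n i
  else if i = -j then 0
  else if j < i then
    ((-1 : ℂ) ^ (i + j) * sq q ^ (2 * (i - j) - 3) * ((q : ℂ) - (q : ℂ)⁻¹)) •
      (adOp q n i * omProd q n j i * aOp q n j * omInv q n j)
  else 0

/-- The image of the generating series `ℓ⁺_{ij}(w)` of the extended quantum loop algebra of
`so_{2n+2}` in the spinor representation with spectral parameter `ρ` (a rational function of `w`). -/
def LP (q : ℝ) (n : ℕ) (ρ w : ℂ) (i j : ℤ) : Op n :=
  (w - ρ)⁻¹ • ((sq q * w) • ellM q n i j - ((sq q)⁻¹ * ρ) • ellP q n i j)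

/-- The image of the generating series `ℓ⁻_{ij}(w)`, likewise. -/
def LM (q : ℝ) (n : ℕ) (ρ w : ℂ) (i j : ℤ) : Op n :=
  (w⁻¹ - ρ⁻¹)⁻¹ • (((sq q)⁻¹ * w⁻¹) • ellP q n i j - (sq q * ρ⁻¹) • ellM q n i j)

/-- The coproduct `∑ₖ ℓ_{ik} ⊗ ℓ_{kj}`, for `X`, `Y` the images of the generators in the two
tensor factors. -/
def coprod (n : ℕ) (X Y : ℤ → ℤ → Op n) (i j : ℤ) : Op₂ n :=
  ∑ k ∈ vecIdx n, X i k ⊗ₖ Y k j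

/-- The opposite coproduct `∑ₖ ℓ_{kj} ⊗ ℓ_{ik}`. -/
def coprodOp (n : ℕ) (X Y : ℤ → ℤ → Op n) (i j : ℤ) : Op₂ n :=
  ∑ k ∈ vecIdx n, X k j ⊗ₖ Y i k

/-! ### Spinor-spinor R-matrices -/

/-- The highest weight vector of `V^{ε(n)}`: `x(0, 0, …, 0)` for `ε = +`, `x(1, 0, …, 0)` for
`ε = -`. -/
def hw (n : ℕ) (ε : ℤˣ) : St n := fun k => if k = 0 ∧ ε = -1 then 1 else -1

/-- `R` is an operator on `V^{ε₁(n)} ⊗ V^{ε₂(n)}` that intertwines the coproduct and the opposite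
coproduct in the spinor evaluation representations with parameters `v` (first factor) and `u`
(second factor), normalised by having coefficient `1` on the tensor product of the highest weight
vectors. -/
structure IsSpinorR (q : ℝ) (n : ℕ) (ε₁ ε₂ : ℤˣ) (u v : ℂ) (R : Op₂ n) : Prop where
  supp : ∀ r c, R r c ≠ 0 → (par r.1 = ε₁ ∧ par r.2 = ε₂) ∧ (par c.1 = ε₁ ∧ par c.2 = ε₂)
  intertwine_pos : ∀ i ∈ vecIdx n, ∀ j ∈ vecIdx n, ∀ w : ℂ, w ≠ 0 → w ≠ u → w ≠ v →
    coprodOp n (LP q n v w) (LP q n u w) i j * R = R * coprod n (LP q n v w) (LP q n u w) i j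
  intertwine_neg : ∀ i ∈ vecIdx n, ∀ j ∈ vecIdx n, ∀ w : ℂ, w ≠ 0 → w ≠ u → w ≠ v →
    coprodOp n (LM q n v w) (LM q n u w) i j * R = R * coprod n (LM q n v w) (LM q n u w) i j
  normalised : R (hw n ε₁, hw n ε₂) (hw n ε₁, hw n ε₂) = 1

/-- Admissible spectral parameters: `u / v ∉ {q^{4k+2}}` if `ε₁ = ε₂`, and `u / v ∉ {q^{4k}}` if
`ε₁ ≠ ε₂`. -/
def Generic (q : ℝ) (ε₁ ε₂ : ℤˣ) (u v : ℂ) : Prop :=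
  u ≠ 0 ∧ v ≠ 0 ∧ ∀ k : ℤ, u ≠ (q : ℂ) ^ (4 * k + if ε₁ = ε₂ then 2 else 0) * v

open Classical in
/-- The spinor-spinor R-matrix `R^{ε₁ε₂(n,n)}(u,v)`: the normalised intertwiner. -/
def spinorR (q : ℝ) (n : ℕ) (ε₁ ε₂ : ℤˣ) (u v : ℂ) : Op₂ n :=
  if h : ∃ R, IsSpinorR q n ε₁ ε₂ u v R then h.choose else 0

/-! ### Auxiliary operators -/

/-- The operator `A ⊗̂ (e_{ab} ⊗ e_{cd})`, that is, `∑ (A' ⊗̂ e_{ab}) ⊗ (A'' ⊗̂ e_{cd})` for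
`A = ∑ A' ⊗ A''`, where `(X ⊗̂ e_{ab})(x ⊗̂ y) = (-1)^{deg e_{ab} deg x} X x ⊗̂ e_{ab} y` and
`deg e_{ab}` is `0` if `a = b` and `1` if `a ≠ b`. -/
def ext {n : ℕ} (A : Op₂ n) (a b c d : ℤˣ) : Op₂ (n + 1) := fun r s =>
  if (r.1 (Fin.last _) = a ∧ s.1 (Fin.last _) = b) ∧
      (r.2 (Fin.last _) = c ∧ s.2 (Fin.last _) = d) then
    (if a = b then 1 else (((par (Fin.init s.1 : St n) : ℤˣ) : ℤ) : ℂ)) *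
    (if c = d then 1 else (((par (Fin.init s.2 : St n) : ℤˣ) : ℤ) : ℂ)) *
    A (Fin.init r.1, Fin.init r.2) (Fin.init s.1, Fin.init s.2)
  else 0

/-- The basis vector `e^{(ε)}_i` of `V^{ε(1)}`: `e^{(+)}_i = e_i ⊗̂ e_i`, `e^{(-)}_i = e_{-i} ⊗̂ e_i`. -/
def vec1 (ε i : ℤˣ) : St 1 := ![ε * i, i]

/-- The operator `f^{(ε)}_{ij} : V^{ε(1)} → V^{-ε(1)}`, `e^{(ε)}_k ↦ δ_{jk} e^{(-ε)}_i`. -/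
def fUnit (ε i j : ℤˣ) : Op 1 := Matrix.single (vec1 (-ε) i) (vec1 ε j) 1

/-- The operator `P^{εε(n,n)} = R^{εε(n,n)}(1,1)` (which is `R^{εε(n,n)}(u,u)` for every `u ≠ 0`). -/
def Pop (q : ℝ) (n : ℕ) (ε : ℤˣ) : Op₂ n := spinorR q n ε ε 1 1

/-- The operator `F^{ε,-ε(n,n)} : V^{ε(n)} ⊗ V^{-ε(n)} → V^{-ε(n)} ⊗ V^{ε(n)}` (`n ≥ 1`). -/
def Fop (q : ℝ) : (n : ℕ) → ℤˣ → Op₂ n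
  | 0, _ => 0
  | 1, ε => ∑ i : ℤˣ, ∑ j : ℤˣ, fUnit ε i j ⊗ₖ fUnit (-ε) j i
  | n + 2, ε =>
      ext (Fop q (n + 1) ε) (-1) (-1) (-1) (-1) + ext (Fop q (n + 1) (-ε)) 1 1 1 1
      + ext (Pop q (n + 1) (-ε)) (-1) 1 1 (-1) + ext (Pop q (n + 1) ε) 1 (-1) (-1) 1

/-- The operator `Q^{εε(n,n)} : V^{ε(n)} ⊗ V^{ε(n)} → V^{-ε(n)} ⊗ V^{-ε(n)}` (`n ≥ 1`). -/
def Qop (q : ℝ) : (n : ℕ) → ℤˣ → Op₂ n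
  | 0, _ => 0
  | 1, ε => ∑ i : ℤˣ, ∑ j : ℤˣ,
      ((((i * j : ℤˣ) : ℤ) : ℂ) * sq q ^ ((i : ℤ) - (j : ℤ))) •
        (fUnit ε i j ⊗ₖ fUnit ε (-i) (-j))
  | n + 2, ε =>
      ext (Qop q (n + 1) ε) (-1) (-1) (-1) (-1) + ext (Qop q (n + 1) (-ε)) 1 1 1 1
      + ext (Fop q (n + 1) ε) (-1) (-1) 1 1 + ext (Fop q (n + 1) (-ε)) 1 1 (-1) (-1)
      + (q : ℂ)⁻¹ • ext (spinorR q (n + 1) (-ε) ε ((q : ℂ) ^ 2) 1) (-1) 1 1 (-1)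
      + (q : ℂ) • ext (spinorR q (n + 1) ε (-ε) ((q : ℂ) ^ 2) 1) 1 (-1) (-1) 1

/-- The operator `U^{ε,-ε(n,n)}(u,v) = R^{-ε,ε(n,n)}(q²,1) F^{ε,-ε(n,n)} R^{ε,-ε(n,n)}(u,v)`. -/
def Uopp (q : ℝ) (n : ℕ) (ε : ℤˣ) (u v : ℂ) : Op₂ n :=
  spinorR q n (-ε) ε ((q : ℂ) ^ 2) 1 * Fop q n ε * spinorR q n ε (-ε) u v

/-- The operator `U^{εε(n,n)}(u,v) = Q^{εε(n,n)} P^{εε(n,n)} R^{εε(n,n)}(u,v)`. -/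
def Usame (q : ℝ) (n : ℕ) (ε : ℤˣ) (u v : ℂ) : Op₂ n :=
  Qop q n ε * Pop q n ε * spinorR q n ε ε u v

/-- `α(u,v) = (v - u) / (q v - q⁻¹ u)`. -/
def alpha (q : ℝ) (u v : ℂ) : ℂ := (v - u) / ((q : ℂ) * v - (q : ℂ)⁻¹ * u)

/-- `β(u,v) = (q - q⁻¹) / (q v - q⁻¹ u)`. -/
def beta (q : ℝ) (u v : ℂ) : ℂ := ((q : ℂ) - (q : ℂ)⁻¹) / ((q : ℂ) * v - (q : ℂ)⁻¹ * u)

end SpinorD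

end

open SpinorD

open scoped Kronecker

noncomputable section

namespace SpinorD

/-! Compose the R-matrix with the flip of the two tensor factors and call the result `G`. For `G`
the two recurrences of the proposition become a single rule for adding a site, which is taken as the
definition of `Gop`. It remains to see that the operator so defined is an intertwiner, that
intertwiners are unique, and that `P`, `F`, `Q`, `U` are what the rule needs.

Existence. In Jordan–Wigner form all generators are tensor products of 2×2 matrices, and the residue
of the spinor `L`-operator has the factorised form `(q² - 1) φ_a χ_b` (`ellM_sub_ellP`). Under the
Chevalley generators of the finite algebra the `χ_b` transform as a vector and the `φ_a` as a dual
vector. Hence the `L`-operator is covariant (`LP_covariant`; its triangular part needs the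
truncation lemmas), and the invariant pairing `∑ φ_k ⊗ χ_k`, which up to parity and a scalar is the
operator `B` of `Bop` (`Bop_eq`), commutes with the coproducts of these generators. The operators
`B` and `G` have a common eigenbasis built site by site: an eigenvector of `B` with eigenvalue `[k]`
keeps it when equal spins are added, and with unequal spins gives one vector for `[1 - k]` and one
for `[-k - 1]`; that `G` acts by scalars is a pair of functional equations for `geig`. As `q` is not
a root of unity, these vectors span and the `[k]` are distinct, so `G` is a polynomial in `B`
(`Gop_eq_aeval`) and commutes with whatever commutes with `B`. The failure of `G` to intertwine is
then itself a covariant matrix of operators, and such a matrix vanishes once its lowest diagonal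
entry does (`Covariant.eq_zero`). That entry involves only `B` on one site fewer and the last site,
and is settled by a 4×4 computation (`lowEntry_mul_Gop`).

Uniqueness. The kernel of a difference of two solutions is stable under all coefficients of the
coproduct. By weight and normalisation it contains the product of the highest weight vectors, and
this product generates the whole sector (`Stable.bv_mem`). The spectral parameters enter there only
through one generator of affine type at the last two sites; the states with opposite spins
everywhere are reached unless `u / v` takes one excluded value.

Recurrences. On its sector `G(u,u)` is the identity and `G(q²,1)` is `B`. Thus `P` and `F` are
flips, `Q` and `R(q²,1)` are `B` composed with the flip, `U` is `B G` composed with the flip, and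
the recurrences are the definition of `Gop` read on a sector. -/

/-! ### Pure tensors -/

/-- The operator `⊗ₖ fₖ` on a tensor power. -/
def pure {N : ℕ} {τ : Type} (f : Fin N → Matrix τ τ ℂ) : Matrix (Fin N → τ) (Fin N → τ) ℂ :=
  fun r c => ∏ k, f k (r k) (c k)

theorem pure_mul {N : ℕ} {τ : Type} [Fintype τ] [DecidableEq τ] (f g : Fin N → Matrix τ τ ℂ) :
    pure f * pure g = pure (fun k => f k * g k) := by
  ext r c
  simp only [pure, Matrix.mul_apply, Finset.prod_univ_sum, Fintype.piFinset_univ,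
    Finset.prod_mul_distrib]

theorem pure_one {N : ℕ} {τ : Type} [DecidableEq τ] :
    pure (fun _ : Fin N => (1 : Matrix τ τ ℂ)) = 1 := by
  ext r c
  rw [pure, Matrix.one_apply]
  split_ifs with h
  · subst h
    exact Finset.prod_eq_one fun k _ => Matrix.one_apply_eq _
  · obtain ⟨k, hk⟩ := Function.ne_iff.1 h
    exact Finset.prod_eq_zero (Finset.mem_univ k) (Matrix.one_apply_ne hk)

theorem pure_diagonal {N : ℕ} {τ : Type} [DecidableEq τ] (d : Fin N → τ → ℂ) :
    pure (fun k => Matrix.diagonal (d k)) = Matrix.diagonal fun m => ∏ k, d k (m k) := by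
  ext r c
  rw [pure, Matrix.diagonal_apply]
  split_ifs with h
  · simp [h]
  · obtain ⟨k, hk⟩ := Function.ne_iff.1 h
    exact Finset.prod_eq_zero (Finset.mem_univ k) (Matrix.diagonal_apply_ne _ hk)

theorem pure_add {N : ℕ} {τ : Type} (k : Fin N) {f g h : Fin N → Matrix τ τ ℂ}
    (hg : ∀ l, l ≠ k → f l = g l) (hh : ∀ l, l ≠ k → f l = h l) (hk : f k = g k + h k) :
    pure f = pure g + pure h := by
  ext r c
  simp only [pure, Matrix.add_apply]
  rw [← Finset.mul_prod_erase _ _ (Finset.mem_univ k), ← Finset.mul_prod_erase _ _ (Finset.mem_univ k),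
    ← Finset.mul_prod_erase _ _ (Finset.mem_univ k), hk, Matrix.add_apply, add_mul]
  congr 2
  · exact Finset.prod_congr rfl fun l hl => by rw [hg l (Finset.ne_of_mem_erase hl)]
  · exact Finset.prod_congr rfl fun l hl => by rw [hh l (Finset.ne_of_mem_erase hl)]

theorem pure_smul {N : ℕ} {τ : Type} (k : Fin N) (c : ℂ) {f g : Fin N → Matrix τ τ ℂ}
    (hg : ∀ l, l ≠ k → f l = g l) (hk : f k = c • g k) : pure f = c • pure g := by
  ext r s
  simp only [pure, Matrix.smul_apply]
  rw [← Finset.mul_prod_erase _ _ (Finset.mem_univ k), ← Finset.mul_prod_erase _ _ (Finset.mem_univ k),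
    hk, Matrix.smul_apply, smul_eq_mul, smul_eq_mul, mul_assoc]
  congr 2
  exact Finset.prod_congr rfl fun l hl => by rw [hg l (Finset.ne_of_mem_erase hl)]

/-- The family equal to `x` before position `t`, to `y` at `t` and to `z` after it. -/
def str {N : ℕ} {α : Type} (x y z : α) (t : ℕ) (k : Fin N) : α :=
  if (k : ℕ) < t then x else if (k : ℕ) = t then y else z

theorem pure_str_mul {N : ℕ} {τ : Type} [Fintype τ] [DecidableEq τ] (x y z x' y' z' : Matrix τ τ ℂ)
    (t : ℕ) : (pure (str x y z t) * pure (str x' y' z' t) : Matrix (Fin N → τ) (Fin N → τ) ℂ) =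
      pure (str (x * x') (y * y') (z * z') t) := by
  rw [pure_mul]
  congr 1
  funext k
  simp only [str]
  split_ifs <;> rfl

theorem pure_str_smul {N : ℕ} {τ : Type} (x y z : Matrix τ τ ℂ) (c : ℂ) {t : ℕ} (ht : t < N) :
    (pure (str x (c • y) z t) : Matrix (Fin N → τ) (Fin N → τ) ℂ) = c • pure (str x y z t) := by
  refine pure_smul ⟨t, ht⟩ c (fun l hl => ?_) (by simp [str])
  have : (l : ℕ) ≠ t := fun h => hl (Fin.ext h)
  simp [str, this]

theorem pure_str_add {N : ℕ} {τ : Type} (x y y' z : Matrix τ τ ℂ) {t : ℕ} (ht : t < N) :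
    (pure (str x (y + y') z t) : Matrix (Fin N → τ) (Fin N → τ) ℂ) =
      pure (str x y z t) + pure (str x y' z t) := by
  refine pure_add ⟨t, ht⟩ (fun l hl => ?_) (fun l hl => ?_) (by simp [str]) <;>
  · have : (l : ℕ) ≠ t := fun h => hl (Fin.ext h)
    simp [str, this]

/-! ### Local matrices -/

/-- The sign operator. -/
def zM : Matrix ℤˣ ℤˣ ℂ := Matrix.diagonal fun τ => if τ = 1 then -1 else 1

/-- The matrix unit with output `τ` and input `-τ`. -/
def sg (τ : ℤˣ) : Matrix ℤˣ ℤˣ ℂ := Matrix.single τ (-τ) 1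

/-- The local form of `ω`. -/
def wM (q : ℂ) : Matrix ℤˣ ℤˣ ℂ := Matrix.diagonal fun τ => if τ = 1 then q⁻¹ else 1

theorem str_of_lt {N : ℕ} {α : Type} (x y z : α) {t : ℕ} {k : Fin N} (h : (k : ℕ) < t) :
    str x y z t k = x := if_pos h

theorem str_of_eq {N : ℕ} {α : Type} (x y z : α) {t : ℕ} {k : Fin N} (h : (k : ℕ) = t) :
    str x y z t k = y := by rw [str, if_neg (by omega), if_pos h]

theorem str_of_gt {N : ℕ} {α : Type} (x y z : α) {t : ℕ} {k : Fin N} (h : t < (k : ℕ)) :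
    str x y z t k = z := by rw [str, if_neg (by omega), if_neg (by omega)]

/-- Jordan–Wigner form: the factors `zM` to the left of `k` multiply to the sign `jwSign`. From here
on all operator identities are checked site by site. -/
theorem pure_str_sg_apply {n : ℕ} (τ : ℤˣ) (k : Fin (n + 1)) (r c : St n) :
    pure (str zM (sg τ) 1 k) r c =
      if c k = -τ ∧ r = Function.update c k τ then jwSign c k else 0 := by
  simp only [pure]
  split_ifs with h
  · obtain ⟨h1, rfl⟩ := h
    rw [jwSign, Finset.prod_filter]
    refine Finset.prod_congr rfl fun l _ => ?_
    rcases lt_trichotomy l k with hl | rfl | hl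
    · rw [str_of_lt _ _ _ hl, if_pos hl, Function.update_of_ne hl.ne]
      rcases Int.units_eq_one_or (c l) with h | h <;> simp [zM, h]
    · rw [str_of_eq _ _ _ rfl]
      simp [sg, h1]
    · rw [str_of_gt _ _ _ hl, if_neg hl.not_gt, Function.update_of_ne hl.ne', Matrix.one_apply_eq]
  · rw [Finset.prod_eq_zero_iff]
    by_contra hc
    push Not at hc
    refine h ⟨?_, ?_⟩
    · have h1 := hc k (Finset.mem_univ _)
      rw [str_of_eq _ _ _ rfl, sg, Matrix.single_apply] at h1
      by_contra h2
      exact h1 (if_neg fun h3 => h2 h3.2.symm)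
    · funext l
      have h1 := hc l (Finset.mem_univ _)
      rcases lt_trichotomy l k with hl | rfl | hl
      · rw [str_of_lt _ _ _ hl, zM, Matrix.diagonal_apply] at h1
        rw [Function.update_of_ne hl.ne]
        by_contra h2
        exact h1 (if_neg h2)
      · rw [str_of_eq _ _ _ rfl, sg, Matrix.single_apply] at h1
        rw [Function.update_self]
        by_contra h2
        exact h1 (if_neg fun h3 => h2 h3.1.symm)
      · rw [str_of_gt _ _ _ hl, Matrix.one_apply] at h1
        rw [Function.update_of_ne hl.ne']
        by_contra h2
        exact h1 (if_neg h2)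

theorem annih_eq {n : ℕ} (k : Fin (n + 1)) : annih k = pure (str zM (sg (-1)) 1 k) := by
  ext r c
  rw [pure_str_sg_apply, annih, neg_neg]

theorem create_eq {n : ℕ} (k : Fin (n + 1)) : create k = pure (str zM (sg 1) 1 k) := by
  ext r c
  rw [pure_str_sg_apply, create]

theorem sq_sq (q : ℝ) : sq q * sq q = q := by
  rw [sq, ← pow_two, ← Complex.cpow_nat_mul]
  simp

theorem sq_ne_zero {q : ℝ} (hq : q ≠ 0) : sq q ≠ 0 := fun h => by
  have := sq_sq q
  rw [h, zero_mul] at this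
  exact hq (by exact_mod_cast this.symm)

theorem sq_zpow_two_mul (q : ℝ) (k : ℤ) : sq q ^ (2 * k) = (q : ℂ) ^ k := by
  rw [zpow_mul, zpow_ofNat, pow_two, sq_sq]

theorem str_self {N : ℕ} {α : Type} (x y z : α) {t : ℕ} (h : t < N) :
    str x y z t (⟨t, h⟩ : Fin N) = y := str_of_eq _ _ _ rfl

/-! ### Indices of the vector representation -/

/-- The position in `0, …, n` of the site on which `a_i` acts. -/
def site (a : ℤ) : ℕ := a.natAbs - 1

/-- The sign of an index of the vector representation. -/
def sgn (a : ℤ) : ℤˣ := if 0 < a then 1 else -1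

theorem mem_vecIdx {n : ℕ} {a : ℤ} : a ∈ vecIdx n ↔ a ≠ 0 ∧ a.natAbs ≤ n + 1 := by
  simp only [vecIdx, Finset.mem_erase, Finset.mem_Icc]
  omega

theorem site_lt {n : ℕ} {a : ℤ} (ha : a ∈ vecIdx n) : site a < n + 1 := by
  have := mem_vecIdx.1 ha
  simp only [site]
  omega

/-- The eigenvalues of `ω` on one site. -/
def wv (Q : ℂ) (τ : ℤˣ) : ℂ := if τ = 1 then Q⁻¹ else 1

/-- The local form of `ω⁻¹`. -/
def wI (Q : ℂ) : Matrix ℤˣ ℤˣ ℂ := Matrix.diagonal fun τ => (wv Q τ)⁻¹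

theorem wM_eq (Q : ℂ) : wM Q = Matrix.diagonal (wv Q) := rfl

theorem wv_ne_zero {Q : ℂ} (hQ : Q ≠ 0) (τ : ℤˣ) : wv Q τ ≠ 0 := by
  rw [wv]; split_ifs <;> simp [hQ]

theorem adOp_eq (q : ℝ) {n : ℕ} {a : ℤ} (ha : a ∈ vecIdx n) :
    adOp q n a = (if 0 < a then (1 : ℂ) else q) • pure (str zM (sg (sgn a)) 1 (site a)) := by
  have h := mem_vecIdx.1 ha
  rw [adOp, sgn]
  split_ifs with h0
  · have hs : (a - 1).toNat = site a := by simp only [site]; omega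
    rw [adPos, dif_pos ⟨h0, by omega⟩, create_eq, one_smul]
    simp only [hs]
  · have hs : (-a - 1).toNat = site a := by simp only [site]; omega
    rw [aPos, dif_pos ⟨by omega, by omega⟩, annih_eq]
    simp only [hs]

theorem aOp_eq (q : ℝ) {n : ℕ} {a : ℤ} (ha : a ∈ vecIdx n) :
    aOp q n a = (if 0 < a then (1 : ℂ) else (q : ℂ)⁻¹) •
      pure (str zM (sg (-sgn a)) 1 (site a)) := by
  have h := mem_vecIdx.1 ha
  rw [aOp, sgn]
  split_ifs with h0
  · have hs : (a - 1).toNat = site a := by simp only [site]; omega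
    rw [aPos, dif_pos ⟨h0, by omega⟩, annih_eq, one_smul]
    simp only [hs]
  · have hs : (-a - 1).toNat = site a := by simp only [site]; omega
    rw [adPos, dif_pos ⟨by omega, by omega⟩, create_eq, neg_neg]
    simp only [hs]

theorem omEig_natCast (q : ℝ) {n : ℕ} (t : ℕ) (ht : t < n + 1) (m : St n) :
    omEig q ((t : ℤ) + 1) m = wv q (m ⟨t, ht⟩) := by
  have hs : ((t : ℤ) + 1 - 1).toNat = t := by omega
  rw [omEig, if_pos (by omega), omPos, dif_pos ⟨by omega, by omega⟩, wv]
  simp only [hs]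

theorem omEig_neg (q : ℝ) {n : ℕ} (t : ℕ) (ht : t < n + 1) (m : St n) :
    omEig q (-((t : ℤ) + 1)) m = (q : ℂ)⁻¹ * (wv q (m ⟨t, ht⟩))⁻¹ := by
  have := omEig_natCast q t ht m
  rw [omEig, if_pos (by omega)] at this
  rw [omEig, if_neg (by omega), if_neg (by omega), neg_neg, this]

theorem omEig_ne_zero {q : ℝ} (hq : q ≠ 0) {n : ℕ} (a : ℤ) (m : St n) : omEig q a m ≠ 0 := by
  have hQ : (q : ℂ) ≠ 0 := by exact_mod_cast hq
  have := sq_ne_zero hq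
  simp only [omEig, omPos]
  split_ifs <;> simp [*]

/-- The eigenvalue of the product of the `ω_k`, `a < k ≤ n + 1`. -/
def tail (q : ℝ) (n : ℕ) (a : ℤ) (m : St n) : ℂ := ∏ k ∈ Finset.Ioc a ((n : ℤ) + 1), omEig q k m

theorem tail_ne_zero {q : ℝ} (hq : q ≠ 0) {n : ℕ} (a : ℤ) (m : St n) : tail q n a m ≠ 0 :=
  Finset.prod_ne_zero_iff.2 fun k _ => omEig_ne_zero hq k m

theorem tail_sub_one (q : ℝ) {n : ℕ} {a : ℤ} (ha : a ≤ n + 1) (m : St n) :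
    tail q n (a - 1) m = omEig q a m * tail q n a m := by
  have : Finset.Ioc (a - 1) ((n : ℤ) + 1) = insert a (Finset.Ioc a ((n : ℤ) + 1)) := by
    ext x; simp only [Finset.mem_insert, Finset.mem_Ioc]; omega
  rw [tail, this, Finset.prod_insert (by simp), tail]

/-- The product of the `ω` between two indices becomes a quotient of a factor depending on `a` only
and one depending on `b` only. This is the source of the factorisation of the residue. -/
theorem prod_Ioo_mul_tail (q : ℝ) {n : ℕ} {a b : ℤ} (hab : a < b) (hb : b ≤ n + 1) (m : St n) :
    (∏ k ∈ Finset.Ioo a b, omEig q k m) * tail q n (b - 1) m = tail q n a m := by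
  have : Finset.Ioc a ((n : ℤ) + 1) = Finset.Ioo a b ∪ Finset.Ioc (b - 1) ((n : ℤ) + 1) := by
    ext x; simp only [Finset.mem_union, Finset.mem_Ioc, Finset.mem_Ioo]; omega
  rw [tail, tail, this, Finset.prod_union]
  exact Finset.disjoint_left.2 fun x hx hy => by
    simp only [Finset.mem_Ioc, Finset.mem_Ioo] at hx hy; omega

theorem prod_str_succ {q : ℝ} {n t : ℕ} (ht : t < n + 1) (m : St n) (y : ℤˣ → ℂ) :
    ∏ k : Fin (n + 1), str (fun _ => 1) y (wv q) t k (m k) =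
      y (m ⟨t, ht⟩) * ∏ k : Fin (n + 1), str (fun _ => 1) (fun _ => 1) (wv q) t k (m k) := by
  rw [← Finset.mul_prod_erase _ _ (Finset.mem_univ ⟨t, ht⟩), str_self]
  conv_rhs => rw [← Finset.mul_prod_erase _ _ (Finset.mem_univ ⟨t, ht⟩), str_self, one_mul]
  congr 1
  refine Finset.prod_congr rfl fun k hk => ?_
  have : (k : ℕ) ≠ t := fun h => (Finset.ne_of_mem_erase hk) (Fin.ext h)
  simp only [str, if_neg this]

theorem str_shift {N : ℕ} {α : Type} (x z : α) (t : ℕ) (k : Fin N) :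
    str x x z t k = str x z z (t + 1) k := by
  simp only [str]
  split_ifs <;> first | rfl | omega

theorem tail_pos (q : ℝ) {n : ℕ} (t : ℕ) (ht : t ≤ n + 1) (m : St n) :
    tail q n t m = ∏ k : Fin (n + 1), str (fun _ => 1) (wv q) (wv q) t k (m k) := by
  induction ht using Nat.decreasingInduction with
  | self =>
    rw [tail, Finset.Ioc_eq_empty (by simp), Finset.prod_empty]
    exact (Finset.prod_eq_one fun k _ => by rw [str_of_lt _ _ _ k.2]).symm
  | of_succ t ht ih =>
    have h := tail_sub_one q (n := n) (a := (t : ℤ) + 1) (by omega) m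
    rw [add_sub_cancel_right] at h
    rw [h, omEig_natCast q t ht, prod_str_succ ht]
    push_cast at ih
    rw [ih]
    simp only [str_shift]

/-- The pairs `ω_{-k} ω_k = q⁻¹` with `k ≤ t` collapse to `q^{-t}`, and `ω_0` contributes
`q^{-1/2}`. -/
theorem tail_neg {q : ℝ} (hq : q ≠ 0) {n : ℕ} (t : ℕ) (ht : t < n + 1) (m : St n) :
    tail q n (-((t : ℤ) + 1)) m = ((sq q)⁻¹ * ((q : ℂ)⁻¹) ^ t) *
      ∏ k : Fin (n + 1), str (fun _ => 1) (wv q) (wv q) t k (m k) := by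
  have hQ : (q : ℂ) ≠ 0 := by exact_mod_cast hq
  induction t with
  | zero =>
    have h := tail_sub_one q (n := n) (a := 0) (by omega) m
    simp only [omEig, lt_irrefl, if_false, if_true] at h
    have h' := tail_pos q 0 (Nat.zero_le _) m
    simp only [Nat.cast_zero, zero_add, pow_zero, mul_one, zero_sub] at h h' ⊢
    rw [h, h']
  | succ t ih =>
    have h := tail_sub_one q (n := n) (a := -((t : ℤ) + 1)) (by omega) m
    have e : -((t : ℤ) + 1) - 1 = -(((t + 1 : ℕ) : ℤ) + 1) := by push_cast; ring
    rw [e] at h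
    rw [h, ih (by omega), omEig_neg q t (by omega), prod_str_succ (by omega)]
    simp only [str_shift]
    have := wv_ne_zero hQ (m ⟨t, by omega⟩)
    rw [pow_succ]
    field_simp

/-! ### The vector operators -/

/-- The scalar in front of `phi`. -/
def cphi (q : ℝ) (a : ℤ) : ℂ := (-1 : ℂ) ^ a * if 0 < a then (q : ℂ) ^ (a - 1) else sq q

/-- The scalar in front of `chi`. -/
def cchi (q : ℝ) (a : ℤ) : ℂ :=
  (-1 : ℂ) ^ a * if 0 < a then (q : ℂ) ^ (-a) else (sq q)⁻¹ * (q : ℂ)⁻¹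

/-- The creation part of the residue of the spinor `L`-operator. -/
def phi (q : ℝ) (n : ℕ) (a : ℤ) : Op n :=
  cphi q a • pure (str zM (sg (sgn a)) (wI q) (site a))

/-- The annihilation part of the residue of the spinor `L`-operator. -/
def chi (q : ℝ) (n : ℕ) (a : ℤ) : Op n :=
  cchi q a • pure (str zM (sg (-sgn a)) (wM q) (site a))

/-- The scalars are arranged so that this product does not depend on the index; hence `∑ φ_k ⊗ χ_k`
has equal coefficients and can be identified with `B`. -/
theorem cphi_mul_cchi {q : ℝ} (hq : q ≠ 0) (a : ℤ) : cphi q a * cchi q a = (q : ℂ)⁻¹ := by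
  have hQ : (q : ℂ) ≠ 0 := by exact_mod_cast hq
  have := sq_ne_zero hq
  have h1 : (-1 : ℂ) ^ a * (-1 : ℂ) ^ a = 1 := by
    rw [← mul_zpow]; simp
  rw [cphi, cchi, mul_mul_mul_comm, h1, one_mul]
  split_ifs
  · rw [← zpow_add₀ hQ, ← zpow_neg_one]; congr 1; ring
  · field_simp

theorem diagonal_prod_str {n : ℕ} (x y z : ℤˣ → ℂ) (t : ℕ) :
    (Matrix.diagonal fun m : St n => ∏ k : Fin (n + 1), str x y z t k (m k)) =
      pure (str (Matrix.diagonal x) (Matrix.diagonal y) (Matrix.diagonal z) t) := by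
  rw [← pure_diagonal]
  congr 1
  funext k
  simp only [str]
  split_ifs <;> rfl

theorem diagonal_site {n : ℕ} (y : ℤˣ → ℂ) (t : ℕ) (ht : t < n + 1) :
    (Matrix.diagonal fun m : St n => y (m ⟨t, ht⟩)) =
      pure (str 1 (Matrix.diagonal y) 1 t) := by
  have h := diagonal_prod_str (n := n) (fun _ => 1) y (fun _ => 1) t
  rw [Matrix.diagonal_one] at h
  rw [← h]
  congr 1
  funext m
  rw [← Finset.mul_prod_erase _ _ (Finset.mem_univ ⟨t, ht⟩), str_self,
    Finset.prod_eq_one, mul_one]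
  intro k hk
  have : (k : ℕ) ≠ t := fun h => (Finset.ne_of_mem_erase hk) (Fin.ext h)
  simp only [str, if_neg this, ite_self]

theorem vecIdx_cases {n : ℕ} {a : ℤ} (ha : a ∈ vecIdx n) :
    ∃ t : ℕ, t < n + 1 ∧ (a = (t : ℤ) + 1 ∨ a = -((t : ℤ) + 1)) := by
  have := mem_vecIdx.1 ha
  exact ⟨a.natAbs - 1, by omega, by omega⟩

@[simp] theorem site_pos (t : ℕ) : site ((t : ℤ) + 1) = t := by simp only [site]; omega

@[simp] theorem site_neg (t : ℕ) : site (-((t : ℤ) + 1)) = t := by simp only [site]; omega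

@[simp] theorem sgn_pos (t : ℕ) : sgn ((t : ℤ) + 1) = 1 := if_pos (by omega)

@[simp] theorem sgn_neg (t : ℕ) : sgn (-((t : ℤ) + 1)) = -1 := if_neg (by omega)

@[simp] theorem site_neg_eq (a : ℤ) : site (-a) = site a := by simp [site]

theorem sgn_neg_eq {a : ℤ} (ha : a ≠ 0) : sgn (-a) = -sgn a := by
  simp only [sgn]; split_ifs <;> first | rfl | omega

theorem sg_mul_same (τ : ℤˣ) : sg τ * sg τ = 0 := by
  rcases Int.units_eq_one_or τ with rfl | rfl <;>
  · ext i j; simp [sg, Matrix.single_mul_single_of_ne]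

theorem diagonal_mul_sg (d : ℤˣ → ℂ) (τ : ℤˣ) : Matrix.diagonal d * sg τ = d τ • sg τ := by
  ext i j
  rw [Matrix.diagonal_mul, Matrix.smul_apply, sg, Matrix.single_apply, smul_eq_mul]
  split_ifs with h
  · rw [h.1]
  · simp

theorem sg_mul_diagonal (d : ℤˣ → ℂ) (τ : ℤˣ) : sg τ * Matrix.diagonal d = d (-τ) • sg τ := by
  ext i j
  rw [Matrix.mul_diagonal, Matrix.smul_apply, sg, Matrix.single_apply, smul_eq_mul]
  split_ifs with h
  · rw [h.2, mul_comm]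
  · simp

theorem wM_mul_sg {Q : ℂ} (τ : ℤˣ) : wM Q * sg τ = wv Q τ • sg τ := diagonal_mul_sg _ _

theorem sg_mul_wM {Q : ℂ} (τ : ℤˣ) : sg τ * wM Q = wv Q (-τ) • sg τ := sg_mul_diagonal _ _

theorem wI_mul_sg {Q : ℂ} (τ : ℤˣ) : wI Q * sg τ = (wv Q τ)⁻¹ • sg τ := diagonal_mul_sg _ _

theorem sg_mul_wI {Q : ℂ} (τ : ℤˣ) : sg τ * wI Q = (wv Q (-τ))⁻¹ • sg τ := sg_mul_diagonal _ _

theorem zM_mul_zM : zM * zM = 1 := by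
  rw [zM, Matrix.diagonal_mul_diagonal, ← Matrix.diagonal_one]
  congr 1; funext τ; split_ifs <;> norm_num

theorem wM_mul_wI {Q : ℂ} (hQ : Q ≠ 0) : wM Q * wI Q = 1 := by
  rw [wM_eq, wI, Matrix.diagonal_mul_diagonal, ← Matrix.diagonal_one]
  congr 1; funext τ; exact mul_inv_cancel₀ (wv_ne_zero hQ τ)

theorem wI_mul_wM {Q : ℂ} (hQ : Q ≠ 0) : wI Q * wM Q = 1 := by
  rw [wM_eq, wI, Matrix.diagonal_mul_diagonal, ← Matrix.diagonal_one]
  congr 1; funext τ; exact inv_mul_cancel₀ (wv_ne_zero hQ τ)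

@[simp] theorem wv_one (Q : ℂ) : wv Q 1 = Q⁻¹ := if_pos rfl
@[simp] theorem wv_neg_one (Q : ℂ) : wv Q (-1) = 1 := if_neg (by decide)

theorem om_pos (q : ℝ) {n t : ℕ} (ht : t < n + 1) :
    om q n ((t : ℤ) + 1) = pure (str 1 (wM q) 1 t) := by
  rw [wM_eq, ← diagonal_site _ t ht, om]
  congr 1; funext m
  exact omEig_natCast q t ht m

theorem om_neg (q : ℝ) {n t : ℕ} (ht : t < n + 1) :
    om q n (-((t : ℤ) + 1)) = (q : ℂ)⁻¹ • pure (str 1 (wI q) 1 t) := by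
  rw [wI, ← diagonal_site _ t ht, om, ← Matrix.diagonal_smul]
  congr 1; funext m
  exact omEig_neg q t ht m

theorem omInv_pos (q : ℝ) {n t : ℕ} (ht : t < n + 1) :
    omInv q n ((t : ℤ) + 1) = pure (str 1 (wI q) 1 t) := by
  rw [wI, ← diagonal_site _ t ht, omInv]
  congr 1; funext m
  rw [omEig_natCast q t ht m]

theorem omInv_neg (q : ℝ) {n t : ℕ} (ht : t < n + 1) :
    omInv q n (-((t : ℤ) + 1)) = (q : ℂ) • pure (str 1 (wM q) 1 t) := by
  rw [wM_eq, ← diagonal_site _ t ht, omInv, ← Matrix.diagonal_smul]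
  congr 1; funext m
  rw [omEig_neg q t ht m, mul_inv, inv_inv, inv_inv]
  rfl

theorem diagonal_tail_pos (q : ℝ) {n t : ℕ} (ht : t ≤ n + 1) :
    (Matrix.diagonal fun m : St n => tail q n t m) = pure (str 1 (wM q) (wM q) t) := by
  have h := diagonal_prod_str (n := n) (fun _ => 1) (wv q) (wv q) t
  rw [Matrix.diagonal_one] at h
  rw [wM_eq, ← h]
  congr 1; funext m
  exact tail_pos q t ht m

theorem diagonal_tail_pos_inv (q : ℝ) {n t : ℕ} (ht : t ≤ n + 1) :
    (Matrix.diagonal fun m : St n => (tail q n t m)⁻¹) = pure (str 1 (wI q) (wI q) t) := by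
  have h := diagonal_prod_str (n := n) (fun _ => 1) (fun τ => (wv q τ)⁻¹) (fun τ => (wv q τ)⁻¹) t
  rw [Matrix.diagonal_one] at h
  rw [wI, ← h]
  congr 1; funext m
  rw [tail_pos q t ht m, ← Finset.prod_inv_distrib]
  refine Finset.prod_congr rfl fun k _ => ?_
  simp only [str]; split_ifs <;> simp

theorem diagonal_tail_neg {q : ℝ} (hq : q ≠ 0) {n t : ℕ} (ht : t < n + 1) :
    (Matrix.diagonal fun m : St n => tail q n (-((t : ℤ) + 1)) m) =
      ((sq q)⁻¹ * ((q : ℂ)⁻¹) ^ t) • pure (str 1 (wM q) (wM q) t) := by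
  rw [← diagonal_tail_pos q ht.le, ← Matrix.diagonal_smul]
  congr 1; funext m
  rw [tail_neg hq t ht m, Pi.smul_apply, tail_pos q t ht.le, smul_eq_mul]

theorem diagonal_tail_neg_inv {q : ℝ} (hq : q ≠ 0) {n t : ℕ} (ht : t < n + 1) :
    (Matrix.diagonal fun m : St n => (tail q n (-((t : ℤ) + 1)) m)⁻¹) =
      (sq q * (q : ℂ) ^ t) • pure (str 1 (wI q) (wI q) t) := by
  rw [← diagonal_tail_pos_inv q ht.le, ← Matrix.diagonal_smul]
  congr 1; funext m
  rw [tail_neg hq t ht m, Pi.smul_apply, tail_pos q t ht.le, smul_eq_mul, mul_inv, mul_inv, inv_inv,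
    inv_pow, inv_inv]

/-- The strings of `ω` between `a` and `b` are extended to the right end of the chain; `phi`
collects the part belonging to `a`, and `chi` below the part belonging to `b`. -/
theorem phi_eq {q : ℝ} (hq : q ≠ 0) {n : ℕ} {a : ℤ} (ha : a ∈ vecIdx n) :
    phi q n a = ((-1 : ℂ) ^ a * (q : ℂ) ^ a) •
      (om q n a * adOp q n a * Matrix.diagonal fun m => (tail q n a m)⁻¹) := by
  have hQ : (q : ℂ) ≠ 0 := by exact_mod_cast hq
  rw [phi, cphi, adOp_eq q ha]
  obtain ⟨t, ht, rfl | rfl⟩ := vecIdx_cases ha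
  · have e : (t : ℤ) + 1 = ((t + 1 : ℕ) : ℤ) := by push_cast; rfl
    have h := diagonal_tail_pos_inv q (n := n) (t := t + 1) (by omega)
    have h' : (pure (str 1 (wI q) (wI q) (t + 1)) : Op n) = pure (str 1 1 (wI q) t) :=
      congrArg pure (funext fun k => (str_shift _ _ _ _).symm)
    rw [om_pos q ht, e, h, ← e, h']
    simp only [site_pos, sgn_pos]
    rw [if_pos (by omega), if_pos (by omega), one_smul, pure_str_mul, pure_str_mul, wM_mul_sg, wv_one]
    simp only [one_mul, mul_one]
    rw [pure_str_smul _ _ _ _ ht, smul_smul,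
      mul_assoc, ← zpow_sub_one₀ hQ]
  · rw [om_neg q ht, diagonal_tail_neg_inv hq ht]
    simp only [site_neg, sgn_neg]
    rw [if_neg (by omega), if_neg (by omega)]
    simp only [Matrix.smul_mul, Matrix.mul_smul, smul_smul]
    rw [pure_str_mul, pure_str_mul, wI_mul_sg, wv_neg_one, inv_one, one_smul, sg_mul_wI, neg_neg, wv_one,
      inv_inv, one_mul, mul_one, mul_one, one_mul, pure_str_smul _ _ _ _ ht, smul_smul]
    congr 1
    rw [zpow_neg (q : ℂ), ← Nat.cast_succ, zpow_natCast, pow_succ]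
    field_simp

theorem chi_eq {q : ℝ} (hq : q ≠ 0) {n : ℕ} {a : ℤ} (ha : a ∈ vecIdx n) :
    chi q n a = ((-1 : ℂ) ^ a * (q : ℂ) ^ (-a)) •
      ((Matrix.diagonal fun m => tail q n (a - 1) m) * aOp q n a) := by
  have hQ : (q : ℂ) ≠ 0 := by exact_mod_cast hq
  rw [chi, cchi, aOp_eq q ha]
  obtain ⟨t, ht, rfl | rfl⟩ := vecIdx_cases ha
  · simp only [add_sub_cancel_right, site_pos, sgn_pos]
    rw [diagonal_tail_pos q ht.le, if_pos (by omega), if_pos (by omega), one_smul, pure_str_mul,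
      wM_mul_sg, wv_neg_one, one_smul, one_mul, mul_one]
  · have h : (Matrix.diagonal fun m : St n => tail q n (-((t : ℤ) + 1) - 1) m) =
        om q n (-((t : ℤ) + 1)) * Matrix.diagonal fun m => tail q n (-((t : ℤ) + 1)) m := by
      rw [om, Matrix.diagonal_mul_diagonal]
      congr 1; funext m
      exact tail_sub_one q (by omega) m
    rw [h, om_neg q ht, diagonal_tail_neg hq ht]
    simp only [site_neg, sgn_neg]
    rw [if_neg (by omega), if_neg (by omega)]
    simp only [Matrix.smul_mul, Matrix.mul_smul, smul_smul]
    rw [pure_str_mul, pure_str_mul, wI_mul_wM hQ, one_mul, one_mul, one_mul, one_mul, neg_neg, mul_one]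
    congr 1
    rw [neg_neg, ← Nat.cast_succ, zpow_natCast, pow_succ, inv_pow]
    field_simp

theorem phi_mul_chi (q : ℝ) (n : ℕ) {a b : ℤ} (h : site a = site b) :
    phi q n a * chi q n b = (cphi q a * cchi q b) •
      pure (str (zM * zM) (sg (sgn a) * sg (-sgn b)) (wI q * wM q) (site a)) := by
  rw [phi, chi, Matrix.smul_mul, Matrix.mul_smul, smul_smul, ← h, pure_str_mul]

theorem pure_str_zero {N t : ℕ} (ht : t < N) {τ : Type} (x z : Matrix τ τ ℂ) :
    (pure (str x 0 z t) : Matrix (Fin N → τ) (Fin N → τ) ℂ) = 0 := by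
  ext r c
  exact Finset.prod_eq_zero (Finset.mem_univ ⟨t, ht⟩) (by rw [str_self]; rfl)

/-- Both operators carry the same nilpotent matrix at the same site. This agrees with the entries `i
= -j` being zero by definition. -/
theorem phi_mul_chi_neg (q : ℝ) {n : ℕ} {a : ℤ} (ha : a ∈ vecIdx n) :
    phi q n a * chi q n (-a) = 0 := by
  rw [phi_mul_chi q n (by simp), sgn_neg_eq (mem_vecIdx.1 ha).1, neg_neg, sg_mul_same,
    pure_str_zero (site_lt ha), smul_zero]

/-- Together with `omInv_mul_aOp` this brings the factors of `ellM` into the order used for `ellP`;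
each of the two reorderings costs one factor `q`. -/
theorem adOp_mul_omInv {q : ℝ} (hq : q ≠ 0) {n : ℕ} {a : ℤ} (ha : a ∈ vecIdx n) :
    adOp q n a * omInv q n a = (q : ℂ) • (om q n a * adOp q n a) := by
  have hQ : (q : ℂ) ≠ 0 := by exact_mod_cast hq
  rw [adOp_eq q ha]
  obtain ⟨t, ht, rfl | rfl⟩ := vecIdx_cases ha
  · rw [om_pos q ht, omInv_pos q ht]
    simp only [site_pos, sgn_pos]
    rw [Matrix.smul_mul, Matrix.mul_smul, pure_str_mul, pure_str_mul, wM_mul_sg, sg_mul_wI,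
      pure_str_smul _ _ _ _ ht, pure_str_smul _ _ _ _ ht, smul_smul, smul_smul, smul_smul]
    simp [hQ]
  · rw [om_neg q ht, omInv_neg q ht]
    simp only [site_neg, sgn_neg]
    rw [Matrix.smul_mul, Matrix.mul_smul, Matrix.smul_mul, Matrix.mul_smul, pure_str_mul,
      pure_str_mul, wI_mul_sg, sg_mul_wM,
      pure_str_smul _ _ _ _ ht, pure_str_smul _ _ _ _ ht, smul_smul, smul_smul, smul_smul, smul_smul,
      smul_smul]
    simp [hQ]

theorem omInv_mul_aOp {q : ℝ} (hq : q ≠ 0) {n : ℕ} {a : ℤ} (ha : a ∈ vecIdx n) :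
    omInv q n a * (aOp q n a * omInv q n a) = (q : ℂ) • aOp q n a := by
  have hQ : (q : ℂ) ≠ 0 := by exact_mod_cast hq
  rw [aOp_eq q ha]
  obtain ⟨t, ht, rfl | rfl⟩ := vecIdx_cases ha
  · rw [omInv_pos q ht]
    simp only [site_pos, sgn_pos]
    rw [Matrix.smul_mul, Matrix.mul_smul, pure_str_mul, pure_str_mul, sg_mul_wI, Matrix.mul_smul,
      wI_mul_sg, pure_str_smul _ _ _ _ ht, pure_str_smul _ _ _ _ ht, smul_smul, smul_smul, smul_smul]
    simp
  · rw [omInv_neg q ht]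
    simp only [site_neg, sgn_neg]
    rw [Matrix.smul_mul, Matrix.mul_smul, Matrix.smul_mul, Matrix.mul_smul, Matrix.mul_smul, pure_str_mul,
      pure_str_mul, sg_mul_wM, Matrix.mul_smul, wM_mul_sg,
      pure_str_smul _ _ _ _ ht, pure_str_smul _ _ _ _ ht, smul_smul, smul_smul, smul_smul, smul_smul,
      smul_smul]
    simp [hQ]

theorem pure_str_sub {N t : ℕ} (ht : t < N) {τ : Type} (x z y y' : Matrix τ τ ℂ) :
    (pure (str x y z t) - pure (str x y' z t) : Matrix (Fin N → τ) (Fin N → τ) ℂ) =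
      pure (str x (y - y') z t) := by
  rw [sub_eq_iff_eq_add, ← pure_str_add _ _ _ _ ht, sub_add_cancel]

theorem sg_mul_sg_neg (τ : ℤˣ) : sg τ * sg (-τ) = Matrix.diagonal fun σ => if σ = τ then 1 else 0 := by
  rcases Int.units_eq_one_or τ with rfl | rfl <;>
  · ext i j
    rcases Int.units_eq_one_or i with rfl | rfl <;> rcases Int.units_eq_one_or j with rfl | rfl <;>
      simp [sg, Matrix.single_apply, Matrix.diagonal_apply]

/-- The residue of the spinor `L`-operator factorises. -/
theorem ellM_sub_ellP {q : ℝ} (hq : q ≠ 0) {n : ℕ} {a b : ℤ} (ha : a ∈ vecIdx n) (hb : b ∈ vecIdx n) :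
    sq q • ellM q n a b - (sq q)⁻¹ • ellP q n a b =
      ((q : ℂ) ^ 2 - 1) • (phi q n a * chi q n b) := by
  have hQ : (q : ℂ) ≠ 0 := by exact_mod_cast hq
  have hp := sq_ne_zero hq
  have hab1 : (-1 : ℂ) ^ (a + b) = (-1) ^ a * (-1) ^ b := zpow_add₀ (by norm_num) _ _
  have hab2 : (q : ℂ) ^ (a - b) = q ^ a * q ^ (-b) := by rw [sub_eq_add_neg, zpow_add₀ hQ]
  have hpp : sq q ^ 3 = q * sq q := by rw [pow_succ, pow_two, sq_sq]
  have ha' := mem_vecIdx.1 ha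
  have hb' := mem_vecIdx.1 hb
  rcases eq_or_ne a b with rfl | hne
  -- On the diagonal `ω⁻¹ - ω` is zero for one spin at the site of `a` and `q - q⁻¹` for the other,
  -- so it is a multiple of the projector `sg τ * sg (-τ)`.
  · rw [phi_mul_chi q n rfl, cphi_mul_cchi hq, zM_mul_zM, wI_mul_wM hQ, sg_mul_sg_neg, ellM, ellP, if_pos rfl,
      if_pos rfl, smul_smul, smul_smul, mul_inv_cancel₀ hp, inv_mul_cancel₀ hp, one_smul, one_smul]
    obtain ⟨t, ht, rfl | rfl⟩ := vecIdx_cases ha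
    · rw [om_pos q ht, omInv_pos q ht, pure_str_sub ht, smul_smul, site_pos, sgn_pos,
        ← pure_str_smul _ _ _ _ ht, wI, wM_eq, Matrix.diagonal_sub, ← Matrix.diagonal_smul]
      congr 3; funext τ
      rcases Int.units_eq_one_or τ with rfl | rfl
      · simp; field_simp
      · simp
    · rw [om_neg q ht, omInv_neg q ht, smul_smul, ← pure_str_smul _ _ _ _ ht, ← pure_str_smul _ _ _ _ ht,
        pure_str_sub ht, site_neg, sgn_neg,
        ← pure_str_smul _ _ _ _ ht, wI, wM_eq, ← Matrix.diagonal_smul, ← Matrix.diagonal_smul,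
        Matrix.diagonal_sub, ← Matrix.diagonal_smul]
      congr 3; funext τ
      rcases Int.units_eq_one_or τ with rfl | rfl
      · simp [hQ]
      · simp; field_simp
  rcases eq_or_ne a (-b) with rfl | hne'
  · have := phi_mul_chi_neg q ha
    rw [neg_neg] at this
    rw [this, smul_zero, ellM, ellP, if_neg hne, if_neg hne, if_pos rfl, if_pos rfl]
    simp
  rw [phi_eq hq ha, chi_eq hq hb, Matrix.smul_mul, Matrix.mul_smul, smul_smul, smul_smul]
  rcases lt_or_gt_of_ne hne with h | h
  · rw [ellM, ellP, if_neg hne, if_neg hne, if_neg hne', if_neg hne', if_neg h.not_gt, if_pos h, smul_zero,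
      zero_sub, smul_smul, ← neg_smul]
    have hd : omProdInv q n a b = (Matrix.diagonal fun m => (tail q n a m)⁻¹) *
        Matrix.diagonal fun m => tail q n (b - 1) m := by
      rw [Matrix.diagonal_mul_diagonal, omProdInv]
      congr 1; funext m
      rw [← prod_Ioo_mul_tail q h (by omega), Finset.prod_inv_distrib, mul_inv, mul_assoc,
        inv_mul_cancel₀ (tail_ne_zero hq _ _), mul_one]
    rw [hd]
    simp only [Matrix.mul_assoc]
    congr 1
    rw [zpow_add₀ hp, sq_zpow_two_mul, hab1, hab2, zpow_ofNat, hpp]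
    field_simp
  · rw [ellM, ellP, if_neg hne, if_neg hne, if_neg hne', if_neg hne', if_neg h.not_gt, if_pos h, smul_zero,
      sub_zero, smul_smul]
    -- Now the string runs upwards from `b` to `a`. Replacing `tail b` and `tail (a - 1)` by `tail
    -- (b - 1)` and `tail a` leaves one factor `ω⁻¹` at each end.
    have hd : omProd q n b a = omInv q n a * (Matrix.diagonal fun m => (tail q n a m)⁻¹) *
        (Matrix.diagonal fun m => tail q n (b - 1) m) * omInv q n b := by
      rw [omInv, omInv, Matrix.diagonal_mul_diagonal, Matrix.diagonal_mul_diagonal,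
        Matrix.diagonal_mul_diagonal, omProd]
      congr 1; funext m
      have h1 := prod_Ioo_mul_tail q h (by omega) m
      rw [tail_sub_one q (by omega)] at h1
      rw [tail_sub_one q (by omega), ← h1]
      have := tail_ne_zero hq a m
      have := omEig_ne_zero hq a m
      have := omEig_ne_zero hq b m
      field_simp
    have hl : adOp q n a * omProd q n b a * aOp q n b * omInv q n b = ((q : ℂ) * q) •
        (om q n a * adOp q n a * (Matrix.diagonal fun m => (tail q n a m)⁻¹) *
        ((Matrix.diagonal fun m => tail q n (b - 1) m) * aOp q n b)) := by
      rw [hd]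
      calc _ = (adOp q n a * omInv q n a) * (Matrix.diagonal fun m => (tail q n a m)⁻¹) *
          ((Matrix.diagonal fun m => tail q n (b - 1) m) * (omInv q n b * (aOp q n b * omInv q n b))) := by
            simp only [Matrix.mul_assoc]
        _ = _ := by
            rw [adOp_mul_omInv hq ha, omInv_mul_aOp hq hb]
            simp only [Matrix.smul_mul, Matrix.mul_smul, smul_smul]
    rw [hl, smul_smul]
    congr 1
    rw [zpow_sub₀ hp, sq_zpow_two_mul, hab1, hab2, zpow_ofNat, hpp]
    field_simp

/-! ### Chevalley generators -/

/-- The family equal to `x` before position `t`, to `y`, `y'` at `t`, `t + 1` and to `z` afterwards. -/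
def str2 {N : ℕ} {α : Type} (x y y' z : α) (t : ℕ) (k : Fin N) : α :=
  if (k : ℕ) < t then x else if (k : ℕ) = t then y else if (k : ℕ) = t + 1 then y' else z

theorem str_eq_str2 {N : ℕ} {α : Type} (x y z : α) (t : ℕ) :
    (str x y z t : Fin N → α) = str2 x y z z t := by
  funext k; simp only [str, str2]; split_ifs <;> rfl

theorem str_succ_eq_str2 {N : ℕ} {α : Type} (x y z : α) (t : ℕ) :
    (str x y z (t + 1) : Fin N → α) = str2 x x y z t := by
  funext k; simp only [str, str2]; split_ifs <;> first | rfl | omega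

theorem pure_str2_mul {N : ℕ} {τ : Type} [Fintype τ] [DecidableEq τ]
    (x y w z x' y' w' z' : Matrix τ τ ℂ) (t : ℕ) :
    (pure (str2 x y w z t) * pure (str2 x' y' w' z' t) : Matrix (Fin N → τ) (Fin N → τ) ℂ) =
      pure (str2 (x * x') (y * y') (w * w') (z * z') t) := by
  rw [pure_mul]
  congr 1
  funext k
  simp only [str2]
  split_ifs <;> rfl

section
variable {N : ℕ} {τ : Type} (x y y' w w' z : Matrix τ τ ℂ) {t : ℕ}

theorem pure_str2_smul_left (c : ℂ) (ht : t < N) :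
    (pure (str2 x (c • y) w z t) : Matrix (Fin N → τ) (Fin N → τ) ℂ) = c • pure (str2 x y w z t) := by
  refine pure_smul ⟨t, ht⟩ c (fun l hl => ?_) (by simp [str2])
  have : (l : ℕ) ≠ t := fun h => hl (Fin.ext h)
  simp [str2, this]

theorem pure_str2_smul_right (c : ℂ) (ht : t + 1 < N) :
    (pure (str2 x y (c • w) z t) : Matrix (Fin N → τ) (Fin N → τ) ℂ) = c • pure (str2 x y w z t) := by
  refine pure_smul ⟨t + 1, ht⟩ c (fun l hl => ?_) (by simp [str2])
  have : (l : ℕ) ≠ t + 1 := fun h => hl (Fin.ext h)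
  simp [str2, this]

theorem pure_str2_add_left (ht : t < N) :
    (pure (str2 x (y + y') w z t) : Matrix (Fin N → τ) (Fin N → τ) ℂ) =
      pure (str2 x y w z t) + pure (str2 x y' w z t) := by
  refine pure_add ⟨t, ht⟩ (fun l hl => ?_) (fun l hl => ?_) (by simp [str2]) <;>
  · have : (l : ℕ) ≠ t := fun h => hl (Fin.ext h)
    simp [str2, this]

theorem pure_str2_add_right (ht : t + 1 < N) :
    (pure (str2 x y (w + w') z t) : Matrix (Fin N → τ) (Fin N → τ) ℂ) =
      pure (str2 x y w z t) + pure (str2 x y w' z t) := by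
  refine pure_add ⟨t + 1, ht⟩ (fun l hl => ?_) (fun l hl => ?_) (by simp [str2]) <;>
  · have : (l : ℕ) ≠ t + 1 := fun h => hl (Fin.ext h)
    simp [str2, this]

end

/-- A Chevalley generator of `so_{2n+2}` in the spinor representation: `a†_x a_y` up to a scalar, for
`x = ε (t + 1)` and `y = δ (t + 2)`, where `ε = δ` or `t = 0`. -/
def genE (n t : ℕ) (ε δ : ℤˣ) : Op n := pure (str2 1 (sg ε) (sg (-δ)) 1 t)

/-- The eigenvalues at the first site of the group-like element belonging to a Chevalley generator. -/
def kv (Q : ℂ) (ε δ τ : ℤˣ) : ℂ := (wv Q (ε * δ * τ))⁻¹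

/-- The group-like element belonging to a Chevalley generator. -/
def genK (q : ℝ) (n t : ℕ) (ε δ : ℤˣ) : Op n :=
  pure (str2 1 (Matrix.diagonal (kv q ε δ)) (wM q) 1 t)

/-- The index `ε (t + 1)` of the vector representation. -/
def ix (t : ℕ) (ε : ℤˣ) : ℤ := ε * ((t : ℤ) + 1)

/-- The matrix of a Chevalley generator in the vector representation. -/
def arrow (q : ℝ) (t : ℕ) (ε δ : ℤˣ) (b' b : ℤ) : ℂ :=
  if b = ix t ε ∧ b' = ix (t + 1) δ then
    -((ε : ℤ) : ℂ) * wv q δ * (cchi q (ix t ε) / cchi q (ix (t + 1) δ))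
  else if b = -ix (t + 1) δ ∧ b' = -ix t ε then
    ((ε : ℤ) : ℂ) * (wv q (-δ))⁻¹ * (cchi q (-ix (t + 1) δ) / cchi q (-ix t ε))
  else 0

/-- The weights of the group-like element in the vector representation. -/
def kap (q : ℝ) (t : ℕ) (ε δ : ℤˣ) (b : ℤ) : ℂ :=
  if b = ix t ε ∨ b = -ix (t + 1) δ then wv q δ / wv q (-δ)
  else if b = -ix t ε ∨ b = ix (t + 1) δ then wv q (-δ) / wv q δ
  else 1

theorem ix_one (t : ℕ) : ix t 1 = (t : ℤ) + 1 := by simp [ix]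

theorem ix_neg (t : ℕ) (ε : ℤˣ) : ix t (-ε) = -ix t ε := by simp [ix]

theorem ix_neg_one (t : ℕ) : ix t (-1) = -((t : ℤ) + 1) := by rw [ix_neg, ix_one]

theorem ix_cases (t : ℕ) (ε : ℤˣ) : ix t ε = (t : ℤ) + 1 ∨ ix t ε = -((t : ℤ) + 1) := by
  rcases Int.units_eq_one_or ε with rfl | rfl
  · exact Or.inl (ix_one t)
  · exact Or.inr (ix_neg_one t)

theorem ix_mem {n t : ℕ} (ht : t < n + 1) (ε : ℤˣ) : ix t ε ∈ vecIdx n := by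
  rcases ix_cases t ε with h | h <;> rw [h, mem_vecIdx] <;> omega

theorem neg_ix_mem {n t : ℕ} (ht : t < n + 1) (ε : ℤˣ) : -ix t ε ∈ vecIdx n := by
  rw [← ix_neg]; exact ix_mem ht _

@[simp] theorem site_ix (t : ℕ) (ε : ℤˣ) : site (ix t ε) = t := by
  rcases ix_cases t ε with h | h <;> rw [h, site] <;> omega

@[simp] theorem sgn_ix (t : ℕ) (ε : ℤˣ) : sgn (ix t ε) = ε := by
  rcases Int.units_eq_one_or ε with rfl | rfl
  · rw [ix_one, sgn_pos]
  · rw [ix_neg_one, sgn_neg]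

@[simp] theorem sgn_neg_ix (t : ℕ) (ε : ℤˣ) : sgn (-ix t ε) = -ε := by rw [← ix_neg, sgn_ix]

theorem exists_eq_ix {n : ℕ} {a : ℤ} (ha : a ∈ vecIdx n) : ∃ t < n + 1, ∃ ε, a = ix t ε := by
  obtain ⟨t, ht, h | h⟩ := vecIdx_cases ha
  · exact ⟨t, ht, 1, by rw [h, ix_one]⟩
  · exact ⟨t, ht, -1, by rw [h, ix_neg_one]⟩

theorem ix_inj {t t' : ℕ} {ε ε' : ℤˣ} : ix t ε = ix t' ε' ↔ t = t' ∧ ε = ε' := by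
  refine ⟨fun h => ⟨?_, ?_⟩, fun h => by rw [h.1, h.2]⟩
  · rw [← site_ix t ε, h, site_ix]
  · rw [← sgn_ix t ε, h, sgn_ix]

theorem cchi_ne_zero {q : ℝ} (hq : q ≠ 0) (a : ℤ) : cchi q a ≠ 0 := by
  have hQ : (q : ℂ) ≠ 0 := by exact_mod_cast hq
  intro h
  have := cphi_mul_cchi hq a
  rw [h, mul_zero] at this
  exact inv_ne_zero hQ this.symm

theorem sum_arrow_col {M : Type} [AddCommGroup M] [Module ℂ M] (q : ℝ) {n t : ℕ}
    (ht : t + 1 < n + 1) (ε δ : ℤˣ) (b : ℤ) (f : ℤ → M) :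
    ∑ b' ∈ vecIdx n, arrow q t ε δ b' b • f b' =
      if b = ix t ε then
        (-((ε : ℤ) : ℂ) * wv q δ * (cchi q (ix t ε) / cchi q (ix (t + 1) δ))) • f (ix (t + 1) δ)
      else if b = -ix (t + 1) δ then
        (((ε : ℤ) : ℂ) * (wv q (-δ))⁻¹ * (cchi q (-ix (t + 1) δ) / cchi q (-ix t ε))) • f (-ix t ε)
      else 0 := by
  have hne : ix t ε ≠ -ix (t + 1) δ := by rw [← ix_neg, Ne, ix_inj]; omega
  split_ifs with h1 h2
  · subst h1
    rw [Finset.sum_eq_single (ix (t + 1) δ)]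
    · rw [arrow, if_pos ⟨rfl, rfl⟩]
    · intro b' _ hb'
      rw [arrow, if_neg (fun h => hb' h.2), if_neg (fun h => hne h.1), zero_smul]
    · exact fun h => absurd (ix_mem ht δ) h
  · subst h2
    rw [Finset.sum_eq_single (-ix t ε)]
    · rw [arrow, if_neg (fun h => h1 h.1), if_pos ⟨rfl, rfl⟩]
    · intro b' _ hb'
      rw [arrow, if_neg (fun h => h1 h.1), if_neg (fun h => hb' h.2), zero_smul]
    · exact fun h => absurd (neg_ix_mem (by omega) ε) h
  · refine Finset.sum_eq_zero fun b' _ => ?_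
    rw [arrow, if_neg (fun h => h1 h.1), if_neg (fun h => h2 h.1), zero_smul]

theorem sum_arrow_row {M : Type} [AddCommGroup M] [Module ℂ M] (q : ℝ) {n t : ℕ}
    (ht : t + 1 < n + 1) (ε δ : ℤˣ) (a : ℤ) (f : ℤ → M) :
    ∑ a' ∈ vecIdx n, arrow q t ε δ a a' • f a' =
      if a = ix (t + 1) δ then
        (-((ε : ℤ) : ℂ) * wv q δ * (cchi q (ix t ε) / cchi q (ix (t + 1) δ))) • f (ix t ε)
      else if a = -ix t ε then
        (((ε : ℤ) : ℂ) * (wv q (-δ))⁻¹ * (cchi q (-ix (t + 1) δ) / cchi q (-ix t ε))) •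
          f (-ix (t + 1) δ)
      else 0 := by
  have hne : ix t ε ≠ -ix (t + 1) δ := by rw [← ix_neg, Ne, ix_inj]; omega
  split_ifs with h1 h2
  · subst h1
    rw [Finset.sum_eq_single (ix t ε)]
    · rw [arrow, if_pos ⟨rfl, rfl⟩]
    · intro b' _ hb'
      rw [arrow, if_neg (fun h => hb' h.1), if_neg, zero_smul]
      rintro ⟨-, h⟩
      exact hne (by rw [h, neg_neg])
    · exact fun h => absurd (ix_mem (by omega) ε) h
  · subst h2
    rw [Finset.sum_eq_single (-ix (t + 1) δ)]
    · rw [arrow, if_neg (fun h => h1 h.2), if_pos ⟨rfl, rfl⟩]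
    · intro b' _ hb'
      rw [arrow, if_neg (fun h => h1 h.2), if_neg (fun h => hb' h.1), zero_smul]
    · exact fun h => absurd (neg_ix_mem ht δ) h
  · refine Finset.sum_eq_zero fun b' _ => ?_
    rw [arrow, if_neg (fun h => h1 h.2), if_neg (fun h => h2 h.2), zero_smul]

theorem zM_mul_sg (τ : ℤˣ) : zM * sg τ = (-((τ : ℤ) : ℂ)) • sg τ := by
  rw [zM, diagonal_mul_sg]
  rcases Int.units_eq_one_or τ with rfl | rfl <;> simp

theorem sg_mul_zM (τ : ℤˣ) : sg τ * zM = ((τ : ℤ) : ℂ) • sg τ := by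
  rw [zM, sg_mul_diagonal]
  rcases Int.units_eq_one_or τ with rfl | rfl <;> simp

theorem diagonal_commute (d d' : ℤˣ → ℂ) : Matrix.diagonal d * Matrix.diagonal d' =
    Matrix.diagonal d' * Matrix.diagonal d := by
  simp [Matrix.diagonal_mul_diagonal, mul_comm]

/-- Signs and weights picked up at individual sites are harmless when they compensate each other;
for a Chevalley generator they arise at two neighbouring sites. -/
theorem pure_commute {N : ℕ} {τ : Type} [Fintype τ] [DecidableEq τ] {f g : Fin N → Matrix τ τ ℂ}
    (c : Fin N → ℂ) (h : ∀ k, f k * g k = c k • (g k * f k)) (hc : ∏ k, c k = 1) :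
    pure f * pure g = pure g * pure f := by
  rw [pure_mul, pure_mul]
  ext r s
  simp only [pure, h, Matrix.smul_apply, smul_eq_mul, Finset.prod_mul_distrib, hc, one_mul]

theorem prod_str2 {N t : ℕ} (ht : t + 1 < N) (a b : ℂ) :
    ∏ k : Fin N, str2 1 a b 1 t k = a * b := by
  rw [Finset.prod_eq_mul (⟨t, by omega⟩ : Fin N) ⟨t + 1, ht⟩ (by simp)]
  · simp [str2]
  · rintro c - ⟨h1, h2⟩
    have h1 : (c : ℕ) ≠ t := fun h => h1 (Fin.ext h)
    have h2 : (c : ℕ) ≠ t + 1 := fun h => h2 (Fin.ext h)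
    simp [str2, h1, h2]
  · simp
  · simp

/-- A string operator on a different site commutes with a Chevalley generator. -/
theorem string_commute_genE {n t : ℕ} (ht : t + 1 < n + 1) {ε δ : ℤˣ} (h : ε = δ ∨ t = 0) {s : ℕ}
    (h1 : s ≠ t) (h2 : s ≠ t + 1) (y : Matrix ℤˣ ℤˣ ℂ) {d : ℤˣ → ℂ} (hd : ∀ τ, d τ ≠ 0) :
    pure (str zM y (Matrix.diagonal d) s) * genE n t ε δ =
      genE n t ε δ * pure (str zM y (Matrix.diagonal d) s) := by
  rcases lt_or_gt_of_ne h1 with hs | hs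
  -- The diagonal part of the string covers both sites of the generator. The factors are inverse to
  -- each other because the two spins move oppositely; the generators at `t = 0` with `ε ≠ δ` have
  -- no site to their left.
  · obtain rfl : ε = δ := h.resolve_right (by omega)
    refine pure_commute (str2 1 (d ε / d (-ε)) (d (-ε) / d ε) 1 t) (fun k => ?_) ?_
    · simp only [str2, str]
      split_ifs <;> first | omega | simp only [diagonal_mul_sg, sg_mul_diagonal, smul_smul, neg_neg,
        one_mul, mul_one, one_smul, div_mul_cancel₀ _ (hd _)]
    · rw [prod_str2 ht, div_mul_div_cancel₀ (hd _), div_self (hd _)]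
  -- The sign part of the string covers both sites, and each gives a sign.
  · refine pure_commute (str2 1 (-1) (-1) 1 t) (fun k => ?_) ?_
    · simp only [str2, str]
      split_ifs <;> first | omega | simp [zM_mul_sg, sg_mul_zM]
    · rw [prod_str2 ht]; norm_num

theorem string_commute_genK {n t : ℕ} {q : ℝ} {ε δ : ℤˣ} {s : ℕ} (h1 : s ≠ t) (h2 : s ≠ t + 1)
    (y : Matrix ℤˣ ℤˣ ℂ) (d : ℤˣ → ℂ) :
    pure (str zM y (Matrix.diagonal d) s) * genK q n t ε δ =
      genK q n t ε δ * pure (str zM y (Matrix.diagonal d) s) := by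
  refine pure_commute (fun _ => 1) (fun k => ?_) (by simp)
  simp only [str2, str, wM_eq, zM]
  split_ifs <;> first | omega | simp [mul_comm]

theorem kap_of_site_ne (q : ℝ) {t : ℕ} (ε δ : ℤˣ) {b : ℤ} (h1 : site b ≠ t) (h2 : site b ≠ t + 1) :
    kap q t ε δ b = 1 := by
  have e1 : b ≠ ix t ε := fun h => h1 (by rw [h, site_ix])
  have e2 : b ≠ -ix t ε := fun h => h1 (by rw [h, site_neg_eq, site_ix])
  have e3 : b ≠ ix (t + 1) δ := fun h => h2 (by rw [h, site_ix])
  have e4 : b ≠ -ix (t + 1) δ := fun h => h2 (by rw [h, site_neg_eq, site_ix])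
  simp [kap, e1, e2, e3, e4]

theorem kap_x (q : ℝ) (t : ℕ) (ε δ : ℤˣ) : kap q t ε δ (ix t ε) = wv q δ / wv q (-δ) :=
  if_pos (Or.inl rfl)

theorem kap_neg_y (q : ℝ) (t : ℕ) (ε δ : ℤˣ) :
    kap q t ε δ (-ix (t + 1) δ) = wv q δ / wv q (-δ) := if_pos (Or.inr rfl)

theorem kap_neg_x (q : ℝ) (t : ℕ) (ε δ : ℤˣ) : kap q t ε δ (-ix t ε) = wv q (-δ) / wv q δ := by
  rw [kap, if_neg, if_pos (Or.inl rfl)]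
  simp only [← ix_neg, ix_inj]
  rcases Int.units_eq_one_or ε with rfl | rfl <;> simp

theorem kap_y (q : ℝ) (t : ℕ) (ε δ : ℤˣ) :
    kap q t ε δ (ix (t + 1) δ) = wv q (-δ) / wv q δ := by
  rw [kap, if_neg, if_pos (Or.inr rfl)]
  simp only [← ix_neg, ix_inj]
  rcases Int.units_eq_one_or δ with rfl | rfl <;> simp

theorem eq_or_eq_neg_ix {b : ℤ} (hb : b ≠ 0) {t : ℕ} (h : site b = t) (ε : ℤˣ) :
    b = ix t ε ∨ b = -ix t ε := by
  simp only [site] at h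
  rcases ix_cases t ε with h' | h' <;> omega

/-- Reduction of a statement about an index to the four indices moved by a Chevalley generator. -/
theorem index_cases {b : ℤ} (hb : b ≠ 0) (t : ℕ) (ε δ : ℤˣ) :
    (site b ≠ t ∧ site b ≠ t + 1) ∨ b = ix t ε ∨ b = -ix t ε ∨ b = ix (t + 1) δ ∨
      b = -ix (t + 1) δ := by
  by_cases h1 : site b = t
  · rcases eq_or_eq_neg_ix hb h1 ε with h | h <;> simp [h]
  by_cases h2 : site b = t + 1
  · rcases eq_or_eq_neg_ix hb h2 δ with h | h <;> simp [h]
  exact Or.inl ⟨h1, h2⟩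

theorem ix_ne {t t' : ℕ} (h : t ≠ t') (ε ε' : ℤˣ) : ix t ε ≠ ix t' ε' := fun h' => h (ix_inj.1 h').1

theorem ix_ne_neg {t : ℕ} (ε : ℤˣ) : ix t ε ≠ -ix t ε := by
  rw [← ix_neg, Ne, ix_inj]
  rcases Int.units_eq_one_or ε with rfl | rfl <;> simp

/-- The annihilation parts transform as a vector. -/
theorem chi_covariant {q : ℝ} (hq : q ≠ 0) {n t : ℕ} (ht : t + 1 < n + 1) {ε δ : ℤˣ}
    (h : ε = δ ∨ t = 0) {b : ℤ} (hb : b ∈ vecIdx n) :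
    ∑ b' ∈ vecIdx n, arrow q t ε δ b' b • chi q n b' +
      kap q t ε δ b • (chi q n b * genE n t ε δ) = genE n t ε δ * chi q n b := by
  have hQ : (q : ℂ) ≠ 0 := by exact_mod_cast hq
  have hc := fun a => cchi_ne_zero hq a
  have hw := wv_ne_zero hQ
  rw [sum_arrow_col q ht]
  have n1 : ∀ ε δ, ix (t + 1) δ ≠ ix t ε := fun ε δ => ix_ne (by omega) _ _
  have n2 : ∀ ε δ, ix (t + 1) δ ≠ -ix t ε := fun ε δ => by rw [← ix_neg]; exact n1 _ _
  have n3 : ∀ ε δ, -ix (t + 1) δ ≠ ix t ε := fun ε δ => by rw [← ix_neg]; exact n1 _ _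
  have n4 : ∀ ε δ, -ix (t + 1) δ ≠ -ix t ε := fun ε δ => by simpa using n1 ε δ
  have ps := @pure_str2_smul_left (n + 1) ℤˣ
  rcases index_cases (mem_vecIdx.1 hb).1 t ε δ with ⟨h1, h2⟩ | rfl | rfl | rfl | rfl
  · rw [kap_of_site_ne q ε δ h1 h2, if_neg (fun e => h1 (by rw [e, site_ix])),
      if_neg (fun e => h2 (by rw [e, site_neg_eq, site_ix])), zero_add, one_smul, chi, wM_eq,
      Matrix.smul_mul, Matrix.mul_smul, string_commute_genE ht h h1 h2 _ hw]
  · rw [if_pos rfl, kap_x]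
    simp only [chi, site_ix, sgn_ix, genE]
    rw [str_succ_eq_str2, str_eq_str2, Matrix.smul_mul, Matrix.mul_smul, pure_str2_mul, pure_str2_mul,
      sg_mul_wM, wM_mul_sg, neg_neg, pure_str2_smul_right _ _ _ _ _ ht,
      pure_str2_smul_right _ _ _ _ _ ht, mul_one, one_mul, mul_one, one_mul]
    -- The commutator at site `t` is a multiple of `zM`, which prolongs the sign string up to site
    -- `t + 1` and so produces `chi` at the index `ix (t + 1) δ`.
    have e : sg ε * sg (-ε) = sg (-ε) * sg ε + (-((ε : ℤ) : ℂ)) • zM := by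
      have := sg_mul_sg_neg (-ε)
      rw [neg_neg] at this
      rw [this, sg_mul_sg_neg, zM, ← Matrix.diagonal_smul, Matrix.diagonal_add]
      congr 1; funext τ
      rcases Int.units_eq_one_or ε with rfl | rfl <;> rcases Int.units_eq_one_or τ with rfl | rfl <;> simp
    rw [e, pure_str2_add_left _ _ _ _ _ (by omega), pure_str2_smul_left _ _ _ _ _ (by omega)]
    simp only [smul_smul, smul_add]
    rw [add_comm]
    congr 1
    · congr 1
      field_simp [hw (-δ)]
    · congr 1
      field_simp [hc (ix (t + 1) δ)]
  · rw [if_neg (ix_ne_neg ε).symm, if_neg (n4 _ _).symm, zero_add]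
    simp only [chi, site_ix, sgn_neg_ix, site_neg_eq,
      genE, neg_neg]
    rw [str_eq_str2, Matrix.smul_mul, Matrix.mul_smul, pure_str2_mul, pure_str2_mul,
      sg_mul_same]
    have z : ∀ x w z : Matrix ℤˣ ℤˣ ℂ, (pure (str2 x 0 w z t) : Op n) = 0 := fun x w z => by
      have := ps x 0 w z 0 (t := t) (by omega)
      rwa [zero_smul, zero_smul] at this
    rw [z, z]; simp
  · rw [if_neg (n1 _ _), if_neg (ix_ne_neg δ), zero_add]
    simp only [chi, site_ix, sgn_ix, genE]
    rw [str_succ_eq_str2, Matrix.smul_mul, Matrix.mul_smul, pure_str2_mul, pure_str2_mul,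
      sg_mul_same]
    have z : ∀ x w z : Matrix ℤˣ ℤˣ ℂ, (pure (str2 x w 0 z t) : Op n) = 0 := fun x w z => by
      have := pure_str2_smul_right (N := n + 1) x w 0 z 0 ht
      rwa [zero_smul, zero_smul] at this
    rw [z, z]; simp
  · rw [if_neg (n3 _ _), if_pos rfl, kap_neg_y]
    simp only [chi, site_ix, sgn_neg_ix, site_neg_eq, genE, neg_neg]
    rw [str_succ_eq_str2, str_eq_str2, Matrix.smul_mul, Matrix.mul_smul, pure_str2_mul, pure_str2_mul,
      zM_mul_sg, sg_mul_zM, mul_one, one_mul, mul_one, one_mul,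
      pure_str2_smul_left _ _ _ _ _ (by omega), pure_str2_smul_left _ _ _ _ _ (by omega)]
    -- The multiple of `wM` at site `t + 1` prolongs the tail of the string to the left and produces
    -- `chi` at `-ix t ε`; the other term is the one with the weight `kap`.
    have e : sg (-δ) * sg δ = (wv q (-δ))⁻¹ • wM q + (-(wv q δ / wv q (-δ))) • (sg δ * sg (-δ)) := by
      have := sg_mul_sg_neg (-δ)
      rw [neg_neg] at this
      rw [this, sg_mul_sg_neg, wM_eq, ← Matrix.diagonal_smul, ← Matrix.diagonal_smul, Matrix.diagonal_add]
      congr 1; funext τ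
      rcases Int.units_eq_one_or δ with rfl | rfl <;> rcases Int.units_eq_one_or τ with rfl | rfl <;>
        simp [hQ]
    rw [e, pure_str2_add_right _ _ _ _ _ ht, pure_str2_smul_right _ _ _ _ _ ht,
      pure_str2_smul_right _ _ _ _ _ ht]
    simp only [smul_smul, smul_add]
    congr 1
    · congr 1
      field_simp [hc (-ix t ε)]
    · congr 1
      ring

theorem genK_mul_chi {q : ℝ} (hq : q ≠ 0) {n t : ℕ} (ht : t + 1 < n + 1) (ε δ : ℤˣ)
    {b : ℤ} (hb : b ∈ vecIdx n) :
    genK q n t ε δ * chi q n b = kap q t ε δ b • (chi q n b * genK q n t ε δ) := by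
  have hQ : (q : ℂ) ≠ 0 := by exact_mod_cast hq
  have hw := wv_ne_zero hQ
  have h1 : ε * δ * ε = δ := by rw [mul_comm ε δ, mul_assoc, Int.units_mul_self, mul_one]
  have h2 : ε * δ * -ε = -δ := by rw [mul_neg, h1]
  rcases index_cases (mem_vecIdx.1 hb).1 t ε δ with ⟨h1, h2⟩ | rfl | rfl | rfl | rfl
  · rw [kap_of_site_ne q ε δ h1 h2, one_smul, chi, wM_eq, Matrix.smul_mul, Matrix.mul_smul,
      string_commute_genK h1 h2]
  · rw [kap_x]
    simp only [chi, site_ix, sgn_ix, genK]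
    rw [str_eq_str2, Matrix.smul_mul, Matrix.mul_smul, pure_str2_mul, pure_str2_mul, diagonal_mul_sg,
      sg_mul_diagonal, neg_neg, pure_str2_smul_left _ _ _ _ _ (by omega),
      pure_str2_smul_left _ _ _ _ _ (by omega), smul_smul, smul_smul, smul_smul, kv, kv, h1, h2]
    simp only [mul_one, one_mul]
    congr 1
    field_simp [hw δ, hw (-δ)]
  · rw [kap_neg_x]
    simp only [chi, site_neg_eq, site_ix, sgn_neg_ix, genK, neg_neg]
    rw [str_eq_str2, Matrix.smul_mul, Matrix.mul_smul, pure_str2_mul, pure_str2_mul, diagonal_mul_sg,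
      sg_mul_diagonal, pure_str2_smul_left _ _ _ _ _ (by omega),
      pure_str2_smul_left _ _ _ _ _ (by omega), smul_smul, smul_smul, smul_smul, kv, kv, h1, h2]
    simp only [mul_one, one_mul]
    congr 1
    field_simp [hw δ, hw (-δ)]
  · rw [kap_y]
    simp only [chi, site_ix, sgn_ix, genK]
    rw [str_succ_eq_str2, Matrix.smul_mul, Matrix.mul_smul, pure_str2_mul, pure_str2_mul, wM_mul_sg,
      sg_mul_wM, neg_neg, pure_str2_smul_right _ _ _ _ _ ht,
      pure_str2_smul_right _ _ _ _ _ ht, smul_smul, smul_smul, smul_smul, zM, diagonal_commute]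
    simp only [mul_one, one_mul]
    congr 1
    field_simp [hw δ, hw (-δ)]
  · rw [kap_neg_y]
    simp only [chi, site_neg_eq, site_ix, sgn_neg_ix, genK, neg_neg]
    rw [str_succ_eq_str2, Matrix.smul_mul, Matrix.mul_smul, pure_str2_mul, pure_str2_mul, wM_mul_sg,
      sg_mul_wM, pure_str2_smul_right _ _ _ _ _ ht,
      pure_str2_smul_right _ _ _ _ _ ht, smul_smul, smul_smul, smul_smul, zM, diagonal_commute]
    simp only [mul_one, one_mul]
    congr 1
    field_simp [hw δ, hw (-δ)]

theorem phi_mul_genK {q : ℝ} (hq : q ≠ 0) {n t : ℕ} (ht : t + 1 < n + 1) (ε δ : ℤˣ)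
    {b : ℤ} (hb : b ∈ vecIdx n) :
    phi q n b * genK q n t ε δ = kap q t ε δ b • (genK q n t ε δ * phi q n b) := by
  have hQ : (q : ℂ) ≠ 0 := by exact_mod_cast hq
  have hw := wv_ne_zero hQ
  have h1 : ε * δ * ε = δ := by rw [mul_comm ε δ, mul_assoc, Int.units_mul_self, mul_one]
  have h2 : ε * δ * -ε = -δ := by rw [mul_neg, h1]
  rcases index_cases (mem_vecIdx.1 hb).1 t ε δ with ⟨h1, h2⟩ | rfl | rfl | rfl | rfl
  · rw [kap_of_site_ne q ε δ h1 h2, one_smul, phi, wI, Matrix.smul_mul, Matrix.mul_smul,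
      string_commute_genK h1 h2]
  · rw [kap_x]
    simp only [phi, site_ix, sgn_ix, genK]
    rw [str_eq_str2, Matrix.smul_mul, Matrix.mul_smul, pure_str2_mul, pure_str2_mul, diagonal_mul_sg,
      sg_mul_diagonal, pure_str2_smul_left _ _ _ _ _ (by omega),
      pure_str2_smul_left _ _ _ _ _ (by omega), smul_smul, smul_smul, smul_smul, kv, kv, h1, h2,
      wM_mul_wI hQ, wI_mul_wM hQ]
    simp only [mul_one, one_mul]
    congr 1
    field_simp [hw δ, hw (-δ)]
  · rw [kap_neg_x]
    simp only [phi, site_neg_eq, site_ix, sgn_neg_ix, genK]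
    rw [str_eq_str2, Matrix.smul_mul, Matrix.mul_smul, pure_str2_mul, pure_str2_mul, diagonal_mul_sg,
      sg_mul_diagonal, neg_neg, pure_str2_smul_left _ _ _ _ _ (by omega),
      pure_str2_smul_left _ _ _ _ _ (by omega), smul_smul, smul_smul, smul_smul, kv, kv, h1, h2,
      wM_mul_wI hQ, wI_mul_wM hQ]
    simp only [mul_one, one_mul]
    congr 1
    field_simp [hw δ, hw (-δ)]
  · rw [kap_y]
    simp only [phi, site_ix, sgn_ix, genK]
    rw [str_succ_eq_str2, Matrix.smul_mul, Matrix.mul_smul, pure_str2_mul, pure_str2_mul, wM_mul_sg,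
      sg_mul_wM, pure_str2_smul_right _ _ _ _ _ ht,
      pure_str2_smul_right _ _ _ _ _ ht, smul_smul, smul_smul, smul_smul, zM, diagonal_commute]
    simp only [mul_one, one_mul]
    congr 1
    field_simp [hw δ, hw (-δ)]
  · rw [kap_neg_y]
    simp only [phi, site_neg_eq, site_ix, sgn_neg_ix, genK]
    rw [str_succ_eq_str2, Matrix.smul_mul, Matrix.mul_smul, pure_str2_mul, pure_str2_mul, wM_mul_sg,
      sg_mul_wM, neg_neg, pure_str2_smul_right _ _ _ _ _ ht,
      pure_str2_smul_right _ _ _ _ _ ht, smul_smul, smul_smul, smul_smul, zM, diagonal_commute]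
    simp only [mul_one, one_mul]
    congr 1
    field_simp [hw δ, hw (-δ)]

theorem sg_anticommutator (τ : ℤˣ) : sg τ * sg (-τ) + sg (-τ) * sg τ = 1 := by
  have := sg_mul_sg_neg (-τ)
  rw [neg_neg] at this
  rw [this, sg_mul_sg_neg, Matrix.diagonal_add, ← Matrix.diagonal_one]
  congr 1; funext σ
  rcases Int.units_eq_one_or τ with rfl | rfl <;> rcases Int.units_eq_one_or σ with rfl | rfl <;> simp

/-- The creation parts transform as a dual vector. -/
theorem phi_covariant {q : ℝ} (hq : q ≠ 0) {n t : ℕ} (ht : t + 1 < n + 1) {ε δ : ℤˣ}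
    (h : ε = δ ∨ t = 0) {a : ℤ} (ha : a ∈ vecIdx n) :
    ∑ a' ∈ vecIdx n, arrow q t ε δ a a' • (genK q n t ε δ * phi q n a') +
      genE n t ε δ * phi q n a = phi q n a * genE n t ε δ := by
  have hQ : (q : ℂ) ≠ 0 := by exact_mod_cast hq
  have hc := fun a => cchi_ne_zero hq a
  have hw := wv_ne_zero hQ
  have hcp : ∀ a, cphi q a = (q : ℂ)⁻¹ / cchi q a := fun a => by
    rw [eq_div_iff (hc a), cphi_mul_cchi hq]
  rw [sum_arrow_row q ht]
  have n1 : ∀ ε δ, ix (t + 1) δ ≠ ix t ε := fun ε δ => ix_ne (by omega) _ _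
  have n2 : ∀ ε δ, ix (t + 1) δ ≠ -ix t ε := fun ε δ => by rw [← ix_neg]; exact n1 _ _
  have n3 : ∀ ε δ, -ix (t + 1) δ ≠ ix t ε := fun ε δ => by rw [← ix_neg]; exact n1 _ _
  have n4 : ∀ ε δ, -ix (t + 1) δ ≠ -ix t ε := fun ε δ => by simpa using n1 ε δ
  have h1 : ε * δ * ε = δ := by rw [mul_comm ε δ, mul_assoc, Int.units_mul_self, mul_one]
  have h2 : ε * δ * -ε = -δ := by rw [mul_neg, h1]
  rcases index_cases (mem_vecIdx.1 ha).1 t ε δ with ⟨h1, h2⟩ | rfl | rfl | rfl | rfl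
  · rw [if_neg (fun e => h2 (by rw [e, site_ix])),
      if_neg (fun e => h1 (by rw [e, site_neg_eq, site_ix])), zero_add, phi, wI,
      Matrix.smul_mul, Matrix.mul_smul, string_commute_genE ht h h1 h2 _ fun τ => inv_ne_zero (hw τ)]
  · rw [if_neg (n1 _ _).symm, if_neg (ix_ne_neg ε), zero_add]
    simp only [phi, site_ix, sgn_ix, genE]
    rw [str_eq_str2, Matrix.smul_mul, Matrix.mul_smul, pure_str2_mul, pure_str2_mul,
      sg_mul_same]
    have z : ∀ x w z : Matrix ℤˣ ℤˣ ℂ, (pure (str2 x 0 w z t) : Op n) = 0 := fun x w z => by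
      have := pure_str2_smul_left (N := n + 1) (t := t) x 0 w z 0 (by omega)
      rwa [zero_smul, zero_smul] at this
    rw [z, z]
  · rw [if_neg (n2 _ _).symm, if_pos rfl]
    simp only [phi, site_neg_eq, site_ix, sgn_neg_ix, genE, genK]
    rw [str_succ_eq_str2, str_eq_str2, Matrix.smul_mul, Matrix.mul_smul, Matrix.mul_smul, pure_str2_mul,
      pure_str2_mul, pure_str2_mul, wM_mul_sg, sg_mul_wI, wI_mul_sg, neg_neg,
      pure_str2_smul_right _ _ _ _ _ ht,
      pure_str2_smul_right _ _ _ _ _ ht, pure_str2_smul_right _ _ _ _ _ ht]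
    simp only [mul_one, one_mul]
    -- The first term is the local factor of `genK` times the sign string of `phi` at `-ix (t + 1)
    -- δ`, the second that of `genE * phi` at `-ix t ε`.
    have e : sg (-ε) * sg ε = (((ε : ℤ) : ℂ) * wv q (-δ)) • (Matrix.diagonal (kv q ε δ) * zM) +
        (wv q (-δ) / wv q δ) • (sg ε * sg (-ε)) := by
      have := sg_mul_sg_neg (-ε)
      rw [neg_neg] at this
      rw [this, sg_mul_sg_neg, zM, Matrix.diagonal_mul_diagonal, ← Matrix.diagonal_smul,
        ← Matrix.diagonal_smul, Matrix.diagonal_add]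
      congr 1; funext τ
      rcases Int.units_eq_one_or ε with rfl | rfl <;> rcases Int.units_eq_one_or δ with rfl | rfl <;>
        rcases Int.units_eq_one_or τ with rfl | rfl <;> simp [kv, hQ]
    rw [e, pure_str2_add_left _ _ _ _ _ (by omega), pure_str2_smul_left _ _ _ _ _ (by omega),
      pure_str2_smul_left _ _ _ _ _ (by omega)]
    simp only [smul_smul, smul_add]
    rw [hcp, hcp]
    congr 1
    · congr 1
      have := hc (-ix (t + 1) δ)
      have := hc (-ix t ε)
      field_simp [hw (-δ)]
    · congr 1
      field_simp [hw (-δ), hw δ]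
  · rw [if_pos rfl]
    simp only [phi, site_ix, sgn_ix, genE, genK]
    rw [str_succ_eq_str2, str_eq_str2, Matrix.smul_mul, Matrix.mul_smul, Matrix.mul_smul, pure_str2_mul,
      pure_str2_mul, pure_str2_mul, zM_mul_sg, sg_mul_zM, diagonal_mul_sg, wM_mul_wI hQ, kv, h1,
      pure_str2_smul_left _ _ _ _ _ (by omega),
      pure_str2_smul_left _ _ _ _ _ (by omega), pure_str2_smul_left _ _ _ _ _ (by omega)]
    simp only [mul_one, one_mul]
    -- In `genK * phi` the factor at site `t + 1` is `wM * wI = 1`. Written as an anticommutator,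
    -- one half cancels `genE * phi` and the other is `phi * genE`.
    rw [← sg_anticommutator δ, pure_str2_add_right _ _ _ _ _ ht]
    simp only [smul_smul, smul_add]
    rw [hcp, hcp, add_assoc, ← add_smul]
    have e : (-((ε : ℤ) : ℂ) * wv q δ * (cchi q (ix t ε) / cchi q (ix (t + 1) δ)) *
      ((q : ℂ)⁻¹ / cchi q (ix t ε) * (wv q δ)⁻¹)) = -((q : ℂ)⁻¹ / cchi q (ix (t + 1) δ) * ((ε : ℤ) : ℂ)) := by
      have := hc (ix (t + 1) δ)
      have := hc (ix t ε)
      field_simp [hw δ]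
    rw [e, neg_add_cancel, zero_smul, add_zero]
    congr 1
    ring
  · rw [if_neg (ix_ne_neg δ).symm, if_neg (n4 _ _), zero_add]
    simp only [phi, site_neg_eq, site_ix, sgn_neg_ix, genE]
    rw [str_succ_eq_str2, Matrix.smul_mul, Matrix.mul_smul, pure_str2_mul, pure_str2_mul,
      sg_mul_same]
    have z : ∀ x w z : Matrix ℤˣ ℤˣ ℂ, (pure (str2 x w 0 z t) : Op n) = 0 := fun x w z => by
      have := pure_str2_smul_right (N := n + 1) x w 0 z 0 ht
      rwa [zero_smul, zero_smul] at this
    rw [z, z]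

/-! ### Covariance of the `L`-operators -/

/-- The matrix of operators `L` intertwines the action of a Chevalley generator given by the matrix `e`
and the weights `κ` on the vector representation, by `E` (inputs) and `E'` (outputs) and the group-like
element `K` on the other representation. -/
def Covariant {I : Type} [Fintype I] (n : ℕ) (e : ℤ → ℤ → ℂ) (κ : ℤ → ℂ) (E E' K : Matrix I I ℂ)
    (L : ℤ → ℤ → Matrix I I ℂ) : Prop :=
  ∀ a ∈ vecIdx n, ∀ b ∈ vecIdx n,
    ∑ b' ∈ vecIdx n, e b' b • L a b' + κ b • (L a b * E) =
      ∑ a' ∈ vecIdx n, e a a' • (K * L a' b) + E' * L a b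

theorem Covariant.add {I : Type} [Fintype I] {n : ℕ} {e : ℤ → ℤ → ℂ} {κ : ℤ → ℂ}
    {E E' K : Matrix I I ℂ} {L L' : ℤ → ℤ → Matrix I I ℂ} (h : Covariant n e κ E E' K L)
    (h' : Covariant n e κ E E' K L') : Covariant n e κ E E' K fun a b => L a b + L' a b := by
  intro a ha b hb
  simp only [smul_add, add_mul, mul_add, Finset.sum_add_distrib]
  rw [add_add_add_comm, h a ha b hb, h' a ha b hb, add_add_add_comm]

theorem Covariant.smul {I : Type} [Fintype I] {n : ℕ} {e : ℤ → ℤ → ℂ} {κ : ℤ → ℂ}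
    {E E' K : Matrix I I ℂ} {L : ℤ → ℤ → Matrix I I ℂ} (h : Covariant n e κ E E' K L) (c : ℂ) :
    Covariant n e κ E E' K fun a b => c • L a b := by
  intro a ha b hb
  have := congrArg (c • ·) (h a ha b hb)
  simpa only [smul_add, Finset.smul_sum, Matrix.smul_mul, Matrix.mul_smul, smul_comm c] using this

/-- The residue of the `L`-operator. -/
def Lam (q : ℝ) (n : ℕ) (a b : ℤ) : Op n := ((q : ℂ) ^ 2 - 1) • (phi q n a * chi q n b)

theorem Lam_neg {q : ℝ} {n : ℕ} {a : ℤ} (ha : a ∈ vecIdx n) : Lam q n a (-a) = 0 := by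
  rw [Lam, phi_mul_chi_neg q ha, smul_zero]

theorem smul_ellM_of_lt {q : ℝ} {n : ℕ} {a b : ℤ} (h : a < b) : sq q • ellM q n a b = 0 := by
  rw [ellM, if_neg h.ne, if_neg h.not_gt]
  split_ifs <;> simp

theorem ellP_of_gt {q : ℝ} {n : ℕ} {a b : ℤ} (h : b < a) : ellP q n a b = 0 := by
  rw [ellP, if_neg h.ne', if_neg h.not_gt]
  split_ifs <;> rfl

theorem smul_ellM_of_gt {q : ℝ} (hq : q ≠ 0) {n : ℕ} {a b : ℤ} (ha : a ∈ vecIdx n)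
    (hb : b ∈ vecIdx n) (h : b < a) : sq q • ellM q n a b = Lam q n a b := by
  rw [Lam, ← ellM_sub_ellP hq ha hb, ellP_of_gt h, smul_zero, sub_zero]

theorem smul_ellP_of_lt {q : ℝ} (hq : q ≠ 0) {n : ℕ} {a b : ℤ} (ha : a ∈ vecIdx n)
    (hb : b ∈ vecIdx n) (h : a < b) : (sq q)⁻¹ • ellP q n a b = -Lam q n a b := by
  rw [Lam, ← ellM_sub_ellP hq ha hb, smul_ellM_of_lt h, zero_sub, neg_neg]

theorem smul_ellM_neg {q : ℝ} {n : ℕ} {a : ℤ} (ha : a ≠ 0) : sq q • ellM q n a (-a) = 0 := by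
  rw [ellM, if_neg (by omega), if_pos (by ring), smul_zero]

theorem smul_ellM_self {q : ℝ} (hq : q ≠ 0) {n : ℕ} {a : ℤ} :
    sq q • ellM q n a a = omInv q n a := by
  rw [ellM, if_pos rfl, smul_smul, mul_inv_cancel₀ (sq_ne_zero hq), one_smul]

theorem smul_ellP_self {q : ℝ} (hq : q ≠ 0) {n : ℕ} {a : ℤ} :
    (sq q)⁻¹ • ellP q n a a = om q n a := by
  rw [ellP, if_pos rfl, smul_smul, inv_mul_cancel₀ (sq_ne_zero hq), one_smul]

theorem smul_ellM_self' {q : ℝ} (hq : q ≠ 0) {n : ℕ} {a : ℤ} (ha : a ∈ vecIdx n) :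
    sq q • ellM q n a a = Lam q n a a + om q n a := by
  rw [Lam, ← ellM_sub_ellP hq ha ha, smul_ellP_self hq, sub_add_cancel]

/-- A dual vector times a vector: `phi * genE * chi` is the common value of both sides of the two
covariance relations. -/
theorem Lam_covariant {q : ℝ} (hq : q ≠ 0) {n t : ℕ} (ht : t + 1 < n + 1) {ε δ : ℤˣ}
    (h : ε = δ ∨ t = 0) : Covariant n (arrow q t ε δ) (kap q t ε δ) (genE n t ε δ) (genE n t ε δ)
      (genK q n t ε δ) (Lam q n) := by
  refine Covariant.smul (L := fun a b => phi q n a * chi q n b) ?_ _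
  intro a ha b hb
  have h1 := congrArg (phi q n a * ·) (chi_covariant hq ht h hb)
  have h2 := congrArg (· * chi q n b) (phi_covariant hq ht h ha)
  simp only [mul_add, add_mul, Finset.mul_sum, Finset.sum_mul, Matrix.mul_smul, Matrix.smul_mul] at h1 h2
  simp only [Matrix.mul_assoc] at h1 h2 ⊢
  rw [h1, h2]

/-- The eigenvalues of `ω_a` on the site of `a`. -/
def ov (Q : ℂ) (ε τ : ℤˣ) : ℂ := if ε = 1 then wv Q τ else Q⁻¹ * (wv Q τ)⁻¹

theorem om_ix (q : ℝ) {n t : ℕ} (ht : t < n + 1) (ε : ℤˣ) :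
    om q n (ix t ε) = pure (str 1 (Matrix.diagonal (ov q ε)) 1 t) := by
  rcases Int.units_eq_one_or ε with rfl | rfl
  · rw [ix_one, om_pos q ht, wM_eq]
    rfl
  · rw [ix_neg_one, om_neg q ht, ← pure_str_smul _ _ _ _ ht, wI, ← Matrix.diagonal_smul]
    rfl

theorem ov_ne_zero {Q : ℂ} (hQ : Q ≠ 0) (ε τ : ℤˣ) : ov Q ε τ ≠ 0 := by
  have := wv_ne_zero hQ τ
  rw [ov]; split_ifs <;> simp [hQ, this]

theorem omInv_ix (q : ℝ) {n t : ℕ} (ht : t < n + 1) (ε : ℤˣ) :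
    omInv q n (ix t ε) = pure (str 1 (Matrix.diagonal fun τ => (ov q ε τ)⁻¹) 1 t) := by
  rcases Int.units_eq_one_or ε with rfl | rfl
  · rw [ix_one, omInv_pos q ht, wI]
    rfl
  · rw [ix_neg_one, omInv_neg q ht, ← pure_str_smul _ _ _ _ ht, wM_eq, ← Matrix.diagonal_smul]
    congr 3; funext τ
    simp [ov, mul_comm]

theorem site_diagonal_genE {n t : ℕ} (ht : t + 1 < n + 1) (ε δ : ℤˣ) (s : ℕ) (d : ℤˣ → ℂ) :
    (s ≠ t → s ≠ t + 1 → pure (str 1 (Matrix.diagonal d) 1 s) * genE n t ε δ =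
      genE n t ε δ * pure (str 1 (Matrix.diagonal d) 1 s)) ∧
    (s = t → d (-ε) • (pure (str 1 (Matrix.diagonal d) 1 s) * genE n t ε δ) =
      d ε • (genE n t ε δ * pure (str 1 (Matrix.diagonal d) 1 s))) ∧
    (s = t + 1 → d δ • (pure (str 1 (Matrix.diagonal d) 1 s) * genE n t ε δ) =
      d (-δ) • (genE n t ε δ * pure (str 1 (Matrix.diagonal d) 1 s))) := by
  refine ⟨fun h1 h2 => ?_, ?_, ?_⟩
  · refine pure_commute (fun _ => 1) (fun k => ?_) (by simp)
    simp only [str2, str]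
    split_ifs <;> first | omega | simp
  · rintro rfl
    rw [genE, str_eq_str2, pure_str2_mul, pure_str2_mul, diagonal_mul_sg, sg_mul_diagonal,
      pure_str2_smul_left _ _ _ _ _ (by omega), pure_str2_smul_left _ _ _ _ _ (by omega), smul_smul, smul_smul,
      mul_comm]
    simp only [mul_one, one_mul]
  · rintro rfl
    rw [genE, str_succ_eq_str2, pure_str2_mul, pure_str2_mul, diagonal_mul_sg, sg_mul_diagonal,
      pure_str2_smul_right _ _ _ _ _ ht, pure_str2_smul_right _ _ _ _ _ ht, smul_smul, smul_smul,
      mul_comm, neg_neg]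
    simp only [mul_one, one_mul]

theorem smul_eq_of_smul_eq {M : Type} [AddCommGroup M] [Module ℂ M] {A B : M} {c₁ c₂ κ : ℂ}
    (h : c₁ • A = c₂ • B) (h₂ : c₂ ≠ 0) (hκ : κ * c₂ = c₁) : κ • A = B := by
  rw [← hκ, mul_comm, mul_smul] at h
  exact smul_right_injective M h₂ h

/-- Diagonal input for `raising_truncation`, where the diagonal `ω⁻¹` of the lower triangular part
has to commute with the generator up to weight. In `lowering_truncation` the difference from the
residue takes this role, which is `ω`; see `kap_om_genE`. -/
theorem kap_omInv_genE {q : ℝ} (hq : q ≠ 0) {n t : ℕ} (ht : t + 1 < n + 1) (ε : ℤˣ) {a : ℤ}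
    (ha : a ∈ vecIdx n) :
    kap q t ε 1 a • (omInv q n a * genE n t ε 1) = genE n t ε 1 * omInv q n a := by
  have hQ : (q : ℂ) ≠ 0 := by exact_mod_cast hq
  obtain ⟨s, hs, η, h⟩ := exists_eq_ix ha
  obtain ⟨h1, h2, h3⟩ := site_diagonal_genE (n := n) ht ε 1 s fun τ => (ov (q : ℂ) η τ)⁻¹
  rw [← omInv_ix q hs, ← h] at h1 h2 h3
  have ht : t < n + 1 := by omega
  rcases index_cases (mem_vecIdx.1 ha).1 t ε 1 with ⟨h4, h5⟩ | e | e | e | e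
  · rw [h, site_ix] at h4 h5
    rw [kap_of_site_ne q ε 1 (by rw [h, site_ix]; exact h4) (by rw [h, site_ix]; exact h5), one_smul, h1 h4 h5]
  · rw [h, ix_inj] at e
    obtain ⟨rfl, rfl⟩ := e
    refine smul_eq_of_smul_eq (h2 rfl) (inv_ne_zero (ov_ne_zero hQ _ _)) ?_
    rw [h, kap_x]
    rcases Int.units_eq_one_or η with rfl | rfl <;> simp [ov, hQ]
  · rw [h, ← ix_neg, ix_inj] at e
    obtain ⟨rfl, rfl⟩ := e
    refine smul_eq_of_smul_eq (h2 rfl) (inv_ne_zero (ov_ne_zero hQ _ _)) ?_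
    rw [h, ix_neg, kap_neg_x]
    rcases Int.units_eq_one_or ε with rfl | rfl <;> simp [ov, hQ]
  · rw [h, ix_inj] at e
    obtain ⟨rfl, rfl⟩ := e
    refine smul_eq_of_smul_eq (h3 rfl) (inv_ne_zero (ov_ne_zero hQ _ _)) ?_
    rw [h, kap_y]
    simp [ov]
  · rw [h, ← ix_neg, ix_inj] at e
    obtain ⟨rfl, rfl⟩ := e
    refine smul_eq_of_smul_eq (h3 rfl) (inv_ne_zero (ov_ne_zero hQ _ _)) ?_
    rw [h, ix_neg, kap_neg_y]
    simp [ov, hQ]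

theorem kap_om_genE {q : ℝ} (hq : q ≠ 0) {n t : ℕ} (ht : t + 1 < n + 1) (ε : ℤˣ) {a : ℤ}
    (ha : a ∈ vecIdx n) :
    kap q t ε (-1) a • (om q n a * genE n t ε (-1)) = genE n t ε (-1) * om q n a := by
  have hQ : (q : ℂ) ≠ 0 := by exact_mod_cast hq
  obtain ⟨s, hs, η, h⟩ := exists_eq_ix ha
  obtain ⟨h1, h2, h3⟩ := site_diagonal_genE (n := n) ht ε (-1) s (ov q η)
  rw [← om_ix q hs, ← h] at h1 h2 h3
  have ht : t < n + 1 := by omega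
  rcases index_cases (mem_vecIdx.1 ha).1 t ε (-1) with ⟨h4, h5⟩ | e | e | e | e
  · rw [h, site_ix] at h4 h5
    rw [kap_of_site_ne q ε (-1) (by rw [h, site_ix]; exact h4) (by rw [h, site_ix]; exact h5), one_smul, h1 h4 h5]
  · rw [h, ix_inj] at e
    obtain ⟨rfl, rfl⟩ := e
    refine smul_eq_of_smul_eq (h2 rfl) (ov_ne_zero hQ _ _) ?_
    rw [h, kap_x]
    rcases Int.units_eq_one_or η with rfl | rfl <;> simp [ov, hQ]
  · rw [h, ← ix_neg, ix_inj] at e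
    obtain ⟨rfl, rfl⟩ := e
    refine smul_eq_of_smul_eq (h2 rfl) (ov_ne_zero hQ _ _) ?_
    rw [h, ix_neg, kap_neg_x]
    rcases Int.units_eq_one_or ε with rfl | rfl <;> simp [ov, hQ]
  · rw [h, ix_inj] at e
    obtain ⟨rfl, rfl⟩ := e
    refine smul_eq_of_smul_eq (h3 rfl) (ov_ne_zero hQ _ _) ?_
    rw [h, kap_y]
    simp [ov, hQ]
  · rw [h, ← ix_neg, ix_inj] at e
    obtain ⟨rfl, rfl⟩ := e
    refine smul_eq_of_smul_eq (h3 rfl) (ov_ne_zero hQ _ _) ?_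
    rw [h, ix_neg, kap_neg_y]
    simp [ov, hQ]

theorem kv_one {Q : ℂ} (hQ : Q ≠ 0) (ε τ : ℤˣ) : kv Q ε 1 τ = (ov Q ε τ)⁻¹ := by
  rcases Int.units_eq_one_or ε with rfl | rfl <;> rcases Int.units_eq_one_or τ with rfl | rfl <;>
    simp [kv, ov, hQ]

theorem kv_neg_one {Q : ℂ} (hQ : Q ≠ 0) (ε τ : ℤˣ) : kv Q ε (-1) τ = Q * ov Q ε τ := by
  rcases Int.units_eq_one_or ε with rfl | rfl <;> rcases Int.units_eq_one_or τ with rfl | rfl <;>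
    simp [kv, ov, hQ]

theorem ov_neg {Q : ℂ} (hQ : Q ≠ 0) (ε τ : ℤˣ) : ov Q (-ε) τ = Q⁻¹ * (ov Q ε τ)⁻¹ := by
  rcases Int.units_eq_one_or ε with rfl | rfl <;> rcases Int.units_eq_one_or τ with rfl | rfl <;>
    simp [ov, hQ]

/-- Truncation changes the relation only where a generator links a diagonal entry to the diagonal
entry of the neighbouring index. These four identities make the changes cancel. -/
theorem genK_mul_om {q : ℝ} (hq : q ≠ 0) {n t : ℕ} (ht : t + 1 < n + 1) (ε : ℤˣ) :
    genK q n t ε 1 * om q n (ix t ε) = om q n (ix (t + 1) 1) ∧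
    genK q n t ε 1 * om q n (-ix (t + 1) 1) = om q n (-ix t ε) ∧
    genK q n t ε (-1) * omInv q n (ix t ε) = omInv q n (ix (t + 1) (-1)) ∧
    genK q n t ε (-1) * omInv q n (-ix (t + 1) (-1)) = omInv q n (-ix t ε) := by
  have hQ : (q : ℂ) ≠ 0 := by exact_mod_cast hq
  have ht' : t < n + 1 := by omega
  have ho := ov_ne_zero hQ
  have hw := wv_ne_zero hQ
  simp only [← ix_neg, om_ix q ht, om_ix q ht', omInv_ix q ht, omInv_ix q ht', genK, wM_eq]
  simp only [str_succ_eq_str2]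
  simp only [str_eq_str2, pure_str2_mul]
  simp only [mul_one, Matrix.diagonal_mul_diagonal]
  refine ⟨?_, ?_, ?_, ?_⟩
  · have e : (fun τ => kv (q : ℂ) ε 1 τ * ov q ε τ) = fun _ => 1 := by
      funext τ; rw [kv_one hQ, inv_mul_cancel₀ (ho _ _)]
    rw [e, Matrix.diagonal_one]
    rfl
  · have e : (fun τ => wv (q : ℂ) τ * ov q (-1) τ) = (q : ℂ)⁻¹ • fun _ => 1 := by
      funext τ; simp only [ov_neg hQ, Pi.smul_apply, smul_eq_mul]
      change wv (q : ℂ) τ * ((q : ℂ)⁻¹ * (wv q τ)⁻¹) = _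
      field_simp [hw τ]
    have e' : ov (q : ℂ) (-ε) = (q : ℂ)⁻¹ • kv q ε 1 := by
      funext τ; simp only [ov_neg hQ, kv_one hQ, Pi.smul_apply, smul_eq_mul]
    rw [e, e', Matrix.diagonal_smul, Matrix.diagonal_smul, pure_str2_smul_right _ _ _ _ _ ht,
      pure_str2_smul_left _ _ _ _ _ ht', Matrix.diagonal_one]
  · have e : (fun τ => kv (q : ℂ) ε (-1) τ * (ov q ε τ)⁻¹) = (q : ℂ) • fun _ => 1 := by
      funext τ; simp only [kv_neg_one hQ, Pi.smul_apply, smul_eq_mul]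
      rw [mul_assoc, mul_inv_cancel₀ (ho _ _)]
    have e' : (fun τ => (ov (q : ℂ) (-1) τ)⁻¹) = (q : ℂ) • wv q := by
      funext τ; simp only [ov_neg hQ, mul_inv, inv_inv, Pi.smul_apply, smul_eq_mul]
      rfl
    rw [e, e', Matrix.diagonal_smul, Matrix.diagonal_smul, pure_str2_smul_right _ _ _ _ _ ht,
      pure_str2_smul_left _ _ _ _ _ ht', Matrix.diagonal_one]
  · have e : (fun τ => wv (q : ℂ) τ * (ov q (- -1) τ)⁻¹) = fun _ => 1 := by
      funext τ; exact mul_inv_cancel₀ (hw τ)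
    have e' : (fun τ => (ov (q : ℂ) (-ε) τ)⁻¹) = kv q ε (-1) := by
      funext τ; simp only [ov_neg hQ, kv_neg_one hQ, mul_inv, inv_inv]
    rw [e, e', Matrix.diagonal_one]

/-! ### Triangular truncation of covariant matrices -/

theorem ite_ite_congr {M : Type} [Zero M] {P Q : Prop} [Decidable P] [Decidable Q] {A A' B B' : M}
    (h1 : P → A = A') (h2 : Q → B = B') :
    (if P then A else if Q then B else 0) = if P then A' else if Q then B' else 0 := by
  split_ifs with h h'
  · exact h1 h
  · exact h2 h'
  · rfl

theorem ite_ite_eq_zero {M : Type} [Zero M] {P Q : Prop} [Decidable P] [Decidable Q] {A B : M}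
    (h1 : P → A = 0) (h2 : Q → B = 0) : (if P then A else if Q then B else 0) = 0 := by
  rw [ite_ite_congr h1 h2, ite_self, ite_self]

/-- The lower triangular part `l` of a covariant matrix of operators `L` is covariant with respect to
a raising generator. -/
theorem raising_truncation {M : Type} [Ring M] [Algebra ℂ M] {S : Finset ℤ} (hS : ∀ a ∈ S, a ≠ 0 ∧ -a ∈ S)
    {l L : ℤ → ℤ → M} (hlt : ∀ a b, a < b → l a b = 0) (hgt : ∀ a ∈ S, ∀ b ∈ S, b < a → l a b = L a b)
    (hl : ∀ a ∈ S, l a (-a) = 0) (hL : ∀ a ∈ S, L a (-a) = 0)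
    {x y : ℤ} (hx : x ∈ S) (hy : y ∈ S) (hxy : x < y) (hxy' : -x < y)
    (hb : ∀ c ∈ S, x < c → c < y → c = -x) {c₁ c₂ : ℂ} {κ : ℤ → ℂ} {E K : M}
    (hd : ∀ a ∈ S, κ a • (l a a * E) = E * l a a)
    (h1 : l y y - L y y = K * (l x x - L x x))
    (h2 : l (-x) (-x) - L (-x) (-x) = K * (l (-y) (-y) - L (-y) (-y)))
    {a b : ℤ} (haS : a ∈ S) (hbS : b ∈ S)
    (hLab : (if b = x then c₁ • L a y else if b = -y then c₂ • L a (-x) else 0) + κ b • (L a b * E) =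
      (if a = y then c₁ • (K * L x b) else if a = -x then c₂ • (K * L (-y) b) else 0) + E * L a b) :
    (if b = x then c₁ • l a y else if b = -y then c₂ • l a (-x) else 0) + κ b • (l a b * E) =
      (if a = y then c₁ • (K * l x b) else if a = -x then c₂ • (K * l (-y) b) else 0) + E * l a b := by
  have hx' := (hS x hx).2
  have hy' := (hS y hy).2
  have hx0 := (hS x hx).1
  have hb' : ∀ c ∈ S, -y < c → c < -x → c = x := fun c hc h h' => by
    have := hb (-c) (hS c hc).2 (by omega) (by omega)
    omega
  rcases lt_trichotomy a b with hab | rfl | hab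
  · have e1 : b = x → l a y = 0 := fun hb => hlt _ _ (by omega)
    have e2 : b = -y → l a (-x) = 0 := fun hb => hlt _ _ (by omega)
    have e3 : a = y → l x b = 0 := fun hb => hlt _ _ (by omega)
    have e4 : a = -x → l (-y) b = 0 := fun hb => hlt _ _ (by omega)
    rw [hlt a b hab]
    have f1 : (if b = x then c₁ • l a y else if b = -y then c₂ • l a (-x) else 0) = 0 :=
      ite_ite_eq_zero (fun h => by rw [e1 h, smul_zero]) (fun h => by rw [e2 h, smul_zero])
    have f2 : (if a = y then c₁ • (K * l x b) else if a = -x then c₂ • (K * l (-y) b) else 0) = 0 :=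
      ite_ite_eq_zero (fun h => by rw [e3 h, mul_zero, smul_zero])
        (fun h => by rw [e4 h, mul_zero, smul_zero])
    rw [f1, f2]
    simp
  · rw [hd a haS]
    have e1 : a = x → l a y = 0 := fun hb => hlt _ _ (by omega)
    have e2 : a = -y → l a (-x) = 0 := fun hb => hlt _ _ (by omega)
    have e3 : a = y → l x a = 0 := fun hb => hlt _ _ (by omega)
    have e4 : a = -x → l (-y) a = 0 := fun hb => hlt _ _ (by omega)
    have f1 : (if a = x then c₁ • l a y else if a = -y then c₂ • l a (-x) else 0) = 0 :=
      ite_ite_eq_zero (fun h => by rw [e1 h, smul_zero]) (fun h => by rw [e2 h, smul_zero])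
    have f2 : (if a = y then c₁ • (K * l x a) else if a = -x then c₂ • (K * l (-y) a) else 0) = 0 :=
      ite_ite_eq_zero (fun h => by rw [e3 h, mul_zero, smul_zero])
        (fun h => by rw [e4 h, mul_zero, smul_zero])
    rw [f1, f2]
  -- Below the diagonal the relation for `l` is that for `L`, except at `(y, x)` and `(-x, -y)`,
  -- where diagonal entries occur; there `h1` and `h2` correct the difference.
  · have e0 := hgt a haS b hbS hab
    by_cases s1 : a = y ∧ b = x
    · obtain ⟨rfl, rfl⟩ := s1
      simp only [if_true] at hLab ⊢
      rw [e0, eq_add_of_sub_eq' h1, smul_add, add_right_comm, hLab]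
      simp only [mul_sub, smul_sub]
      abel
    by_cases s2 : a = -x ∧ b = -y
    · obtain ⟨rfl, rfl⟩ := s2
      rw [if_neg (by omega), if_pos rfl, if_neg (by omega), if_pos rfl] at hLab ⊢
      rw [e0, eq_add_of_sub_eq' h2, smul_add, add_right_comm, hLab]
      simp only [mul_sub, smul_sub]
      abel
    -- This entry lies below the diagonal only if `x` is negative, which happens at the branching
    -- node. All terms for `l` are then zero separately.
    by_cases s3 : a = -x ∧ b = x
    · obtain ⟨rfl, rfl⟩ := s3
      have := hl (-b) hx'
      rw [neg_neg] at this
      rw [if_pos rfl, if_neg (by omega), if_pos rfl, hlt _ _ hxy', this, hlt (-y) b (by omega)]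
      simp
    have e1 : b = x → l a y = L a y := by
      rintro rfl
      by_cases h : a = -y
      · subst h
        have h1 := hl (-y) hy'
        have h2 := hL (-y) hy'
        rw [neg_neg] at h1 h2
        rw [h1, h2]
      · exact hgt _ haS _ hy (by
          rcases lt_or_ge y a with h' | h'
          · exact h'
          · have := hb a haS hab (by omega)
            omega)
    have e2 : b = -y → l a (-x) = L a (-x) := by
      rintro rfl
      by_cases h : a = x
      · subst h
        rw [hl _ haS, hL _ haS]
      · exact hgt _ haS _ hx' (by
          rcases lt_or_ge (-x) a with h' | h'
          · exact h'
          · have := hb' a haS hab (by omega)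
            omega)
    have e3 : a = y → l x b = L x b := by
      rintro rfl
      by_cases h : b = -x
      · subst h
        rw [hl _ hx, hL _ hx]
      · exact hgt _ hx _ hbS (by
          rcases lt_or_ge b x with h' | h'
          · exact h'
          · have := hb b hbS (by omega) hab
            omega)
    have e4 : a = -x → l (-y) b = L (-y) b := by
      rintro rfl
      by_cases h : b = y
      · subst h
        omega
      · exact hgt _ hy' _ hbS (by
          rcases lt_or_ge b (-y) with h' | h'
          · exact h'
          · have := hb' b hbS (by omega) hab
            omega)
    rw [e0]
    have f1 : (if b = x then c₁ • l a y else if b = -y then c₂ • l a (-x) else 0) =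
        if b = x then c₁ • L a y else if b = -y then c₂ • L a (-x) else 0 :=
      ite_ite_congr (fun h => by rw [e1 h]) (fun h => by rw [e2 h])
    have f2 : (if a = y then c₁ • (K * l x b) else if a = -x then c₂ • (K * l (-y) b) else 0) =
        if a = y then c₁ • (K * L x b) else if a = -x then c₂ • (K * L (-y) b) else 0 :=
      ite_ite_congr (fun h => by rw [e3 h]) (fun h => by rw [e4 h])
    rw [f1, f2]
    exact hLab

/-- The lower triangular part `l` of a covariant matrix of operators `L` is covariant with respect to
a lowering generator. -/
theorem lowering_truncation {M : Type} [Ring M] [Algebra ℂ M] {S : Finset ℤ} (hS : ∀ a ∈ S, a ≠ 0 ∧ -a ∈ S)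
    {l L : ℤ → ℤ → M} (hlt : ∀ a b, a < b → l a b = 0) (hgt : ∀ a ∈ S, ∀ b ∈ S, b < a → l a b = L a b)
    (hl : ∀ a ∈ S, l a (-a) = 0) (hL : ∀ a ∈ S, L a (-a) = 0)
    {x y : ℤ} (hx : x ∈ S) (hy : y ∈ S) (hxy : y < x) (hxy' : y < -x)
    (hb : ∀ c ∈ S, y < c → c < x → c = -x) {c₁ c₂ : ℂ} {κ : ℤ → ℂ} {E K : M}
    (hd : ∀ a ∈ S, κ a • ((l a a - L a a) * E) = E * (l a a - L a a))
    (h1 : l y y = K * l x x) (h2 : l (-x) (-x) = K * l (-y) (-y))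
    {a b : ℤ} (haS : a ∈ S) (hbS : b ∈ S)
    (hLab : (if b = x then c₁ • L a y else if b = -y then c₂ • L a (-x) else 0) + κ b • (L a b * E) =
      (if a = y then c₁ • (K * L x b) else if a = -x then c₂ • (K * L (-y) b) else 0) + E * L a b) :
    (if b = x then c₁ • l a y else if b = -y then c₂ • l a (-x) else 0) + κ b • (l a b * E) =
      (if a = y then c₁ • (K * l x b) else if a = -x then c₂ • (K * l (-y) b) else 0) + E * l a b := by
  have hx' := (hS x hx).2
  have hy' := (hS y hy).2
  have hx0 := (hS x hx).1
  have hb' : ∀ c ∈ S, -x < c → c < -y → c = x := fun c hc h h' => by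
    have := hb (-c) (hS c hc).2 (by omega) (by omega)
    omega
  rcases lt_trichotomy a b with hab | rfl | hab
  · rw [hlt a b hab]
    -- Above the diagonal the generator still reaches diagonal entries, at `(y, x)` and `(-x, -y)`;
    -- the two contributions cancel by `h1` and `h2`.
    by_cases s1 : a = y ∧ b = x
    · obtain ⟨rfl, rfl⟩ := s1
      simp [h1]
    by_cases s2 : a = -x ∧ b = -y
    · obtain ⟨rfl, rfl⟩ := s2
      rw [if_neg (by omega), if_pos rfl, if_neg (by omega), if_pos rfl, h2]
      simp
    -- At the branching node the generator jumps from this entry above the diagonal to entries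
    -- strictly below it. There `l` and `L` agree, and both vanish at `(-x, x)`.
    by_cases s3 : a = -x ∧ b = x
    · obtain ⟨rfl, rfl⟩ := s3
      have := hL (-b) hx'
      rw [neg_neg] at this
      rw [if_pos rfl, if_neg (by omega), if_pos rfl, this] at hLab
      rw [if_pos rfl, if_neg (by omega), if_pos rfl, hgt _ haS _ hy hxy', hgt _ hy' _ hbS (by omega)]
      exact hLab
    have e1 : b = x → l a y = 0 := by
      rintro rfl
      rcases lt_or_ge a y with h | h
      · exact hlt _ _ h
      · have := hb a haS (by omega) hab
        omega
    have e2 : b = -y → l a (-x) = 0 := by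
      rintro rfl
      rcases lt_or_ge a (-x) with h | h
      · exact hlt _ _ h
      · rw [hb' a haS (by omega) hab, hl x hx]
    have e3 : a = y → l x b = 0 := by
      rintro rfl
      rcases lt_or_ge x b with h | h
      · exact hlt _ _ h
      · rw [hb b hbS hab (by omega), hl x hx]
    have e4 : a = -x → l (-y) b = 0 := by
      rintro rfl
      rcases lt_or_ge (-y) b with h | h
      · exact hlt _ _ h
      · have := hb' b hbS hab (by omega)
        omega
    have f1 : (if b = x then c₁ • l a y else if b = -y then c₂ • l a (-x) else 0) = 0 :=
      ite_ite_eq_zero (fun h => by rw [e1 h, smul_zero]) (fun h => by rw [e2 h, smul_zero])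
    have f2 : (if a = y then c₁ • (K * l x b) else if a = -x then c₂ • (K * l (-y) b) else 0) = 0 :=
      ite_ite_eq_zero (fun h => by rw [e3 h, mul_zero, smul_zero])
        (fun h => by rw [e4 h, mul_zero, smul_zero])
    rw [f1, f2]
    simp
  · have e1 : a = x → l a y = L a y := fun h => hgt _ haS _ hy (by omega)
    have e2 : a = -y → l a (-x) = L a (-x) := fun h => hgt _ haS _ hx' (by omega)
    have e3 : a = y → l x a = L x a := fun h => hgt _ hx _ haS (by omega)
    have e4 : a = -x → l (-y) a = L (-y) a := fun h => hgt _ hy' _ haS (by omega)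
    have h0 := hd a haS
    simp only [sub_mul, mul_sub, smul_sub] at h0
    have f1 : (if a = x then c₁ • l a y else if a = -y then c₂ • l a (-x) else 0) =
        if a = x then c₁ • L a y else if a = -y then c₂ • L a (-x) else 0 :=
      ite_ite_congr (fun h => by rw [e1 h]) (fun h => by rw [e2 h])
    have f2 : (if a = y then c₁ • (K * l x a) else if a = -x then c₂ • (K * l (-y) a) else 0) =
        if a = y then c₁ • (K * L x a) else if a = -x then c₂ • (K * L (-y) a) else 0 :=
      ite_ite_congr (fun h => by rw [e3 h]) (fun h => by rw [e4 h])
    rw [f1, f2]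
    clear f1 f2
    generalize (if a = x then c₁ • L a y else if a = -y then c₂ • L a (-x) else 0) = X at hLab ⊢
    generalize (if a = y then c₁ • (K * L x a) else if a = -x then c₂ • (K * L (-y) a) else 0) = Y
      at hLab ⊢
    have h3 := congrArg₂ (· + ·) hLab h0
    rw [← sub_eq_zero] at h3 ⊢
    rw [← h3]
    abel
  · have e1 : b = x → l a y = L a y := fun h => hgt _ haS _ hy (by omega)
    have e2 : b = -y → l a (-x) = L a (-x) := fun h => hgt _ haS _ hx' (by omega)
    have e3 : a = y → l x b = L x b := fun h => hgt _ hx _ hbS (by omega)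
    have e4 : a = -x → l (-y) b = L (-y) b := fun h => hgt _ hy' _ hbS (by omega)
    rw [hgt a haS b hbS hab]
    have f1 : (if b = x then c₁ • l a y else if b = -y then c₂ • l a (-x) else 0) =
        if b = x then c₁ • L a y else if b = -y then c₂ • L a (-x) else 0 :=
      ite_ite_congr (fun h => by rw [e1 h]) (fun h => by rw [e2 h])
    have f2 : (if a = y then c₁ • (K * l x b) else if a = -x then c₂ • (K * l (-y) b) else 0) =
        if a = y then c₁ • (K * L x b) else if a = -x then c₂ • (K * L (-y) b) else 0 :=
      ite_ite_congr (fun h => by rw [e3 h]) (fun h => by rw [e4 h])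
    rw [f1, f2]
    exact hLab

/-- Generators with `δ = 1` raise and those with `δ = -1` lower the order of indices. For adjacent
simple steps no index lies between `x` and `y`; for `t = 0` and `ε ≠ δ` the index `-x` does, which
is the exception allowed in the truncation lemmas. -/
theorem smul_ellM_covariant {q : ℝ} (hq : q ≠ 0) {n t : ℕ} (ht : t + 1 < n + 1) {ε δ : ℤˣ}
    (h : ε = δ ∨ t = 0) : Covariant n (arrow q t ε δ) (kap q t ε δ) (genE n t ε δ) (genE n t ε δ)
      (genK q n t ε δ) fun a b => sq q • ellM q n a b := by
  have hcov := Lam_covariant hq ht h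
  obtain ⟨hK1, hK2, hK3, hK4⟩ := genK_mul_om hq (n := n) ht ε
  intro a ha b hb
  have hLab := hcov a ha b hb
  rw [sum_arrow_col q ht, sum_arrow_row q ht] at hLab ⊢
  have hS : ∀ a ∈ vecIdx n, a ≠ 0 ∧ -a ∈ vecIdx n := fun a ha => by
    have := mem_vecIdx.1 ha
    exact ⟨this.1, mem_vecIdx.2 (by omega)⟩
  have hom : ∀ a ∈ vecIdx n, sq q • ellM q n a a - Lam q n a a = om q n a := fun a ha => by
    rw [smul_ellM_self' hq ha, add_sub_cancel_left]
  have hx := ix_mem (n := n) (t := t) (by omega) ε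
  have hy := ix_mem (n := n) ht δ
  rcases Int.units_eq_one_or δ with rfl | rfl
  · have hsx : ix t ε = (t : ℤ) + 1 ∨ (ix t ε = -1 ∧ t = 0) := by
      rcases h with rfl | rfl
      · exact Or.inl (ix_one t)
      · rcases ix_cases 0 ε with h | h <;> rw [h] <;> simp
    have hsy : ix (t + 1) 1 = (t : ℤ) + 2 := by rw [ix_one]; push_cast; ring
    refine raising_truncation hS (fun a b => smul_ellM_of_lt)
      (fun a ha b hb => smul_ellM_of_gt hq ha hb) (fun a ha => smul_ellM_neg (hS a ha).1)
      (fun a ha => Lam_neg ha) hx hy (by omega) (by omega)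
      (fun c hc h1 h2 => by have := (hS c hc).1; omega) (fun a ha => ?_) ?_ ?_ ha hb hLab
    · simp only [smul_ellM_self hq, kap_omInv_genE hq ht ε ha]
    · simp only [hom _ hx, hom _ hy, hK1]
    · simp only [hom _ (hS _ hx).2, hom _ (hS _ hy).2, hK2]
  · have hsx : ix t ε = -((t : ℤ) + 1) ∨ (ix t ε = 1 ∧ t = 0) := by
      rcases h with rfl | rfl
      · exact Or.inl (ix_neg_one t)
      · rcases ix_cases 0 ε with h | h <;> rw [h] <;> simp
    have hsy : ix (t + 1) (-1) = -((t : ℤ) + 2) := by rw [ix_neg_one]; push_cast; ring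
    refine lowering_truncation hS (fun a b => smul_ellM_of_lt)
      (fun a ha b hb => smul_ellM_of_gt hq ha hb) (fun a ha => smul_ellM_neg (hS a ha).1)
      (fun a ha => Lam_neg ha) hx hy (by omega) (by omega)
      (fun c hc h1 h2 => by have := (hS c hc).1; omega) (fun a ha => ?_) ?_ ?_ ha hb hLab
    · simp only [hom _ ha, kap_om_genE hq ht ε ha]
    · simp only [smul_ellM_self hq, hK3]
    · simp only [smul_ellM_self hq, hK4]

/-- The upper triangular part is eliminated in favour of the residue, so covariance of two pieces
suffices for every spectral parameter. -/
theorem LP_eq {q : ℝ} (hq : q ≠ 0) {n : ℕ} (ρ w : ℂ) {a b : ℤ} (ha : a ∈ vecIdx n) (hb : b ∈ vecIdx n) :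
    LP q n ρ w a b = (w - ρ)⁻¹ • ((w - ρ) • (sq q • ellM q n a b) + ρ • Lam q n a b) := by
  rw [Lam, ← ellM_sub_ellP hq ha hb, LP]
  congr 1
  module

/-- The spinor `L`-operator with spectral parameter intertwines the Chevalley generators. -/
theorem LP_covariant {q : ℝ} (hq : q ≠ 0) {n t : ℕ} (ht : t + 1 < n + 1) {ε δ : ℤˣ}
    (h : ε = δ ∨ t = 0) (ρ w : ℂ) : Covariant n (arrow q t ε δ) (kap q t ε δ) (genE n t ε δ)
      (genE n t ε δ) (genK q n t ε δ) (LP q n ρ w) := by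
  have := (((smul_ellM_covariant hq ht h).smul (w - ρ)).add ((Lam_covariant hq ht h).smul ρ)).smul
    (w - ρ)⁻¹
  intro a ha b hb
  have h1 := this a ha b hb
  have e1 : ∑ b' ∈ vecIdx n, arrow q t ε δ b' b • LP q n ρ w a b' = _ :=
    Finset.sum_congr rfl fun b' hb' => by rw [LP_eq hq ρ w ha hb']
  have e2 : ∑ a' ∈ vecIdx n, arrow q t ε δ a a' • (genK q n t ε δ * LP q n ρ w a' b) = _ :=
    Finset.sum_congr rfl fun a' ha' => by rw [LP_eq hq ρ w ha' hb]
  rw [e1, e2, LP_eq hq ρ w ha hb]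
  exact h1

/-! ### Covariance of coproducts -/

theorem Lam_weight {q : ℝ} (hq : q ≠ 0) {n t : ℕ} (ht : t + 1 < n + 1) (ε δ : ℤˣ) {a b : ℤ}
    (ha : a ∈ vecIdx n) (hb : b ∈ vecIdx n) :
    kap q t ε δ a • (genK q n t ε δ * Lam q n a b) = kap q t ε δ b • (Lam q n a b * genK q n t ε δ) := by
  rw [Lam, Matrix.mul_smul, Matrix.smul_mul, smul_comm, smul_comm (kap q t ε δ b)]
  congr 1
  rw [← Matrix.mul_assoc, ← Matrix.smul_mul, ← phi_mul_genK hq ht ε δ ha, Matrix.mul_assoc,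
    genK_mul_chi hq ht ε δ hb, Matrix.mul_smul, Matrix.mul_assoc]

theorem genK_eq_diagonal (q : ℝ) (n t : ℕ) (ε δ : ℤˣ) : ∃ d : St n → ℂ, genK q n t ε δ = Matrix.diagonal d := by
  refine ⟨fun m => ∏ k : Fin (n + 1), str2 1 (kv q ε δ) (wv q) 1 t k (m k), ?_⟩
  rw [← pure_diagonal (N := n + 1) (fun k => str2 1 (kv q ε δ) (wv q) 1 t k), genK, wM_eq]
  congr 1
  funext k
  simp only [str2]
  split_ifs <;> rfl

theorem LP_weight {q : ℝ} (hq : q ≠ 0) {n t : ℕ} (ht : t + 1 < n + 1) (ε δ : ℤˣ) (ρ w : ℂ) {a b : ℤ}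
    (ha : a ∈ vecIdx n) (hb : b ∈ vecIdx n) :
    kap q t ε δ a • (genK q n t ε δ * LP q n ρ w a b) =
      kap q t ε δ b • (LP q n ρ w a b * genK q n t ε δ) := by
  have h : kap q t ε δ a • (genK q n t ε δ * sq q • ellM q n a b) =
      kap q t ε δ b • (sq q • ellM q n a b * genK q n t ε δ) := by
    rcases lt_trichotomy a b with hab | rfl | hab
    · simp [smul_ellM_of_lt hab]
    · obtain ⟨d, hd⟩ := genK_eq_diagonal q n t ε δ
      rw [smul_ellM_self hq, hd, omInv, Matrix.diagonal_mul_diagonal, Matrix.diagonal_mul_diagonal]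
      simp only [mul_comm]
    · rw [smul_ellM_of_gt hq ha hb hab, Lam_weight hq ht ε δ ha hb]
  rw [LP_eq hq ρ w ha hb]
  simp only [Matrix.mul_smul, Matrix.smul_mul, mul_add, add_mul, smul_add] at h ⊢
  have h' := Lam_weight hq ht ε δ ha hb
  rw [smul_comm _ (w - ρ)⁻¹, smul_comm _ (w - ρ)⁻¹, smul_comm _ (w - ρ)⁻¹, smul_comm _ (w - ρ)⁻¹,
    smul_comm _ (w - ρ), h, smul_comm _ ρ, h', smul_comm _ (w - ρ) (sq q • _), smul_comm _ ρ (_ * _)]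

/-- In a matrix product the action on the summation index occurs once from each factor and cancels.
The weight condition `hw` moves `K₂` through `Y`, and this yields the coproduct form `E₁ K₂ + E₂`.
-/
theorem Covariant.comp {I : Type} [Fintype I] [DecidableEq I] {n : ℕ} {e : ℤ → ℤ → ℂ} {κ : ℤ → ℂ}
    {E₁ K₁ E₂ K₂ : Matrix I I ℂ} {X Y : ℤ → ℤ → Matrix I I ℂ} (hX : Covariant n e κ E₁ E₁ K₁ X)
    (hY : Covariant n e κ E₂ E₂ K₂ Y)
    (hw : ∀ a ∈ vecIdx n, ∀ b ∈ vecIdx n, κ a • (K₂ * Y a b) = κ b • (Y a b * K₂))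
    (hXE : ∀ a b, Commute (X a b) E₂) (hXK : ∀ a b, Commute (X a b) K₂)
    (hYE : ∀ a b, Commute (Y a b) E₁) :
    Covariant n e κ (E₁ * K₂ + E₂) (E₁ * K₂ + E₂) (K₁ * K₂) fun a b =>
      ∑ k ∈ vecIdx n, X a k * Y k b := by
  intro a ha b hb
  have h1 : ∀ k ∈ vecIdx n, ∑ b' ∈ vecIdx n, e b' b • (X a k * Y k b') =
      ∑ k' ∈ vecIdx n, e k k' • (X a k * (K₂ * Y k' b)) + X a k * (E₂ * Y k b) -
        κ b • (X a k * (Y k b * E₂)) := fun k hk => by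
    have := congrArg (X a k * ·) (eq_sub_of_add_eq (hY k hk b hb))
    simpa only [Finset.mul_sum, mul_sub, mul_add, Matrix.mul_smul] using this
  have h2 : ∀ k ∈ vecIdx n, ∑ k' ∈ vecIdx n, e k' k • (X a k' * (K₂ * Y k b)) =
      ∑ a' ∈ vecIdx n, e a a' • (K₁ * X a' k * (K₂ * Y k b)) + E₁ * X a k * (K₂ * Y k b) -
        κ k • (X a k * E₁ * (K₂ * Y k b)) := fun k hk => by
    have := congrArg (· * (K₂ * Y k b)) (eq_sub_of_add_eq (hX a ha k hk))
    simpa only [Finset.sum_mul, sub_mul, add_mul, Matrix.smul_mul] using this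
  have h3 : ∀ k ∈ vecIdx n, κ k • (X a k * E₁ * (K₂ * Y k b)) =
      κ b • (X a k * Y k b * (E₁ * K₂)) := fun k hk => by
    rw [← Matrix.mul_smul, hw k hk b hb, Matrix.mul_smul]
    simp only [Matrix.mul_assoc]
    rw [← Matrix.mul_assoc E₁, ← (hYE k b).eq, Matrix.mul_assoc]
  have h4 : ∀ k, E₁ * X a k * (K₂ * Y k b) = E₁ * K₂ * (X a k * Y k b) := fun k => by
    simp only [Matrix.mul_assoc]
    rw [← Matrix.mul_assoc (X a k), (hXK a k).eq, Matrix.mul_assoc]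
  have h5 : ∀ k a', K₁ * X a' k * (K₂ * Y k b) = K₁ * K₂ * (X a' k * Y k b) := fun k a' => by
    simp only [Matrix.mul_assoc]
    rw [← Matrix.mul_assoc (X a' k), (hXK a' k).eq, Matrix.mul_assoc]
  have h6 : ∀ k, X a k * (E₂ * Y k b) = E₂ * (X a k * Y k b) := fun k => by
    rw [← Matrix.mul_assoc, (hXE a k).eq, Matrix.mul_assoc]
  simp only [Finset.smul_sum]
  rw [Finset.sum_comm, Finset.sum_congr rfl h1, Finset.sum_sub_distrib, Finset.sum_add_distrib,
    Finset.sum_comm, Finset.sum_congr rfl h2, Finset.sum_sub_distrib, Finset.sum_add_distrib,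
    Finset.sum_comm, Finset.sum_congr rfl h3]
  simp only [h4, h5, h6, Finset.mul_sum, Finset.sum_mul, Finset.smul_sum, mul_add, add_mul, smul_add,
    Finset.sum_add_distrib, Matrix.mul_assoc]
  abel

theorem one_kronecker_commute {I J : Type} [Fintype I] [DecidableEq I] [Fintype J] [DecidableEq J]
    (A : Matrix I I ℂ) (B : Matrix J J ℂ) :
    Commute (A ⊗ₖ (1 : Matrix J J ℂ)) ((1 : Matrix I I ℂ) ⊗ₖ B) := by
  simp [Commute, SemiconjBy, ← Matrix.mul_kronecker_mul]

theorem Covariant.kronecker_one {n : ℕ} {e : ℤ → ℤ → ℂ} {κ : ℤ → ℂ} {E E' K : Op n}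
    {L : ℤ → ℤ → Op n} (h : Covariant n e κ E E' K L) :
    Covariant n e κ (E ⊗ₖ (1 : Op n)) (E' ⊗ₖ 1) (K ⊗ₖ 1) fun a b => L a b ⊗ₖ (1 : Op n) := by
  intro a ha b hb
  have := congrArg (fun A : Op n => A ⊗ₖ (1 : Op n)) (h a ha b hb)
  have hs : ∀ f : ℤ → Op n, (∑ k ∈ vecIdx n, f k) ⊗ₖ (1 : Op n) = ∑ k ∈ vecIdx n, f k ⊗ₖ (1 : Op n) :=
    fun f => by
      ext r c; simp only [Matrix.kroneckerMap_apply, Matrix.sum_apply, Finset.sum_mul]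
  simpa only [Matrix.add_kronecker, hs, Matrix.smul_kronecker, ← Matrix.mul_kronecker_mul, one_mul,
    mul_one] using this

theorem Covariant.one_kronecker {n : ℕ} {e : ℤ → ℤ → ℂ} {κ : ℤ → ℂ} {E E' K : Op n}
    {L : ℤ → ℤ → Op n} (h : Covariant n e κ E E' K L) :
    Covariant n e κ ((1 : Op n) ⊗ₖ E) ((1 : Op n) ⊗ₖ E') ((1 : Op n) ⊗ₖ K) fun a b =>
      (1 : Op n) ⊗ₖ L a b := by
  intro a ha b hb
  have := congrArg (fun A : Op n => (1 : Op n) ⊗ₖ A) (h a ha b hb)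
  have hs : ∀ f : ℤ → Op n, (1 : Op n) ⊗ₖ (∑ k ∈ vecIdx n, f k) = ∑ k ∈ vecIdx n, (1 : Op n) ⊗ₖ f k :=
    fun f => by
      ext r c; simp only [Matrix.kroneckerMap_apply, Matrix.sum_apply, Finset.mul_sum]
  simpa only [Matrix.kronecker_add, hs, Matrix.kronecker_smul, ← Matrix.mul_kronecker_mul, one_mul,
    mul_one] using this

/-- The opposite coproduct of a Chevalley generator. -/
def genDop (q : ℝ) (n t : ℕ) (ε δ : ℤˣ) : Op₂ n :=
  genK q n t ε δ ⊗ₖ genE n t ε δ + genE n t ε δ ⊗ₖ (1 : Op n)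

/-- The coproduct of the group-like element belonging to a Chevalley generator. -/
def genKK (q : ℝ) (n t : ℕ) (ε δ : ℤˣ) : Op₂ n := genK q n t ε δ ⊗ₖ genK q n t ε δ

/-- In `coprodOp` the second tensor factor carries the row index, so it comes first in the matrix
product. -/
theorem coprodOp_covariant {q : ℝ} (hq : q ≠ 0) {n t : ℕ} (ht : t + 1 < n + 1) {ε δ : ℤˣ}
    (h : ε = δ ∨ t = 0) (ρ ρ' w : ℂ) : Covariant n (arrow q t ε δ) (kap q t ε δ) (genDop q n t ε δ)
      (genDop q n t ε δ) (genKK q n t ε δ) (coprodOp n (LP q n ρ w) (LP q n ρ' w)) := by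
  have := Covariant.comp (LP_covariant hq ht h ρ' w).one_kronecker (LP_covariant hq ht h ρ w).kronecker_one
    (fun a ha b hb => by
      have := congrArg (fun A : Op n => A ⊗ₖ (1 : Op n)) (LP_weight hq ht ε δ ρ w ha hb)
      simpa only [Matrix.smul_kronecker, ← Matrix.mul_kronecker_mul, one_mul] using this)
    (fun a b => (one_kronecker_commute _ _).symm) (fun a b => (one_kronecker_commute _ _).symm)
    (fun a b => one_kronecker_commute _ _)
  unfold genDop genKK coprodOp
  simpa only [← Matrix.mul_kronecker_mul, one_mul, mul_one] using this

/-- The defect of the intertwining property transforms covariantly. -/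
theorem Covariant.defect {I : Type} [Fintype I] {n : ℕ} {e : ℤ → ℤ → ℂ} {κ : ℤ → ℂ}
    {D D' K R : Matrix I I ℂ} {C C' : ℤ → ℤ → Matrix I I ℂ} (h : Covariant n e κ D D K C)
    (h' : Covariant n e κ D' D' K C') (hR : D' * R = R * D) (hK : K * R = R * K) :
    Covariant n e κ D D' K fun a b => C' a b * R - R * C a b := by
  intro a ha b hb
  have h1 := congrArg (R * ·) (h a ha b hb)
  have h2 := congrArg (· * R) (h' a ha b hb)
  simp only [mul_add, add_mul, Finset.mul_sum, Finset.sum_mul, Matrix.mul_smul, Matrix.smul_mul] at h1 h2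
  simp only [← Matrix.mul_assoc] at h1 h2
  simp only [← Matrix.mul_assoc, sub_mul, mul_sub, smul_sub, Finset.sum_sub_distrib]
  simp only [← hK, ← hR] at h1
  rw [Matrix.mul_assoc (C' a b), hR, ← Matrix.mul_assoc] at h2
  rw [sub_add_sub_comm, h1, h2, add_sub_add_comm]

/-- The diagram of the vector representation is connected: from `-(n + 1)` one climbs to `-2`, from
there to both `-1` and `1`, and then up to `n + 1`. The indices `-1` and `1` are not joined to each
other, hence `1 ≤ n`. -/
theorem vecIdx_induction {n : ℕ} (hn : 1 ≤ n) {P : ℤ → Prop} (h0 : P (ix n (-1)))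
    (h1 : ∀ t, t + 1 < n + 1 → ∀ ε : ℤˣ, ε = -1 ∨ t = 0 → P (ix (t + 1) (-1)) → P (ix t ε))
    (h2 : ∀ t, t + 1 < n + 1 → ∀ ε : ℤˣ, ε = 1 ∨ t = 0 → P (ix t ε) → P (ix (t + 1) 1)) :
    ∀ a ∈ vecIdx n, P a := by
  have hm : ∀ t, t < n + 1 → P (ix t (-1)) := fun t ht => by
    refine Nat.decreasingInduction' (P := fun t => P (ix t (-1))) (m := t) (n := n) ?_ (by omega) h0
    exact fun k hk _ h => h1 k (by omega) _ (Or.inl rfl) h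
  have hp : ∀ t, t < n + 1 → P (ix t 1) := fun t ht => by
    induction t with
    | zero => exact h1 0 (by omega) 1 (Or.inr rfl) (hm 1 (by omega))
    | succ t ih => exact h2 t ht 1 (Or.inl rfl) (ih (by omega))
  intro a ha
  obtain ⟨t, ht, ε, rfl⟩ := exists_eq_ix ha
  rcases Int.units_eq_one_or ε with rfl | rfl
  · exact hp t ht
  · exact hm t ht

/-- A covariant matrix of operators is determined by one of its entries. -/
theorem Covariant.eq_zero {I : Type} [Fintype I] [DecidableEq I] {q : ℝ} (hq : q ≠ 0) {n : ℕ}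
    (hn : 1 ≤ n) {E E' K : ℕ → ℤˣ → ℤˣ → Matrix I I ℂ} {Y : ℤ → ℤ → Matrix I I ℂ}
    (h : ∀ t, t + 1 < n + 1 → ∀ ε δ : ℤˣ, ε = δ ∨ t = 0 →
      Covariant n (arrow q t ε δ) (kap q t ε δ) (E t ε δ) (E' t ε δ) (K t ε δ) Y)
    (hK : ∀ t, t + 1 < n + 1 → ∀ ε δ : ℤˣ, ∀ A : Matrix I I ℂ, K t ε δ * A = 0 → A = 0)
    (h0 : Y (ix n (-1)) (ix n (-1)) = 0) : ∀ a ∈ vecIdx n, ∀ b ∈ vecIdx n, Y a b = 0 := by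
  have hQ : (q : ℂ) ≠ 0 := by exact_mod_cast hq
  have hc := fun a => cchi_ne_zero hq a
  have hw := wv_ne_zero hQ
  have hu : ∀ ε : ℤˣ, ((ε : ℤ) : ℂ) ≠ 0 := fun ε => by
    rcases Int.units_eq_one_or ε with rfl | rfl <;> simp
  have hc1 : ∀ (t : ℕ) (ε δ : ℤˣ),
      -((ε : ℤ) : ℂ) * wv q δ * (cchi q (ix t ε) / cchi q (ix (t + 1) δ)) ≠ 0 := fun t ε δ =>
    mul_ne_zero (mul_ne_zero (neg_ne_zero.2 (hu ε)) (hw _)) (div_ne_zero (hc _) (hc _))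
  have hc2 : ∀ (t : ℕ) (ε δ : ℤˣ), ((ε : ℤ) : ℂ) * (wv q (-δ))⁻¹ *
      (cchi q (-ix (t + 1) δ) / cchi q (-ix t ε)) ≠ 0 := fun t ε δ =>
    mul_ne_zero (mul_ne_zero (hu ε) (inv_ne_zero (hw _))) (div_ne_zero (hc _) (hc _))
  have he : ∀ (t : ℕ) (ε : ℤˣ), -ix t (-ε) = ix t ε := fun t ε => by rw [ix_neg, neg_neg]
  -- The lowest row index is not in the image of a raising generator. If the entry in column `b`
  -- vanishes, the relation leaves only the entry in the next column.
  have hrow : ∀ b ∈ vecIdx n, Y (ix n (-1)) b = 0 := by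
    have key : ∀ t, t + 1 < n + 1 → ∀ ε : ℤˣ, ε = 1 ∨ t = 0 → ∀ b ∈ vecIdx n,
        Y (ix n (-1)) b = 0 → (if b = ix t ε then
          (-((ε : ℤ) : ℂ) * wv q 1 * (cchi q (ix t ε) / cchi q (ix (t + 1) 1))) •
            Y (ix n (-1)) (ix (t + 1) 1)
        else if b = -ix (t + 1) 1 then
          (((ε : ℤ) : ℂ) * (wv q (-1))⁻¹ * (cchi q (-ix (t + 1) 1) / cchi q (-ix t ε))) •
            Y (ix n (-1)) (-ix t ε)
        else 0) = 0 := fun t ht ε hε b hb hb0 => by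
      have := h t ht ε 1 hε _ (ix_mem (Nat.lt_succ_self n) (-1)) b hb
      rw [sum_arrow_col q ht, sum_arrow_row q ht, hb0, if_neg (show ix n (-1) ≠ ix (t + 1) 1 by
        rw [Ne, ix_inj]; simp), if_neg (show ix n (-1) ≠ -ix t ε by
        rw [← ix_neg, Ne, ix_inj]; omega)] at this
      simpa using this
    refine vecIdx_induction hn h0 (fun t ht ε hε h' => ?_) (fun t ht ε hε h' => ?_)
    · have := key t ht (-ε) (by rcases hε with rfl | h; exacts [Or.inl (neg_neg 1), Or.inr h]) _
        (ix_mem ht _) h'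
      rw [if_neg (ix_ne (by omega) _ _), if_pos (ix_neg _ _)] at this
      rw [← he t ε]
      exact (smul_eq_zero.1 this).resolve_left (hc2 _ _ _)
    · have := key t ht ε hε _ (ix_mem (by omega) _) h'
      rw [if_pos rfl] at this
      exact (smul_eq_zero.1 this).resolve_left (hc1 _ _ _)
  -- Once the whole row `a` vanishes, a lowering generator leaves only `K` times an entry of the
  -- next row, and `K` is injective.
  have key : ∀ t, t + 1 < n + 1 → ∀ ε : ℤˣ, ε = -1 ∨ t = 0 → ∀ a ∈ vecIdx n,
      (∀ b ∈ vecIdx n, Y a b = 0) → ∀ b ∈ vecIdx n, (if a = ix (t + 1) (-1) then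
        (-((ε : ℤ) : ℂ) * wv q (-1) * (cchi q (ix t ε) / cchi q (ix (t + 1) (-1)))) •
          (K t ε (-1) * Y (ix t ε) b)
      else if a = -ix t ε then
        (((ε : ℤ) : ℂ) * (wv q (-(-1)))⁻¹ * (cchi q (-ix (t + 1) (-1)) / cchi q (-ix t ε))) •
          (K t ε (-1) * Y (-ix (t + 1) (-1)) b)
      else 0) = 0 := fun t ht ε hε a ha ha0 b hb => by
    have := h t ht ε (-1) hε a ha b hb
    rw [Finset.sum_eq_zero (fun b' hb' => by rw [ha0 b' hb', smul_zero]), sum_arrow_row q ht, ha0 b hb]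
      at this
    simpa using this.symm
  refine vecIdx_induction hn hrow (fun t ht ε hε h' b hb => ?_) (fun t ht ε hε h' b hb => ?_)
  · have := key t ht ε hε _ (ix_mem ht _) h' b hb
    rw [if_pos rfl] at this
    exact hK t ht _ _ _ ((smul_eq_zero.1 this).resolve_left (hc1 _ _ _))
  · have := key t ht (-ε) (by rcases hε with rfl | h; exacts [Or.inl rfl, Or.inr h]) _
      (ix_mem (by omega) _) h' b hb
    rw [if_neg (ix_ne (by omega) _ _), if_pos (he _ _).symm] at this
    rw [← he (t + 1) 1]
    exact hK t ht _ _ _ ((smul_eq_zero.1 this).resolve_left (hc2 _ _ _))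

theorem genKK_mul_eq_zero {q : ℝ} (hq : q ≠ 0) (n t : ℕ) (ε δ : ℤˣ) (A : Op₂ n)
    (h : genKK q n t ε δ * A = 0) : A = 0 := by
  have hQ : (q : ℂ) ≠ 0 := by exact_mod_cast hq
  have hw := wv_ne_zero hQ
  let g : Op n := pure (str2 1 (Matrix.diagonal fun τ => (kv (q : ℂ) ε δ τ)⁻¹) (wI q) 1 t)
  have hg : g * genK q n t ε δ = 1 := by
    have e : (fun τ => (kv (q : ℂ) ε δ τ)⁻¹ * kv q ε δ τ) = fun _ => 1 := by
      funext τ; exact inv_mul_cancel₀ (inv_ne_zero (hw _))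
    rw [genK, pure_str2_mul, Matrix.diagonal_mul_diagonal, e, wI_mul_wM hQ, mul_one, Matrix.diagonal_one,
      ← pure_one]
    congr 1; funext k; simp [str2]
  have := congrArg ((g ⊗ₖ g) * ·) h
  simpa only [genKK, ← Matrix.mul_assoc, ← Matrix.mul_kronecker_mul, hg, Matrix.one_kronecker_one, one_mul,
    mul_zero] using this

/-! ### Adding one site -/

/-- Basis states of the tensor square of the spinor space with `N` sites. -/
abbrev PSt (N : ℕ) : Type := (Fin N → ℤˣ) × (Fin N → ℤˣ)

/-- Splitting off the last site. -/
def splitLast (N : ℕ) : PSt (N + 1) ≃ PSt N × (ℤˣ × ℤˣ) where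
  toFun r := ((Fin.init r.1, Fin.init r.2), (r.1 (Fin.last _), r.2 (Fin.last _)))
  invFun r := (Fin.snoc r.1.1 r.2.1, Fin.snoc r.1.2 r.2.2)
  left_inv r := by simp
  right_inv r := by simp

/-- The operator `A ⊗ m`, where `m` acts on the last site. -/
def tens {N : ℕ} (A : Matrix (PSt N) (PSt N) ℂ) (m : Matrix (ℤˣ × ℤˣ) (ℤˣ × ℤˣ) ℂ) :
    Matrix (PSt (N + 1)) (PSt (N + 1)) ℂ := (A ⊗ₖ m).submatrix (splitLast N) (splitLast N)

/-- The vector `x ⊗ y`, where `y` belongs to the last site. -/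
def tvec {N : ℕ} (x : PSt N → ℂ) (y : ℤˣ × ℤˣ → ℂ) : PSt (N + 1) → ℂ := fun r =>
  x (splitLast N r).1 * y (splitLast N r).2

section
variable {N : ℕ} (A A' : Matrix (PSt N) (PSt N) ℂ) (m m' : Matrix (ℤˣ × ℤˣ) (ℤˣ × ℤˣ) ℂ)

theorem tens_mul : tens A m * tens A' m' = tens (A * A') (m * m') := by
  rw [tens, tens, tens, Matrix.submatrix_mul_equiv, Matrix.mul_kronecker_mul]

theorem tens_add : tens (A + A') m = tens A m + tens A' m := by
  rw [tens, Matrix.add_kronecker]; rfl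

theorem tens_add_right : tens A (m + m') = tens A m + tens A m' := by
  rw [tens, Matrix.kronecker_add]; rfl

theorem tens_smul (c : ℂ) : tens (c • A) m = c • tens A m := by
  rw [tens, Matrix.smul_kronecker]; rfl

theorem tens_smul_right (c : ℂ) : tens A (c • m) = c • tens A m := by
  rw [tens, Matrix.kronecker_smul]; rfl

theorem tens_zero : tens (0 : Matrix (PSt N) (PSt N) ℂ) m = 0 := by
  rw [tens, Matrix.zero_kronecker]; rfl

theorem tens_zero_right : tens A (0 : Matrix (ℤˣ × ℤˣ) (ℤˣ × ℤˣ) ℂ) = 0 := by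
  rw [tens, Matrix.kronecker_zero]; rfl

theorem tens_mulVec (x : PSt N → ℂ) (y : ℤˣ × ℤˣ → ℂ) :
    (tens A m).mulVec (tvec x y) = tvec (A.mulVec x) (m.mulVec y) := by
  funext r
  simp only [Matrix.mulVec, dotProduct, tvec, tens, Matrix.submatrix_apply]
  rw [(splitLast N).sum_comp fun s => (A ⊗ₖ m) (splitLast N r) s * (x s.1 * y s.2),
    Fintype.sum_prod_type, Finset.sum_mul_sum]
  refine Finset.sum_congr rfl fun i _ => Finset.sum_congr rfl fun j _ => ?_
  rw [Matrix.kroneckerMap_apply]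
  ring

end

section
variable {N : ℕ} (x x' : PSt N → ℂ) (y y' : ℤˣ × ℤˣ → ℂ)

theorem tvec_add : tvec (x + x') y = tvec x y + tvec x' y := by
  funext r; simp [tvec, add_mul]

theorem tvec_add_right : tvec x (y + y') = tvec x y + tvec x y' := by
  funext r; simp [tvec, mul_add]

theorem tvec_smul (c : ℂ) : tvec (c • x) y = c • tvec x y := by
  funext r; simp [tvec, mul_assoc]

theorem tvec_smul_right (c : ℂ) : tvec x (c • y) = c • tvec x y := by
  funext r; simp [tvec, mul_left_comm]

theorem tvec_zero : tvec (0 : PSt N → ℂ) y = 0 := by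
  funext r; simp [tvec]

end

/-! ### The operators `B` and `G` -/

/-- The exchange of `(-, +)` and `(+, -)`. -/
def exch : Matrix (ℤˣ × ℤˣ) (ℤˣ × ℤˣ) ℂ := fun r c => if r.1 = -r.2 ∧ c = r.swap then 1 else 0

/-- The projection onto the span of `(-, -)` and `(+, +)`. -/
def eqProj : Matrix (ℤˣ × ℤˣ) (ℤˣ × ℤˣ) ℂ := Matrix.diagonal fun r => if r.1 = r.2 then 1 else 0

/-- The diagonal operator with eigenvalue `x` on `(-, +)` and `y` on `(+, -)`. -/
def mixDiag (x y : ℂ) : Matrix (ℤˣ × ℤˣ) (ℤˣ × ℤˣ) ℂ :=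
  Matrix.diagonal fun r => if r.1 = r.2 then 0 else if r.2 = 1 then x else y

/-- The local operator `k = diag(1, -q⁻¹, -q, 1)`. -/
def kdiag (Q : ℂ) : Matrix (ℤˣ × ℤˣ) (ℤˣ × ℤˣ) ℂ := eqProj + mixDiag (-Q⁻¹) (-Q)

/-- The operator `B = ∑ⱼ 1 ⊗ ⋯ ⊗ 1 ⊗ b ⊗ k ⊗ ⋯ ⊗ k`, where `b` exchanges `(-, +)` and `(+, -)`. -/
def Bop (Q : ℂ) : (N : ℕ) → Matrix (PSt N) (PSt N) ℂ
  | 0 => 0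
  | N + 1 => tens (Bop Q N) (kdiag Q) + tens 1 exch

/-- The normalisation of the mixed part of the recurrence. -/
def mixc (Q : ℂ) (δ : ℤˣ) (u v : ℂ) : ℂ := if δ = 1 then (Q * v - Q⁻¹ * u)⁻¹ else (v - u)⁻¹

/-- The spinor-spinor R-matrix composed with the flip. -/
def Gop (Q : ℂ) : (N : ℕ) → ℤˣ → ℂ → ℂ → Matrix (PSt N) (PSt N) ℂ
  | 0, δ, _, _ => if δ = 1 then 1 else 0
  | N + 1, δ, u, v => tens (Gop Q N δ u v) eqProj +
      mixc Q δ u v • ((v - u) • tens (Gop Q N (-δ) u (Q ^ 2 * v)) exch +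
        (Q - Q⁻¹) • tens (Bop Q N * Gop Q N (-δ) u (Q ^ 2 * v)) (mixDiag v u))

/-- Spectral parameters for which `G` is regular. -/
def Regular (Q : ℂ) (δ : ℤˣ) (u v : ℂ) : Prop :=
  ∀ m : ℤ, (-1 : ℤˣ) ^ m = δ → u ≠ Q ^ (2 * m + 2) * v

/-- The recursion for `Gop` replaces `(δ, v)` by `(-δ, Q² v)`. The excluded ratios move along with
it, so regularity descends to all smaller numbers of sites. -/
theorem Regular.shift {Q : ℂ} (hQ : Q ≠ 0) {δ : ℤˣ} {u v : ℂ} (h : Regular Q δ u v) :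
    Regular Q (-δ) u (Q ^ 2 * v) := by
  intro m hm
  have := h (m + 1) (by rw [zpow_add, hm]; simp)
  rwa [mul_add, mul_one, zpow_add₀ hQ _ 2, mul_assoc] at this

/-- The `q`-number `[k]`. -/
def qnum (Q : ℂ) (k : ℤ) : ℂ := (Q ^ k - Q ^ (-k)) / (Q - Q⁻¹)

/-- The eigenvalues of `G` for non-negative index. -/
def gval (Q : ℂ) : ℕ → ℂ → ℂ → ℂ
  | 0, _, _ => 1
  | 1, _, _ => 1
  | m + 2, u, v => (v * (Q ^ (m + 1))⁻¹ - u * Q ^ (m + 1)) / (u * (Q ^ (m + 1))⁻¹ - v * Q ^ (m + 1)) *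
      gval Q m u v

/-- The eigenvalues of `G`. -/
def geig (Q : ℂ) (k : ℤ) (u v : ℂ) : ℂ :=
  if 0 ≤ k then gval Q k.toNat u v else (-1) ^ k.natAbs * gval Q k.natAbs u v

theorem Regular.den {Q : ℂ} (hQ : Q ≠ 0) {δ : ℤˣ} {u v : ℂ} (h : Regular Q δ u v) {m : ℕ}
    (hm : (-1 : ℤˣ) ^ m = δ) : u * (Q ^ (m + 1))⁻¹ - v * Q ^ (m + 1) ≠ 0 := by
  intro h0
  refine h m (by simpa using hm) ?_
  have e : Q ^ (2 * (m : ℤ) + 2) = Q ^ (m + 1) * Q ^ (m + 1) := by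
    rw [← pow_add, ← zpow_natCast]; congr 1; push_cast; ring
  rw [e]
  have hp := pow_ne_zero (m + 1) hQ
  field_simp at h0
  linear_combination h0

theorem mixc_ne_zero {Q : ℂ} (hQ : Q ≠ 0) {δ : ℤˣ} {u v : ℂ} (h : Regular Q δ u v) :
    mixc Q δ u v ≠ 0 := by
  rw [mixc]
  split_ifs with hδ
  · have := h.den hQ (m := 0) (by simp [hδ])
    refine inv_ne_zero fun h0 => this ?_
    rw [zero_add, pow_one]
    linear_combination -h0
  · refine inv_ne_zero fun h0 => h (-1) ?_ ?_
    · rcases Int.units_eq_one_or δ with rfl | rfl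
      · exact absurd rfl hδ
      · simp
    · norm_num
      linear_combination -h0

/-! ### Functional equations and special values of the eigenvalues -/

theorem mixc_one {Q : ℂ} (u v : ℂ) : mixc Q 1 u v = (Q * v - Q⁻¹ * u)⁻¹ := if_pos rfl

theorem mixc_neg_one {Q : ℂ} (u v : ℂ) : mixc Q (-1) u v = (v - u)⁻¹ := if_neg (by decide)

/-- This and `gval_reflect'` are what the induction on the number of sites needs when the eigenvalue
`[k]` turns into `[-k - 1]`, for non-negative and negative `k`. The induction goes in steps of two,
as `gval` does. -/
theorem gval_reflect {Q : ℂ} (hQ : Q ≠ 0) (m : ℕ) : ∀ {δ : ℤˣ} {u v : ℂ}, Regular Q δ u v →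
    (-1 : ℤˣ) ^ (m + 1) = δ →
    (-1 : ℂ) ^ (m + 1) * gval Q (m + 1) u v =
      mixc Q δ u v * (u * Q ^ m - v * (Q ^ m)⁻¹) * gval Q m u (Q ^ 2 * v) := by
  induction m using Nat.twoStepInduction with
  | zero =>
    rintro _ u v h rfl
    have := mixc_ne_zero hQ h
    norm_num [mixc_neg_one, gval] at this ⊢
    field_simp
    ring
  | one =>
    rintro _ u v h rfl
    have h1 := h.den hQ (m := 0) rfl
    have := mixc_ne_zero hQ h
    norm_num [mixc_one, gval] at this h1 ⊢
    have h2 : v * Q - u * Q⁻¹ ≠ 0 := fun h0 => this (by linear_combination h0)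
    rw [show (Q * v - Q⁻¹ * u) = -(u * Q⁻¹ - v * Q) by ring, div_eq_mul_inv, inv_neg]
    ring
  | more m ih _ =>
    intro δ u v h hδ
    have h1 := h.den hQ (m := m + 1) (by rw [← hδ]; simp [pow_succ])
    have ih := ih h (by rw [← hδ]; simp [pow_succ])
    have hp := pow_ne_zero m hQ
    have h2 : u * (Q ^ (m + 1))⁻¹ - Q ^ 2 * v * Q ^ (m + 1) =
        Q * (u * (Q ^ (m + 1 + 1))⁻¹ - v * Q ^ (m + 1 + 1)) := by
      field_simp; try ring
    simp only [gval]
    rw [h2, show (-1 : ℂ) ^ (m + 2 + 1) = (-1) ^ (m + 1) by ring, mul_left_comm, ih]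
    generalize hD : u * (Q ^ (m + 1 + 1))⁻¹ - v * Q ^ (m + 1 + 1) = D at *
    field_simp
    ring

theorem gval_reflect' {Q : ℂ} (hQ : Q ≠ 0) (m : ℕ) : ∀ {δ : ℤˣ} {u v : ℂ}, Regular Q δ u v →
    (-1 : ℤˣ) ^ m = δ →
    gval Q m u v = mixc Q δ u v * (u * (Q ^ (m + 1))⁻¹ - v * Q ^ (m + 1)) *
      ((-1 : ℂ) ^ (m + 1) * gval Q (m + 1) u (Q ^ 2 * v)) := by
  induction m using Nat.twoStepInduction with
  | zero =>
    rintro _ u v h rfl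
    have := mixc_ne_zero hQ h
    norm_num [mixc_one, gval] at this ⊢
    have h2 : Q * v - Q⁻¹ * u ≠ 0 := this
    rw [show (u * Q⁻¹ - v * Q) = -(Q * v - Q⁻¹ * u) by ring, mul_neg, inv_mul_cancel₀ h2, neg_neg]
  | one =>
    rintro _ u v h rfl
    have h1 := h.den hQ (m := 1) rfl
    have := mixc_ne_zero hQ h
    norm_num [mixc_neg_one, gval] at this h1 ⊢
    have h2 : u * Q⁻¹ - Q ^ 2 * v * Q = Q * (u * (Q ^ 2)⁻¹ - v * Q ^ 2) := by field_simp
    rw [h2]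
    generalize u * (Q ^ 2)⁻¹ - v * Q ^ 2 = D at *
    field_simp
  | more m ih _ =>
    intro δ u v h hδ
    have h1 := h.den hQ (m := m + 2) hδ
    have h0 := h.den hQ (m := m) (by rw [← hδ]; simp [pow_succ])
    have ih := ih h (by rw [← hδ]; simp [pow_succ])
    have hp := pow_ne_zero m hQ
    have h2 : u * (Q ^ (m + 1 + 1))⁻¹ - Q ^ 2 * v * Q ^ (m + 1 + 1) =
        Q * (u * (Q ^ (m + 2 + 1))⁻¹ - v * Q ^ (m + 2 + 1)) := by
      field_simp; try ring
    simp only [gval]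
    rw [h2, show (-1 : ℂ) ^ (m + 2 + 1) = (-1) ^ (m + 1) by ring, ih]
    generalize hD : u * (Q ^ (m + 2 + 1))⁻¹ - v * Q ^ (m + 2 + 1) = D at *
    generalize hD' : u * (Q ^ (m + 1))⁻¹ - v * Q ^ (m + 1) = D' at *
    field_simp
    try ring

theorem geig_neg {Q : ℂ} (k : ℤ) (u v : ℂ) : geig Q (-k) u v = (-1) ^ k.natAbs * geig Q k u v := by
  rcases lt_trichotomy k 0 with h | rfl | h
  · rw [geig, if_pos (by omega), geig, if_neg (by omega), ← mul_assoc, ← mul_pow]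
    rw [show (-k).toNat = k.natAbs by omega]; simp
  · simp
  · rw [geig, if_neg (by omega), geig, if_pos h.le, Int.natAbs_neg, show k.toNat = k.natAbs by omega]

theorem geig_reflect {Q : ℂ} (hQ : Q ≠ 0) (k : ℤ) {δ : ℤˣ} {u v : ℂ} (h : Regular Q δ u v)
    (hk : (-1 : ℤˣ) ^ (k + 1) = δ) : geig Q (-k - 1) u v =
      mixc Q δ u v * (u * Q ^ k - v * Q ^ (-k)) * geig Q k u (Q ^ 2 * v) := by
  rcases le_or_gt 0 k with hk0 | hk0
  · obtain ⟨m, rfl⟩ := Int.eq_ofNat_of_zero_le hk0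
    have := gval_reflect hQ m h (by rw [← hk]; norm_cast)
    rw [geig, if_neg (by omega), geig, if_pos hk0, show (-(m : ℤ) - 1).natAbs = m + 1 by omega, this]
    simp
  · obtain ⟨m, hm⟩ := Int.eq_ofNat_of_zero_le (show 0 ≤ -k - 1 by omega)
    obtain rfl : k = -((m + 1 : ℕ) : ℤ) := by push_cast; omega
    have := gval_reflect' hQ m h (by
      rw [← hk, show -((m + 1 : ℕ) : ℤ) + 1 = -(m : ℤ) by push_cast; ring, zpow_neg]; simp)
    rw [geig, if_pos (by omega), hm, geig, if_neg (not_le.2 hk0), Int.natAbs_neg, Int.natAbs_natCast, neg_neg]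
    simp only [Int.toNat_natCast, zpow_neg, zpow_natCast]
    exact this

/-- Obtained from `geig_reflect` by `k ↦ -k`, since `geig` is even or odd according to the parity of
`k`. -/
theorem geig_reflect' {Q : ℂ} (hQ : Q ≠ 0) (k : ℤ) {δ : ℤˣ} {u v : ℂ} (h : Regular Q δ u v)
    (hk : (-1 : ℤˣ) ^ (k + 1) = δ) : geig Q (1 - k) u v =
      mixc Q δ u v * (v * Q ^ k - u * Q ^ (-k)) * geig Q k u (Q ^ 2 * v) := by
  have h1 : (-1 : ℤˣ) ^ (-k + 1) = δ := by
    rw [← hk, zpow_add, zpow_add, zpow_neg]; simp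
  have := geig_reflect hQ (-k) h h1
  rw [geig_neg] at this
  rw [show 1 - k = -(- -k - 1) by ring, geig_neg, this, neg_neg]
  have e : (-1 : ℂ) ^ (k - 1).natAbs * (-1) ^ k.natAbs = -1 := by
    rw [← pow_add]
    exact Odd.neg_one_pow (by rw [Nat.odd_iff]; omega)
  linear_combination (mixc Q δ u v * (u * Q ^ (-k) - v * Q ^ k) * geig Q k u (Q ^ 2 * v)) * e

theorem gval_self {Q : ℂ} (hQ : Q ≠ 0) {u : ℂ} (h : Regular Q 1 u u) {m : ℕ} :
    (-1 : ℤˣ) ^ m = 1 → gval Q m u u = 1 := by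
  induction m using Nat.twoStepInduction with
  | zero => intro; rfl
  | one => intro; rfl
  | more m ih _ =>
    intro hm
    have hm : (-1 : ℤˣ) ^ m = 1 := by simpa [pow_succ] using hm
    rw [gval, div_self (h.den hQ hm), ih hm, one_mul]

theorem geig_self {Q : ℂ} (hQ : Q ≠ 0) {u : ℂ} (h : Regular Q 1 u u) {k : ℤ}
    (hk : (-1 : ℤˣ) ^ k = 1) : geig Q k u u = 1 := by
  have h1 : Even k := by
    by_contra h
    rw [Int.not_even_iff_odd] at h
    rw [h.neg_one_zpow] at hk
    exact absurd hk (by decide)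
  have h2 : Even k.natAbs := Int.natAbs_even.2 h1
  rw [geig]
  split_ifs with h0
  · rw [show k.toNat = k.natAbs by omega, gval_self hQ h h2.neg_one_pow]
  · rw [gval_self hQ h h2.neg_one_pow, h2.neg_one_pow, one_mul]

/-- At these parameters each factor of the product is `[m + 2] / [m]`, so it telescopes from `[1] =
1`. -/
theorem gval_special {Q : ℂ} (hQ : Q ≠ 0) (h1 : Q - Q⁻¹ ≠ 0) (h : Regular Q (-1) (Q ^ 2) 1) {m : ℕ} :
    (-1 : ℤˣ) ^ m = -1 → gval Q m (Q ^ 2) 1 = qnum Q m := by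
  induction m using Nat.twoStepInduction with
  | zero => intro h; exact absurd h (by decide)
  | one => intro; simp [gval, qnum, h1]
  | more m ih _ =>
    intro hm
    have hm : (-1 : ℤˣ) ^ m = -1 := by simpa [pow_succ] using hm
    have hd := h.den hQ hm
    have hp := pow_ne_zero m hQ
    rw [gval, ih hm, qnum, qnum, ← mul_div_assoc]
    congr 1
    rw [div_mul_eq_mul_div, div_eq_iff hd]
    simp only [zpow_neg, zpow_natCast]
    field_simp
    ring

theorem geig_special {Q : ℂ} (hQ : Q ≠ 0) (h1 : Q - Q⁻¹ ≠ 0) (h : Regular Q (-1) (Q ^ 2) 1) {k : ℤ}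
    (hk : (-1 : ℤˣ) ^ k = -1) : geig Q k (Q ^ 2) 1 = qnum Q k := by
  have h1' : Odd k := by
    by_contra h
    rw [Int.not_odd_iff_even] at h
    rw [h.neg_one_zpow] at hk
    exact absurd hk (by decide)
  have h2 : Odd k.natAbs := Int.natAbs_odd.2 h1'
  rw [geig]
  split_ifs with h0
  · rw [show k.toNat = k.natAbs by omega, gval_special hQ h1 h h2.neg_one_pow]
    congr 1; omega
  · rw [gval_special hQ h1 h h2.neg_one_pow, h2.neg_one_pow, qnum, qnum,
      show (k.natAbs : ℤ) = -k by omega]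
    rw [neg_neg]; ring

/-! ### The spectrum of `B` and `G` -/

/-- The vector on the last site with coefficient `a` on `(-, +)` and `b` on `(+, -)`. -/
def mvec (a b : ℂ) : ℤˣ × ℤˣ → ℂ := fun r => if r.1 = r.2 then 0 else if r.2 = 1 then a else b

/-- The vector on the last site with coefficient `a` on `(+, +)` and `b` on `(-, -)`. -/
def nvec (a b : ℂ) : ℤˣ × ℤˣ → ℂ := fun r => if r.1 = r.2 then (if r.2 = 1 then a else b) else 0

theorem exch_mulVec (y : ℤˣ × ℤˣ → ℂ) :
    exch.mulVec y = fun r => if r.1 = -r.2 then y r.swap else 0 := by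
  funext r
  simp only [Matrix.mulVec, dotProduct, exch]
  split_ifs with h <;> simp [h]

theorem exch_mvec (a b : ℂ) : exch.mulVec (mvec a b) = mvec b a := by
  rw [exch_mulVec]
  funext ⟨r, s⟩
  rcases Int.units_eq_one_or r with rfl | rfl <;> rcases Int.units_eq_one_or s with rfl | rfl <;>
    simp [mvec]

theorem exch_nvec (a b : ℂ) : exch.mulVec (nvec a b) = 0 := by
  rw [exch_mulVec]
  funext ⟨r, s⟩
  rcases Int.units_eq_one_or r with rfl | rfl <;> rcases Int.units_eq_one_or s with rfl | rfl <;>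
    simp [nvec]

theorem eqProj_mvec (a b : ℂ) : eqProj.mulVec (mvec a b) = 0 := by
  funext r; rw [eqProj, Matrix.mulVec_diagonal, mvec]; split_ifs <;> simp

theorem eqProj_nvec (a b : ℂ) : eqProj.mulVec (nvec a b) = nvec a b := by
  funext r; rw [eqProj, Matrix.mulVec_diagonal, nvec]; split_ifs <;> simp

theorem mixDiag_mvec (x y a b : ℂ) : (mixDiag x y).mulVec (mvec a b) = mvec (x * a) (y * b) := by
  funext r; rw [mixDiag, Matrix.mulVec_diagonal, mvec, mvec]; split_ifs <;> simp

theorem mixDiag_nvec (x y a b : ℂ) : (mixDiag x y).mulVec (nvec a b) = 0 := by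
  funext r; rw [mixDiag, Matrix.mulVec_diagonal, nvec]; split_ifs <;> simp

theorem smul_mvec (c a b : ℂ) : c • mvec a b = mvec (c * a) (c * b) := by
  funext r; simp only [mvec, Pi.smul_apply]; split_ifs <;> simp

theorem mvec_add (a b a' b' : ℂ) : mvec a b + mvec a' b' = mvec (a + a') (b + b') := by
  funext r; simp only [mvec, Pi.add_apply]; split_ifs <;> simp

theorem nvec_add_mvec (y : ℤˣ × ℤˣ → ℂ) :
    y = nvec (y (1, 1)) (y (-1, -1)) + mvec (y (-1, 1)) (y (1, -1)) := by
  funext ⟨r, s⟩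
  rcases Int.units_eq_one_or r with rfl | rfl <;> rcases Int.units_eq_one_or s with rfl | rfl <;>
    simp [mvec, nvec]

/-- `(-1) ^ deg m`. -/
def parN {N : ℕ} (m : Fin N → ℤˣ) : ℤˣ := ∏ k, -(m k)

theorem parN_init {N : ℕ} (m : Fin (N + 1) → ℤˣ) : parN m = parN (Fin.init m) * -m (Fin.last N) := by
  rw [parN, Fin.prod_univ_castSucc]; rfl

/-- The projection onto the states with product of parities `δ`. -/
def secProj (N : ℕ) (δ : ℤˣ) : Matrix (PSt N) (PSt N) ℂ :=
  Matrix.diagonal fun r => if parN r.1 * parN r.2 = δ then 1 else 0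

theorem tens_diagonal {N : ℕ} (d : PSt N → ℂ) (d' : ℤˣ × ℤˣ → ℂ) :
    tens (Matrix.diagonal d) (Matrix.diagonal d') =
      Matrix.diagonal fun r => d (splitLast N r).1 * d' (splitLast N r).2 := by
  rw [tens, Matrix.diagonal_kronecker_diagonal]
  exact Matrix.submatrix_diagonal_equiv _ _

theorem secProj_succ (N : ℕ) (δ : ℤˣ) :
    secProj (N + 1) δ = tens (secProj N δ) eqProj + tens (secProj N (-δ)) (mixDiag 1 1) := by
  rw [secProj, secProj, secProj, eqProj, mixDiag, tens_diagonal, tens_diagonal, Matrix.diagonal_add]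
  congr 1
  funext r
  have e : parN r.1 * parN r.2 = parN (Fin.init r.1) * parN (Fin.init r.2) *
      (r.1 (Fin.last N) * r.2 (Fin.last N)) := by
    rw [parN_init, parN_init r.2]
    simp only [mul_neg, neg_mul, neg_neg]
    rw [mul_mul_mul_comm]
  rw [e]
  simp only [splitLast, Equiv.coe_fn_mk]
  rcases Int.units_eq_one_or (r.1 (Fin.last N)) with h | h <;>
    rcases Int.units_eq_one_or (r.2 (Fin.last N)) with h' | h' <;> simp [h, h', neg_eq_iff_eq_neg] <;> rfl

/-- Joint eigenvectors of the operators `B` and `G`. -/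
structure SpecVec (Q : ℂ) (N : ℕ) (k : ℤ) (x : PSt N → ℂ) : Prop where
  bound : k.natAbs ≤ N
  mulB : (Bop Q N).mulVec x = qnum Q k • x
  mulG : ∀ δ u v, Regular Q δ u v →
    (Gop Q N δ u v).mulVec x = (if (-1 : ℤˣ) ^ k = δ then geig Q k u v else 0) • x
  sector : ∀ δ, (secProj N δ).mulVec x = (if (-1 : ℤˣ) ^ k = δ then (1 : ℂ) else 0) • x

/-- On equal spins `kdiag` and `eqProj` are the identity and the exchange vanishes. -/
theorem SpecVec.nonmixed {Q : ℂ} {N : ℕ} {k : ℤ} {x : PSt N → ℂ} (h : SpecVec Q N k x)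
    (a b : ℂ) : SpecVec Q (N + 1) k (tvec x (nvec a b)) where
  bound := h.bound.trans N.le_succ
  mulB := by
    rw [Bop, kdiag, Matrix.add_mulVec, tens_mulVec, tens_mulVec, Matrix.add_mulVec, eqProj_nvec,
      mixDiag_nvec, exch_nvec, h.mulB, add_zero, tvec_smul]
    funext r; simp [tvec]
  mulG δ u v hr := by
    rw [Gop, Matrix.add_mulVec, Matrix.smul_mulVec, Matrix.add_mulVec, Matrix.smul_mulVec,
      Matrix.smul_mulVec, tens_mulVec, tens_mulVec, tens_mulVec, eqProj_nvec,
      mixDiag_nvec, exch_nvec, h.mulG δ u v hr, tvec_smul]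
    funext r; split_ifs <;> simp [tvec]
  sector δ := by
    rw [secProj_succ, Matrix.add_mulVec, tens_mulVec, tens_mulVec, eqProj_nvec, mixDiag_nvec, h.sector,
      tvec_smul]
    funext r; split_ifs <;> simp [tvec]

/-- On unequal spins `B` and `G` act by 2×2 matrices, and `(1, c)` is tested as a common
eigenvector: `hB1` and `hB2` are the two rows of the equation for `B`, `hG1` and `hG2` those for
`G`. -/
theorem SpecVec.mixed {Q : ℂ} (hQ : Q ≠ 0) {N : ℕ} {k k' : ℤ} {x : PSt N → ℂ}
    (h : SpecVec Q N k x) {c : ℂ} (hb : k'.natAbs ≤ k.natAbs + 1) (hk : (-1 : ℤˣ) ^ k' = -(-1) ^ k)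
    (hB1 : c - Q⁻¹ * qnum Q k = qnum Q k') (hB2 : 1 - Q * c * qnum Q k = qnum Q k' * c)
    (hG1 : ∀ δ u v, Regular Q δ u v → (-1 : ℤˣ) ^ k' = δ → mixc Q δ u v * ((v - u) * c +
      (Q - Q⁻¹) * qnum Q k * v) * geig Q k u (Q ^ 2 * v) = geig Q k' u v)
    (hG2 : ∀ u v, (v - u) + (Q - Q⁻¹) * qnum Q k * u * c =
      c * ((v - u) * c + (Q - Q⁻¹) * qnum Q k * v)) :
    SpecVec Q (N + 1) k' (tvec x (mvec 1 c)) where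
  bound := hb.trans (by have := h.bound; omega)
  mulB := by
    rw [Bop, kdiag, Matrix.add_mulVec, tens_mulVec, tens_mulVec, Matrix.add_mulVec, eqProj_mvec,
      mixDiag_mvec, exch_mvec, h.mulB, zero_add, Matrix.one_mulVec, tvec_smul, ← tvec_smul_right,
      ← tvec_add_right, smul_mvec, mvec_add, ← tvec_smul_right, smul_mvec, ← hB1]
    congr 2
    · ring
    · rw [hB1, ← hB2]; ring
  mulG δ u v hr := by
    rw [Gop, Matrix.add_mulVec, Matrix.smul_mulVec, Matrix.add_mulVec, Matrix.smul_mulVec,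
      Matrix.smul_mulVec, tens_mulVec, tens_mulVec, tens_mulVec, eqProj_mvec, ← Matrix.mulVec_mulVec,
      mixDiag_mvec, exch_mvec, h.mulG (-δ) u (Q ^ 2 * v) (hr.shift hQ), Matrix.mulVec_smul, h.mulB]
    simp only [tvec_smul, ← tvec_smul_right, smul_mvec, ← tvec_add_right, mvec_add]
    by_cases hδ : (-1 : ℤˣ) ^ k' = δ
    · have hδ' : (-1 : ℤˣ) ^ k = -δ := by rw [← hδ, hk, neg_neg]
      rw [if_pos hδ, if_pos hδ', ← hG1 δ u v hr hδ]
      have : tvec ((Gop Q N δ u v).mulVec x) 0 = 0 := by funext r; simp [tvec]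
      rw [this, zero_add]
      congr 2
      · ring
      · have := hG2 u v
        linear_combination (mixc Q δ u v * geig Q k u (Q ^ 2 * v)) * this
    · have hδ' : ¬ (-1 : ℤˣ) ^ k = -δ := fun h' => hδ (by rw [hk, h', neg_neg])
      rw [if_neg hδ, if_neg hδ']
      funext r; simp [tvec, mvec]
  sector δ := by
    rw [secProj_succ, Matrix.add_mulVec, tens_mulVec, tens_mulVec, eqProj_mvec, mixDiag_mvec, h.sector, h.sector,
      tvec_smul, tvec_smul, one_mul, one_mul]
    simp only [hk, neg_eq_iff_eq_neg]
    funext r; split_ifs <;> simp [tvec]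

section
variable {Q : ℂ}

/-- The 2×2 block of `B` has the eigenvectors `(1, -Q^k)` and `(1, Q^(-k))`; the second is
`mixed_right`. -/
theorem SpecVec.mixed_left (hQ : Q ≠ 0) (h1 : Q - Q⁻¹ ≠ 0) {N : ℕ} {k : ℤ} {x : PSt N → ℂ}
    (h : SpecVec Q N k x) : SpecVec Q (N + 1) (-k - 1) (tvec x (mvec 1 (-Q ^ k))) := by
  have hk : Q ^ (-k) = (Q ^ k)⁻¹ := zpow_neg _ _
  have hp : Q ^ k ≠ 0 := zpow_ne_zero _ hQ
  have e1 : Q ^ (-k - 1) = (Q ^ k)⁻¹ * Q⁻¹ := by rw [zpow_sub_one₀ hQ, zpow_neg]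
  have e2 : Q ^ (-(-k - 1)) = Q ^ k * Q := by rw [← zpow_add_one₀ hQ]; congr 1; ring
  have e3 : (Q - Q⁻¹) * qnum Q k = Q ^ k - (Q ^ k)⁻¹ := by rw [qnum, mul_div_cancel₀ _ h1, hk]
  refine h.mixed hQ (by omega) ?_ ?_ ?_ ?_ ?_
  · rw [zpow_sub, zpow_neg]; simp
  · rw [qnum, qnum, e1, e2, hk, eq_div_iff h1, sub_mul, mul_assoc, div_mul_cancel₀ _ h1]
    field_simp
    ring
  · rw [qnum, qnum, e1, e2, hk, div_mul_eq_mul_div, eq_div_iff h1, sub_mul, mul_assoc _ (_ / _),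
      div_mul_cancel₀ _ h1]
    field_simp
    ring
  · intro δ u v hr hδ
    rw [geig_reflect hQ k hr, hk, e3]
    · ring
    · rw [← hδ, zpow_sub, zpow_neg, zpow_add]; simp
  · intro u v
    rw [e3]
    field_simp
    ring

theorem SpecVec.mixed_right (hQ : Q ≠ 0) (h1 : Q - Q⁻¹ ≠ 0) {N : ℕ} {k : ℤ} {x : PSt N → ℂ}
    (h : SpecVec Q N k x) : SpecVec Q (N + 1) (1 - k) (tvec x (mvec 1 (Q ^ (-k)))) := by
  have hk : Q ^ (-k) = (Q ^ k)⁻¹ := zpow_neg _ _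
  have hp : Q ^ k ≠ 0 := zpow_ne_zero _ hQ
  have e1 : Q ^ (1 - k) = (Q ^ k)⁻¹ * Q := by rw [sub_eq_neg_add, zpow_add_one₀ hQ, zpow_neg]
  have e2 : Q ^ (-(1 - k)) = Q ^ k * Q⁻¹ := by rw [neg_sub, zpow_sub_one₀ hQ]
  have e3 : (Q - Q⁻¹) * qnum Q k = Q ^ k - (Q ^ k)⁻¹ := by rw [qnum, mul_div_cancel₀ _ h1, hk]
  refine h.mixed hQ (by omega) ?_ ?_ ?_ ?_ ?_
  · rw [zpow_sub, zpow_one, ← zpow_neg, zpow_neg]; simp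
  · rw [qnum, qnum, e1, e2, hk, eq_div_iff h1, sub_mul, mul_assoc, div_mul_cancel₀ _ h1]
    field_simp
    ring
  · rw [qnum, qnum, e1, e2, hk, div_mul_eq_mul_div, eq_div_iff h1, sub_mul, mul_assoc _ (_ / _),
      div_mul_cancel₀ _ h1]
    field_simp
    ring
  · intro δ u v hr hδ
    rw [geig_reflect' hQ k hr, hk, e3]
    · ring
    · rw [← hδ, zpow_sub, zpow_add, mul_comm]; simp
  · intro u v
    rw [e3, hk]
    field_simp
    ring

/-- The two eigenvectors of a mixed block have determinant `Q^k + Q^(-k)`, so they span the block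
when this is nonzero. -/
theorem span_specVec (hQ : Q ≠ 0) (h1 : Q - Q⁻¹ ≠ 0) (h2 : ∀ k : ℤ, Q ^ k + Q ^ (-k) ≠ 0) (N : ℕ) :
    Submodule.span ℂ {x | ∃ k, SpecVec Q N k x} = ⊤ := by
  induction N with
  | zero =>
    refine eq_top_iff.2 fun x _ => Submodule.subset_span ⟨0, ⟨le_rfl, ?_, ?_, ?_⟩⟩
    · simp [Bop, qnum]
    · intro δ u v _
      rw [Gop]
      rcases Int.units_eq_one_or δ with rfl | rfl <;> simp [geig, gval]
    · intro δ
      rcases Int.units_eq_one_or δ with rfl | rfl <;> simp [secProj, parN]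
  | succ N ih =>
    have key : ∀ (y : ℤˣ × ℤˣ → ℂ) (x : PSt N → ℂ),
        tvec x y ∈ Submodule.span ℂ {x | ∃ k, SpecVec Q (N + 1) k x} := by
      intro y x
      have hx : x ∈ Submodule.span ℂ {x | ∃ k, SpecVec Q N k x} := ih ▸ Submodule.mem_top
      induction hx using Submodule.span_induction with
      | mem x hx =>
        obtain ⟨k, hk⟩ := hx
        rw [nvec_add_mvec y, tvec_add_right]
        refine add_mem (Submodule.subset_span ⟨k, hk.nonmixed _ _⟩) ?_
        have e1 := Submodule.subset_span (R := ℂ) (s := {x | ∃ k, SpecVec Q (N + 1) k x})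
          ⟨_, hk.mixed_left hQ h1⟩
        have e2 := Submodule.subset_span (R := ℂ) (s := {x | ∃ k, SpecVec Q (N + 1) k x})
          ⟨_, hk.mixed_right hQ h1⟩
        generalize y (-1, 1) = a
        generalize y (1, -1) = b
        -- The coefficients come from Cramer's rule for `(a, b)` in the basis `(1, -Q^k)`, `(1,
        -- Q^(-k))`.
        have := add_mem (Submodule.smul_mem _ ((a * Q ^ (-k) - b) / (Q ^ k + Q ^ (-k))) e1)
          (Submodule.smul_mem _ ((a * Q ^ k + b) / (Q ^ k + Q ^ (-k))) e2)
        rw [← tvec_smul_right, ← tvec_smul_right, ← tvec_add_right, smul_mvec, smul_mvec, mvec_add] at this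
        have hs := h2 k
        convert this using 3
        · field_simp
          ring
        · field_simp
          ring
      | zero => rw [tvec_zero]; exact zero_mem _
      | add x x' _ _ h h' => rw [tvec_add]; exact add_mem h h'
      | smul c x _ h => rw [tvec_smul]; exact Submodule.smul_mem _ _ h
    refine eq_top_iff.2 fun z _ => ?_
    have : z = ∑ y : ℤˣ × ℤˣ, tvec (fun r => z ((splitLast N).symm (r, y))) (Pi.single y 1) := by
      funext r
      obtain ⟨⟨r, y⟩, rfl⟩ := (splitLast N).symm.surjective r
      simp [tvec, Finset.sum_apply, Pi.single_apply]
    rw [this]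
    exact sum_mem fun y _ => key _ _

/-- Matrices are determined by their action on the eigenvectors of `B`. -/
theorem eq_of_specVec (hQ : Q ≠ 0) (h1 : Q - Q⁻¹ ≠ 0) (h2 : ∀ k : ℤ, Q ^ k + Q ^ (-k) ≠ 0) {N : ℕ}
    {A A' : Matrix (PSt N) (PSt N) ℂ} (h : ∀ k x, SpecVec Q N k x → A.mulVec x = A'.mulVec x) : A = A' := by
  refine Matrix.mulVec_injective (funext fun x => ?_)
  have hx : x ∈ Submodule.span ℂ {x | ∃ k, SpecVec Q N k x} :=
    span_specVec hQ h1 h2 N ▸ Submodule.mem_top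
  induction hx using Submodule.span_induction with
  | mem x hx => obtain ⟨k, hk⟩ := hx; exact h k x hk
  | zero => simp
  | add x x' _ _ h h' => rw [Matrix.mulVec_add, Matrix.mulVec_add, h, h']
  | smul c x _ h => rw [Matrix.mulVec_smul, Matrix.mulVec_smul, h]

/-! ### `G` as a polynomial in `B` -/

theorem aeval_mulVec {I : Type} [Fintype I] [DecidableEq I] {A : Matrix I I ℂ} {x : I → ℂ} {l : ℂ}
    (h : A.mulVec x = l • x) (p : Polynomial ℂ) : (Polynomial.aeval A p).mulVec x = p.eval l • x := by
  induction p using Polynomial.induction_on' with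
  | add p p' h h' => rw [map_add, Matrix.add_mulVec, h, h', Polynomial.eval_add, add_smul]
  | monomial m c =>
    have hm : (A ^ m).mulVec x = l ^ m • x := by
      induction m with
      | zero => simp
      | succ m ih => rw [pow_succ, ← Matrix.mulVec_mulVec, h, Matrix.mulVec_smul, ih, smul_smul, pow_succ,
          mul_comm]
    rw [Polynomial.aeval_monomial, ← Algebra.smul_def, Matrix.smul_mulVec, hm, Polynomial.eval_monomial,
      smul_smul]

theorem qnum_injective (hQ : Q ≠ 0) (h1 : Q - Q⁻¹ ≠ 0) (hinj : ∀ k : ℤ, Q ^ k = 1 → k = 0)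
    (h3 : ∀ k : ℤ, Q ^ k ≠ -1) : Function.Injective (qnum Q) := by
  intro j k h
  rw [qnum, qnum, div_left_inj' h1, zpow_neg, zpow_neg] at h
  have hj : Q ^ j ≠ 0 := zpow_ne_zero _ hQ
  have hk : Q ^ k ≠ 0 := zpow_ne_zero _ hQ
  -- Equality of the two `q`-numbers, multiplied by `Q^(j + k)`, factorises.
  have : (Q ^ j - Q ^ k) * (Q ^ (j + k) + 1) = 0 := by
    rw [zpow_add₀ hQ]
    field_simp at h
    linear_combination h
  rcases mul_eq_zero.1 this with h | h
  · have := hinj (j - k) (by rw [zpow_sub₀ hQ, div_eq_one_iff_eq hk]; exact sub_eq_zero.1 h)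
    omega
  · exact absurd (eq_neg_of_add_eq_zero_left h) (h3 _)

/-- On `N` sites the eigenvalues of `B` are among the distinct numbers `[k]` with `|k| ≤ N`.
Lagrange interpolation at these nodes reproduces the eigenvalues of `G`. -/
theorem Gop_eq_aeval (hQ : Q ≠ 0) (h1 : Q - Q⁻¹ ≠ 0) (h2 : ∀ k : ℤ, Q ^ k + Q ^ (-k) ≠ 0)
    (hinj : Function.Injective (qnum Q)) (N : ℕ) {δ : ℤˣ} {u v : ℂ} (h : Regular Q δ u v) :
    ∃ p : Polynomial ℂ, Gop Q N δ u v = Polynomial.aeval (Bop Q N) p := by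
  refine ⟨Lagrange.interpolate (Finset.Icc (-(N : ℤ)) N) (qnum Q)
    (fun k => if (-1 : ℤˣ) ^ k = δ then geig Q k u v else 0), eq_of_specVec hQ h1 h2 fun k x hx => ?_⟩
  have hb := hx.bound
  rw [hx.mulG δ u v h, aeval_mulVec hx.mulB, Lagrange.eval_interpolate_at_node _ hinj.injOn
    (Finset.mem_Icc.2 ⟨by omega, by omega⟩)]

theorem commute_Gop (hQ : Q ≠ 0) (h1 : Q - Q⁻¹ ≠ 0) (h2 : ∀ k : ℤ, Q ^ k + Q ^ (-k) ≠ 0)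
    (hinj : Function.Injective (qnum Q)) {N : ℕ} {δ : ℤˣ} {u v : ℂ} (h : Regular Q δ u v)
    {A : Matrix (PSt N) (PSt N) ℂ} (hA : Commute A (Bop Q N)) : Commute A (Gop Q N δ u v) := by
  obtain ⟨p, hp⟩ := Gop_eq_aeval hQ h1 h2 hinj N h
  rw [hp]
  exact Algebra.commute_of_mem_adjoin_singleton_of_commute (Polynomial.aeval_mem_adjoin_singleton ℂ _) hA

theorem Gop_self (hQ : Q ≠ 0) (h1 : Q - Q⁻¹ ≠ 0) (h2 : ∀ k : ℤ, Q ^ k + Q ^ (-k) ≠ 0) (N : ℕ) {u : ℂ}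
    (h : Regular Q 1 u u) : Gop Q N 1 u u = secProj N 1 := by
  refine eq_of_specVec hQ h1 h2 fun k x hx => ?_
  rw [hx.mulG 1 u u h, hx.sector]
  split_ifs with hk
  · rw [geig_self hQ h hk]
  · rfl

theorem Gop_special (hQ : Q ≠ 0) (h1 : Q - Q⁻¹ ≠ 0) (h2 : ∀ k : ℤ, Q ^ k + Q ^ (-k) ≠ 0) (N : ℕ)
    (h : Regular Q (-1) (Q ^ 2) 1) : Gop Q N (-1) (Q ^ 2) 1 = Bop Q N * secProj N (-1) := by
  refine eq_of_specVec hQ h1 h2 fun k x hx => ?_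
  rw [hx.mulG (-1) _ _ h, ← Matrix.mulVec_mulVec, hx.sector, Matrix.mulVec_smul, hx.mulB, smul_smul]
  split_ifs with hk
  · rw [geig_special hQ h1 h hk, one_mul]
  · rw [zero_mul]

end

/-! ### `B` as a quadratic expression in the residue of the `L`-operator -/

theorem pure_kronecker_pure {N : ℕ} (f g : Fin (N + 1) → Matrix ℤˣ ℤˣ ℂ) :
    pure f ⊗ₖ pure g = tens (pure (fun k : Fin N => f k.castSucc) ⊗ₖ pure fun k : Fin N => g k.castSucc)
      (f (Fin.last N) ⊗ₖ g (Fin.last N)) := by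
  ext r c
  simp only [Matrix.kroneckerMap_apply, tens, Matrix.submatrix_apply, splitLast, Equiv.coe_fn_mk, pure,
    Fin.prod_univ_castSucc, Fin.init]
  ring

theorem str_castSucc {N : ℕ} {α : Type} (x y z : α) (t : ℕ) :
    (fun k : Fin N => (str x y z t : Fin (N + 1) → α) k.castSucc) = str x y z t := rfl

theorem str_full {N : ℕ} {α : Type} (x y z : α) : (str x y z N : Fin N → α) = fun _ => x := by
  funext k; exact if_pos k.2

theorem sum_units {M : Type} [AddCommMonoid M] (f : ℤˣ → M) : ∑ ε : ℤˣ, f ε = f 1 + f (-1) := by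
  rw [show (Finset.univ : Finset ℤˣ) = {1, -1} from rfl, Finset.sum_pair (by decide)]

theorem exch_eq : exch = -∑ ε : ℤˣ, (zM * sg ε) ⊗ₖ (zM * sg (-ε)) := by
  ext ⟨a, b⟩ ⟨c, d⟩
  simp only [zM_mul_sg, sum_units, Matrix.neg_apply, Matrix.add_apply, Matrix.kroneckerMap_apply,
    Matrix.smul_apply]
  simp only [sg, Matrix.single_apply, exch]
  rcases Int.units_eq_one_or a with rfl | rfl <;> rcases Int.units_eq_one_or b with rfl | rfl <;>
    rcases Int.units_eq_one_or c with rfl | rfl <;> rcases Int.units_eq_one_or d with rfl | rfl <;> simp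

theorem kdiag_eq {Q : ℂ} (hQ : Q ≠ 0) : kdiag Q = (zM * wI Q) ⊗ₖ (zM * wM Q) := by
  rw [zM, wI, wM_eq, Matrix.diagonal_mul_diagonal, Matrix.diagonal_mul_diagonal,
    Matrix.diagonal_kronecker_diagonal, kdiag, eqProj, mixDiag, Matrix.diagonal_add]
  congr 1
  funext ⟨a, b⟩
  rcases Int.units_eq_one_or a with rfl | rfl <;> rcases Int.units_eq_one_or b with rfl | rfl <;>
    simp [wv, hQ]

theorem tens_sum {N : ℕ} {ι : Type} (s : Finset ι) (f : ι → Matrix (PSt N) (PSt N) ℂ)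
    (m : Matrix (ℤˣ × ℤˣ) (ℤˣ × ℤˣ) ℂ) : tens (∑ i ∈ s, f i) m = ∑ i ∈ s, tens (f i) m := by
  classical
  induction s using Finset.induction_on with
  | empty => simp [tens_zero]
  | insert a s h ih => rw [Finset.sum_insert h, Finset.sum_insert h, tens_add, ih]

theorem tens_sum_right {N : ℕ} {ι : Type} (s : Finset ι) (A : Matrix (PSt N) (PSt N) ℂ)
    (m : ι → Matrix (ℤˣ × ℤˣ) (ℤˣ × ℤˣ) ℂ) : tens A (∑ i ∈ s, m i) = ∑ i ∈ s, tens A (m i) := by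
  classical
  induction s using Finset.induction_on with
  | empty => simp [tens_zero_right]
  | insert a s h ih => rw [Finset.sum_insert h, Finset.sum_insert h, tens_add_right, ih]

theorem tens_neg {N : ℕ} (A : Matrix (PSt N) (PSt N) ℂ) (m : Matrix (ℤˣ × ℤˣ) (ℤˣ × ℤˣ) ℂ) :
    tens (-A) m = -tens A m := by
  rw [← neg_one_smul ℂ A, tens_smul, neg_one_smul]

theorem tens_neg_right {N : ℕ} (A : Matrix (PSt N) (PSt N) ℂ) (m : Matrix (ℤˣ × ℤˣ) (ℤˣ × ℤˣ) ℂ) :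
    tens A (-m) = -tens A m := by
  rw [← neg_one_smul ℂ m, tens_smul_right, neg_one_smul]

theorem Bop_eq_sum {Q : ℂ} (hQ : Q ≠ 0) (N : ℕ) : Bop Q N = -∑ t ∈ Finset.range N, ∑ ε : ℤˣ,
    pure (str 1 (zM * sg ε) (zM * wI Q) t) ⊗ₖ pure (str 1 (zM * sg (-ε)) (zM * wM Q) t) := by
  induction N with
  | zero => simp [Bop]
  | succ N ih =>
    rw [Bop, ih, Finset.sum_range_succ, neg_add, kdiag_eq hQ, exch_eq, tens_neg, tens_neg_right, tens_sum,
      tens_sum_right]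
    congr 2
    · refine Finset.sum_congr rfl fun t ht => ?_
      have ht := Finset.mem_range.1 ht
      rw [tens_sum]
      refine Finset.sum_congr rfl fun ε _ => ?_
      rw [pure_kronecker_pure, str_castSucc, str_castSucc, str_of_gt _ _ _ (by simpa using ht),
        str_of_gt _ _ _ (by simpa using ht)]
    · refine Finset.sum_congr rfl fun ε _ => ?_
      rw [pure_kronecker_pure, str_castSucc, str_castSucc, str_full, str_full,
        str_of_eq _ _ _ (by simp), str_of_eq _ _ _ (by simp), pure_one, Matrix.one_kronecker_one]

theorem sum_vecIdx {M : Type} [AddCommMonoid M] (n : ℕ) (f : ℤ → M) :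
    ∑ k ∈ vecIdx n, f k = ∑ t ∈ Finset.range (n + 1), ∑ ε : ℤˣ, f (ix t ε) := by
  rw [← Finset.sum_product', eq_comm]
  refine Finset.sum_bij (fun p _ => ix p.1 p.2) (fun p hp => ?_) (fun p _ p' _ h => ?_) (fun k hk => ?_)
    (fun _ _ => rfl)
  · exact ix_mem (Finset.mem_range.1 (Finset.mem_product.1 hp).1) _
  · exact Prod.ext (ix_inj.1 h).1 (ix_inj.1 h).2
  · obtain ⟨t, ht, ε, rfl⟩ := exists_eq_ix hk
    exact ⟨(t, ε), Finset.mem_product.2 ⟨Finset.mem_range.2 ht, Finset.mem_univ _⟩, rfl⟩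

/-- The parity operator. -/
def parOp (n : ℕ) : Op n := pure fun _ => zM

theorem parOp_mul_str (n : ℕ) (y z : Matrix ℤˣ ℤˣ ℂ) (t : ℕ) :
    parOp n * pure (str zM y z t) = pure (str 1 (zM * y) (zM * z) t) := by
  rw [parOp, pure_mul]
  congr 1
  funext k
  simp only [str]
  split_ifs
  · exact zM_mul_zM
  · rfl
  · rfl

/-- Multiplication by the parity operator in both factors removes the sign strings to the left and
puts them to the right, where they become part of `kdiag`. -/
theorem Bop_eq {q : ℝ} (hq : q ≠ 0) (n : ℕ) : Bop q (n + 1) =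
    -(q : ℂ) • ((parOp n ⊗ₖ parOp n) * ∑ k ∈ vecIdx n, phi q n k ⊗ₖ chi q n k) := by
  have hQ : (q : ℂ) ≠ 0 := by exact_mod_cast hq
  rw [Bop_eq_sum hQ, sum_vecIdx, Finset.mul_sum, Finset.smul_sum, ← Finset.sum_neg_distrib]
  refine Finset.sum_congr rfl fun t ht => ?_
  rw [Finset.mul_sum, Finset.smul_sum, ← Finset.sum_neg_distrib]
  refine Finset.sum_congr rfl fun ε _ => ?_
  rw [phi, chi, site_ix, sgn_ix, Matrix.smul_kronecker, Matrix.kronecker_smul, smul_smul, cphi_mul_cchi hq,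
    Matrix.mul_smul, ← Matrix.mul_kronecker_mul, parOp_mul_str, parOp_mul_str, smul_smul, neg_mul,
    mul_inv_cancel₀ hQ, neg_one_smul]

theorem parOp_commute_genE {n t : ℕ} (ht : t + 1 < n + 1) (ε δ : ℤˣ) :
    parOp n * genE n t ε δ = genE n t ε δ * parOp n := by
  have h : ∀ τ : ℤˣ, zM * sg τ = (-1 : ℂ) • (sg τ * zM) := fun τ => by
    rw [zM_mul_sg, sg_mul_zM, smul_smul, neg_one_mul]
  refine pure_commute (str2 1 (-1) (-1) 1 t) (fun k => ?_) (by rw [prod_str2 ht]; norm_num)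
  simp only [str2]
  split_ifs <;> simp [h]

theorem parOp_commute_genK (q : ℝ) (n t : ℕ) (ε δ : ℤˣ) :
    parOp n * genK q n t ε δ = genK q n t ε δ * parOp n := by
  obtain ⟨d, hd⟩ := genK_eq_diagonal q n t ε δ
  have : parOp n = Matrix.diagonal fun m => ∏ k, (fun τ : ℤˣ => if τ = 1 then (-1 : ℂ) else 1) (m k) :=
    pure_diagonal (N := n + 1) fun _ τ => if τ = 1 then (-1 : ℂ) else 1
  rw [hd, this, Matrix.diagonal_mul_diagonal, Matrix.diagonal_mul_diagonal]
  simp only [mul_comm]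

/-- Invariance of the pairing of a dual vector with a vector: the sums over arrows from the two
covariance relations have opposite signs and cancel after exchanging the summation indices. -/
theorem sum_phi_chi_commute {q : ℝ} (hq : q ≠ 0) {n t : ℕ} (ht : t + 1 < n + 1) {ε δ : ℤˣ}
    (h : ε = δ ∨ t = 0) : Commute (∑ k ∈ vecIdx n, phi q n k ⊗ₖ chi q n k) (genDop q n t ε δ) := by
  set e := arrow q t ε δ
  set E := genE n t ε δ
  set K := genK q n t ε δ
  have h1 : ∀ k ∈ vecIdx n, (phi q n k * K) ⊗ₖ (chi q n k * E) =
      (K * phi q n k) ⊗ₖ (E * chi q n k) - ∑ k' ∈ vecIdx n, e k' k • ((K * phi q n k) ⊗ₖ chi q n k') :=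
    fun k hk => by
      rw [phi_mul_genK hq ht ε δ hk, Matrix.smul_kronecker, ← Matrix.kronecker_smul,
        eq_sub_of_add_eq' (chi_covariant hq ht h hk)]
      ext r c
      simp only [Matrix.kroneckerMap_apply, Matrix.sub_apply, Matrix.sum_apply, Matrix.smul_apply,
        smul_eq_mul, mul_sub, Finset.mul_sum]
      congr 1
      exact Finset.sum_congr rfl fun _ _ => by ring
  have h2 : ∀ k ∈ vecIdx n, (phi q n k * E) ⊗ₖ chi q n k =
      ∑ k' ∈ vecIdx n, e k k' • ((K * phi q n k') ⊗ₖ chi q n k) + (E * phi q n k) ⊗ₖ chi q n k :=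
    fun k hk => by
      rw [← phi_covariant hq ht h hk]
      ext r c
      simp only [Matrix.kroneckerMap_apply, Matrix.add_apply, Matrix.sum_apply, Matrix.smul_apply,
        smul_eq_mul, add_mul, Finset.sum_mul]
      congr 1
      exact Finset.sum_congr rfl fun _ _ => by ring
  rw [Commute, SemiconjBy, genDop, mul_add, add_mul, Finset.sum_mul, Finset.sum_mul, Finset.mul_sum,
    Finset.mul_sum]
  simp only [← Matrix.mul_kronecker_mul, one_mul, mul_one]
  rw [Finset.sum_congr rfl h1, Finset.sum_congr rfl h2, Finset.sum_sub_distrib, Finset.sum_add_distrib,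
    Finset.sum_comm]
  abel

theorem Bop_commute {q : ℝ} (hq : q ≠ 0) {n t : ℕ} (ht : t + 1 < n + 1) {ε δ : ℤˣ}
    (h : ε = δ ∨ t = 0) : Commute (genDop q n t ε δ) (Bop q (n + 1)) := by
  rw [Bop_eq hq]
  refine Commute.smul_right (Commute.mul_right ?_ (sum_phi_chi_commute hq ht h).symm) _
  rw [Commute, SemiconjBy, genDop, mul_add, add_mul]
  simp only [← Matrix.mul_kronecker_mul, one_mul, mul_one, parOp_commute_genE ht, parOp_commute_genK]

/-- The weights of `phi` and `chi` at the same index are inverse to each other. -/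
theorem genK_weight_sum {q : ℝ} (hq : q ≠ 0) {n t : ℕ} (ht : t + 1 < n + 1) (ε δ : ℤˣ) :
    Commute (genKK q n t ε δ) (Bop q (n + 1)) := by
  rw [Bop_eq hq]
  refine Commute.smul_right (Commute.mul_right ?_ ?_) _
  · rw [Commute, SemiconjBy, genKK]
    simp only [← Matrix.mul_kronecker_mul, parOp_commute_genK]
  · rw [Commute, SemiconjBy, genKK, Finset.sum_mul, Finset.mul_sum]
    refine Finset.sum_congr rfl fun k hk => ?_
    rw [← Matrix.mul_kronecker_mul, ← Matrix.mul_kronecker_mul, genK_mul_chi hq ht ε δ hk,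
      phi_mul_genK hq ht ε δ hk, Matrix.smul_kronecker, Matrix.kronecker_smul]

/-! ### Parity of operators -/

/-- `A` changes the parity by `σ`. -/
def ChangesParity {N : ℕ} (σ : ℤˣ) (A : Matrix (Fin N → ℤˣ) (Fin N → ℤˣ) ℂ) : Prop :=
  ∀ r c, A r c ≠ 0 → parN r = σ * parN c

/-- `A` changes both parities by `σ`. -/
def ChangesParities {N : ℕ} (σ : ℤˣ) (A : Matrix (PSt N) (PSt N) ℂ) : Prop :=
  ∀ r c, A r c ≠ 0 → parN r.1 = σ * parN c.1 ∧ parN r.2 = σ * parN c.2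

theorem exists_of_mul_apply_ne_zero {I : Type} [Fintype I] {A B : Matrix I I ℂ} {r c : I}
    (h : (A * B) r c ≠ 0) : ∃ k, A r k ≠ 0 ∧ B k c ≠ 0 := by
  obtain ⟨k, -, hk⟩ := Finset.exists_ne_zero_of_sum_ne_zero h
  exact ⟨k, left_ne_zero_of_mul hk, right_ne_zero_of_mul hk⟩

theorem add_apply_ne_zero {I : Type} {A B : Matrix I I ℂ} {r c : I} (h : (A + B) r c ≠ 0) :
    A r c ≠ 0 ∨ B r c ≠ 0 := by
  by_contra! h'
  exact h (by rw [Matrix.add_apply, h'.1, h'.2, add_zero])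

section
variable {N : ℕ} {σ σ' : ℤˣ}

theorem ChangesParity.smul {A : Matrix (Fin N → ℤˣ) (Fin N → ℤˣ) ℂ} (h : ChangesParity σ A) (c : ℂ) :
    ChangesParity σ (c • A) := fun _ _ h' => h _ _ (right_ne_zero_of_mul h')

theorem ChangesParity.add {A B : Matrix (Fin N → ℤˣ) (Fin N → ℤˣ) ℂ} (h : ChangesParity σ A)
    (h' : ChangesParity σ B) : ChangesParity σ (A + B) := fun _ _ hn =>
  (add_apply_ne_zero hn).elim (h _ _) (h' _ _)

theorem ChangesParity.mul {A B : Matrix (Fin N → ℤˣ) (Fin N → ℤˣ) ℂ} (h : ChangesParity σ A)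
    (h' : ChangesParity σ' B) : ChangesParity (σ * σ') (A * B) := fun r c hn => by
  obtain ⟨k, h1, h2⟩ := exists_of_mul_apply_ne_zero hn
  rw [h _ _ h1, h' _ _ h2, mul_assoc]

theorem ChangesParity.diagonal (d : (Fin N → ℤˣ) → ℂ) : ChangesParity 1 (Matrix.diagonal d) := by
  intro r c h
  obtain rfl : r = c := by
    by_contra h'
    exact h (Matrix.diagonal_apply_ne _ h')
  rw [one_mul]

theorem ChangesParity.zero : ChangesParity σ (0 : Matrix (Fin N → ℤˣ) (Fin N → ℤˣ) ℂ) :=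
  fun _ _ h => absurd rfl h

theorem ChangesParities.smul {A : Matrix (PSt N) (PSt N) ℂ} (h : ChangesParities σ A) (c : ℂ) :
    ChangesParities σ (c • A) := fun _ _ h' => h _ _ (right_ne_zero_of_mul h')

theorem ChangesParities.add {A B : Matrix (PSt N) (PSt N) ℂ} (h : ChangesParities σ A)
    (h' : ChangesParities σ B) : ChangesParities σ (A + B) := fun _ _ hn =>
  (add_apply_ne_zero hn).elim (h _ _) (h' _ _)

theorem ChangesParities.mul {A B : Matrix (PSt N) (PSt N) ℂ} (h : ChangesParities σ A)
    (h' : ChangesParities σ' B) : ChangesParities (σ * σ') (A * B) := fun r c hn => by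
  obtain ⟨k, h1, h2⟩ := exists_of_mul_apply_ne_zero hn
  rw [(h _ _ h1).1, (h _ _ h1).2, (h' _ _ h2).1, (h' _ _ h2).2, mul_assoc, mul_assoc]
  exact ⟨rfl, rfl⟩

theorem ChangesParities.kronecker {A B : Matrix (Fin N → ℤˣ) (Fin N → ℤˣ) ℂ} (h : ChangesParity σ A)
    (h' : ChangesParity σ B) : ChangesParities σ (A ⊗ₖ B) := fun _ _ hn =>
  ⟨h _ _ (left_ne_zero_of_mul hn), h' _ _ (right_ne_zero_of_mul hn)⟩

theorem ChangesParities.sum {ι : Type} {s : Finset ι} {f : ι → Matrix (PSt N) (PSt N) ℂ}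
    (h : ∀ i ∈ s, ChangesParities σ (f i)) : ChangesParities σ (∑ i ∈ s, f i) := fun r c hn => by
  rw [Matrix.sum_apply] at hn
  obtain ⟨i, hi, hn⟩ := Finset.exists_ne_zero_of_sum_ne_zero hn
  exact h i hi r c hn

theorem ChangesParities.tens {A : Matrix (PSt N) (PSt N) ℂ} (h : ChangesParities σ A)
    {m : Matrix (ℤˣ × ℤˣ) (ℤˣ × ℤˣ) ℂ} (h' : ∀ r c, m r c ≠ 0 → r.1 = σ' * c.1 ∧ r.2 = σ' * c.2) :
    ChangesParities (σ * σ') (tens A m) := fun r c hn => by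
  obtain ⟨h1, h2⟩ := h _ _ (left_ne_zero_of_mul hn)
  obtain ⟨h3, h4⟩ := h' _ _ (right_ne_zero_of_mul hn)
  simp only [splitLast, Equiv.coe_fn_mk] at h1 h2 h3 h4
  rw [parN_init, parN_init c.1, parN_init r.2, parN_init c.2, h1, h2, h3, h4]
  simp only [mul_neg, neg_inj]
  constructor <;> exact mul_mul_mul_comm _ _ _ _

end

theorem exch_support {r c : ℤˣ × ℤˣ} (h : exch r c ≠ 0) :
    (r.1 = -1 * c.1 ∧ r.2 = -1 * c.2) ∧ c.1 * c.2 = -1 := by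
  rw [exch, ite_ne_right_iff] at h
  obtain ⟨⟨h1, rfl⟩, -⟩ := h
  simp [h1]

theorem eqProj_support {r c : ℤˣ × ℤˣ} (h : eqProj r c ≠ 0) :
    (r.1 = 1 * c.1 ∧ r.2 = 1 * c.2) ∧ c.1 * c.2 = 1 := by
  rw [eqProj, Matrix.diagonal_apply, ite_ne_right_iff, ite_ne_right_iff] at h
  obtain ⟨rfl, h, -⟩ := h
  simp [h]

theorem mixDiag_support {x y : ℂ} {r c : ℤˣ × ℤˣ} (h : mixDiag x y r c ≠ 0) :
    (r.1 = 1 * c.1 ∧ r.2 = 1 * c.2) ∧ c.1 * c.2 = -1 := by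
  rw [mixDiag, Matrix.diagonal_apply, ite_ne_right_iff, ite_ne_left_iff] at h
  obtain ⟨rfl, h, -⟩ := h
  refine ⟨⟨(one_mul _).symm, (one_mul _).symm⟩, ?_⟩
  rw [Int.units_ne_iff_eq_neg.1 h, neg_mul, Int.units_mul_self]

theorem Bop_changesParities (Q : ℂ) (N : ℕ) : ChangesParities (-1) (Bop Q N) := by
  induction N with
  | zero => exact fun _ _ h => absurd rfl h
  | succ N ih =>
    rw [Bop, kdiag, tens_add_right]
    refine ChangesParities.add (ChangesParities.add ?_ ?_) ?_
    · exact ih.tens (σ' := 1) fun r c h => (eqProj_support h).1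
    · exact ih.tens (σ' := 1) fun r c h => (mixDiag_support h).1
    · refine ChangesParities.tens (σ := 1) (σ' := -1) (fun r c h => ?_) fun r c h => (exch_support h).1
      obtain rfl : r = c := by
        by_contra h'
        exact h (Matrix.one_apply_ne h')
      simp

theorem Gop_changesParities (Q : ℂ) (N : ℕ) : ∀ (δ : ℤˣ) (u v : ℂ),
    ChangesParities δ (Gop Q N δ u v) := by
  induction N with
  | zero =>
    intro δ u v r c h
    rw [Gop] at h
    split_ifs at h with hδ
    · simp [parN, hδ]
    · exact absurd rfl h
  | succ N ih =>
    intro δ u v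
    rw [Gop]
    refine ChangesParities.add ?_ (ChangesParities.smul (ChangesParities.add
      (ChangesParities.smul ?_ _) (ChangesParities.smul ?_ _)) _)
    · simpa using (ih δ u v).tens (σ' := 1) fun r c h => (eqProj_support h).1
    · simpa using (ih (-δ) u (Q ^ 2 * v)).tens (σ' := -1) fun r c h => (exch_support h).1
    · simpa using ((Bop_changesParities Q N).mul (ih (-δ) u (Q ^ 2 * v))).tens (σ' := 1)
        fun r c h => (mixDiag_support h).1

theorem pure_changesParity {N : ℕ} (f : Fin N → Matrix ℤˣ ℤˣ ℂ) (τ : Fin N → ℤˣ)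
    (h : ∀ k r c, f k r c ≠ 0 → r = τ k * c) : ChangesParity (∏ k, τ k) (pure f) := by
  intro r c hn
  have : ∀ k, r k = τ k * c k := fun k => h k _ _ (Finset.prod_ne_zero_iff.1 hn k (Finset.mem_univ k))
  rw [parN, parN, ← Finset.prod_mul_distrib]
  exact Finset.prod_congr rfl fun k _ => by rw [this, mul_neg]

theorem string_changesParity {N t : ℕ} (ht : t < N) (d d' : ℤˣ → ℂ) (τ : ℤˣ) :
    ChangesParity (N := N) (-1) (pure (str (Matrix.diagonal d) (sg τ) (Matrix.diagonal d') t)) := by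
  have hd : ∀ (d : ℤˣ → ℂ) (r c : ℤˣ), Matrix.diagonal d r c ≠ 0 → r = 1 * c := fun d r c h => by
    by_contra h'
    exact h (Matrix.diagonal_apply_ne _ (by rwa [one_mul] at h'))
  have hs : ∀ r c : ℤˣ, sg τ r c ≠ 0 → r = -1 * c := fun r c h => by
    rw [sg, Matrix.single_apply, ite_ne_right_iff] at h
    rw [← h.1.1, ← h.1.2]; simp
  have := pure_changesParity (N := N) (str (Matrix.diagonal d) (sg τ) (Matrix.diagonal d') t)
    (str 1 (-1) 1 t) fun k r c h => by
      simp only [str] at h ⊢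
      split_ifs at h ⊢
      · exact hd _ _ _ h
      · exact hs _ _ h
      · exact hd _ _ _ h
  convert this
  rw [Finset.prod_eq_single (⟨t, ht⟩ : Fin N)]
  · exact (str_self _ _ _ _).symm
  · intro k _ hk
    have : (k : ℕ) ≠ t := fun h => hk (Fin.ext h)
    simp [str, this]
  · simp

theorem LP_changesParity {q : ℝ} (hq : q ≠ 0) {n : ℕ} (ρ w : ℂ) {a b : ℤ} (ha : a ∈ vecIdx n)
    (hb : b ∈ vecIdx n) : ChangesParity 1 (LP q n ρ w a b) := by
  have h1 : ChangesParity 1 (Lam q n a b) :=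
    ((((string_changesParity (site_lt ha) _ _ _).smul _).mul
      ((string_changesParity (site_lt hb) _ _ _).smul _)).smul _)
  rw [LP_eq hq ρ w ha hb]
  refine ((ChangesParity.smul ?_ _).add (h1.smul _)).smul _
  rcases lt_trichotomy a b with hab | rfl | hab
  · rw [smul_ellM_of_lt hab]; exact ChangesParity.zero
  · rw [smul_ellM_self hq]; exact ChangesParity.diagonal _
  · rw [smul_ellM_of_gt hq ha hb hab]; exact h1

theorem coprod_changesParities {q : ℝ} (hq : q ≠ 0) {n : ℕ} (ρ ρ' w : ℂ) {a b : ℤ}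
    (ha : a ∈ vecIdx n) (hb : b ∈ vecIdx n) :
    ChangesParities 1 (coprod n (LP q n ρ w) (LP q n ρ' w) a b) :=
  ChangesParities.sum fun _ hk => ChangesParities.kronecker (LP_changesParity hq _ _ ha hk)
    (LP_changesParity hq _ _ hk hb)

/-! ### The lowest entry of the coproduct -/

/-- Numerator of the lowest diagonal entry of the `L`-operator. -/
def dlow (Q ρ w : ℂ) (τ : ℤˣ) : ℂ := if τ = 1 then w - ρ else w * Q - ρ * Q⁻¹

/-- Numerator of the lowest diagonal entry of the coproduct. -/
def lowEntry (Q : ℂ) (n : ℕ) (ρ ρ' w : ℂ) : Op₂ n :=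
  tens 1 (Matrix.diagonal (dlow Q ρ w) ⊗ₖ Matrix.diagonal (dlow Q ρ' w)) +
    (w * ρ' * (Q - Q⁻¹) ^ 2) • tens (Bop Q n) (sg 1 ⊗ₖ sg (-1))

theorem Lam_self {q : ℝ} (hq : q ≠ 0) {n : ℕ} {a : ℤ} (ha : a ∈ vecIdx n) :
    Lam q n a a = omInv q n a - om q n a := by
  rw [eq_sub_iff_add_eq, ← smul_ellM_self' hq ha, smul_ellM_self hq]

theorem LP_low {q : ℝ} (hq : q ≠ 0) (n : ℕ) (ρ w : ℂ) : LP q n ρ w (ix n (-1)) (ix n (-1)) =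
    (w - ρ)⁻¹ • pure (str 1 (Matrix.diagonal (dlow q ρ w)) 1 n) := by
  have hQ : (q : ℂ) ≠ 0 := by exact_mod_cast hq
  have hm : ix n (-1) ∈ vecIdx n := ix_mem (Nat.lt_succ_self n) _
  rw [LP_eq hq ρ w hm hm, smul_ellM_self hq, Lam_self hq hm, om_ix q (Nat.lt_succ_self n),
    omInv_ix q (Nat.lt_succ_self n), ← pure_str_smul _ _ _ _ (Nat.lt_succ_self n),
    pure_str_sub (Nat.lt_succ_self n), ← pure_str_smul _ _ _ _ (Nat.lt_succ_self n),
    ← pure_str_add _ _ _ _ (Nat.lt_succ_self n)]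
  congr 4
  rw [Matrix.diagonal_sub, ← Matrix.diagonal_smul, ← Matrix.diagonal_smul, Matrix.diagonal_add]
  congr 1
  funext τ
  rcases Int.units_eq_one_or τ with rfl | rfl <;> simp [ov, dlow, hQ]; ring

theorem LP_low_left {q : ℝ} (hq : q ≠ 0) {n t : ℕ} (ht : t < n) (ε : ℤˣ) (ρ w : ℂ) :
    LP q n ρ w (ix n (-1)) (ix t ε) = ((w - ρ)⁻¹ * ρ) • Lam q n (ix n (-1)) (ix t ε) := by
  rw [LP_eq hq ρ w (ix_mem (Nat.lt_succ_self n) _) (ix_mem (by omega) _), smul_ellM_of_lt, smul_zero,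
    zero_add, smul_smul]
  rw [ix_neg_one]
  rcases ix_cases t ε with h | h <;> omega

theorem LP_low_right {q : ℝ} (hq : q ≠ 0) {n t : ℕ} (ht : t < n) (ε : ℤˣ) (ρ w : ℂ) :
    LP q n ρ w (ix t ε) (ix n (-1)) = ((w - ρ)⁻¹ * w) • Lam q n (ix t ε) (ix n (-1)) := by
  have h1 : ix t ε ∈ vecIdx n := ix_mem (by omega) _
  have h2 : ix n (-1) ∈ vecIdx n := ix_mem (Nat.lt_succ_self n) _
  rw [LP_eq hq ρ w h1 h2, smul_ellM_of_gt hq h1 h2, ← add_smul, smul_smul, sub_add_cancel]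
  rw [ix_neg_one]
  rcases ix_cases t ε with h | h <;> omega

theorem LP_low_zero {q : ℝ} (hq : q ≠ 0) (n : ℕ) (ρ w : ℂ) :
    LP q n ρ w (ix n (-1)) (ix n 1) = 0 := by
  have h2 : ix n (-1) ∈ vecIdx n := ix_mem (Nat.lt_succ_self n) _
  have e : ix n 1 = -ix n (-1) := by rw [← ix_neg, neg_neg]
  rw [LP_eq hq ρ w h2 (ix_mem (Nat.lt_succ_self n) _), e, Lam_neg h2,
    smul_ellM_neg (mem_vecIdx.1 h2).1]
  simp

theorem pure_low {n t : ℕ} (ht : t < n) {f : Fin (n + 1) → Matrix ℤˣ ℤˣ ℂ} {y z a : Matrix ℤˣ ℤˣ ℂ}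
    {c d : ℂ} (hf : ∀ k : Fin (n + 1), (k : ℕ) < n → f k = str 1 (c • y) z t k)
    (hl : f (Fin.last n) = d • a) : pure f =
      (c * d) • pure (fun k : Fin (n + 1) => if (k : ℕ) < n then str 1 y z t k else a) := by
  rw [mul_smul, ← pure_smul (Fin.last n) d (f := fun k : Fin (n + 1) => if (k : ℕ) < n then
    str 1 y z t k else d • a) (fun l hl => ?_) (by simp)]
  · refine pure_smul ⟨t, by omega⟩ c (fun l hl' => ?_) ?_
    · have h1 : (l : ℕ) ≠ t := fun h => hl' (Fin.ext h)
      have h2 := l.2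
      by_cases h3 : (l : ℕ) < n
      · rw [hf l h3, if_pos h3]
        simp [str, h1]
      · rw [if_neg h3, ← hl]
        congr 1
        exact Fin.ext (by rw [Fin.val_last]; omega)
    · rw [hf _ ht, str_self, if_pos ht, str_self]
  · have h1 : (l : ℕ) ≠ n := fun h => hl (Fin.ext h)
    have h2 := l.2
    simp only [if_pos (show (l : ℕ) < n by omega)]

/-- In each residue the two strings cancel beyond both sites and survive only between `t` and the
last one. What is left is one summand of `B` on `n` sites, times a raising and a lowering matrix on
the last site. -/
theorem Lam_low {q : ℝ} (hq : q ≠ 0) {n t : ℕ} (ht : t < n) (ε : ℤˣ) :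
    Lam q n (ix t ε) (ix n (-1)) ⊗ₖ Lam q n (ix n (-1)) (ix t ε) =
      -((q : ℂ) - (q : ℂ)⁻¹) ^ 2 • tens (pure (str 1 (zM * sg ε) (zM * wI q) t) ⊗ₖ
        pure (str 1 (zM * sg (-ε)) (zM * wM q) t)) (sg 1 ⊗ₖ sg (-1)) := by
  have hQ : (q : ℂ) ≠ 0 := by exact_mod_cast hq
  have h1 : cphi q (ix t ε) * cchi q (ix t ε) = (q : ℂ)⁻¹ := cphi_mul_cchi hq _
  have h2 : cphi q (ix n (-1)) * cchi q (ix n (-1)) = (q : ℂ)⁻¹ := cphi_mul_cchi hq _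
  have hz : ∀ τ : ℤˣ, sg τ * zM = (-1 : ℂ) • (zM * sg τ) := fun τ => by
    rw [zM_mul_sg, sg_mul_zM, smul_smul]; simp
  have e1 : phi q n (ix t ε) * chi q n (ix n (-1)) = (-(q : ℂ) * (cphi q (ix t ε) * cchi q (ix n (-1)))) •
      pure (fun k : Fin (n + 1) => if (k : ℕ) < n then
        str 1 (zM * sg ε) (zM * wI q) t k else sg 1) := by
    rw [phi, chi, Matrix.smul_mul, Matrix.mul_smul, smul_smul, site_ix, site_ix, sgn_ix, sgn_ix,
      neg_neg, pure_mul, pure_low ht (c := -1) (d := q) (y := zM * sg ε) (z := zM * wI q) (a := sg 1)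
        (fun k hk => ?_) ?_, smul_smul]
    · congr 1; ring
    · rw [str_of_gt _ _ _ (by simpa using ht), str_of_eq _ _ _ (Fin.val_last n), wI_mul_sg, wv_one, inv_inv]
    · rw [str_of_lt _ _ _ hk]
      simp only [str]
      split_ifs
      · exact zM_mul_zM
      · exact hz ε
      · rw [wI, zM, Matrix.diagonal_mul_diagonal, Matrix.diagonal_mul_diagonal]
        simp only [mul_comm]
  have e2 : phi q n (ix n (-1)) * chi q n (ix t ε) = ((q : ℂ)⁻¹ * (cphi q (ix n (-1)) * cchi q (ix t ε))) •
      pure (fun k : Fin (n + 1) => if (k : ℕ) < n then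
        str 1 (zM * sg (-ε)) (zM * wM q) t k else sg (-1)) := by
    rw [phi, chi, Matrix.smul_mul, Matrix.mul_smul, smul_smul, site_ix, site_ix, sgn_ix, sgn_ix,
      pure_mul, pure_low ht (c := 1) (d := (q : ℂ)⁻¹) (y := zM * sg (-ε)) (z := zM * wM q) (a := sg (-1))
        (fun k hk => ?_) ?_, smul_smul]
    · congr 1; ring
    · rw [str_of_gt (t := t) _ _ _ (by simpa using ht), str_of_eq _ _ _ (Fin.val_last n), sg_mul_wM, neg_neg,
        wv_one]
    · rw [str_of_lt _ _ _ hk, one_smul]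
      simp only [str]
      split_ifs
      · exact zM_mul_zM
      · rfl
      · rfl
  rw [Lam, Lam, e1, e2, smul_smul, smul_smul, Matrix.smul_kronecker, Matrix.kronecker_smul, smul_smul,
    pure_kronecker_pure]
  simp only [Fin.val_castSucc, Fin.is_lt, if_true, Fin.val_last, lt_irrefl, if_false]
  congr 1
  field_simp at h1 h2 ⊢
  linear_combination (-(q : ℂ) * ((q : ℂ) ^ 2 - 1) ^ 2 * cphi q (ix n (-1)) * cchi q (ix n (-1))) * h1 -
    ((q : ℂ) ^ 2 - 1) ^ 2 * h2

/-- The summation index `n + 1` drops out by `LP_low_zero`, the index `-(n + 1)` gives the diagonal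
term, and the others add up to `B`. The factors `w` and `ρ'` come from the entries below and above
the diagonal respectively. -/
theorem coprodOp_low {q : ℝ} (hq : q ≠ 0) (n : ℕ) (ρ ρ' w : ℂ) :
    coprodOp n (LP q n ρ w) (LP q n ρ' w) (ix n (-1)) (ix n (-1)) =
      ((w - ρ)⁻¹ * (w - ρ')⁻¹) • lowEntry q n ρ ρ' w := by
  have hQ : (q : ℂ) ≠ 0 := by exact_mod_cast hq
  rw [coprodOp, sum_vecIdx, Finset.sum_range_succ, sum_units (fun ε => LP q n ρ w (ix n ε) _ ⊗ₖ _),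
    LP_low_zero hq, Matrix.kronecker_zero, zero_add, LP_low hq, LP_low hq, lowEntry, smul_add, add_comm]
  congr 1
  · rw [Matrix.smul_kronecker, Matrix.kronecker_smul, smul_smul, pure_kronecker_pure, str_castSucc,
      str_castSucc, str_full, str_full, str_of_eq _ _ _ (Fin.val_last n), str_of_eq _ _ _ (Fin.val_last n), pure_one, Matrix.one_kronecker_one]
  · rw [Bop_eq_sum hQ, tens_neg, tens_sum, ← Finset.sum_neg_distrib, Finset.smul_sum, Finset.smul_sum]
    refine Finset.sum_congr rfl fun t ht => ?_
    have ht := Finset.mem_range.1 ht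
    rw [tens_sum, ← Finset.sum_neg_distrib, Finset.smul_sum, Finset.smul_sum]
    refine Finset.sum_congr rfl fun ε _ => ?_
    rw [LP_low_left hq ht, LP_low_right hq ht, Matrix.smul_kronecker, Matrix.kronecker_smul, Lam_low hq ht]
    module

theorem sg_kronecker_apply (a b c d : ℤˣ) : (sg 1 ⊗ₖ sg (-1)) (a, b) (c, d) =
    if (a = 1 ∧ b = -1) ∧ (c = -1 ∧ d = 1) then 1 else 0 := by
  rw [Matrix.kroneckerMap_apply, sg, sg, Matrix.single_apply, Matrix.single_apply]
  rcases Int.units_eq_one_or a with rfl | rfl <;> rcases Int.units_eq_one_or b with rfl | rfl <;>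
    rcases Int.units_eq_one_or c with rfl | rfl <;> rcases Int.units_eq_one_or d with rfl | rfl <;> simp

theorem sg_kronecker_mul_eqProj : sg 1 ⊗ₖ sg (-1) * eqProj = 0 := by
  ext ⟨a, b⟩ ⟨c, d⟩
  rw [eqProj, Matrix.mul_diagonal, sg_kronecker_apply]
  rcases Int.units_eq_one_or c with rfl | rfl <;> rcases Int.units_eq_one_or d with rfl | rfl <;> simp

theorem eqProj_mul_sg_kronecker : eqProj * sg 1 ⊗ₖ sg (-1) = 0 := by
  ext ⟨a, b⟩ ⟨c, d⟩
  rw [eqProj, Matrix.diagonal_mul, sg_kronecker_apply]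
  rcases Int.units_eq_one_or a with rfl | rfl <;> rcases Int.units_eq_one_or b with rfl | rfl <;> simp

theorem sg_kronecker_mul_mixDiag (x y : ℂ) : sg 1 ⊗ₖ sg (-1) * mixDiag x y = x • (sg 1 ⊗ₖ sg (-1)) := by
  ext ⟨a, b⟩ ⟨c, d⟩
  rw [mixDiag, Matrix.mul_diagonal, Matrix.smul_apply, sg_kronecker_apply]
  rcases Int.units_eq_one_or c with rfl | rfl <;> rcases Int.units_eq_one_or d with rfl | rfl <;> simp

theorem mixDiag_mul_sg_kronecker (x y : ℂ) : mixDiag x y * sg 1 ⊗ₖ sg (-1) = y • (sg 1 ⊗ₖ sg (-1)) := by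
  ext ⟨a, b⟩ ⟨c, d⟩
  rw [mixDiag, Matrix.diagonal_mul, Matrix.smul_apply, sg_kronecker_apply]
  rcases Int.units_eq_one_or a with rfl | rfl <;> rcases Int.units_eq_one_or b with rfl | rfl <;> simp

theorem sg_kronecker_mul_exch : sg 1 ⊗ₖ sg (-1) * exch = mixDiag 0 1 := by
  ext ⟨a, b⟩ ⟨c, d⟩
  rw [Matrix.mul_apply, Fintype.sum_prod_type]
  simp only [sum_units, sg_kronecker_apply, exch, mixDiag, Matrix.diagonal_apply]
  rcases Int.units_eq_one_or a with rfl | rfl <;> rcases Int.units_eq_one_or b with rfl | rfl <;>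
    rcases Int.units_eq_one_or c with rfl | rfl <;> rcases Int.units_eq_one_or d with rfl | rfl <;> simp

theorem exch_mul_sg_kronecker : exch * sg 1 ⊗ₖ sg (-1) = mixDiag 1 0 := by
  ext ⟨a, b⟩ ⟨c, d⟩
  rw [Matrix.mul_apply, Fintype.sum_prod_type]
  simp only [sum_units, sg_kronecker_apply, exch, mixDiag, Matrix.diagonal_apply]
  rcases Int.units_eq_one_or a with rfl | rfl <;> rcases Int.units_eq_one_or b with rfl | rfl <;>
    rcases Int.units_eq_one_or c with rfl | rfl <;> rcases Int.units_eq_one_or d with rfl | rfl <;> simp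

/-- As `B` commutes with `G` on `n` sites, everything is sorted by operators on these sites, and
only identities between 4×4 matrices on the last site remain. -/
theorem lowEntry_mul_Gop {Q : ℂ} (hQ : Q ≠ 0) {n : ℕ} {δ : ℤˣ} {u v : ℂ}
    (hG : ∀ δ u v, Regular Q δ u v → Commute (Bop Q n) (Gop Q n δ u v)) (h : Regular Q δ u v) (w : ℂ) :
    lowEntry Q n v u w * Gop Q (n + 1) δ u v = Gop Q (n + 1) δ u v * lowEntry Q n u v w := by
  have h0 := (hG δ u v h).eq
  have h1 := (hG _ _ _ (h.shift hQ)).eq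
  rw [lowEntry, lowEntry, Gop]
  generalize Gop Q n δ u v = G₀ at *
  generalize Gop Q n (-δ) u (Q ^ 2 * v) = G₁ at *
  generalize Bop Q n = B at *
  -- This is the identity with content: the asymmetry of the diagonal entry on unequal spins is
  -- balanced by the exchange composed with the transfer of a spin.
  have hm : (Q - Q⁻¹) • (Matrix.diagonal (dlow Q v w) ⊗ₖ Matrix.diagonal (dlow Q u w) * mixDiag v u) +
      (w * u * (Q - Q⁻¹) ^ 2 * (v - u)) • (sg 1 ⊗ₖ sg (-1) * exch) =
      (Q - Q⁻¹) • (mixDiag v u * Matrix.diagonal (dlow Q u w) ⊗ₖ Matrix.diagonal (dlow Q v w)) +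
      (w * v * (Q - Q⁻¹) ^ 2 * (v - u)) • (exch * sg 1 ⊗ₖ sg (-1)) := by
    rw [Matrix.diagonal_kronecker_diagonal, Matrix.diagonal_kronecker_diagonal, mixDiag,
      Matrix.diagonal_mul_diagonal, Matrix.diagonal_mul_diagonal, sg_kronecker_mul_exch,
      exch_mul_sg_kronecker, mixDiag, mixDiag, ← Matrix.diagonal_smul, ← Matrix.diagonal_smul, ← Matrix.diagonal_smul,
      ← Matrix.diagonal_smul, Matrix.diagonal_add, Matrix.diagonal_add]
    congr 1
    funext ⟨a, b⟩
    rcases Int.units_eq_one_or a with rfl | rfl <;> rcases Int.units_eq_one_or b with rfl | rfl <;>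
      simp [dlow] <;> field_simp <;> ring
  have hP : Matrix.diagonal (dlow Q v w) ⊗ₖ Matrix.diagonal (dlow Q u w) * eqProj =
      eqProj * Matrix.diagonal (dlow Q u w) ⊗ₖ Matrix.diagonal (dlow Q v w) := by
    rw [Matrix.diagonal_kronecker_diagonal, Matrix.diagonal_kronecker_diagonal, eqProj,
      Matrix.diagonal_mul_diagonal, Matrix.diagonal_mul_diagonal]
    congr 1
    funext ⟨a, b⟩
    dsimp only
    split_ifs with hab
    · rw [hab]; ring
    · ring
  have hX : Matrix.diagonal (dlow Q v w) ⊗ₖ Matrix.diagonal (dlow Q u w) * exch =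
      exch * Matrix.diagonal (dlow Q u w) ⊗ₖ Matrix.diagonal (dlow Q v w) := by
    rw [Matrix.diagonal_kronecker_diagonal, Matrix.diagonal_kronecker_diagonal]
    ext ⟨a, b⟩ ⟨c, d⟩
    rw [Matrix.diagonal_mul, Matrix.mul_diagonal, exch]
    split_ifs with hab
    · obtain ⟨-, h⟩ := hab
      cases h
      simp [mul_comm]
    · ring
  -- `hm` governs the terms linear in `B`. Those quadratic in `B` carry the factor `u v` on both
  -- sides and agree at once.
  have hB := congrArg (tens (B * G₁)) hm
  simp only [tens_add_right, tens_smul_right] at hB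
  simp only [add_mul, mul_add, Matrix.smul_mul, Matrix.mul_smul, tens_mul, smul_add, one_mul, mul_one,
    Matrix.mul_assoc, ← h0, ← h1, hP, hX, sg_kronecker_mul_eqProj, eqProj_mul_sg_kronecker,
    sg_kronecker_mul_mixDiag, mixDiag_mul_sg_kronecker, tens_zero_right, tens_smul_right, smul_zero]
  linear_combination (norm := module) mixc Q δ u v • hB

/-! ### Existence of the R-matrix -/

section
variable {q : ℝ}

theorem cast_zpow_eq_one (hq : ∀ k : ℕ, 0 < k → q ^ k ≠ 1) {k : ℤ} (h : (q : ℂ) ^ k = 1) :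
    k = 0 := by
  have h : q ^ k = 1 := by exact_mod_cast h
  by_contra hk
  rcases lt_or_gt_of_ne hk with hk | hk
  · refine hq (-k).toNat (by omega) ?_
    rw [← zpow_natCast, Int.toNat_of_nonneg (by omega), zpow_neg, h, inv_one]
  · refine hq k.toNat (by omega) ?_
    rw [← zpow_natCast, Int.toNat_of_nonneg (by omega), h]

theorem cast_zpow_ne_neg_one (hq : ∀ k : ℕ, 0 < k → q ^ k ≠ 1) (k : ℤ) :
    (q : ℂ) ^ k ≠ -1 := by
  intro h
  have h2 : (q : ℂ) ^ (k * 2) = 1 := by rw [zpow_mul, h]; norm_num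
  have := cast_zpow_eq_one hq h2
  obtain rfl : k = 0 := by omega
  norm_num at h

theorem sub_inv_ne_zero (hq0 : q ≠ 0) (hq : ∀ k : ℕ, 0 < k → q ^ k ≠ 1) : (q : ℂ) - (q : ℂ)⁻¹ ≠ 0 := by
  have hQ : (q : ℂ) ≠ 0 := by exact_mod_cast hq0
  intro h
  have : (q : ℂ) ^ (2 : ℤ) = 1 := by
    rw [zpow_ofNat]
    field_simp at h
    linear_combination h
  exact absurd (cast_zpow_eq_one hq this) (by norm_num)

theorem zpow_add_zpow_neg_ne_zero (hq0 : q ≠ 0) (hq : ∀ k : ℕ, 0 < k → q ^ k ≠ 1) (k : ℤ) :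
    (q : ℂ) ^ k + (q : ℂ) ^ (-k) ≠ 0 := by
  have hQ : (q : ℂ) ≠ 0 := by exact_mod_cast hq0
  intro h
  refine cast_zpow_ne_neg_one hq (k + k) ?_
  have hk := zpow_ne_zero k hQ
  rw [zpow_neg] at h
  rw [zpow_add₀ hQ]
  field_simp at h
  linear_combination h

theorem qnum_inj (hq0 : q ≠ 0) (hq : ∀ k : ℕ, 0 < k → q ^ k ≠ 1) : Function.Injective (qnum (q : ℂ)) :=
  qnum_injective (by exact_mod_cast hq0) (sub_inv_ne_zero hq0 hq) (fun _ => cast_zpow_eq_one hq)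
    (cast_zpow_ne_neg_one hq)

/-- The exponent `2 m + 2` is `4 k + 2` for `m = 2 k` and `4 (k + 1)` for `m = 2 k + 1`, and the
parity of `m` is tied to `ε₁ ε₂`. -/
theorem generic_iff {ε₁ ε₂ : ℤˣ} {u v : ℂ} :
    Generic q ε₁ ε₂ u v ↔ u ≠ 0 ∧ v ≠ 0 ∧ Regular q (ε₁ * ε₂) u v := by
  rw [Generic]
  refine and_congr_right fun _ => and_congr_right fun _ => ?_
  by_cases hε : ε₁ = ε₂
  · subst hε
    rw [Int.units_mul_self, if_pos rfl]
    constructor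
    · intro h m hm
      obtain ⟨k, rfl⟩ : Even m := by
        by_contra h'
        rw [(Int.not_even_iff_odd.1 h').neg_one_zpow] at hm
        exact absurd hm (by decide)
      convert h k using 3
      ring
    · intro h k
      convert h (2 * k) (by rw [zpow_mul]; simp) using 3
      ring
  · rw [Int.units_ne_iff_eq_neg.1 hε, neg_mul, Int.units_mul_self, if_neg (by
      rcases Int.units_eq_one_or ε₂ with rfl | rfl <;> decide)]
    constructor
    · intro h m hm
      obtain ⟨k, rfl⟩ : Odd m := by
        by_contra h'
        rw [(Int.not_odd_iff_even.1 h').neg_one_zpow] at hm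
        exact absurd hm (by decide)
      convert h (k + 1) using 3
      ring
    · intro h k
      convert h (2 * k - 1) (by rw [zpow_sub, zpow_mul]; simp) using 3
      ring

/-- `G` commutes with the coproducts of the Chevalley generators and of their group-like elements,
so the defect is covariant, and it vanishes at the lowest entry. On the right `u` and `v` are
interchanged because the flip has been absorbed. -/
theorem coprodOp_mul_Gop (hq0 : q ≠ 0) (hq : ∀ k : ℕ, 0 < k → q ^ k ≠ 1) {n : ℕ} (hn : 1 ≤ n)
    {δ : ℤˣ} {u v : ℂ} (h : Regular q δ u v) (w : ℂ) : ∀ a ∈ vecIdx n, ∀ b ∈ vecIdx n,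
      coprodOp n (LP q n v w) (LP q n u w) a b * Gop q (n + 1) δ u v =
        Gop q (n + 1) δ u v * coprodOp n (LP q n u w) (LP q n v w) a b := by
  have hQ : (q : ℂ) ≠ 0 := by exact_mod_cast hq0
  have h1 := sub_inv_ne_zero hq0 hq
  have h2 := zpow_add_zpow_neg_ne_zero hq0 hq
  have hi := qnum_inj hq0 hq
  suffices H : ∀ a ∈ vecIdx n, ∀ b ∈ vecIdx n,
      coprodOp n (LP q n v w) (LP q n u w) a b * Gop q (n + 1) δ u v -
        Gop q (n + 1) δ u v * coprodOp n (LP q n u w) (LP q n v w) a b = 0 from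
    fun a ha b hb => sub_eq_zero.1 (H a ha b hb)
  refine Covariant.eq_zero hq0 hn (K := genKK q n) (E := genDop q n) (E' := genDop q n)
    (fun t ht ε δ' hε => Covariant.defect (coprodOp_covariant hq0 ht hε u v w)
      (coprodOp_covariant hq0 ht hε v u w) (commute_Gop hQ h1 h2 hi h (Bop_commute hq0 ht hε)).eq
      (commute_Gop hQ h1 h2 hi h (genK_weight_sum hq0 ht ε δ')).eq)
    (fun t _ ε δ' => genKK_mul_eq_zero hq0 n t ε δ') ?_
  rw [coprodOp_low hq0, coprodOp_low hq0, Matrix.smul_mul, Matrix.mul_smul,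
    lowEntry_mul_Gop hQ (fun δ u v h => commute_Gop hQ h1 h2 hi h (Commute.refl _)) h, mul_comm,
    sub_self]

/-- The R-matrix in terms of `G`. -/
def Rmat (Q : ℂ) (n : ℕ) (ε₁ ε₂ : ℤˣ) (u v : ℂ) : Op₂ n := fun r c =>
  if par c.1 = ε₁ ∧ par c.2 = ε₂ then Gop Q (n + 1) (ε₁ * ε₂) u v r c.swap else 0

/-- Both series are the same rational function of `w`: numerator and denominator differ by the
factor `-w ρ`. -/
theorem LM_eq_LP {n : ℕ} {ρ w : ℂ} (hρ : ρ ≠ 0) (hw : w ≠ 0) : LM q n ρ w = LP q n ρ w := by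
  funext a b
  rw [LM, LP]
  by_cases h : w = ρ
  · rw [h]; simp
  have h1 : w - ρ ≠ 0 := sub_ne_zero.2 h
  have h2 : w⁻¹ - ρ⁻¹ = -((w - ρ) * (w⁻¹ * ρ⁻¹)) := by field_simp; ring
  have h3 : (w⁻¹ - ρ⁻¹)⁻¹ * w⁻¹ = -((w - ρ)⁻¹ * ρ) := by rw [h2]; field_simp
  have h4 : (w⁻¹ - ρ⁻¹)⁻¹ * ρ⁻¹ = -((w - ρ)⁻¹ * w) := by rw [h2]; field_simp
  simp only [smul_sub, smul_smul]
  rw [mul_left_comm, h3, mul_left_comm, h4]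
  module

theorem coprod_submatrix_swap {n : ℕ} (X Y : ℤ → ℤ → Op n) (a b : ℤ) :
    (coprod n X Y a b).submatrix Prod.swap Prod.swap = coprodOp n Y X a b := by
  ext r c
  simp only [coprod, coprodOp, Matrix.submatrix_apply, Matrix.sum_apply, Matrix.kroneckerMap_apply,
    Prod.fst_swap, Prod.snd_swap, mul_comm]

/-- Undoing the flip interchanges coproduct and opposite coproduct. Restriction to a sector is
harmless because the `L`-operators preserve parity. -/
theorem Rmat_intertwines (hq0 : q ≠ 0) (hq : ∀ k : ℕ, 0 < k → q ^ k ≠ 1) {n : ℕ} (hn : 1 ≤ n)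
    {ε₁ ε₂ : ℤˣ} {u v : ℂ} (h : Regular q (ε₁ * ε₂) u v) (w : ℂ) {a b : ℤ} (ha : a ∈ vecIdx n)
    (hb : b ∈ vecIdx n) : coprodOp n (LP q n v w) (LP q n u w) a b * Rmat q n ε₁ ε₂ u v =
      Rmat q n ε₁ ε₂ u v * coprod n (LP q n v w) (LP q n u w) a b := by
  have key := coprodOp_mul_Gop hq0 hq hn h w a ha b hb
  have hpar := coprod_changesParities hq0 (n := n) v u w ha hb
  ext r c
  have h1 := congrFun (congrFun key r) c.swap
  rw [Matrix.mul_apply, Matrix.mul_apply] at h1 ⊢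
  rw [← (Equiv.prodComm (St n) (St n)).sum_comp fun k => Gop (q : ℂ) (n + 1) (ε₁ * ε₂) u v r k * _] at h1
  simp only [Equiv.prodComm_apply, ← coprod_submatrix_swap (LP q n v w), Matrix.submatrix_apply,
    Prod.swap_swap] at h1
  by_cases hc : par c.1 = ε₁ ∧ par c.2 = ε₂
  · simp only [Rmat, if_pos hc]
    rw [h1]
    refine Finset.sum_congr rfl fun k _ => ?_
    by_cases h0 : coprod n (LP q n v w) (LP q n u w) a b k c = 0
    · rw [h0, mul_zero, mul_zero]
    · have := hpar k c h0
      rw [one_mul, one_mul] at this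
      rw [if_pos ⟨this.1.trans hc.1, this.2.trans hc.2⟩]
  · simp only [Rmat, if_neg hc, mul_zero, Finset.sum_const_zero]
    refine (Finset.sum_eq_zero fun k _ => ?_).symm
    by_cases h0 : coprod n (LP q n v w) (LP q n u w) a b k c = 0
    · rw [h0, mul_zero]
    · have := hpar k c h0
      rw [one_mul, one_mul] at this
      rw [if_neg fun h' => hc ⟨this.1.symm.trans h'.1, this.2.symm.trans h'.2⟩, zero_mul]

theorem Gop_succ_apply_of_eq (Q : ℂ) (N : ℕ) (δ : ℤˣ) (u v : ℂ) {r c : PSt (N + 1)}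
    (hr : r.1 (Fin.last N) = -1) (hr' : r.2 (Fin.last N) = -1) (hc : c.1 (Fin.last N) = -1)
    (hc' : c.2 (Fin.last N) = -1) : Gop Q (N + 1) δ u v r c =
      Gop Q N δ u v (Fin.init r.1, Fin.init r.2) (Fin.init c.1, Fin.init c.2) := by
  rw [Gop]
  simp [tens, splitLast, hr, hr', hc, hc', eqProj, exch, mixDiag]

theorem par_hw (n : ℕ) (ε : ℤˣ) : par (hw n ε) = ε := by
  rw [par, Fin.prod_univ_succ]
  rcases Int.units_eq_one_or ε with rfl | rfl <;> simp [hw]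

/-- All sites but the first carry spin `-`, where `G` acts through `eqProj` and reduces to one site
fewer. On a single site with unequal spins the value is `(v - u)⁻¹ (v - u)`. -/
theorem Gop_hw {Q : ℂ} (hQ : Q ≠ 0) (n : ℕ) (ε₁ ε₂ : ℤˣ) {u v : ℂ} (h : Regular Q (ε₁ * ε₂) u v) :
    Gop Q (n + 1) (ε₁ * ε₂) u v (hw n ε₁, hw n ε₂) (hw n ε₂, hw n ε₁) = 1 := by
  induction n with
  | zero =>
    have hm := mixc_ne_zero hQ h
    have hl : ∀ ε, hw 0 ε 0 = -ε := fun ε => by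
      rcases Int.units_eq_one_or ε with rfl | rfl <;> simp [hw]
    rcases Int.units_eq_one_or ε₁ with rfl | rfl <;> rcases Int.units_eq_one_or ε₂ with rfl | rfl <;>
      simp [Gop, tens, splitLast, hl, eqProj, exch, mixDiag, Matrix.one_apply, mixc] at hm ⊢
    all_goals
      rw [inv_mul_cancel₀ hm]
      simp [Subsingleton.elim (Fin.init (hw 0 (-1))) (Fin.init (hw 0 1))]
  | succ n ih =>
    have hl : ∀ ε, hw (n + 1) ε (Fin.last (n + 1)) = -1 := fun ε => by
      simp [hw]
    have hi : ∀ ε, Fin.init (hw (n + 1) ε) = hw n ε := fun ε => by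
      funext k
      simp [Fin.init, hw]
    rw [Gop_succ_apply_of_eq Q (n + 1) _ u v (hl ε₁) (hl ε₂) (hl ε₂) (hl ε₁)]
    simp only [hi]
    exact ih

theorem Rmat_isSpinorR (hq0 : q ≠ 0) (hq : ∀ k : ℕ, 0 < k → q ^ k ≠ 1) {n : ℕ} (hn : 1 ≤ n)
    {ε₁ ε₂ : ℤˣ} {u v : ℂ} (h : Generic q ε₁ ε₂ u v) :
    IsSpinorR q n ε₁ ε₂ u v (Rmat q n ε₁ ε₂ u v) := by
  have hQ : (q : ℂ) ≠ 0 := by exact_mod_cast hq0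
  obtain ⟨hu, hv, h⟩ := generic_iff.1 h
  refine ⟨fun r c hn => ?_, fun i hi j hj w _ _ _ => Rmat_intertwines hq0 hq hn h w hi hj,
    fun i hi j hj w hw _ _ => ?_, ?_⟩
  · rw [Rmat, ite_ne_right_iff] at hn
    obtain ⟨hc, hn⟩ := hn
    obtain ⟨h1, h2⟩ := Gop_changesParities q (n + 1) _ u v _ _ hn
    refine ⟨⟨h1.trans ?_, h2.trans ?_⟩, hc⟩
    · rw [show parN c.swap.1 = ε₂ from hc.2, mul_assoc, Int.units_mul_self, mul_one]
    · rw [show parN c.swap.2 = ε₁ from hc.1, mul_comm ε₁, mul_assoc, Int.units_mul_self, mul_one]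
  · rw [LM_eq_LP hv hw, LM_eq_LP hu hw]
    exact Rmat_intertwines hq0 hq hn h w hi hj
  · rw [Rmat, if_pos ⟨par_hw _ _, par_hw _ _⟩]
    exact Gop_hw hQ n ε₁ ε₂ h

end

/-! ### Hopping operators -/

/-- The basis vectors. -/
def bv {N : ℕ} (c : PSt N) : PSt N → ℂ := Pi.single c 1

/-- Reversal of the spins at two sites. -/
def flip2 {N : ℕ} (i j : Fin N) (c : Fin N → ℤˣ) : Fin N → ℤˣ := fun k =>
  if k = i ∨ k = j then -c k else c k

/-- The states on which a Chevalley generator does not vanish. -/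
def Allowed {N : ℕ} (i j : Fin N) (ε δ : ℤˣ) (c : Fin N → ℤˣ) : Prop := c i = -ε ∧ c j = δ

instance {N : ℕ} (i j : Fin N) (ε δ : ℤˣ) (c : Fin N → ℤˣ) : Decidable (Allowed i j ε δ c) :=
  inferInstanceAs (Decidable (_ ∧ _))

/-- The action of a Chevalley generator on states, where it does not vanish. -/
def hopSt {N : ℕ} (i j : Fin N) (ε δ : ℤˣ) (c : Fin N → ℤˣ) : Fin N → ℤˣ :=
  if Allowed i j ε δ c then flip2 i j c else c

section
variable {N : ℕ} {i j : Fin N}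

@[simp] theorem flip2_left (c : Fin N → ℤˣ) : flip2 i j c i = -c i := by simp [flip2]

@[simp] theorem flip2_right (c : Fin N → ℤˣ) : flip2 i j c j = -c j := by simp [flip2]

theorem flip2_of_ne (c : Fin N → ℤˣ) {k : Fin N} (h : k ≠ i) (h' : k ≠ j) : flip2 i j c k = c k := by
  simp [flip2, h, h']

@[simp] theorem flip2_flip2 (c : Fin N → ℤˣ) : flip2 i j (flip2 i j c) = c := by
  funext k
  simp only [flip2]
  split_ifs <;> simp

theorem flip2_neg (c : Fin N → ℤˣ) : flip2 i j (-c) = -flip2 i j c := by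
  funext k
  simp only [flip2, Pi.neg_apply]
  split_ifs <;> rfl

theorem parN_flip2 (hij : i ≠ j) (c : Fin N → ℤˣ) : parN (flip2 i j c) = parN c := by
  have h : parN (flip2 i j c) = parN c * ∏ k, if k = i ∨ k = j then (-1 : ℤˣ) else 1 := by
    rw [parN, parN, ← Finset.prod_mul_distrib]
    refine Finset.prod_congr rfl fun k _ => ?_
    simp only [flip2]
    split_ifs <;> simp
  rw [h, Finset.prod_eq_mul i j hij (fun k _ hk => by simp [hk.1, hk.2]) (by simp) (by simp)]
  simp

theorem parN_hopSt (hij : i ≠ j) (ε δ : ℤˣ) (c : Fin N → ℤˣ) : parN (hopSt i j ε δ c) = parN c := by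
  rw [hopSt]
  split_ifs
  · exact parN_flip2 hij c
  · rfl

theorem not_allowed_flip2 {ε δ : ℤˣ} {c : Fin N → ℤˣ} (h : Allowed i j ε δ c) :
    ¬ Allowed i j ε δ (flip2 i j c) := by
  intro h'
  have h1 := h'.1
  rw [flip2_left, h.1] at h1
  rcases Int.units_eq_one_or ε with rfl | rfl <;> simp at h1

theorem hopSt_of {ε δ : ℤˣ} {c : Fin N → ℤˣ} (h : Allowed i j ε δ c) :
    hopSt i j ε δ c = flip2 i j c := if_pos h

theorem hopSt_of_not {ε δ : ℤˣ} {c : Fin N → ℤˣ} (h : ¬ Allowed i j ε δ c) :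
    hopSt i j ε δ c = c := if_neg h

theorem hopSt_hopSt {ε δ : ℤˣ} {c : Fin N → ℤˣ} (h : ¬ Allowed i j ε δ c) :
    hopSt i j ε δ (hopSt i j (-ε) (-δ) c) = c := by
  by_cases h' : Allowed i j (-ε) (-δ) c
  · have : Allowed i j ε δ (flip2 i j c) := ⟨by rw [flip2_left, h'.1, neg_neg],
      by rw [flip2_right, h'.2, neg_neg]⟩
    rw [hopSt_of h', hopSt_of this, flip2_flip2]
  · rw [hopSt_of_not h', hopSt_of_not h]

end

/-- Coproduct-like combination of a Chevalley generator and diagonal operators. -/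
def hopOp (n : ℕ) (t : ℕ) (ε δ : ℤˣ) (d d' : St n → ℂ) : Op₂ n :=
  genE n t ε δ ⊗ₖ Matrix.diagonal d + Matrix.diagonal d' ⊗ₖ genE n t ε δ

theorem genE_apply {n : ℕ} {i j : Fin (n + 1)} (hij : (j : ℕ) = i + 1) (ε δ : ℤˣ) (r c : St n) :
    genE n i ε δ r c = if Allowed i j ε δ c ∧ r = flip2 i j c then 1 else 0 := by
  have hne : i ≠ j := fun h => by rw [h] at hij; omega
  have hval : ∀ k : Fin (n + 1), str2 (1 : Matrix ℤˣ ℤˣ ℂ) (sg ε) (sg (-δ)) 1 i k (r k) (c k) =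
      if (if k = i then r k = ε ∧ c k = -ε else if k = j then r k = -δ ∧ c k = δ else r k = c k)
        then 1 else 0 := by
    intro k
    by_cases h1 : k = i
    · subst h1
      simp [str2, sg, Matrix.single_apply, eq_comm]
    by_cases h2 : k = j
    · subst h2
      simp [str2, sg, Matrix.single_apply, hij, h1, eq_comm]
    have h1' : (k : ℕ) ≠ i := fun h => h1 (Fin.ext h)
    have h2' : (k : ℕ) ≠ i + 1 := fun h => h2 (Fin.ext (h.trans hij.symm))
    simp only [str2, h1', h2', if_neg h1, if_neg h2, if_false, ite_self, Matrix.one_apply]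
  rw [genE, pure]
  simp only [hval]
  rw [Finset.prod_ite_zero]
  simp only [Finset.mem_univ, true_imp_iff, Finset.prod_const_one]
  congr 1
  refine propext ⟨fun h => ?_, ?_⟩
  · have hi := h i
    have hj := h j
    rw [if_pos rfl] at hi
    rw [if_neg hne.symm, if_pos rfl] at hj
    refine ⟨⟨hi.2, hj.2⟩, funext fun k => ?_⟩
    have hk := h k
    by_cases h1 : k = i
    · rw [h1, flip2_left, hi.1, hi.2, neg_neg]
    by_cases h2 : k = j
    · rw [h2, flip2_right, hj.1, hj.2]
    rw [if_neg h1, if_neg h2] at hk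
    rw [flip2_of_ne _ h1 h2, hk]
  · rintro ⟨⟨hi, hj⟩, rfl⟩ k
    split_ifs with h1 h2
    · subst h1; simp [hi]
    · subst h2; simp [hj]
    · exact flip2_of_ne _ h1 h2

theorem hopOp_mulVec_bv {n : ℕ} {i j : Fin (n + 1)} (hij : (j : ℕ) = i + 1) (ε δ : ℤˣ)
    (d d' : St n → ℂ) (c : PSt (n + 1)) : (hopOp n i ε δ d d').mulVec (bv c) =
      (if Allowed i j ε δ c.1 then d c.2 • bv (flip2 i j c.1, c.2) else 0) +
      (if Allowed i j ε δ c.2 then d' c.1 • bv (c.1, flip2 i j c.2) else 0) := by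
  rw [bv, Matrix.mulVec_single_one]
  funext r
  obtain ⟨r1, r2⟩ := r
  obtain ⟨c1, c2⟩ := c
  simp only [hopOp, Matrix.col_apply, Matrix.add_apply, Matrix.kroneckerMap_apply, genE_apply hij, Pi.add_apply,
    Matrix.diagonal_apply, ite_and]
  congr 1
  · split_ifs with h1 h2 h3 h3 <;> simp_all [bv]
  · split_ifs with h1 h2 h3 h3 <;> simp_all [bv]

/-- A subspace with the closure properties resulting from stability under a hopping operator. -/
structure Hop {N : ℕ} (W : Submodule ℂ (PSt N → ℂ)) (i j : Fin N) (ε δ : ℤˣ)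
    (d d' : (Fin N → ℤˣ) → ℂ) : Prop where
  move : ∀ c : PSt N, bv c ∈ W → bv (hopSt i j ε δ c.1, hopSt i j ε δ c.2) ∈ W
  rel : ∀ c : PSt N, bv c ∈ W → Allowed i j ε δ c.1 → Allowed i j ε δ c.2 →
    d c.2 • bv (flip2 i j c.1, c.2) + d' c.1 • bv (c.1, flip2 i j c.2) ∈ W

/-- If only one component can hop, the operator itself moves the state. If both can, its square
moves both components, with the coefficient in `hc`, and this must not vanish. -/
theorem Hop.of_stable {n : ℕ} {W : Submodule ℂ (PSt (n + 1) → ℂ)} {i j : Fin (n + 1)}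
    (hij : (j : ℕ) = i + 1) {ε δ : ℤˣ} {d d' : St n → ℂ}
    (h : ∀ x ∈ W, (hopOp n i ε δ d d').mulVec x ∈ W) (hd : ∀ c, d c ≠ 0) (hd' : ∀ c, d' c ≠ 0)
    (hc : ∀ c₁ c₂, Allowed i j ε δ c₁ → Allowed i j ε δ c₂ →
      d c₂ * d' (flip2 i j c₁) + d' c₁ * d (flip2 i j c₂) ≠ 0) : Hop W i j ε δ d d' := by
  have rel : ∀ c : PSt (n + 1), bv c ∈ W → Allowed i j ε δ c.1 → Allowed i j ε δ c.2 →
      d c.2 • bv (flip2 i j c.1, c.2) + d' c.1 • bv (c.1, flip2 i j c.2) ∈ W := by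
    intro c hcW h1 h2
    have := h _ hcW
    rwa [hopOp_mulVec_bv hij, if_pos h1, if_pos h2] at this
  refine ⟨fun c hcW => ?_, rel⟩
  have hmv := h _ hcW
  rw [hopOp_mulVec_bv hij] at hmv
  simp only [hopSt]
  by_cases h1 : Allowed i j ε δ c.1 <;> by_cases h2 : Allowed i j ε δ c.2
  -- Each of the two summands admits only one further hop, and both lead to the same state.
  · have := h _ (rel c hcW h1 h2)
    rw [Matrix.mulVec_add, Matrix.mulVec_smul, Matrix.mulVec_smul, hopOp_mulVec_bv hij,
      hopOp_mulVec_bv hij, if_neg (not_allowed_flip2 h1), if_pos h2, if_pos h1,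
      if_neg (not_allowed_flip2 h2), zero_add, add_zero, smul_smul, smul_smul, ← add_smul] at this
    rw [if_pos h1, if_pos h2]
    exact (W.smul_mem_iff (hc _ _ h1 h2)).1 this
  · rw [if_pos h1, if_neg h2, add_zero] at hmv
    rw [if_pos h1, if_neg h2]
    exact (W.smul_mem_iff (hd _)).1 hmv
  · rw [if_neg h1, if_pos h2, zero_add] at hmv
    rw [if_neg h1, if_pos h2]
    exact (W.smul_mem_iff (hd' _)).1 hmv
  · rw [if_neg h1, if_neg h2]
    exact hcW

theorem Hop.mem {N : ℕ} {W : Submodule ℂ (PSt N → ℂ)} {i j : Fin N} {ε δ : ℤˣ}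
    {d d' : (Fin N → ℤˣ) → ℂ} (h : Hop W i j ε δ d d') {r : PSt N} (h1 : ¬ Allowed i j ε δ r.1)
    (h2 : ¬ Allowed i j ε δ r.2)
    (hr : bv (hopSt i j (-ε) (-δ) r.1, hopSt i j (-ε) (-δ) r.2) ∈ W) : bv r ∈ W := by
  have := h.move _ hr
  rwa [hopSt_hopSt h1, hopSt_hopSt h2] at this

/-! ### The triangular `L`-operators -/

/-- The lower triangular `L`-operator. -/
def Am (q : ℝ) (n : ℕ) (a b : ℤ) : Op n := sq q • ellM q n a b

/-- The upper triangular `L`-operator. -/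
def Pm (q : ℝ) (n : ℕ) (a b : ℤ) : Op n := (sq q)⁻¹ • ellP q n a b

theorem LP_eq_Am_sub_Pm (q : ℝ) (n : ℕ) (ρ w : ℂ) (a b : ℤ) :
    LP q n ρ w a b = (w - ρ)⁻¹ • (w • Am q n a b - ρ • Pm q n a b) := by
  rw [LP, Am, Pm, smul_smul, smul_smul, mul_comm w, mul_comm ρ]

/-- A subspace stable under the coefficients of the coproduct of the `L`-operators. -/
structure Stable (q : ℝ) (n : ℕ) (u v : ℂ) (W : Submodule ℂ (PSt (n + 1) → ℂ)) : Prop where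
  mm : ∀ a ∈ vecIdx n, ∀ b ∈ vecIdx n, ∀ x ∈ W, (coprod n (Am q n) (Am q n) a b).mulVec x ∈ W
  pp : ∀ a ∈ vecIdx n, ∀ b ∈ vecIdx n, ∀ x ∈ W, (coprod n (Pm q n) (Pm q n) a b).mulVec x ∈ W
  mp : ∀ a ∈ vecIdx n, ∀ b ∈ vecIdx n, ∀ x ∈ W,
    (u • coprod n (Am q n) (Pm q n) a b + v • coprod n (Pm q n) (Am q n) a b).mulVec x ∈ W

section
variable {q : ℝ} {n : ℕ}

theorem Am_of_lt {a b : ℤ} (h : a < b) : Am q n a b = 0 := smul_ellM_of_lt h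

theorem Pm_of_gt {a b : ℤ} (h : b < a) : Pm q n a b = 0 := by rw [Pm, ellP_of_gt h, smul_zero]

theorem Am_neg {a : ℤ} (ha : a ≠ 0) : Am q n a (-a) = 0 := smul_ellM_neg ha

theorem Am_self (hq : q ≠ 0) {t : ℕ} (ht : t < n + 1) (ε : ℤˣ) : Am q n (ix t ε) (ix t ε) =
    Matrix.diagonal fun m => (ov q ε (m ⟨t, ht⟩))⁻¹ := by
  rw [Am, smul_ellM_self hq, omInv_ix q ht, ← diagonal_site _ t ht]

theorem Pm_self (hq : q ≠ 0) {t : ℕ} (ht : t < n + 1) (ε : ℤˣ) : Pm q n (ix t ε) (ix t ε) =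
    Matrix.diagonal fun m => ov q ε (m ⟨t, ht⟩) := by
  rw [Pm, smul_ellP_self hq, om_ix q ht, ← diagonal_site _ t ht]

theorem Am_of_gt (hq : q ≠ 0) {a b : ℤ} (ha : a ∈ vecIdx n) (hb : b ∈ vecIdx n) (h : b < a) :
    Am q n a b = Lam q n a b := smul_ellM_of_gt hq ha hb h

theorem Pm_of_lt (hq : q ≠ 0) {a b : ℤ} (ha : a ∈ vecIdx n) (hb : b ∈ vecIdx n) (h : a < b) :
    Pm q n a b = -Lam q n a b := smul_ellP_of_lt hq ha hb h

theorem Pm_neg (hq : q ≠ 0) {a : ℤ} (ha : a ∈ vecIdx n) : Pm q n a (-a) = 0 := by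
  rcases lt_or_gt_of_ne (mem_vecIdx.1 ha).1 with h | h
  · rw [Pm_of_lt hq ha (by rw [mem_vecIdx] at *; omega) (by omega), Lam_neg ha, neg_zero]
  · exact Pm_of_gt (by omega)

theorem cphi_ne_zero (hq : q ≠ 0) (a : ℤ) : cphi q a ≠ 0 := by
  have hQ : (q : ℂ) ≠ 0 := by exact_mod_cast hq
  intro h
  have := cphi_mul_cchi hq a
  rw [h, zero_mul] at this
  exact inv_ne_zero hQ this.symm

/-- For neighbouring sites the strings of `phi` and `chi` cancel except at the two sites themselves,
leaving a Chevalley generator. -/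
theorem exists_Lam_succ_left (hq : q ≠ 0) (hq2 : (q : ℂ) ^ 2 - 1 ≠ 0) {t : ℕ} (ht : t + 1 < n + 1)
    (ε η : ℤˣ) : ∃ κ : ℂ, κ ≠ 0 ∧
      Lam q n (ix (t + 1) η) (ix t ε) = κ • genE n t (-ε) (-η) := by
  have hQ : (q : ℂ) ≠ 0 := by exact_mod_cast hq
  refine ⟨((q : ℂ) ^ 2 - 1) * (cphi q (ix (t + 1) η) * cchi q (ix t ε) * (((ε : ℤ) : ℂ) * wv q (-η))), ?_, ?_⟩
  · have h1 := cphi_ne_zero hq (ix (t + 1) η)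
    have h2 := cchi_ne_zero hq (ix t ε)
    have h3 := wv_ne_zero hQ (-η)
    have h4 : ((ε : ℤ) : ℂ) ≠ 0 := by simp
    positivity
  · rw [Lam, phi, chi, site_ix, site_ix, sgn_ix, sgn_ix, str_succ_eq_str2, str_eq_str2, Matrix.smul_mul,
      Matrix.mul_smul, pure_str2_mul, zM_mul_zM, zM_mul_sg, sg_mul_wM, wI_mul_wM hQ,
      pure_str2_smul_right _ _ _ _ _ ht, pure_str2_smul_left _ _ _ _ _ (by omega), genE, neg_neg]
    simp only [smul_smul]
    congr 1
    push_cast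
    ring

theorem exists_Lam_succ_right (hq : q ≠ 0) (hq2 : (q : ℂ) ^ 2 - 1 ≠ 0) {t : ℕ} (ht : t + 1 < n + 1)
    (ε η : ℤˣ) : ∃ κ : ℂ, κ ≠ 0 ∧ Lam q n (ix t ε) (ix (t + 1) η) = κ • genE n t ε η := by
  have hQ : (q : ℂ) ≠ 0 := by exact_mod_cast hq
  refine ⟨((q : ℂ) ^ 2 - 1) * (cphi q (ix t ε) * cchi q (ix (t + 1) η) *
    (((ε : ℤ) : ℂ) * (wv q (-η))⁻¹)), ?_, ?_⟩
  · have h1 := cphi_ne_zero hq (ix t ε)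
    have h2 := cchi_ne_zero hq (ix (t + 1) η)
    have h3 := wv_ne_zero hQ (-η)
    have h4 : ((ε : ℤ) : ℂ) ≠ 0 := by simp
    positivity
  · rw [Lam, phi, chi, site_ix, site_ix, sgn_ix, sgn_ix, str_succ_eq_str2, str_eq_str2, Matrix.smul_mul,
      Matrix.mul_smul, pure_str2_mul, zM_mul_zM, sg_mul_zM, wI_mul_sg, wI_mul_wM hQ,
      pure_str2_smul_right _ _ _ _ _ ht, pure_str2_smul_left _ _ _ _ _ (by omega), genE]
    simp only [smul_smul]
    congr 1
    ring

end

/-! ### Hopping operators in the coproduct -/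

theorem coprod_eq_add {n : ℕ} {X Y : ℤ → ℤ → Op n} {a b : ℤ} (ha : a ∈ vecIdx n) (hb : b ∈ vecIdx n)
    (hab : a ≠ b) (h : ∀ k ∈ vecIdx n, k ≠ a → k ≠ b → X a k = 0 ∨ Y k b = 0) :
    coprod n X Y a b = X a b ⊗ₖ Y b b + X a a ⊗ₖ Y a b := by
  rw [coprod, Finset.sum_eq_add_of_mem b a hb ha hab.symm]
  intro k hk hne
  rcases h k hk hne.2 hne.1 with h | h <;> simp [h]

section
variable {q : ℝ} {n : ℕ} {u v : ℂ} {W : Submodule ℂ (PSt (n + 1) → ℂ)}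

theorem ofReal_sq_add_one_ne_zero (x : ℝ) : (x : ℂ) * x + 1 ≠ 0 := by
  have : x * x + 1 ≠ 0 := (by nlinarith [mul_self_nonneg x] : 0 < x * x + 1).ne'
  exact_mod_cast this

theorem mem_of_smul_hop {c : ℂ} (hc : c ≠ 0) {A H : Op₂ n} (hA : A = c • H)
    (h : ∀ x ∈ W, A.mulVec x ∈ W) : ∀ x ∈ W, H.mulVec x ∈ W := fun x hx => by
  have := h x hx
  rw [hA, Matrix.smul_mulVec] at this
  exact (W.smul_mem_iff hc).1 this

/-- By triangularity an entry of the coproduct next to the diagonal has only two summands and is the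
coproduct of a Chevalley generator. -/
theorem Stable.hop_mm (hW : Stable q n u v W) (hq : q ≠ 0) (hq2 : (q : ℂ) ^ 2 - 1 ≠ 0)
    {i j : Fin (n + 1)} (hij : (j : ℕ) = i + 1) {ε : ℤˣ} (hε : ε = 1 ∨ (i : ℕ) = 0) :
    Hop W i j (-ε) (-1) (fun m => (ov q ε (m i))⁻¹) fun m => (ov q 1 (m j))⁻¹ := by
  have hQ : (q : ℂ) ≠ 0 := by exact_mod_cast hq
  have ht : (i : ℕ) + 1 < n + 1 := by omega
  have hb : ix i ε ∈ vecIdx n := ix_mem i.2 ε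
  have ha : ix (i + 1) 1 ∈ vecIdx n := ix_mem ht 1
  have hlt : ix i ε < ix (i + 1) 1 := by
    rw [ix_one]
    rcases ix_cases i ε with h | h <;> rw [h] <;> push_cast <;> omega
  obtain ⟨κ, hκ, e⟩ := exists_Lam_succ_left (n := n) hq hq2 ht ε 1
  have key : coprod n (Am q n) (Am q n) (ix (i + 1) 1) (ix i ε) =
      κ • hopOp n i (-ε) (-1) (fun m => (ov q ε (m i))⁻¹) fun m => (ov q 1 (m j))⁻¹ := by
    rw [coprod_eq_add ha hb hlt.ne', Am_of_gt hq ha hb hlt, e, Am_self hq i.2, Am_self hq ht, hopOp,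
      smul_add, Matrix.smul_kronecker, Matrix.kronecker_smul]
    · have : (⟨i + 1, ht⟩ : Fin (n + 1)) = j := Fin.ext hij.symm
      rw [this]
    · intro k hk h1 h2
      by_cases h3 : ix (i + 1) 1 < k
      · exact Or.inl (Am_of_lt h3)
      by_cases h4 : k < ix i ε
      · exact Or.inr (Am_of_lt h4)
      right
      have hk0 := (mem_vecIdx.1 hk).1
      rw [ix_one] at *
      push_cast at *
      -- At the branching node the index `1` lies strictly between `-1` and `2`; its summand
      -- vanishes because the entry `(1, -1)` does.
      rcases hε with rfl | h0
      · rw [ix_one] at *; omega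
      · rcases ix_cases i ε with h | h
        · omega
        · obtain rfl : k = 1 := by omega
          have : ix i ε = -1 := by omega
          rw [this]
          exact Am_neg one_ne_zero
  refine Hop.of_stable hij (mem_of_smul_hop hκ key (hW.mm _ ha _ hb))
    (fun c => inv_ne_zero (ov_ne_zero hQ _ _)) (fun c => inv_ne_zero (ov_ne_zero hQ _ _)) ?_
  rintro c₁ c₂ ⟨h1, h2⟩ ⟨h3, h4⟩
  simp only [flip2_left, flip2_right, h2, h3, neg_neg]
  rcases Int.units_eq_one_or ε with rfl | rfl <;> simpa [ov, hQ] using ofReal_sq_add_one_ne_zero q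

theorem Stable.hop_pp (hW : Stable q n u v W) (hq : q ≠ 0) (hq2 : (q : ℂ) ^ 2 - 1 ≠ 0)
    {i j : Fin (n + 1)} (hij : (j : ℕ) = i + 1) :
    Hop W i j 1 1 (fun m => ov q 1 (m j)) fun m => ov q 1 (m i) := by
  have hQ : (q : ℂ) ≠ 0 := by exact_mod_cast hq
  have ht : (i : ℕ) + 1 < n + 1 := by omega
  have hb : ix (i + 1) 1 ∈ vecIdx n := ix_mem ht 1
  have ha : ix i 1 ∈ vecIdx n := ix_mem i.2 1
  have hlt : ix i 1 < ix (i + 1) 1 := by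
    rw [ix_one, ix_one]; push_cast; omega
  obtain ⟨κ, hκ, e⟩ := exists_Lam_succ_right (n := n) hq hq2 ht 1 1
  have key : coprod n (Pm q n) (Pm q n) (ix i 1) (ix (i + 1) 1) =
      (-κ) • hopOp n i 1 1 (fun m => ov q 1 (m j)) fun m => ov q 1 (m i) := by
    rw [coprod_eq_add ha hb hlt.ne, Pm_of_lt hq ha hb hlt, e, Pm_self hq i.2, Pm_self hq ht, hopOp,
      smul_add, ← neg_smul, Matrix.smul_kronecker, Matrix.kronecker_smul]
    · have : (⟨i + 1, ht⟩ : Fin (n + 1)) = j := Fin.ext hij.symm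
      rw [this]
    · intro k hk h1 h2
      by_cases h3 : ix (i + 1) 1 < k
      · exact Or.inr (Pm_of_gt h3)
      by_cases h4 : k < ix i 1
      · exact Or.inl (Pm_of_gt h4)
      exfalso
      rw [ix_one] at *
      rw [ix_one] at *
      push_cast at *
      omega
  refine Hop.of_stable hij (mem_of_smul_hop (neg_ne_zero.2 hκ) key (hW.pp _ ha _ hb))
    (fun c => ov_ne_zero hQ _ _) (fun c => ov_ne_zero hQ _ _) ?_
  rintro c₁ c₂ ⟨h1, h2⟩ ⟨h3, h4⟩
  simp only [flip2_left, flip2_right, h1, h4, neg_neg]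
  simpa [ov, hQ] using ofReal_sq_add_one_ne_zero q⁻¹

/-- The coefficient linear in `w` supplies a generator of affine type: for `ε = -1` it turns two
spins `-` at the last two sites into `+`. This is the only hopping operator whose coefficients
contain `u` and `v`. -/
theorem Stable.hop_mp (hW : Stable q n u v W) (hq : q ≠ 0) (hq2 : (q : ℂ) ^ 2 - 1 ≠ 0)
    (hu : u ≠ 0) (hv : v ≠ 0) {i j : Fin (n + 1)} (hij : (j : ℕ) = i + 1) (hj : (j : ℕ) = n) {ε : ℤˣ}
    (hε : ε = -1 ∨ (i : ℕ) = 0) :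
    Hop W i j (-ε) (-1) (fun m => u * ov q ε (m i)) fun m => v * ov q 1 (m j) := by
  have hQ : (q : ℂ) ≠ 0 := by exact_mod_cast hq
  have ht : (i : ℕ) + 1 < n + 1 := by omega
  have hb : ix i ε ∈ vecIdx n := ix_mem i.2 ε
  have ha : ix (i + 1) 1 ∈ vecIdx n := ix_mem ht 1
  have hlt : ix i ε < ix (i + 1) 1 := by
    rw [ix_one]
    rcases ix_cases i ε with h | h <;> rw [h] <;> push_cast <;> omega
  obtain ⟨κ, hκ, e⟩ := exists_Lam_succ_left (n := n) hq hq2 ht ε 1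
  have key : u • coprod n (Am q n) (Pm q n) (ix (i + 1) 1) (ix i ε) +
      v • coprod n (Pm q n) (Am q n) (ix (i + 1) 1) (ix i ε) =
      κ • hopOp n i (-ε) (-1) (fun m => u * ov q ε (m i)) fun m => v * ov q 1 (m j) := by
    have hd : ∀ (c : ℂ) (f : St n → ℂ), (Matrix.diagonal fun m => c * f m) = c • Matrix.diagonal f :=
      fun c f => by rw [← Matrix.diagonal_smul]; rfl
    rw [coprod_eq_add ha hb hlt.ne', coprod_eq_add ha hb hlt.ne', Am_of_gt hq ha hb hlt, e, Pm_of_gt hlt,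
      Pm_self hq i.2, Pm_self hq ht, hopOp, Matrix.kronecker_zero, Matrix.zero_kronecker, add_zero,
      zero_add, smul_add, hd, hd, Matrix.kronecker_smul, Matrix.smul_kronecker, Matrix.smul_kronecker,
      Matrix.kronecker_smul, smul_comm u, smul_comm v]
    · have : (⟨i + 1, ht⟩ : Fin (n + 1)) = j := Fin.ext hij.symm
      rw [this]
    · intro k hk h1 h2
      left
      have := mem_vecIdx.1 hk
      refine Pm_of_gt ?_
      rw [ix_one] at *
      push_cast at *
      omega
    · intro k hk h1 h2
      have hk' := mem_vecIdx.1 hk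
      by_cases h4 : ix i ε < k
      · exact Or.inr (Pm_of_gt h4)
      -- Below the column index only the negative of the row index remains and, if `i = 0`, possibly
      -- the negative of the column index; both summands contain a zero entry.
      by_cases h5 : k = -ix (i + 1) 1
      · left
        rw [h5]
        exact Am_neg (mem_vecIdx.1 ha).1
      right
      rw [ix_one] at *
      push_cast at *
      rcases hε with rfl | h0
      · rw [ix_neg_one] at *; omega
      · rcases ix_cases i ε with h | h
        · have h7 : ix i ε = -k := by omega
          rw [h7]
          exact Pm_neg hq hk
        · omega
  refine Hop.of_stable hij (mem_of_smul_hop hκ key (hW.mp _ ha _ hb))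
    (fun c => mul_ne_zero hu (ov_ne_zero hQ _ _)) (fun c => mul_ne_zero hv (ov_ne_zero hQ _ _)) ?_
  rintro c₁ c₂ ⟨h1, h2⟩ ⟨h3, h4⟩
  simp only [flip2_left, flip2_right, h2, h3, neg_neg]
  have := mul_ne_zero (mul_ne_zero hu hv) (ofReal_sq_add_one_ne_zero q⁻¹)
  push_cast at this
  rcases Int.units_eq_one_or ε with rfl | rfl
  · convert this using 1
    simp [ov]
    ring
  · convert this using 1
    simp [ov, hQ]
    ring

end

/-! ### Restriction to the last site -/

/-- `A = A' ⊗ 1`. -/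
def IsExt {N : ℕ} (A : Matrix (Fin (N + 1) → ℤˣ) (Fin (N + 1) → ℤˣ) ℂ)
    (A' : Matrix (Fin N → ℤˣ) (Fin N → ℤˣ) ℂ) : Prop :=
  ∀ r c, A r c = A' (Fin.init r) (Fin.init c) * (1 : Matrix ℤˣ ℤˣ ℂ) (r (Fin.last N)) (c (Fin.last N))

theorem IsExt.smul {N : ℕ} {A : Matrix (Fin (N + 1) → ℤˣ) (Fin (N + 1) → ℤˣ) ℂ}
    {A' : Matrix (Fin N → ℤˣ) (Fin N → ℤˣ) ℂ} (h : IsExt A A') (c : ℂ) : IsExt (c • A) (c • A') := by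
  intro r s
  rw [Matrix.smul_apply, h, Matrix.smul_apply, smul_eq_mul, smul_eq_mul, mul_assoc]

theorem IsExt.zero {N : ℕ} : IsExt (0 : Matrix (Fin (N + 1) → ℤˣ) (Fin (N + 1) → ℤˣ) ℂ) 0 := by
  intro r s; simp

theorem pure_apply_last {N : ℕ} (f : Fin (N + 1) → Matrix ℤˣ ℤˣ ℂ) (r c : Fin (N + 1) → ℤˣ) :
    pure f r c = pure (fun k : Fin N => f k.castSucc) (Fin.init r) (Fin.init c) *
      f (Fin.last N) (r (Fin.last N)) (c (Fin.last N)) := by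
  simp only [pure, Fin.prod_univ_castSucc, Fin.init]

theorem pure_isExt {N : ℕ} {f : Fin (N + 1) → Matrix ℤˣ ℤˣ ℂ} {f' : Fin N → Matrix ℤˣ ℤˣ ℂ}
    (h : ∀ k : Fin N, f k.castSucc = f' k) (h1 : f (Fin.last N) = 1) : IsExt (pure f) (pure f') := by
  intro r c
  rw [pure_apply_last, h1]
  simp only [h]

/-- A family of operators compatible with the restriction to states whose last spin is `-`. -/
structure Restricts {n : ℕ} (X : ℤ → ℤ → Op (n + 1)) (X' : ℤ → ℤ → Op n) : Prop where
  ext : ∀ a ∈ vecIdx n, ∀ b ∈ vecIdx n, IsExt (X a b) (X' a b)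
  right : ∀ a ∈ vecIdx n, ∀ r c : St (n + 1), c (Fin.last _) = -1 → X a (ix (n + 1) 1) r c = 0
  left : ∀ b ∈ vecIdx n, ∀ r c : St (n + 1), c (Fin.last _) = -1 → X (ix (n + 1) (-1)) b r c = 0

/-- On states whose last spins are both `-`, the two additional summation indices `±(n + 2)`
contribute nothing, so the coproduct is that of one site fewer. -/
theorem Restricts.coprod {n : ℕ} {X Y : ℤ → ℤ → Op (n + 1)} {X' Y' : ℤ → ℤ → Op n}
    (hX : Restricts X X') (hY : Restricts Y Y') {a b : ℤ} (ha : a ∈ vecIdx n) (hb : b ∈ vecIdx n)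
    (x : PSt (n + 1) → ℂ) : (coprod (n + 1) X Y a b).mulVec (tvec x (Pi.single (-1, -1) 1)) =
      tvec ((SpinorD.coprod n X' Y' a b).mulVec x) (Pi.single (-1, -1) 1) := by
  have key : ∀ r c : PSt (n + 2), splitLast (n + 1) c = ((splitLast (n + 1) c).1, (-1, -1)) →
      SpinorD.coprod (n + 1) X Y a b r c = tens (SpinorD.coprod n X' Y' a b) 1 r c := by
    intro r c hc
    obtain ⟨h1, h2⟩ := Prod.ext_iff.1 (Prod.ext_iff.1 hc).2
    change c.1 (Fin.last _) = -1 at h1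
    change c.2 (Fin.last _) = -1 at h2
    rw [SpinorD.coprod, SpinorD.coprod, sum_vecIdx, Finset.sum_range_succ, sum_units, Matrix.add_apply,
      Matrix.add_apply, Matrix.kroneckerMap_apply, Matrix.kroneckerMap_apply, hX.right a ha _ _ h1,
      hY.left b hb _ _ h2, zero_mul, mul_zero, add_zero, add_zero, sum_vecIdx, tens_sum,
      Matrix.sum_apply, Matrix.sum_apply]
    refine Finset.sum_congr rfl fun t ht => ?_
    rw [tens_sum, Matrix.sum_apply, Matrix.sum_apply]
    refine Finset.sum_congr rfl fun ε _ => ?_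
    have ht := ix_mem (Finset.mem_range.1 ht) ε
    rw [Matrix.kroneckerMap_apply, hX.ext a ha _ ht, hY.ext _ ht b hb, tens, Matrix.submatrix_apply,
      Matrix.kroneckerMap_apply, Matrix.kroneckerMap_apply, ← Matrix.one_kronecker_one,
      Matrix.kroneckerMap_apply, mul_mul_mul_comm]
    rfl
  have h1 := tens_mulVec (SpinorD.coprod n X' Y' a b) 1 x (Pi.single (-1, -1) 1)
  rw [Matrix.one_mulVec] at h1
  rw [← h1]
  funext r
  simp only [Matrix.mulVec, dotProduct]
  refine Finset.sum_congr rfl fun c _ => ?_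
  by_cases hc : (splitLast (n + 1) c).2 = (-1, -1)
  · rw [key r c (Prod.ext rfl hc)]
  · rw [tvec, Pi.single_eq_of_ne hc, mul_zero, mul_zero, mul_zero]

section
variable {q : ℝ} {n : ℕ}

theorem vecIdx_succ_mem {a : ℤ} (ha : a ∈ vecIdx n) : a ∈ vecIdx (n + 1) := by
  rw [mem_vecIdx] at *; omega

theorem Lam_eq_pure (a b : ℤ) : Lam q n a b = (((q : ℂ) ^ 2 - 1) * (cphi q a * cchi q b)) •
    pure fun k : Fin (n + 1) => str zM (sg (sgn a)) (wI q) (site a) k *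
      str zM (sg (-sgn b)) (wM q) (site b) k := by
  rw [Lam, phi, chi, Matrix.smul_mul, Matrix.mul_smul, pure_mul, smul_smul, smul_smul, mul_assoc]

theorem Lam_isExt (hq : q ≠ 0) {a b : ℤ} (ha : a ∈ vecIdx n) (hb : b ∈ vecIdx n) :
    IsExt (Lam q (n + 1) a b) (Lam q n a b) := by
  have hQ : (q : ℂ) ≠ 0 := by exact_mod_cast hq
  rw [Lam_eq_pure, Lam_eq_pure]
  refine (pure_isExt (fun k => rfl) ?_).smul _
  rw [str_of_gt _ _ _ (by simpa using site_lt ha), str_of_gt _ _ _ (by simpa using site_lt hb),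
    wI_mul_wM hQ]

theorem site_diagonal_isExt {N t : ℕ} (ht : t < N) (d : ℤˣ → ℂ) :
    IsExt (N := N) (pure (str 1 (Matrix.diagonal d) 1 t)) (pure (str 1 (Matrix.diagonal d) 1 t)) :=
  pure_isExt (fun k => rfl) (str_of_gt _ _ _ (by simpa using ht))

theorem sg_neg_one_apply (r : ℤˣ) : sg (-1) r (-1) = 0 :=
  if_neg fun h => absurd h.2 (by decide)

theorem Lam_right_apply {a : ℤ} (ha : a ∈ vecIdx n) (r c : St (n + 1)) (hc : c (Fin.last _) = -1) :
    Lam q (n + 1) a (ix (n + 1) 1) r c = 0 := by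
  rw [Lam_eq_pure, Matrix.smul_apply, pure_apply_last, str_of_gt _ _ _ (by simpa using site_lt ha),
    str_of_eq _ _ _ (by simp), sgn_ix, wI_mul_sg, Matrix.smul_apply, hc, sg_neg_one_apply]
  simp

theorem Lam_left_apply {b : ℤ} (hb : b ∈ vecIdx n) (r c : St (n + 1)) (hc : c (Fin.last _) = -1) :
    Lam q (n + 1) (ix (n + 1) (-1)) b r c = 0 := by
  rw [Lam_eq_pure, Matrix.smul_apply, pure_apply_last, str_of_eq _ _ _ (by simp),
    str_of_gt _ _ _ (by simpa using site_lt hb), sgn_ix, sg_mul_wM, Matrix.smul_apply, hc,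
    sg_neg_one_apply]
  simp

theorem lt_ix_top {a : ℤ} (ha : a ∈ vecIdx n) : a < ix (n + 1) 1 := by
  have := mem_vecIdx.1 ha
  rw [ix_one]; push_cast; omega

theorem ix_bot_lt {a : ℤ} (ha : a ∈ vecIdx n) : ix (n + 1) (-1) < a := by
  have := mem_vecIdx.1 ha
  rw [ix_neg_one]; push_cast; omega

theorem Am_restricts (hq : q ≠ 0) : Restricts (Am q (n + 1)) (Am q n) where
  ext a ha b hb := by
    rcases lt_trichotomy a b with h | rfl | h
    · rw [Am_of_lt h, Am_of_lt h]; exact IsExt.zero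
    · obtain ⟨t, ht, ε, rfl⟩ := exists_eq_ix ha
      rw [Am, Am, smul_ellM_self hq, smul_ellM_self hq, omInv_ix q ht, omInv_ix q (by omega)]
      exact site_diagonal_isExt ht _
    · rw [Am_of_gt hq ha hb h, Am_of_gt hq (vecIdx_succ_mem ha) (vecIdx_succ_mem hb) h]
      exact Lam_isExt hq ha hb
  right a ha r c _ := by rw [Am_of_lt (lt_ix_top ha)]; rfl
  left b hb r c _ := by rw [Am_of_lt (ix_bot_lt hb)]; rfl

theorem Pm_restricts (hq : q ≠ 0) : Restricts (Pm q (n + 1)) (Pm q n) where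
  ext a ha b hb := by
    rcases lt_trichotomy a b with h | rfl | h
    · rw [Pm_of_lt hq ha hb h, Pm_of_lt hq (vecIdx_succ_mem ha) (vecIdx_succ_mem hb) h, ← neg_one_smul ℂ,
        ← neg_one_smul ℂ (Lam q n a b)]
      exact (Lam_isExt hq ha hb).smul _
    · obtain ⟨t, ht, ε, rfl⟩ := exists_eq_ix ha
      rw [Pm, Pm, smul_ellP_self hq, smul_ellP_self hq, om_ix q ht, om_ix q (by omega)]
      exact site_diagonal_isExt ht _
    · rw [Pm_of_gt h, Pm_of_gt h]; exact IsExt.zero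
  right a ha r c hc := by
    rw [Pm_of_lt hq (vecIdx_succ_mem ha) (ix_mem (by omega) _) (lt_ix_top ha), Matrix.neg_apply,
      Lam_right_apply ha r c hc, neg_zero]
  left b hb r c hc := by
    rw [Pm_of_lt hq (ix_mem (by omega) _) (vecIdx_succ_mem hb) (ix_bot_lt hb), Matrix.neg_apply,
      Lam_left_apply hb r c hc, neg_zero]

/-- The vectors `x` for which `x ⊗ y` belongs to `W`. -/
def lastSlice {N : ℕ} (W : Submodule ℂ (PSt (N + 1) → ℂ)) (y : ℤˣ × ℤˣ → ℂ) :
    Submodule ℂ (PSt N → ℂ) where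
  carrier := {x | tvec x y ∈ W}
  add_mem' {x x'} h h' := by
    rw [Set.mem_ofPred_eq] at *
    rw [tvec_add]
    exact W.add_mem h h'
  zero_mem' := by
    rw [Set.mem_ofPred_eq, tvec_zero]
    exact W.zero_mem
  smul_mem' c x h := by
    rw [Set.mem_ofPred_eq] at *
    rw [tvec_smul]
    exact W.smul_mem c h

theorem mem_lastSlice {N : ℕ} {W : Submodule ℂ (PSt (N + 1) → ℂ)} {y : ℤˣ × ℤˣ → ℂ} {x : PSt N → ℂ} :
    x ∈ lastSlice W y ↔ tvec x y ∈ W := Iff.rfl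

/-- Makes the proof of cyclicity an induction on the number of sites. -/
theorem Stable.lastSlice (hq : q ≠ 0) {u v : ℂ} {W : Submodule ℂ (PSt (n + 2) → ℂ)}
    (hW : Stable q (n + 1) u v W) : Stable q n u v (lastSlice W (Pi.single (-1, -1) 1)) where
  mm a ha b hb x hx := by
    rw [mem_lastSlice, ← (Am_restricts hq).coprod (Am_restricts hq) ha hb]
    exact hW.mm a (vecIdx_succ_mem ha) b (vecIdx_succ_mem hb) _ hx
  pp a ha b hb x hx := by
    rw [mem_lastSlice, ← (Pm_restricts hq).coprod (Pm_restricts hq) ha hb]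
    exact hW.pp a (vecIdx_succ_mem ha) b (vecIdx_succ_mem hb) _ hx
  mp a ha b hb x hx := by
    have := hW.mp a (vecIdx_succ_mem ha) b (vecIdx_succ_mem hb) _ hx
    rw [Matrix.add_mulVec, Matrix.smul_mulVec, Matrix.smul_mulVec,
      (Am_restricts hq).coprod (Pm_restricts hq) ha hb, (Pm_restricts hq).coprod (Am_restricts hq) ha hb,
      ← tvec_smul, ← tvec_smul, ← tvec_add] at this
    rw [mem_lastSlice, Matrix.add_mulVec, Matrix.smul_mulVec, Matrix.smul_mulVec]
    exact this

theorem bv_eq_tvec {N : ℕ} (c : PSt (N + 1)) :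
    bv c = tvec (bv (splitLast N c).1) (Pi.single (splitLast N c).2 1) := by
  funext r
  by_cases h : r = c
  · simp [tvec, bv, h]
  · rw [tvec, bv, bv, Pi.single_eq_of_ne h]
    by_cases h1 : (splitLast N r).1 = (splitLast N c).1
    · have h2 : (splitLast N r).2 ≠ (splitLast N c).2 := fun h2 =>
        h ((splitLast N).injective (Prod.ext h1 h2))
      rw [Pi.single_eq_of_ne h2, mul_zero]
    · rw [Pi.single_eq_of_ne h1, zero_mul]

end

/-! ### Cyclicity -/

section
variable {N : ℕ} {i j : Fin N}

theorem hopSt_right {ε δ : ℤˣ} {c : Fin N → ℤˣ} (h : c i = -ε) : hopSt i j ε δ c j = -δ := by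
  by_cases h' : c j = δ
  · rw [hopSt_of ⟨h, h'⟩, flip2_right, h']
  · rw [hopSt_of_not fun h'' => h' h''.2, Int.units_ne_iff_eq_neg.1 h']

theorem hopSt_left {ε δ : ℤˣ} {c : Fin N → ℤˣ} (h : c j = δ) : hopSt i j ε δ c i = ε := by
  by_cases h' : c i = -ε
  · rw [hopSt_of ⟨h', h⟩, flip2_left, h', neg_neg]
  · rw [hopSt_of_not fun h'' => h' h''.1, Int.units_ne_iff_eq_neg.1 h', neg_neg]

theorem flip2_comm {i' j' : Fin N} (c : Fin N → ℤˣ) :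
    flip2 i j (flip2 i' j' c) = flip2 i' j' (flip2 i j c) := by
  funext k
  simp only [flip2]
  split_ifs <;> rfl

theorem parN_neg (c : Fin N → ℤˣ) : parN (-c) = (-1) ^ N * parN c := by
  simp [parN, Finset.prod_neg, ← mul_assoc, ← mul_pow]

/-- The class of the state `(σ, -σ)` modulo `W`. -/
def mixCl (W : Submodule ℂ (PSt N → ℂ)) (σ : Fin N → ℤˣ) : (PSt N → ℂ) ⧸ W := W.mkQ (bv (σ, -σ))

/-- All states of a sector with equal spins at a site belong to `W`. -/
def HasEqual (W : Submodule ℂ (PSt N → ℂ)) (ε₁ ε₂ : ℤˣ) (k : Fin N) : Prop :=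
  ∀ r : PSt N, parN r.1 = ε₁ → parN r.2 = ε₂ → r.1 k = r.2 k → bv r ∈ W

variable {W : Submodule ℂ (PSt N → ℂ)} {ε₁ ε₂ : ℤˣ}

/-- The state `(σ, flip2 i j (-σ))` has equal spins at `i`, so it lies in `W`, and hopping from it
relates two states with opposite spins everywhere. -/
theorem Hop.mixCl_rel {ε δ : ℤˣ} {d d' : (Fin N → ℤˣ) → ℂ} (h : Hop W i j ε δ d d') (hij : i ≠ j)
    (hW : HasEqual W ε₁ ε₂ i) {σ : Fin N → ℤˣ} (h1 : parN σ = ε₁) (h2 : parN (-σ) = ε₂)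
    (ha : Allowed i j ε δ σ) :
    d (flip2 i j (-σ)) • mixCl W (flip2 i j σ) + d' σ • mixCl W σ = 0 := by
  have hs : bv (σ, flip2 i j (-σ)) ∈ W := hW _ h1 (by rw [parN_flip2 hij, h2]) (by simp)
  have := h.rel _ hs ha ⟨by simpa using ha.1, by simpa using ha.2⟩
  rw [flip2_flip2] at this
  rw [mixCl, mixCl, ← flip2_neg, ← map_smul, ← map_smul, ← map_add]
  exact (Submodule.Quotient.mk_eq_zero W).2 this

/-- If the spins at `i` are equal, undoing a suitable hop makes the spins at `j` equal, and those
states are already in `W`. -/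
theorem HasEqual.push {d₁ d₁' d₂ d₂' : (Fin N → ℤˣ) → ℂ} (hij : i ≠ j)
    (h₁ : Hop W i j (-1) (-1) d₁ d₁') (h₂ : Hop W i j 1 1 d₂ d₂') (hW : HasEqual W ε₁ ε₂ j) :
    HasEqual W ε₁ ε₂ i := by
  rintro ⟨r₁, r₂⟩ h1 h2 (h : r₁ i = r₂ i)
  rcases Int.units_eq_one_or (r₁ i) with hr | hr
  · refine h₂.mem (fun h' => ?_) (fun h' => ?_) (hW _ ?_ ?_ ?_)
    · exact absurd (hr.symm.trans h'.1) (by decide)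
    · exact absurd ((h.symm.trans hr).symm.trans h'.1) (by decide)
    · rw [parN_hopSt hij]; exact h1
    · rw [parN_hopSt hij]; exact h2
    · change hopSt i j _ _ r₁ j = hopSt i j _ _ r₂ j
      rw [hopSt_right (by rw [hr]; decide), hopSt_right (by rw [← h, hr]; decide)]
  · refine h₁.mem (fun h' => ?_) (fun h' => ?_) (hW _ ?_ ?_ ?_)
    · exact absurd (hr.symm.trans h'.1) (by decide)
    · exact absurd ((h.symm.trans hr).symm.trans h'.1) (by decide)
    · rw [parN_hopSt hij]; exact h1
    · rw [parN_hopSt hij]; exact h2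
    · change hopSt i j _ _ r₁ j = hopSt i j _ _ r₂ j
      rw [hopSt_right (by rw [hr]; decide), hopSt_right (by rw [← h, hr]; decide)]

end

section
variable {q : ℝ} {n : ℕ} {u v : ℂ} {W : Submodule ℂ (PSt (n + 2) → ℂ)} {ε₁ ε₂ : ℤˣ}

/-- Equal spins `-` at the last site are the hypothesis, equal spins `+` there need the affine hop,
and `HasEqual.push` carries the property to the left. -/
theorem Stable.hasEqual (hW : Stable q (n + 1) u v W) (hq : q ≠ 0) (hq2 : (q : ℂ) ^ 2 - 1 ≠ 0)
    (hu : u ≠ 0) (hv : v ≠ 0)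
    (h0 : ∀ r : PSt (n + 2), parN r.1 = ε₁ → parN r.2 = ε₂ → r.1 (Fin.last _) = -1 →
      r.2 (Fin.last _) = -1 → bv r ∈ W) (k : Fin (n + 2)) : HasEqual W ε₁ ε₂ k := by
  have hval : ∀ k : Fin (n + 1), ((k.succ : Fin (n + 2)) : ℕ) = (k.castSucc : Fin (n + 2)) + 1 :=
    fun k => by simp
  have hne : ∀ k : Fin (n + 1), k.castSucc ≠ k.succ := fun k => (Fin.castSucc_lt_succ).ne
  have hR := fun k : Fin (n + 1) => hW.hop_mm hq hq2 (hval k) (Or.inl rfl)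
  have hL := fun k : Fin (n + 1) => hW.hop_pp hq hq2 (hval k)
  induction k using Fin.reverseInduction with
  | cast k ih => exact ih.push (hne k) (hR k) (hL k)
  | last =>
    rintro ⟨r₁, r₂⟩ h1 h2 (h : r₁ _ = r₂ _)
    -- For last spins `+`, undoing the affine hop makes both spins at the preceding site `-`.
    -- Undoing an ordinary hop then makes the last spins `-`, where `h0` applies.
    rcases Int.units_eq_one_or (r₁ (Fin.last _)) with hr | hr
    · have hr' := h.symm.trans hr
      have hne := hne (Fin.last n)
      have hR := hR (Fin.last n)
      have hA := hW.hop_mp hq hq2 hu hv (hval (Fin.last n)) (by simp) (Or.inl rfl)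
      rw [Fin.succ_last] at *
      refine hA.mem (fun h' => ?_) (fun h' => ?_) (hR.mem (fun h' => ?_) (fun h' => ?_) (h0 _ ?_ ?_ ?_ ?_))
      · exact absurd (hr.symm.trans h'.2) (by decide)
      · exact absurd (hr'.symm.trans h'.2) (by decide)
      · exact absurd ((hopSt_left (hr.trans (by decide))).symm.trans h'.1) (by decide)
      · exact absurd ((hopSt_left (hr'.trans (by decide))).symm.trans h'.1) (by decide)
      · rw [parN_hopSt hne, parN_hopSt hne]; exact h1
      · rw [parN_hopSt hne, parN_hopSt hne]; exact h2
      · exact (hopSt_right ((hopSt_left (hr.trans (by decide))).trans (by decide))).trans (by decide)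
      · exact (hopSt_right ((hopSt_left (hr'.trans (by decide))).trans (by decide))).trans (by decide)
    · exact h0 _ h1 h2 hr (h.symm.trans hr)

theorem Stable.mixCl_swap (hW : Stable q (n + 1) u v W) (hq : q ≠ 0) (hq2 : (q : ℂ) ^ 2 - 1 ≠ 0)
    (hE : ∀ k, HasEqual W ε₁ ε₂ k) {i j : Fin (n + 2)} (hij : (j : ℕ) = i + 1) {ε : ℤˣ}
    (hε : ε = 1 ∨ (i : ℕ) = 0) {σ : Fin (n + 2) → ℤˣ} (h1 : parN σ = ε₁) (h2 : parN (-σ) = ε₂)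
    (hi : σ i = ε) (hj : σ j = -1) : mixCl W σ = -(q : ℂ) • mixCl W (flip2 i j σ) := by
  have hQ : (q : ℂ) ≠ 0 := by exact_mod_cast hq
  have hne : i ≠ j := fun h => by rw [h] at hij; omega
  have := (hW.hop_mm hq hq2 hij hε).mixCl_rel hne (hE i) h1 h2 ⟨by rw [hi, neg_neg], hj⟩
  rw [flip2_left, Pi.neg_apply, neg_neg, hi, hj] at this
  have e1 : (ov (q : ℂ) ε ε)⁻¹ = q := by
    rcases Int.units_eq_one_or ε with rfl | rfl <;> simp [ov]
  have e2 : (ov (q : ℂ) 1 (-1))⁻¹ = 1 := by simp [ov]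
  rw [e1, e2, one_smul] at this
  rw [neg_smul]
  exact eq_neg_of_add_eq_zero_right this

theorem Stable.mixCl_affine (hW : Stable q (n + 1) u v W) (hq : q ≠ 0) (hq2 : (q : ℂ) ^ 2 - 1 ≠ 0)
    (hu : u ≠ 0) (hv : v ≠ 0)
    (hE : ∀ k, HasEqual W ε₁ ε₂ k) {i j : Fin (n + 2)} (hij : (j : ℕ) = i + 1) (hj : (j : ℕ) = n + 1)
    {ε : ℤˣ} (hε : ε = -1 ∨ (i : ℕ) = 0) {σ : Fin (n + 2) → ℤˣ} (h1 : parN σ = ε₁)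
    (h2 : parN (-σ) = ε₂) (hi : σ i = ε) (hj' : σ j = -1) :
    v • mixCl W σ = -(u * (q : ℂ)⁻¹) • mixCl W (flip2 i j σ) := by
  have hQ : (q : ℂ) ≠ 0 := by exact_mod_cast hq
  have hne : i ≠ j := fun h => by rw [h] at hij; omega
  have := (hW.hop_mp hq hq2 hu hv hij hj hε).mixCl_rel hne (hE i) h1 h2 ⟨by rw [hi, neg_neg], hj'⟩
  rw [flip2_left, Pi.neg_apply, neg_neg, hi, hj'] at this
  have e1 : ov (q : ℂ) ε ε = (q : ℂ)⁻¹ := by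
    rcases Int.units_eq_one_or ε with rfl | rfl <;> simp [ov]
  have e2 : ov (q : ℂ) 1 (-1) = 1 := by simp [ov]
  rw [e1, e2, mul_one] at this
  rw [neg_smul]
  exact eq_neg_of_add_eq_zero_right this

/-- At the first two sites the branching generator flips a pair `-, -` at the cost `-q`. Further
right the flip is conjugated by exchanges with the neighbouring site, and each step costs another
`q²`. -/
theorem Stable.mixCl_create (hW : Stable q (n + 1) u v W) (hq : q ≠ 0) (hq2 : (q : ℂ) ^ 2 - 1 ≠ 0)
    (hE : ∀ k, HasEqual W ε₁ ε₂ k) (t : ℕ) : ∀ {i j : Fin (n + 2)}, (i : ℕ) = t → (j : ℕ) = i + 1 →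
    ∀ {σ : Fin (n + 2) → ℤˣ}, parN σ = ε₁ → parN (-σ) = ε₂ → σ i = -1 → σ j = -1 →
      mixCl W σ = -(q : ℂ) ^ (2 * t + 1) • mixCl W (flip2 i j σ) := by
  induction t with
  | zero =>
    intro i j hi hij σ h1 h2 hi' hj'
    rw [hW.mixCl_swap hq hq2 hE hij (Or.inr hi) h1 h2 hi' hj']
    simp
  | succ t ih =>
    intro j k hj hjk σ h1 h2 hj' hk'
    obtain ⟨i, hi⟩ : ∃ i : Fin (n + 2), (i : ℕ) = t := ⟨⟨t, by omega⟩, rfl⟩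
    have hij : (j : ℕ) = i + 1 := by omega
    have nij : i ≠ j := fun h => by rw [h] at hij; omega
    have njk : j ≠ k := fun h => by rw [h] at hjk; omega
    have nik : i ≠ k := fun h => by rw [h] at hij; omega
    have e : flip2 i j (flip2 j k (flip2 i j σ)) = flip2 j k σ := by
      rw [flip2_comm, flip2_flip2]
    have f1 : parN (flip2 i j σ) = ε₁ := by rw [parN_flip2 nij, h1]
    have f2 : parN (-flip2 i j σ) = ε₂ := by rw [← flip2_neg, parN_flip2 nij, h2]
    have g1 : parN (flip2 j k (flip2 i j σ)) = ε₁ := by rw [parN_flip2 njk, f1]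
    have g2 : parN (-flip2 j k (flip2 i j σ)) = ε₂ := by rw [← flip2_neg, parN_flip2 njk, f2]
    have vj : flip2 i j σ j = 1 := by rw [flip2_right, hj', neg_neg]
    have vk : flip2 i j σ k = -1 := by rw [flip2_of_ne _ nik.symm njk.symm, hk']
    have wi : flip2 j k (flip2 i j σ) i = -σ i := by rw [flip2_of_ne _ nij nik, flip2_left]
    have wj : flip2 j k (flip2 i j σ) j = -1 := by rw [flip2_left, vj]
    -- Depending on the spin to the left, the two exchanges come before the flip of the pair at `i,
    -- j`, or after it.
    rcases Int.units_eq_one_or (σ i) with hs | hs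
    · rw [hW.mixCl_swap hq hq2 hE hij (Or.inl rfl) h1 h2 hs hj',
        hW.mixCl_swap hq hq2 hE hjk (Or.inl rfl) f1 f2 vj vk,
        ih hi hij g1 g2 (by rw [wi, hs]) wj, e, smul_smul, smul_smul]
      congr 1
      ring
    · rw [ih hi hij h1 h2 hs hj', hW.mixCl_swap hq hq2 hE hjk (Or.inl rfl) f1 f2 vj vk,
        hW.mixCl_swap hq hq2 hE hij (Or.inl rfl) g1 g2 (by rw [wi, hs, neg_neg]) wj, e, smul_smul, smul_smul]
      congr 1
      ring

/-- A pair `-, -` at the last two sites can be flipped by the affine generator or through the finite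
ones. The two proportionality factors agree only for `u = q^(2n + 2) v`, which regularity excludes,
so the classes vanish. -/
theorem Stable.mixCl_eq_zero (hW : Stable q (n + 1) u v W) (hq : q ≠ 0) (hq2 : (q : ℂ) ^ 2 - 1 ≠ 0)
    (hu : u ≠ 0) (hv : v ≠ 0) (hr : Regular q (ε₁ * ε₂) u v)
    (hE : ∀ k, HasEqual W ε₁ ε₂ k) {σ : Fin (n + 2) → ℤˣ} (h1 : parN σ = ε₁) (h2 : parN (-σ) = ε₂) :
    mixCl W σ = 0 := by
  have hQ : (q : ℂ) ≠ 0 := by exact_mod_cast hq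
  obtain ⟨i, hi⟩ : ∃ i : Fin (n + 2), (i : ℕ) = n := ⟨⟨n, by omega⟩, rfl⟩
  obtain ⟨j, hj⟩ : ∃ j : Fin (n + 2), (j : ℕ) = n + 1 := ⟨⟨n + 1, by omega⟩, rfl⟩
  have hij : (j : ℕ) = i + 1 := by omega
  have nij : i ≠ j := fun h => by rw [h] at hij; omega
  have par_flip : ∀ {i' j' : Fin (n + 2)} {σ : Fin (n + 2) → ℤˣ}, (j' : ℕ) = i' + 1 →
      parN σ = ε₁ ∧ parN (-σ) = ε₂ →
      parN (flip2 i' j' σ) = ε₁ ∧ parN (-flip2 i' j' σ) = ε₂ := fun {i' j'} {σ} hne h => by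
    have hne : i' ≠ j' := fun h => by rw [h] at hne; omega
    rw [← flip2_neg, parN_flip2 hne, parN_flip2 hne]
    exact h
  -- The parities of `σ` and `-σ` on `n + 2` sites have product `(-1)^n`, so the value in question
  -- is among those excluded for this sector.
  have hcoef : u * (q : ℂ)⁻¹ - v * (q : ℂ) ^ (2 * n + 1) ≠ 0 := by
    have hpar : (-1 : ℤˣ) ^ (n : ℤ) = ε₁ * ε₂ := by
      rw [parN_neg, h1] at h2
      rw [← h2, mul_comm, mul_assoc, Int.units_mul_self, mul_one, pow_add]
      simp
    intro h
    refine hr n hpar ?_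
    have : (q : ℂ) ^ (2 * (n : ℤ) + 2) = (q : ℂ) ^ (2 * n + 1) * q := by
      rw [← pow_succ, ← zpow_natCast]
      push_cast
      ring_nf
    rw [this]
    field_simp at h
    linear_combination h
  have cancel : ∀ x y : (PSt (n + 2) → ℂ) ⧸ W, v • x = -(u * (q : ℂ)⁻¹) • y →
      x = -(q : ℂ) ^ (2 * n + 1) • y → x = 0 := by
    intro x y hx hxy
    have h3 : (u * (q : ℂ)⁻¹ - v * (q : ℂ) ^ (2 * n + 1)) • y = 0 := by
      rw [hxy] at hx
      linear_combination (norm := module) hx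
    rw [hxy, (smul_eq_zero.1 h3).resolve_left hcoef, smul_zero]
  have down : ∀ σ : Fin (n + 2) → ℤˣ, parN σ = ε₁ ∧ parN (-σ) = ε₂ → σ i = -1 → σ j = -1 →
      mixCl W σ = 0 := fun σ h hi' hj' =>
    cancel _ _ (hW.mixCl_affine hq hq2 hu hv hE hij hj (Or.inl rfl) h.1 h.2 hi' hj')
      (hW.mixCl_create hq hq2 hE n hi hij h.1 h.2 hi' hj')
  have up : ∀ σ : Fin (n + 2) → ℤˣ, parN σ = ε₁ ∧ parN (-σ) = ε₂ → σ i = 1 → σ j = 1 →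
      mixCl W σ = 0 := fun σ h hi' hj' => by
    have h3 : flip2 i j σ i = -1 := by rw [flip2_left, hi']
    have h4 : flip2 i j σ j = -1 := by rw [flip2_right, hj']
    have h5 := down _ (par_flip hij h) h3 h4
    rw [hW.mixCl_create hq hq2 hE n hi hij (par_flip hij h).1 (par_flip hij h).2 h3 h4, flip2_flip2] at h5
    exact (smul_eq_zero.1 h5).resolve_left (neg_ne_zero.2 (pow_ne_zero _ hQ))
  have unequal : ∀ σ : Fin (n + 2) → ℤˣ, parN σ = ε₁ ∧ parN (-σ) = ε₂ → σ i = 1 → σ j = -1 →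
      mixCl W σ = 0 := fun σ h hi' hj' => by
    have hs := hW.mixCl_swap hq hq2 hE hij (Or.inl rfl) h.1 h.2 hi' hj'
    -- With two sites the second affine generator relates the same two states as the exchange, and
    -- `cancel` applies. Otherwise a third site serves to reach a state covered by `up`.
    rcases n.eq_zero_or_pos with rfl | hn
    · exact cancel _ _ (hW.mixCl_affine hq hq2 hu hv hE hij hj (Or.inr hi) h.1 h.2 hi' hj') (by simpa using hs)
    · obtain ⟨o, ho⟩ : ∃ o : Fin (n + 2), (o : ℕ) = n - 1 := ⟨⟨n - 1, by omega⟩, rfl⟩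
      have hoi : (i : ℕ) = o + 1 := by omega
      have noj : j ≠ o := fun h => by rw [h] at hij; omega
      have h3 := par_flip hij h
      have vi : flip2 i j σ i = -1 := by rw [flip2_left, hi']
      have vj : flip2 i j σ j = 1 := by rw [flip2_right, hj', neg_neg]
      have h4 := up _ (par_flip hoi h3) (by rw [flip2_right, vi, neg_neg])
        (by rw [flip2_of_ne _ noj nij.symm, vj])
      rw [hs]
      rcases Int.units_eq_one_or (flip2 i j σ o) with h5 | h5
      · rw [hW.mixCl_swap hq hq2 hE hoi (Or.inl rfl) h3.1 h3.2 h5 vi, h4, smul_zero, smul_zero]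
      · rw [hW.mixCl_create hq hq2 hE _ ho hoi h3.1 h3.2 h5 vi, h4, smul_zero, smul_zero]
  rcases Int.units_eq_one_or (σ i) with hi' | hi' <;> rcases Int.units_eq_one_or (σ j) with hj' | hj'
  · exact up σ ⟨h1, h2⟩ hi' hj'
  · exact unequal σ ⟨h1, h2⟩ hi' hj'
  · have h3 := unequal _ (par_flip hij ⟨h1, h2⟩) (by rw [flip2_left, hi', neg_neg]) (by rw [flip2_right, hj'])
    rw [hW.mixCl_swap hq hq2 hE hij (Or.inl rfl) (par_flip hij ⟨h1, h2⟩).1 (par_flip hij ⟨h1, h2⟩).2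
      (by rw [flip2_left, hi', neg_neg]) (by rw [flip2_right, hj']), flip2_flip2] at h3
    exact (smul_eq_zero.1 h3).resolve_left (neg_ne_zero.2 hQ)
  · exact down σ ⟨h1, h2⟩ hi' hj'

end

theorem hw_succ_last (n : ℕ) (ε : ℤˣ) : hw (n + 1) ε (Fin.last (n + 1)) = -1 := by
  simp [hw]

theorem init_hw_succ (n : ℕ) (ε : ℤˣ) : Fin.init (hw (n + 1) ε) = hw n ε := by
  funext k
  simp [Fin.init, hw]

/-- The product of the highest weight vectors generates a sector. -/
theorem Stable.bv_mem {q : ℝ} (hq : q ≠ 0) (hq2 : (q : ℂ) ^ 2 - 1 ≠ 0) {u v : ℂ} (hu : u ≠ 0)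
    (hv : v ≠ 0) {ε₁ ε₂ : ℤˣ} (hr : Regular q (ε₁ * ε₂) u v) {n : ℕ}
    {W : Submodule ℂ (PSt (n + 1) → ℂ)} (hW : Stable q n u v W) (h0 : bv (hw n ε₁, hw n ε₂) ∈ W)
    (r : PSt (n + 1)) (h1 : parN r.1 = ε₁) (h2 : parN r.2 = ε₂) : bv r ∈ W := by
  induction n with
  | zero =>
    have key : ∀ (ε : ℤˣ) (m : Fin 1 → ℤˣ), parN m = ε → hw 0 ε = m := by
      intro ε m hm
      funext k
      obtain rfl : k = 0 := Fin.fin_one_eq_zero k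
      rw [← hm, parN, Fin.prod_univ_one]
      rcases Int.units_eq_one_or (m 0) with h | h <;> simp [hw, h]
    rw [key _ _ h1, key _ _ h2] at h0
    exact h0
  | succ n ih =>
    -- States with last spins `-` come from the induction hypothesis for the slice of `W`; the
    -- highest weight vectors are of this kind.
    have hlast : ∀ r : PSt (n + 2), parN r.1 = ε₁ → parN r.2 = ε₂ → r.1 (Fin.last _) = -1 →
        r.2 (Fin.last _) = -1 → bv r ∈ W := by
      intro r h1 h2 h3 h4
      have h5 : (splitLast (n + 1) r).2 = (-1, -1) := Prod.ext h3 h4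
      rw [bv_eq_tvec, h5, ← mem_lastSlice]
      refine ih (hW.lastSlice hq) ?_ _ ?_ ?_
      · have h6 : splitLast (n + 1) (hw (n + 1) ε₁, hw (n + 1) ε₂) = ((hw n ε₁, hw n ε₂), (-1, -1)) :=
          Prod.ext (Prod.ext (init_hw_succ n ε₁) (init_hw_succ n ε₂))
            (Prod.ext (hw_succ_last n ε₁) (hw_succ_last n ε₂))
        rw [bv_eq_tvec, h6] at h0
        exact h0
      · rw [← h1, parN_init r.1, h3, neg_neg, mul_one]
        rfl
      · rw [← h2, parN_init r.2, h4, neg_neg, mul_one]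
        rfl
    have hE := hW.hasEqual hq hq2 hu hv hlast
    -- A state without a site of equal spins has the form `(σ, -σ)`, and its class in the quotient
    -- is `mixCl W σ`.
    by_cases hr' : ∃ k, r.1 k = r.2 k
    · obtain ⟨k, hk⟩ := hr'
      exact hE k r h1 h2 hk
    · obtain ⟨r₁, r₂⟩ := r
      have : r₂ = -r₁ := funext fun k => by
        rw [Pi.neg_apply, ← Int.units_ne_iff_eq_neg]
        exact fun h => hr' ⟨k, h.symm⟩
      subst this
      exact (Submodule.Quotient.mk_eq_zero W).1 (hW.mixCl_eq_zero hq hq2 hu hv hr hE h1 h2)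

/-! ### Uniqueness of the R-matrix -/

section
variable {q : ℝ} {n : ℕ}

theorem sub_kronecker (A A' B : Op n) : (A - A') ⊗ₖ B = A ⊗ₖ B - A' ⊗ₖ B := by
  ext; simp [sub_mul]

theorem kronecker_sub (A B B' : Op n) : A ⊗ₖ (B - B') = A ⊗ₖ B - A ⊗ₖ B' := by
  ext; simp [mul_sub]

/-- After clearing denominators the coproduct is quadratic in `w`; its three coefficients are the
operators in `Stable`. -/
theorem coprod_LP (ρ ρ' w : ℂ) (a b : ℤ) : coprod n (LP q n ρ w) (LP q n ρ' w) a b =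
    ((w - ρ)⁻¹ * (w - ρ')⁻¹) • (w ^ 2 • coprod n (Am q n) (Am q n) a b -
      w • (ρ' • coprod n (Am q n) (Pm q n) a b + ρ • coprod n (Pm q n) (Am q n) a b) +
      (ρ * ρ') • coprod n (Pm q n) (Pm q n) a b) := by
  simp only [coprod, Finset.smul_sum, ← Finset.sum_add_distrib, ← Finset.sum_sub_distrib]
  refine Finset.sum_congr rfl fun k _ => ?_
  rw [LP_eq_Am_sub_Pm, LP_eq_Am_sub_Pm]
  simp only [Matrix.smul_kronecker, Matrix.kronecker_smul, sub_kronecker, kronecker_sub]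
  module

theorem coprodOp_LP (ρ ρ' w : ℂ) (a b : ℤ) : coprodOp n (LP q n ρ w) (LP q n ρ' w) a b =
    ((w - ρ)⁻¹ * (w - ρ')⁻¹) • (w ^ 2 • coprodOp n (Am q n) (Am q n) a b -
      w • (ρ' • coprodOp n (Am q n) (Pm q n) a b + ρ • coprodOp n (Pm q n) (Am q n) a b) +
      (ρ * ρ') • coprodOp n (Pm q n) (Pm q n) a b) := by
  simp only [coprodOp, Finset.smul_sum, ← Finset.sum_add_distrib, ← Finset.sum_sub_distrib]
  refine Finset.sum_congr rfl fun k _ => ?_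
  rw [LP_eq_Am_sub_Pm, LP_eq_Am_sub_Pm]
  simp only [Matrix.smul_kronecker, Matrix.kronecker_smul, sub_kronecker, kronecker_sub]
  module

theorem quadratic_coeffs_eq_zero {M : Type} [AddCommGroup M] [Module ℂ M] {x y z : M} {u v : ℂ}
    (h : ∀ w : ℂ, w ≠ 0 → w ≠ u → w ≠ v → w ^ 2 • x - w • y + z = 0) : x = 0 ∧ y = 0 ∧ z = 0 := by
  -- The points `t`, `2 t`, `3 t` avoid `0`, `u` and `v` by their size, and three points determine a
  -- quadratic polynomial.
  obtain ⟨t, ht⟩ : ∃ t : ℝ, t = 1 + ‖u‖ + ‖v‖ := ⟨_, rfl⟩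
  have hu := norm_nonneg u
  have hv := norm_nonneg v
  have hne : ∀ k : ℝ, 1 ≤ k → ((k * t : ℝ) : ℂ) ≠ 0 ∧ ((k * t : ℝ) : ℂ) ≠ u ∧ ((k * t : ℝ) : ℂ) ≠ v := by
    intro k hk
    have h1 : t ≤ k * t := by nlinarith
    have h2 : ‖((k * t : ℝ) : ℂ)‖ = k * t := by
      rw [Complex.norm_real, Real.norm_of_nonneg (by linarith)]
    refine ⟨fun h => ?_, fun h => ?_, fun h => ?_⟩
    · rw [h, norm_zero] at h2; linarith
    · rw [h] at h2; linarith
    · rw [h] at h2; linarith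
  have h1 := h _ (hne 1 le_rfl).1 (hne 1 le_rfl).2.1 (hne 1 le_rfl).2.2
  have h2 := h _ (hne 2 (by norm_num)).1 (hne 2 (by norm_num)).2.1 (hne 2 (by norm_num)).2.2
  have h3 := h _ (hne 3 (by norm_num)).1 (hne 3 (by norm_num)).2.1 (hne 3 (by norm_num)).2.2
  have ht0 : (t : ℂ) ≠ 0 := by
    have : t ≠ 0 := by linarith
    exact_mod_cast this
  push_cast at h1 h2 h3
  have hx : x = 0 := by
    have : (2 * (t : ℂ) ^ 2) • x = 0 := by
      linear_combination (norm := module) h1 - (2 : ℂ) • h2 + h3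
    exact (smul_eq_zero.1 this).resolve_left (by simp [ht0])
  subst hx
  have hy : y = 0 := by
    have : (t : ℂ) • y = 0 := by
      linear_combination (norm := module) h1 - h2
    exact (smul_eq_zero.1 this).resolve_left ht0
  subst hy
  simp only [smul_zero, sub_zero, zero_add] at h1
  exact ⟨rfl, rfl, h1⟩

theorem intertwine_coeffs {u v : ℂ} {S : Op₂ n} {a b : ℤ}
    (h : ∀ w : ℂ, w ≠ 0 → w ≠ u → w ≠ v →
      coprodOp n (LP q n v w) (LP q n u w) a b * S = S * coprod n (LP q n v w) (LP q n u w) a b) :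
    coprodOp n (Am q n) (Am q n) a b * S = S * coprod n (Am q n) (Am q n) a b ∧
    (u • coprodOp n (Am q n) (Pm q n) a b + v • coprodOp n (Pm q n) (Am q n) a b) * S =
      S * (u • coprod n (Am q n) (Pm q n) a b + v • coprod n (Pm q n) (Am q n) a b) ∧
    (v * u) • (coprodOp n (Pm q n) (Pm q n) a b * S) =
      (v * u) • (S * coprod n (Pm q n) (Pm q n) a b) := by
  have key := quadratic_coeffs_eq_zero
    (x := coprodOp n (Am q n) (Am q n) a b * S - S * coprod n (Am q n) (Am q n) a b)
    (y := (u • coprodOp n (Am q n) (Pm q n) a b + v • coprodOp n (Pm q n) (Am q n) a b) * S -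
      S * (u • coprod n (Am q n) (Pm q n) a b + v • coprod n (Pm q n) (Am q n) a b))
    (z := (v * u) • (coprodOp n (Pm q n) (Pm q n) a b * S) -
      (v * u) • (S * coprod n (Pm q n) (Pm q n) a b)) (u := u) (v := v) fun w h0 hu hv => by
    have hw := h w h0 hu hv
    rw [coprod_LP, coprodOp_LP, Matrix.smul_mul, Matrix.mul_smul] at hw
    have hw := smul_right_injective _
      (mul_ne_zero (inv_ne_zero (sub_ne_zero.2 hv)) (inv_ne_zero (sub_ne_zero.2 hu))) hw
    simp only [add_mul, sub_mul, mul_add, mul_sub, Matrix.smul_mul, Matrix.mul_smul] at hw ⊢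
    linear_combination (norm := module) hw
  exact ⟨sub_eq_zero.1 key.1, sub_eq_zero.1 key.2.1, sub_eq_zero.1 key.2.2⟩

theorem stable_ker {u v : ℂ} (hu : u ≠ 0) (hv : v ≠ 0) {S : Op₂ n}
    (h : ∀ a ∈ vecIdx n, ∀ b ∈ vecIdx n, ∀ w : ℂ, w ≠ 0 → w ≠ u → w ≠ v →
      coprodOp n (LP q n v w) (LP q n u w) a b * S = S * coprod n (LP q n v w) (LP q n u w) a b) :
    Stable q n u v (LinearMap.ker S.mulVecLin) := by
  have key : ∀ A B : Op₂ n, A * S = S * B → ∀ x ∈ LinearMap.ker S.mulVecLin,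
      B.mulVec x ∈ LinearMap.ker S.mulVecLin := fun A B hAB x hx => by
    rw [LinearMap.mem_ker, Matrix.mulVecLin_apply] at *
    rw [Matrix.mulVec_mulVec, ← hAB, ← Matrix.mulVec_mulVec, hx, Matrix.mulVec_zero]
  exact ⟨fun a ha b hb => key _ _ (intertwine_coeffs (h a ha b hb)).1,
    fun a ha b hb => key _ _ (smul_right_injective _ (mul_ne_zero hv hu)
      (intertwine_coeffs (h a ha b hb)).2.2), fun a ha b hb => key _ _ (intertwine_coeffs (h a ha b hb)).2.1⟩

theorem coprod_Am_diag (hq : q ≠ 0) {t : ℕ} (ht : t < n + 1) :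
    coprod n (Am q n) (Am q n) (ix t 1) (ix t 1) =
      Matrix.diagonal fun c : PSt (n + 1) => (wv q (c.1 ⟨t, ht⟩) * wv q (c.2 ⟨t, ht⟩))⁻¹ := by
  rw [coprod, Finset.sum_eq_single_of_mem _ (ix_mem ht 1), Am_self hq ht,
    Matrix.diagonal_kronecker_diagonal]
  · congr 1
    funext c
    rw [mul_inv]
    rfl
  · intro k _ hk
    rcases lt_or_gt_of_ne hk with h | h
    · rw [Am_of_lt h, Matrix.kronecker_zero]
    · rw [Am_of_lt h, Matrix.zero_kronecker]

theorem coprodOp_Am_diag (hq : q ≠ 0) {t : ℕ} (ht : t < n + 1) :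
    coprodOp n (Am q n) (Am q n) (ix t 1) (ix t 1) =
      Matrix.diagonal fun c : PSt (n + 1) => (wv q (c.1 ⟨t, ht⟩) * wv q (c.2 ⟨t, ht⟩))⁻¹ := by
  rw [coprodOp, Finset.sum_eq_single_of_mem _ (ix_mem ht 1), Am_self hq ht,
    Matrix.diagonal_kronecker_diagonal]
  · congr 1
    funext c
    rw [mul_inv]
    rfl
  · intro k _ hk
    rcases lt_or_gt_of_ne hk with h | h
    · rw [Am_of_lt h, Matrix.zero_kronecker]
    · rw [Am_of_lt h, Matrix.kronecker_zero]

theorem wv_mul_eq_one {Q : ℂ} (h1 : Q ≠ 1) (h2 : Q ^ 2 ≠ 1) {σ τ : ℤˣ} (h : wv Q σ * wv Q τ = 1) :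
    σ = -1 ∧ τ = -1 := by
  have h3 : Q⁻¹ ≠ 1 := fun h => h1 (inv_eq_one.1 h)
  have h4 : Q⁻¹ * Q⁻¹ ≠ 1 := fun h => h2 (by rwa [← mul_inv, inv_eq_one, ← pow_two] at h)
  rcases Int.units_eq_one_or σ with rfl | rfl <;> rcases Int.units_eq_one_or τ with rfl | rfl <;>
    simp_all [wv]

theorem eq_hw {m : St n} {ε : ℤˣ} (hp : par m = ε) (h : ∀ k, k ≠ 0 → m k = -1) : m = hw n ε := by
  have h0 : m 0 = hw n ε 0 := by
    rw [par, Fin.prod_univ_succ, Finset.prod_eq_one fun k _ => by rw [h _ (Fin.succ_ne_zero k)]; rfl,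
      mul_one] at hp
    rw [← hp]
    rcases Int.units_eq_one_or (m 0) with h' | h' <;> simp [hw, h']
  funext k
  by_cases hk : k = 0
  · rw [hk, h0]
  · rw [h k hk]; simp [hw, hk]

/-- The kernel of the difference is stable under the coproduct and contains the product of the
highest weight vectors, which generates the sector. -/
theorem IsSpinorR.unique (hq0 : q ≠ 0) (hq : ∀ k : ℕ, 0 < k → q ^ k ≠ 1) {ε₁ ε₂ : ℤˣ} {u v : ℂ}
    (hg : Generic q ε₁ ε₂ u v) {R R' : Op₂ n} (hR : IsSpinorR q n ε₁ ε₂ u v R)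
    (hR' : IsSpinorR q n ε₁ ε₂ u v R') : R = R' := by
  have hQ : (q : ℂ) ≠ 0 := by exact_mod_cast hq0
  have hpow : ∀ k : ℕ, 0 < k → (q : ℂ) ^ k ≠ 1 := fun k hk h => hq k hk (by exact_mod_cast h)
  obtain ⟨hu, hv, hr⟩ := generic_iff.1 hg
  obtain ⟨S, hS⟩ : ∃ S, S = R - R' := ⟨_, rfl⟩
  have hint : ∀ a ∈ vecIdx n, ∀ b ∈ vecIdx n, ∀ w : ℂ, w ≠ 0 → w ≠ u → w ≠ v →
      coprodOp n (LP q n v w) (LP q n u w) a b * S = S * coprod n (LP q n v w) (LP q n u w) a b :=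
    fun a ha b hb w h0 h1 h2 => by
      rw [hS, mul_sub, sub_mul, hR.intertwine_pos a ha b hb w h0 h1 h2,
        hR'.intertwine_pos a ha b hb w h0 h1 h2]
  have hsupp : ∀ r c, S r c ≠ 0 → (par r.1 = ε₁ ∧ par r.2 = ε₂) ∧ (par c.1 = ε₁ ∧ par c.2 = ε₂) := by
    intro r c h
    by_cases h1 : R r c = 0
    · refine hR'.supp r c fun h2 => h ?_
      rw [hS, Matrix.sub_apply, h1, h2, sub_zero]
    · exact hR.supp r c h1
  have hker := stable_ker hu hv hint
  have hhw : bv (hw n ε₁, hw n ε₂) ∈ LinearMap.ker S.mulVecLin := by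
    rw [LinearMap.mem_ker, Matrix.mulVecLin_apply, bv, Matrix.mulVec_single_one]
    funext r
    rw [Matrix.col_apply, Pi.zero_apply]
    by_contra h
    -- The diagonal entries of the coproduct fix the weight, hence all spins at sites other than the
    -- first; the parity then fixes the first one.
    have hr : ∀ k : Fin (n + 1), k ≠ 0 → r.1 k = -1 ∧ r.2 k = -1 := by
      intro k hk
      have hk' := ix_mem k.2 1
      have e := (intertwine_coeffs (hint _ hk' _ hk')).1
      rw [coprod_Am_diag hq0 k.2, coprodOp_Am_diag hq0 k.2] at e
      have e := congrFun (congrFun e r) (hw n ε₁, hw n ε₂)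
      rw [Matrix.diagonal_mul, Matrix.mul_diagonal, mul_comm] at e
      have e := inv_injective (mul_left_cancel₀ h e)
      refine wv_mul_eq_one (by simpa using hpow 1 one_pos) (hpow 2 two_pos) (e.trans ?_)
      simp [hw, hk]
    have hr' : r = (hw n ε₁, hw n ε₂) := Prod.ext (eq_hw (hsupp _ _ h).1.1 fun k hk => (hr k hk).1)
      (eq_hw (hsupp _ _ h).1.2 fun k hk => (hr k hk).2)
    apply h
    rw [hr', hS, Matrix.sub_apply, hR.normalised, hR'.normalised, sub_self]
  have hS0 : S = 0 := by
    ext r c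
    by_contra h
    have h1 := hker.bv_mem hq0 (sub_ne_zero.2 (hpow 2 two_pos)) hu hv hr hhw c (hsupp r c h).2.1
      (hsupp r c h).2.2
    rw [LinearMap.mem_ker, Matrix.mulVecLin_apply, bv, Matrix.mulVec_single_one] at h1
    exact h (congrFun h1 r)
  exact sub_eq_zero.1 (hS.symm.trans hS0)

theorem spinorR_eq_Rmat (hq0 : q ≠ 0) (hq : ∀ k : ℕ, 0 < k → q ^ k ≠ 1) (hn : 1 ≤ n) {ε₁ ε₂ : ℤˣ}
    {u v : ℂ} (hg : Generic q ε₁ ε₂ u v) : spinorR q n ε₁ ε₂ u v = Rmat q n ε₁ ε₂ u v := by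
  have hex := Rmat_isSpinorR hq0 hq hn hg
  have h : ∃ R, IsSpinorR q n ε₁ ε₂ u v R := ⟨_, hex⟩
  rw [spinorR, dif_pos h]
  exact IsSpinorR.unique hq0 hq hg h.choose_spec hex

end

/-! ### Recurrences -/

/-- The operator `M ∘ flip` on the sector with parities `ε₁`, `ε₂`. -/
def flipOn {n : ℕ} (M : Op₂ n) (ε₁ ε₂ : ℤˣ) : Op₂ n := fun r c =>
  if par c.1 = ε₁ ∧ par c.2 = ε₂ then M r c.swap else 0

/-- The operator `M` on the sector with parities `ε₁`, `ε₂`. -/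
def colOn {n : ℕ} (M : Op₂ n) (ε₁ ε₂ : ℤˣ) : Op₂ n := fun r c =>
  if par c.1 = ε₁ ∧ par c.2 = ε₂ then M r c else 0

section
variable {n : ℕ} (M M' : Op₂ n) (ε₁ ε₂ : ℤˣ)

theorem flipOn_add : flipOn (M + M') ε₁ ε₂ = flipOn M ε₁ ε₂ + flipOn M' ε₁ ε₂ := by
  ext r c
  simp only [flipOn, Matrix.add_apply]
  split_ifs <;> simp

theorem flipOn_smul (a : ℂ) : flipOn (a • M) ε₁ ε₂ = a • flipOn M ε₁ ε₂ := by
  ext r c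
  simp only [flipOn, Matrix.smul_apply]
  split_ifs <;> simp

theorem flipOn_mul_secProj {δ : ℤˣ} (h : ε₁ * ε₂ = δ) :
    flipOn (M * secProj (n + 1) δ) ε₁ ε₂ = flipOn M ε₁ ε₂ := by
  ext r c
  simp only [flipOn]
  split_ifs with hc
  · rw [secProj, Matrix.mul_diagonal, if_pos, mul_one]
    change par c.2 * par c.1 = δ
    rw [hc.1, hc.2, mul_comm, h]
  · rfl

theorem flipOn_mul_flipOn_one : flipOn M ε₂ ε₁ * flipOn 1 ε₁ ε₂ = colOn M ε₁ ε₂ := by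
  ext r c
  rw [Matrix.mul_apply, Finset.sum_eq_single_of_mem c.swap (Finset.mem_univ _)]
  · simp only [flipOn, colOn, Matrix.one_apply_eq, Prod.fst_swap, Prod.snd_swap, Prod.swap_swap]
    split_ifs with h1 h2 h2 <;> simp_all
  · intro k _ hk
    rw [show flipOn 1 ε₁ ε₂ k c = 0 by rw [flipOn, Matrix.one_apply_ne hk, ite_self], mul_zero]

variable {ε₁ ε₂}

/-- The flip exchanges the parities and `A` changes each by `ε₁ ε₂`, so the composite preserves the
sector and the projection in between has no effect. -/
theorem colOn_mul_flipOn {A : Op₂ n} (hA : ChangesParities (N := n + 1) (ε₁ * ε₂) A) :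
    colOn M ε₁ ε₂ * flipOn A ε₁ ε₂ = flipOn (M * A) ε₁ ε₂ := by
  ext r c
  simp only [flipOn]
  split_ifs with hc
  · rw [Matrix.mul_apply, Matrix.mul_apply]
    refine Finset.sum_congr rfl fun k _ => ?_
    rw [show flipOn A ε₁ ε₂ k c = A k c.swap from if_pos hc]
    by_cases h : A k c.swap = 0
    · rw [h, mul_zero, mul_zero]
    · obtain ⟨h1, h2⟩ := hA _ _ h
      rw [colOn, if_pos]
      constructor
      · refine h1.trans ?_
        rw [show parN c.swap.1 = ε₂ from hc.2, mul_assoc, Int.units_mul_self, mul_one]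
      · refine h2.trans ?_
        rw [show parN c.swap.2 = ε₁ from hc.1, mul_comm ε₁, mul_assoc, Int.units_mul_self, mul_one]
  · rw [Matrix.mul_apply]
    refine Finset.sum_eq_zero fun k _ => ?_
    rw [show flipOn A ε₁ ε₂ k c = 0 from if_neg hc, mul_zero]

variable (A : Op₂ n) (ε₁ ε₂)

theorem flipOn_tens_apply (m : Matrix (ℤˣ × ℤˣ) (ℤˣ × ℤˣ) ℂ) (r c : PSt (n + 2)) :
    flipOn (n := n + 1) (tens A m) ε₁ ε₂ r c =
      if par (Fin.init c.1 : St n) * -c.1 (Fin.last _) = ε₁ ∧ par (Fin.init c.2 : St n) * -c.2 (Fin.last _) = ε₂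
        then A (Fin.init r.1, Fin.init r.2) (Fin.init c.2, Fin.init c.1) *
          m (r.1 (Fin.last _), r.2 (Fin.last _)) (c.2 (Fin.last _), c.1 (Fin.last _)) else 0 := by
  have h : ∀ m : St (n + 1), par m = par (Fin.init m : St n) * -m (Fin.last _) := fun m => parN_init m
  rw [flipOn, h, h]
  rfl

theorem flipOn_eqProj : flipOn (n := n + 1) (tens A eqProj) ε₁ ε₂ =
    ext (flipOn A ε₁ ε₂) (-1) (-1) (-1) (-1) + ext (flipOn A (-ε₁) (-ε₂)) 1 1 1 1 := by
  ext r c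
  rw [flipOn_tens_apply]
  simp only [ext, Matrix.add_apply, flipOn]
  rcases Int.units_eq_one_or (r.1 (Fin.last _)) with h1 | h1 <;>
    rcases Int.units_eq_one_or (r.2 (Fin.last _)) with h2 | h2 <;>
    rcases Int.units_eq_one_or (c.1 (Fin.last _)) with h3 | h3 <;>
    rcases Int.units_eq_one_or (c.2 (Fin.last _)) with h4 | h4 <;>
    simp [h1, h2, h3, h4, eqProj, neg_eq_iff_eq_neg]

theorem flipOn_exch : flipOn (n := n + 1) (tens A exch) ε₁ ε₂ =
    ext (flipOn A ε₁ (-ε₂)) (-1) (-1) 1 1 + ext (flipOn A (-ε₁) ε₂) 1 1 (-1) (-1) := by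
  ext r c
  rw [flipOn_tens_apply]
  simp only [ext, Matrix.add_apply, flipOn]
  rcases Int.units_eq_one_or (r.1 (Fin.last _)) with h1 | h1 <;>
    rcases Int.units_eq_one_or (r.2 (Fin.last _)) with h2 | h2 <;>
    rcases Int.units_eq_one_or (c.1 (Fin.last _)) with h3 | h3 <;>
    rcases Int.units_eq_one_or (c.2 (Fin.last _)) with h4 | h4 <;>
    simp [h1, h2, h3, h4, exch, neg_eq_iff_eq_neg]

/-- The sign is the product of the two parities in `ext`: the last spins are opposite, so the
remaining parities multiply to `-ε₁ ε₂`. This is why the last terms of the two recurrences have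
opposite signs. -/
theorem flipOn_mixDiag (x y : ℂ) : flipOn (n := n + 1) (tens A (mixDiag x y)) ε₁ ε₂ =
    (-(((ε₁ * ε₂ : ℤˣ) : ℤ) : ℂ)) • (x • ext (flipOn A (-ε₁) ε₂) (-1) 1 1 (-1) +
      y • ext (flipOn A ε₁ (-ε₂)) 1 (-1) (-1) 1) := by
  ext r c
  rw [flipOn_tens_apply]
  simp only [ext, Matrix.add_apply, Matrix.smul_apply, flipOn]
  have hs : ∀ ε : ℤˣ, ((ε : ℤ) : ℂ) * ((ε : ℤ) : ℂ) = 1 := fun ε => by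
    rcases Int.units_eq_one_or ε with rfl | rfl <;> simp
  rcases Int.units_eq_one_or (r.1 (Fin.last _)) with h1 | h1 <;>
    rcases Int.units_eq_one_or (r.2 (Fin.last _)) with h2 | h2 <;>
    rcases Int.units_eq_one_or (c.1 (Fin.last _)) with h3 | h3 <;>
    rcases Int.units_eq_one_or (c.2 (Fin.last _)) with h4 | h4 <;>
    simp [h1, h2, h3, h4, mixDiag, neg_eq_iff_eq_neg]
  all_goals
    split_ifs with h
    · rw [h.1, h.2]
      generalize A _ _ = z
      push_cast
      first
        | linear_combination -(z * y * (((ε₂ : ℤ) : ℂ) * ((ε₂ : ℤ) : ℂ))) * hs ε₁ - z * y * hs ε₂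
        | linear_combination -(z * x * (((ε₂ : ℤ) : ℂ) * ((ε₂ : ℤ) : ℂ))) * hs ε₁ - z * x * hs ε₂
    · rfl

end

/-! ### Special values of the R-matrix and the auxiliary operators -/

section
variable {q : ℝ}

theorem generic_self (hq : ∀ k : ℕ, 0 < k → q ^ k ≠ 1) (ε : ℤˣ) {u : ℂ} (hu : u ≠ 0) :
    Generic q ε ε u u := by
  refine ⟨hu, hu, fun k h => ?_⟩
  rw [if_pos rfl] at h
  have h1 : (q : ℂ) ^ (4 * k + 2) = 1 := (mul_eq_right₀ hu).1 h.symm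
  have := cast_zpow_eq_one hq h1
  omega

theorem generic_special (hq0 : q ≠ 0) (hq : ∀ k : ℕ, 0 < k → q ^ k ≠ 1) (ε : ℤˣ) :
    Generic q ε (-ε) ((q : ℂ) ^ 2) 1 := by
  have hQ : (q : ℂ) ≠ 0 := by exact_mod_cast hq0
  refine ⟨pow_ne_zero 2 hQ, one_ne_zero, fun k h => ?_⟩
  rw [if_neg (by rcases Int.units_eq_one_or ε with rfl | rfl <;> decide), mul_one, add_zero] at h
  have h1 : (q : ℂ) ^ (4 * k - 2) = 1 := by
    rw [zpow_sub₀ hQ, ← h]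
    exact div_self (pow_ne_zero 2 hQ)
  have := cast_zpow_eq_one hq h1
  omega

theorem Generic.shift (hq0 : q ≠ 0) {ε₁ ε₂ η₁ η₂ : ℤˣ} {u v : ℂ} (h : Generic q ε₁ ε₂ u v)
    (hη : η₁ * η₂ = -(ε₁ * ε₂)) : Generic q η₁ η₂ u ((q : ℂ) ^ 2 * v) := by
  have hQ : (q : ℂ) ≠ 0 := by exact_mod_cast hq0
  obtain ⟨hu, hv, h⟩ := generic_iff.1 h
  rw [generic_iff, hη]
  exact ⟨hu, mul_ne_zero (pow_ne_zero 2 hQ) hv, h.shift hQ⟩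

theorem Generic.neg {ε₁ ε₂ : ℤˣ} {u v : ℂ} (h : Generic q ε₁ ε₂ u v) : Generic q (-ε₁) (-ε₂) u v := by
  rw [generic_iff] at *
  rwa [neg_mul_neg]

theorem Rmat_eq_flipOn (n : ℕ) (ε₁ ε₂ : ℤˣ) (u v : ℂ) :
    Rmat q n ε₁ ε₂ u v = flipOn (Gop q (n + 1) (ε₁ * ε₂) u v) ε₁ ε₂ := rfl

theorem spinorR_self (hq0 : q ≠ 0) (hq : ∀ k : ℕ, 0 < k → q ^ k ≠ 1) {n : ℕ} (hn : 1 ≤ n) (ε : ℤˣ)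
    {u : ℂ} (hu : u ≠ 0) : spinorR q n ε ε u u = flipOn 1 ε ε := by
  have hg := generic_self hq ε hu
  have hQ : (q : ℂ) ≠ 0 := by exact_mod_cast hq0
  obtain ⟨-, -, hr⟩ := generic_iff.1 hg
  rw [Int.units_mul_self] at hr
  rw [spinorR_eq_Rmat hq0 hq hn hg, Rmat_eq_flipOn, Int.units_mul_self, Gop_self hQ
    (sub_inv_ne_zero hq0 hq) (zpow_add_zpow_neg_ne_zero hq0 hq) _ hr, ← one_mul (secProj _ _),
    flipOn_mul_secProj _ _ _ (Int.units_mul_self ε)]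

theorem Pop_eq_flipOn (hq0 : q ≠ 0) (hq : ∀ k : ℕ, 0 < k → q ^ k ≠ 1) {n : ℕ} (hn : 1 ≤ n) (ε : ℤˣ) :
    Pop q n ε = flipOn 1 ε ε := spinorR_self hq0 hq hn ε one_ne_zero

theorem spinorR_special (hq0 : q ≠ 0) (hq : ∀ k : ℕ, 0 < k → q ^ k ≠ 1) {n : ℕ} (hn : 1 ≤ n) (ε : ℤˣ) :
    spinorR q n ε (-ε) ((q : ℂ) ^ 2) 1 = flipOn (Bop q (n + 1)) ε (-ε) := by
  have hg := generic_special hq0 hq ε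
  have hQ : (q : ℂ) ≠ 0 := by exact_mod_cast hq0
  have hε : ε * -ε = -1 := by rw [mul_neg, Int.units_mul_self]
  obtain ⟨-, -, hr⟩ := generic_iff.1 hg
  rw [hε] at hr
  rw [spinorR_eq_Rmat hq0 hq hn hg, Rmat_eq_flipOn, hε, Gop_special hQ (sub_inv_ne_zero hq0 hq)
    (zpow_add_zpow_neg_ne_zero hq0 hq) _ hr, flipOn_mul_secProj _ _ _ hε]

theorem spinorR_special' (hq0 : q ≠ 0) (hq : ∀ k : ℕ, 0 < k → q ^ k ≠ 1) {n : ℕ} (hn : 1 ≤ n) (ε : ℤˣ) :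
    spinorR q n (-ε) ε ((q : ℂ) ^ 2) 1 = flipOn (Bop q (n + 1)) (-ε) ε := by
  have := spinorR_special hq0 hq hn (-ε)
  rwa [neg_neg] at this

theorem eqProj_add_mixDiag : eqProj + mixDiag 1 1 = 1 := by
  rw [eqProj, mixDiag, Matrix.diagonal_add, ← Matrix.diagonal_one]
  congr 1
  funext r
  split_ifs <;> simp

theorem tens_one_one (N : ℕ) : tens (1 : Matrix (PSt N) (PSt N) ℂ) 1 = 1 := by
  rw [tens, Matrix.one_kronecker_one, Matrix.submatrix_one_equiv]

/-- The flip obeys the recursion defining `Fop`, once `Pop` is known to be a flip. -/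
theorem flipOn_one_succ (n : ℕ) (ε : ℤˣ) : flipOn (n := n + 1) 1 ε (-ε) =
    ext (flipOn 1 ε (-ε)) (-1) (-1) (-1) (-1) + ext (flipOn 1 (-ε) ε) 1 1 1 1
      + ext (flipOn 1 (-ε) (-ε)) (-1) 1 1 (-1) + ext (flipOn 1 ε ε) 1 (-1) (-1) 1 := by
  rw [← tens_one_one (n + 1), ← eqProj_add_mixDiag, tens_add_right, flipOn_add, flipOn_eqProj, flipOn_mixDiag,
    mul_neg, Int.units_mul_self, neg_neg]
  simp [add_assoc]

/-- The flip followed by `B` obeys the recursion defining `Qop`; the factors `q⁻¹` and `q` are the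
mixed entries of `kdiag`, up to sign. -/
theorem flipOn_Bop_succ (n : ℕ) (ε : ℤˣ) : flipOn (n := n + 1) (Bop q (n + 2)) ε ε =
    ext (flipOn (Bop q (n + 1)) ε ε) (-1) (-1) (-1) (-1) + ext (flipOn (Bop q (n + 1)) (-ε) (-ε)) 1 1 1 1
      + ext (flipOn 1 ε (-ε)) (-1) (-1) 1 1 + ext (flipOn 1 (-ε) ε) 1 1 (-1) (-1)
      + (q : ℂ)⁻¹ • ext (flipOn (Bop q (n + 1)) (-ε) ε) (-1) 1 1 (-1)
      + (q : ℂ) • ext (flipOn (Bop q (n + 1)) ε (-ε)) 1 (-1) (-1) 1 := by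
  rw [Bop, kdiag, tens_add_right, flipOn_add, flipOn_add, flipOn_eqProj, flipOn_mixDiag, flipOn_exch,
    Int.units_mul_self]
  simp only [Units.val_one, Int.cast_one]
  module

theorem vec1_eq_iff {ε j : ℤˣ} {m : St 1} : vec1 ε j = m ↔ par m = ε ∧ j = m 1 := by
  have hp : par m = m 0 * m 1 := by rw [par, Fin.prod_univ_two, neg_mul_neg]
  rw [hp]
  constructor
  · rintro rfl
    refine ⟨?_, rfl⟩
    change ε * j * j = ε
    rw [mul_assoc, Int.units_mul_self, mul_one]
  · rintro ⟨rfl, rfl⟩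
    funext k
    fin_cases k
    · change m 0 * m 1 * m 1 = m 0
      rw [mul_assoc, Int.units_mul_self, mul_one]
    · rfl

theorem sum_ite_and_eq (a b : ℤˣ) (P : Prop) [Decidable P] (f : ℤˣ → ℤˣ → ℂ) :
    ∑ i : ℤˣ, ∑ j : ℤˣ, (if (i = a ∧ j = b) ∧ P then f i j else 0) = if P then f a b else 0 := by
  rw [Finset.sum_eq_single_of_mem a (Finset.mem_univ _), Finset.sum_eq_single_of_mem b (Finset.mem_univ _)]
  · simp
  · intro j _ hj
    rw [if_neg fun h => hj h.1.2]
  · intro i _ hi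
    exact Finset.sum_eq_zero fun j _ => if_neg fun h => hi h.1.1

theorem fUnit_apply (ε i j : ℤˣ) (r c : St 1) :
    fUnit ε i j r c = if (par r = -ε ∧ i = r 1) ∧ par c = ε ∧ j = c 1 then 1 else 0 := by
  rw [fUnit, Matrix.single_apply]
  simp only [vec1_eq_iff]

theorem st_one_ext {m m' : St 1} (h : par m = par m') (h1 : m 1 = m' 1) : m = m' :=
  (vec1_eq_iff.2 ⟨h.symm ▸ rfl, rfl⟩ : vec1 (par m') (m 1) = m).symm.trans (vec1_eq_iff.2 ⟨rfl, h1⟩)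

theorem Fop_one (ε : ℤˣ) : Fop q 1 ε = flipOn 1 ε (-ε) := by
  ext r c
  have key : ∀ i j : ℤˣ, (fUnit ε i j ⊗ₖ fUnit (-ε) j i) r c =
      if (i = c.2 1 ∧ j = c.1 1) ∧ (par c.1 = ε ∧ par c.2 = -ε) ∧ r = c.swap then (1 : ℂ) else 0 := by
    intro i j
    rw [Matrix.kroneckerMap_apply, fUnit_apply, fUnit_apply, mul_ite, mul_one, mul_zero, ← ite_and, neg_neg]
    congr 1
    refine propext ⟨?_, ?_⟩
    · rintro ⟨⟨⟨h1, h2⟩, h3, h4⟩, ⟨h5, h6⟩, h7, h8⟩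
      exact ⟨⟨h4, h8⟩, ⟨h7, h3⟩, Prod.ext (st_one_ext (h5.trans h3.symm) (h6.symm.trans h4))
        (st_one_ext (h1.trans h7.symm) (h2.symm.trans h8))⟩
    · rintro ⟨⟨h4, h8⟩, ⟨h7, h3⟩, rfl⟩
      exact ⟨⟨⟨h7, h8⟩, h3, h4⟩, ⟨h3, h4⟩, h7, h8⟩
  rw [Fop, Matrix.sum_apply]
  simp only [Matrix.sum_apply, key]
  rw [sum_ite_and_eq _ _ ((par c.1 = ε ∧ par c.2 = -ε) ∧ r = c.swap) fun _ _ => (1 : ℂ), flipOn, Matrix.one_apply, ← ite_and]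

theorem Qop_one_apply (ε : ℤˣ) (r c : PSt 2) : Qop q 1 ε r c =
    if ((par r.1 = -ε ∧ par r.2 = -ε) ∧ par c.1 = ε ∧ par c.2 = ε) ∧ r.2 1 = -r.1 1 ∧ c.2 1 = -c.1 1 then
      (((r.1 1 * c.1 1 : ℤˣ) : ℤ) : ℂ) * sq q ^ ((r.1 1 : ℤ) - (c.1 1 : ℤ)) else 0 := by
  have key : ∀ i j : ℤˣ, ((((i * j : ℤˣ) : ℤ) : ℂ) * sq q ^ ((i : ℤ) - (j : ℤ))) •
        (fUnit ε i j ⊗ₖ fUnit ε (-i) (-j)) r c =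
      if (i = r.1 1 ∧ j = c.1 1) ∧
        ((par r.1 = -ε ∧ par r.2 = -ε) ∧ par c.1 = ε ∧ par c.2 = ε) ∧ r.2 1 = -r.1 1 ∧ c.2 1 = -c.1 1
        then ((((i * j : ℤˣ) : ℤ) : ℂ) * sq q ^ ((i : ℤ) - (j : ℤ))) else (0 : ℂ) := by
    intro i j
    rw [Matrix.kroneckerMap_apply, fUnit_apply, fUnit_apply, mul_ite, mul_one, mul_zero, ← ite_and, smul_eq_mul,
      mul_ite, mul_one, mul_zero]
    congr 1
    refine propext ⟨?_, ?_⟩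
    · rintro ⟨⟨⟨h1, h2⟩, h3, h4⟩, ⟨h5, h6⟩, h7, h8⟩
      exact ⟨⟨h6, h8⟩, ⟨⟨h5, h1⟩, h7, h3⟩, by rw [← h2, h6], by rw [← h4, h8]⟩
    · rintro ⟨⟨h6, h8⟩, ⟨⟨h5, h1⟩, h7, h3⟩, h9, h10⟩
      exact ⟨⟨⟨h1, by rw [h9, h6]⟩, h3, by rw [h10, h8]⟩, ⟨h5, h6⟩, h7, h8⟩
  rw [Qop, Matrix.sum_apply]
  simp only [Matrix.sum_apply, Matrix.smul_apply, key]
  rw [sum_ite_and_eq]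

theorem Bop_two_apply (r c : PSt 2) : Bop q 2 r c =
    exch (r.1 0, r.2 0) (c.1 0, c.2 0) * kdiag q (r.1 1, r.2 1) (c.1 1, c.2 1) +
      (if (r.1 0, r.2 0) = (c.1 0, c.2 0) then 1 else 0) * exch (r.1 1, r.2 1) (c.1 1, c.2 1) := by
  have h1 : ∀ r c : PSt 1, Bop q 1 r c = exch (r.1 0, r.2 0) (c.1 0, c.2 0) := by
    intro r c
    have : (splitLast 0 r).1 = (splitLast 0 c).1 := Subsingleton.elim _ _
    rw [Bop, Bop, tens_zero, zero_add, tens, Matrix.submatrix_apply, Matrix.kroneckerMap_apply, this,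
      Matrix.one_apply_eq, one_mul]
    rfl
  rw [Bop, Matrix.add_apply]
  congr 1
  · rw [tens, Matrix.submatrix_apply, Matrix.kroneckerMap_apply, h1]
    rfl
  · rw [tens, Matrix.submatrix_apply, Matrix.kroneckerMap_apply, Matrix.one_apply]
    congr 2
    simp only [splitLast, Equiv.coe_fn_mk, Prod.mk.injEq, funext_iff, Fin.forall_fin_one]
    rfl

theorem Qop_one (ε : ℤˣ) : Qop q 1 ε = flipOn (Bop q 2) ε ε := by
  ext r c
  have hp : ∀ m : St 1, par m = m 0 * m 1 := fun m => by rw [par, Fin.prod_univ_two, neg_mul_neg]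
  have hs : sq q ^ 2 = q := by rw [pow_two, sq_sq]
  rw [Qop_one_apply, flipOn, Bop_two_apply]
  simp only [hp, Prod.fst_swap, Prod.snd_swap]
  rcases Int.units_eq_one_or (r.1 1) with h1 | h1 <;>
    rcases Int.units_eq_one_or (r.2 1) with h2 | h2 <;>
    rcases Int.units_eq_one_or (c.1 1) with h3 | h3 <;>
    rcases Int.units_eq_one_or (c.2 1) with h4 | h4 <;>
    simp [h1, h2, h3, h4, kdiag, eqProj, mixDiag, exch]
  all_goals
    generalize r.1 0 = a₁, r.2 0 = a₂, c.1 0 = b₁, c.2 0 = b₂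
    rcases Int.units_eq_one_or a₁ with rfl | rfl <;> rcases Int.units_eq_one_or a₂ with rfl | rfl <;>
      rcases Int.units_eq_one_or b₁ with rfl | rfl <;> rcases Int.units_eq_one_or b₂ with rfl | rfl <;>
      rcases Int.units_eq_one_or ε with rfl | rfl <;> simp [hs]

theorem Fop_eq_flipOn (hq0 : q ≠ 0) (hq : ∀ k : ℕ, 0 < k → q ^ k ≠ 1) (n : ℕ) (ε : ℤˣ) :
    Fop q (n + 1) ε = flipOn 1 ε (-ε) := by
  induction n generalizing ε with
  | zero => exact Fop_one ε
  | succ n ih =>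
    rw [Fop, ih, ih, Pop_eq_flipOn hq0 hq (by omega), Pop_eq_flipOn hq0 hq (by omega),
      flipOn_one_succ (n + 1),
      neg_neg]

theorem Qop_eq_flipOn (hq0 : q ≠ 0) (hq : ∀ k : ℕ, 0 < k → q ^ k ≠ 1) (n : ℕ) (ε : ℤˣ) :
    Qop q (n + 1) ε = flipOn (Bop q (n + 2)) ε ε := by
  induction n generalizing ε with
  | zero => exact Qop_one ε
  | succ n ih =>
    rw [Qop, ih, ih, Fop_eq_flipOn hq0 hq, Fop_eq_flipOn hq0 hq, spinorR_special hq0 hq (by omega),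
      spinorR_special' hq0 hq (by omega), flipOn_Bop_succ (n + 1), neg_neg]

/-- In `(B flip)(flip)(G flip)` the first two flips cancel. -/
theorem Uopp_eq_flipOn (hq0 : q ≠ 0) (hq : ∀ k : ℕ, 0 < k → q ^ k ≠ 1) {n : ℕ} (hn : 1 ≤ n) {ε : ℤˣ}
    {u v : ℂ} (hg : Generic q ε (-ε) u v) :
    Uopp q n ε u v = flipOn (Bop q (n + 1) * Gop q (n + 1) (-1) u v) ε (-ε) := by
  obtain ⟨k, rfl⟩ := Nat.exists_eq_add_of_le' hn
  have hε : ε * -ε = -1 := by rw [mul_neg, Int.units_mul_self]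
  rw [Uopp, spinorR_special' hq0 hq hn, Fop_eq_flipOn hq0 hq, flipOn_mul_flipOn_one,
    spinorR_eq_Rmat hq0 hq hn hg, Rmat_eq_flipOn, hε, colOn_mul_flipOn]
  rw [hε]
  exact Gop_changesParities _ _ _ _ _

theorem Usame_eq_flipOn (hq0 : q ≠ 0) (hq : ∀ k : ℕ, 0 < k → q ^ k ≠ 1) {n : ℕ} (hn : 1 ≤ n) {ε : ℤˣ}
    {u v : ℂ} (hg : Generic q ε ε u v) :
    Usame q n ε u v = flipOn (Bop q (n + 1) * Gop q (n + 1) 1 u v) ε ε := by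
  obtain ⟨k, rfl⟩ := Nat.exists_eq_add_of_le' hn
  have hε : ε * ε = 1 := Int.units_mul_self ε
  rw [Usame, Pop_eq_flipOn hq0 hq hn, Qop_eq_flipOn hq0 hq, flipOn_mul_flipOn_one,
    spinorR_eq_Rmat hq0 hq hn hg, Rmat_eq_flipOn, hε, colOn_mul_flipOn]
  rw [hε]
  exact Gop_changesParities _ _ _ _ _

/-- Both recurrences at once; they differ only in the value of `mixc` and in the sign `ε₁ ε₂`. -/
theorem flipOn_Gop_succ (n : ℕ) (ε₁ ε₂ : ℤˣ) (u v : ℂ) :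
    flipOn (n := n + 1) (Gop q (n + 2) (ε₁ * ε₂) u v) ε₁ ε₂ =
      ext (flipOn (Gop q (n + 1) (ε₁ * ε₂) u v) ε₁ ε₂) (-1) (-1) (-1) (-1) +
      ext (flipOn (Gop q (n + 1) (ε₁ * ε₂) u v) (-ε₁) (-ε₂)) 1 1 1 1 +
      (mixc q (ε₁ * ε₂) u v * (v - u)) •
        (ext (flipOn (Gop q (n + 1) (-(ε₁ * ε₂)) u ((q : ℂ) ^ 2 * v)) ε₁ (-ε₂)) (-1) (-1) 1 1 +
        ext (flipOn (Gop q (n + 1) (-(ε₁ * ε₂)) u ((q : ℂ) ^ 2 * v)) (-ε₁) ε₂) 1 1 (-1) (-1)) -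
      ((((ε₁ * ε₂ : ℤˣ) : ℤ) : ℂ) * (mixc q (ε₁ * ε₂) u v * ((q : ℂ) - (q : ℂ)⁻¹))) •
        (v • ext (flipOn (Bop q (n + 1) * Gop q (n + 1) (-(ε₁ * ε₂)) u ((q : ℂ) ^ 2 * v)) (-ε₁) ε₂)
          (-1) 1 1 (-1) +
        u • ext (flipOn (Bop q (n + 1) * Gop q (n + 1) (-(ε₁ * ε₂)) u ((q : ℂ) ^ 2 * v)) ε₁ (-ε₂))
          1 (-1) (-1) 1) := by
  rw [Gop, flipOn_add, flipOn_smul, flipOn_add, flipOn_smul, flipOn_smul, flipOn_eqProj, flipOn_exch,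
    flipOn_mixDiag]
  module

theorem spinorR_succ_same (hq0 : q ≠ 0) (hq : ∀ k : ℕ, 0 < k → q ^ k ≠ 1) {n : ℕ} (hn : 1 ≤ n)
    (ε : ℤˣ) {u v : ℂ} (hg : Generic q ε ε u v) :
    spinorR q (n + 1) ε ε u v =
      ext (spinorR q n ε ε u v) (-1) (-1) (-1) (-1)
      + ext (spinorR q n (-ε) (-ε) u v) 1 1 1 1
      + alpha q u v •
        (ext (spinorR q n ε (-ε) u ((q : ℂ) ^ 2 * v)) (-1) (-1) 1 1
        + ext (spinorR q n (-ε) ε u ((q : ℂ) ^ 2 * v)) 1 1 (-1) (-1))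
      - beta q u v •
        (v • ext (Uopp q n (-ε) u ((q : ℂ) ^ 2 * v)) (-1) 1 1 (-1)
        + u • ext (Uopp q n ε u ((q : ℂ) ^ 2 * v)) 1 (-1) (-1) 1) := by
  have hε : ε * ε = 1 := Int.units_mul_self ε
  have g1 : Generic q ε (-ε) u ((q : ℂ) ^ 2 * v) := hg.shift hq0 (mul_neg _ _)
  have g2 : Generic q (-ε) ε u ((q : ℂ) ^ 2 * v) := hg.shift hq0 (neg_mul _ _)
  have g2' : Generic q (-ε) (- -ε) u ((q : ℂ) ^ 2 * v) := by rwa [neg_neg]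
  have key := flipOn_Gop_succ (q := q) n ε ε u v
  rw [spinorR_eq_Rmat hq0 hq (by omega) hg, spinorR_eq_Rmat hq0 hq hn hg, spinorR_eq_Rmat hq0 hq hn hg.neg,
    spinorR_eq_Rmat hq0 hq hn g1, spinorR_eq_Rmat hq0 hq hn g2, Uopp_eq_flipOn hq0 hq hn g1,
    Uopp_eq_flipOn hq0 hq hn g2', neg_neg]
  simp only [Rmat_eq_flipOn, neg_mul, mul_neg, neg_neg, hε] at key ⊢
  rw [key, mixc_one, alpha, beta, div_eq_mul_inv, div_eq_mul_inv, Units.val_one, Int.cast_one, one_mul,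
    mul_comm (v - u), mul_comm ((q : ℂ) - (q : ℂ)⁻¹)]

theorem spinorR_succ_opp (hq0 : q ≠ 0) (hq : ∀ k : ℕ, 0 < k → q ^ k ≠ 1) {n : ℕ} (hn : 1 ≤ n)
    (ε : ℤˣ) {u v : ℂ} (hg : Generic q ε (-ε) u v) :
    spinorR q (n + 1) ε (-ε) u v =
      ext (spinorR q n ε (-ε) u v) (-1) (-1) (-1) (-1)
      + ext (spinorR q n (-ε) ε u v) 1 1 1 1
      + ext (spinorR q n ε ε u ((q : ℂ) ^ 2 * v)) (-1) (-1) 1 1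
      + ext (spinorR q n (-ε) (-ε) u ((q : ℂ) ^ 2 * v)) 1 1 (-1) (-1)
      + (((q : ℂ) - (q : ℂ)⁻¹) / (v - u)) •
        (v • ext (Usame q n (-ε) u ((q : ℂ) ^ 2 * v)) (-1) 1 1 (-1)
        + u • ext (Usame q n ε u ((q : ℂ) ^ 2 * v)) 1 (-1) (-1) 1) := by
  have hε : ε * ε = 1 := Int.units_mul_self ε
  have g0 : Generic q (-ε) ε u v := by simpa using hg.neg
  have g1 : Generic q ε ε u ((q : ℂ) ^ 2 * v) := hg.shift hq0 (by rw [mul_neg, neg_neg])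
  have g2 : Generic q (-ε) (-ε) u ((q : ℂ) ^ 2 * v) := g1.neg
  have hvu : v - u ≠ 0 := by
    have := (generic_iff.1 hg).2.2 (-1) (by rw [mul_neg, hε]; decide)
    rw [sub_ne_zero]
    intro h
    exact this (by simp [h])
  have key := flipOn_Gop_succ (q := q) n ε (-ε) u v
  rw [spinorR_eq_Rmat hq0 hq (by omega) hg, spinorR_eq_Rmat hq0 hq hn hg, spinorR_eq_Rmat hq0 hq hn g0,
    spinorR_eq_Rmat hq0 hq hn g1, spinorR_eq_Rmat hq0 hq hn g2, Usame_eq_flipOn hq0 hq hn g1,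
    Usame_eq_flipOn hq0 hq hn g2]
  simp only [Rmat_eq_flipOn, neg_mul, mul_neg, neg_neg, hε] at key ⊢
  rw [key, mixc_neg_one, inv_mul_cancel₀ hvu, div_eq_mul_inv, mul_comm ((q : ℂ) - (q : ℂ)⁻¹)]
  push_cast
  module

end

end SpinorD

end

open SpinorD

/-- The R-matrices of `so_{2n+4}` (rank index `n + 1 > 2`) in terms of those of `so_{2n+2}`. -/
theorem proposition2p13 (q : ℝ) (hq0 : q ≠ 0) (hq : ∀ k : ℕ, 0 < k → q ^ k ≠ 1)
    (n : ℕ) (hn : 2 ≤ n) :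
    -- the R-matrices are well defined
    (∀ m : ℕ, 1 ≤ m → m ≤ n + 1 → ∀ (ε₁ ε₂ : ℤˣ) (u v : ℂ), Generic q ε₁ ε₂ u v →
      ∃! R : Op₂ m, IsSpinorR q m ε₁ ε₂ u v R) ∧
    -- `R(u,u)` does not depend on `u`
    (∀ m : ℕ, 1 ≤ m → m ≤ n + 1 → ∀ (ε : ℤˣ) (u : ℂ), u ≠ 0 →
      spinorR q m ε ε u u = Pop q m ε) ∧
    -- the recurrence for equal chiralities
    (∀ (ε : ℤˣ) (u v : ℂ), Generic q ε ε u v →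
      spinorR q (n + 1) ε ε u v =
        ext (spinorR q n ε ε u v) (-1) (-1) (-1) (-1)
        + ext (spinorR q n (-ε) (-ε) u v) 1 1 1 1
        + alpha q u v •
          (ext (spinorR q n ε (-ε) u ((q : ℂ) ^ 2 * v)) (-1) (-1) 1 1
          + ext (spinorR q n (-ε) ε u ((q : ℂ) ^ 2 * v)) 1 1 (-1) (-1))
        - beta q u v •
          (v • ext (Uopp q n (-ε) u ((q : ℂ) ^ 2 * v)) (-1) 1 1 (-1)
          + u • ext (Uopp q n ε u ((q : ℂ) ^ 2 * v)) 1 (-1) (-1) 1)) ∧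
    -- the recurrence for opposite chiralities
    (∀ (ε : ℤˣ) (u v : ℂ), Generic q ε (-ε) u v →
      spinorR q (n + 1) ε (-ε) u v =
        ext (spinorR q n ε (-ε) u v) (-1) (-1) (-1) (-1)
        + ext (spinorR q n (-ε) ε u v) 1 1 1 1
        + ext (spinorR q n ε ε u ((q : ℂ) ^ 2 * v)) (-1) (-1) 1 1
        + ext (spinorR q n (-ε) (-ε) u ((q : ℂ) ^ 2 * v)) 1 1 (-1) (-1)
        + (((q : ℂ) - (q : ℂ)⁻¹) / (v - u)) •
          (v • ext (Usame q n (-ε) u ((q : ℂ) ^ 2 * v)) (-1) 1 1 (-1)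
          + u • ext (Usame q n ε u ((q : ℂ) ^ 2 * v)) 1 (-1) (-1) 1)) := by
  refine ⟨fun m hm _ ε₁ ε₂ u v hg => ⟨Rmat q m ε₁ ε₂ u v, Rmat_isSpinorR hq0 hq hm hg,
    fun R hR => hR.unique hq0 hq hg (Rmat_isSpinorR hq0 hq hm hg)⟩, fun m hm _ ε u hu => ?_,
    fun ε u v hg => spinorR_succ_same hq0 hq (by omega) ε hg,
    fun ε u v hg => spinorR_succ_opp hq0 hq (by omega) ε hg⟩
  rw [spinorR_self hq0 hq hm ε hu, Pop_eq_flipOn hq0 hq hm]
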